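/- **Setting.** Let $\nu\ge 1$, $\tau\ge 2\nu+6$, $L>0$, $s_0:=[\nu/2]+3$, $\gamma\in(0,1)$, $\varepsilon>0$. Write $\langle x\rangle=\max\{1,|x|\}$, $|\ell|=\sum_i|\ell_i|$, $\langle \ell,j\rangle=\max\{1,|\ell|,|j|\}$, and let $$\mathcal O_0=\{\omega\in[L,2L]^\nu:\ |\omega\cdot\ell|\ge 2\gamma\langle\ell\rangle^{-\nu}\ \ \forall\,\ell\in\mathbb Z^\nu\setminus\{0\}\}.$$ For $u(\varphi,x)=\sum u_{\ell j}e^{\mathrm i(\ell\cdot\varphi+jx)}$ on $\mathbb T^{\nu+1}$, $\mathbb T=\mathbb R/2\pi\mathbb Z$, put $\|u\|_s^2=\sum|u_{\ell j}|^2\langle\ell,j\rangle^{2s}$; $H^s$ is the space of real $u$ with $\|u\|_s<\infty$ and zero average in $x$. For functions of $\omega\in\mathcal O$ put $\|u\|_s^{\gamma,\mathcal O}=\sup_\omega\|u(\omega)\|_s+\gamma\sup_{\omega\ne\omega'}\|u(\omega)-u(\omega')\|_{s-1}/|\omega-\omega'|$, and $|f|^{\gamma,\mathcal O}=\sup_\omega|f|+\gamma\sup_{\omega\neq\omega'}|f(\omega)-f(\omega')|/|\omega-\omega'|$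 for scalar $f$. Symbols $a\in S^m$ have the norms $|a|_{m,s,\alpha}=\max_{\beta\le\alpha}\sup_\xi\|\partial_\xi^\beta a(\cdot,\cdot,\xi)\|_s\langle\xi\rangle^{-m+\beta}$, with Lipschitz versions $|a|^{\gamma,\mathcal O}_{m,s,\alpha}$ defined as above (differences in $\omega$ are measured with index $s-1$). $J=(1-\partial_{xx})^{-1}(4-\partial_{xx})\partial_x$, and symplectic and Hamiltonian refer to $\Omega(u,v)=\int_{\mathbb T}(J^{-1}u)\,v\,dx$: a $\varphi$-dependent family $A(\varphi)$ is symplectic if every $A(\varphi)$ preserves $\Omega$, and Hamiltonian if every $J^{-1}A(\varphi)$ is real and symmetric. A family $A(\omega)$, $\omega\in\mathcal O$, is Lip-$0$-tame for $s_0\le s\le S$ with non-decreasing constants $M(s)$ if $\|A(\omega)u\|_s$ and $\gamma\|(A(\omega)-A(\omega'))u\|_{s-1}/|\omega-\omega'|$ are at most $M(s)\|u\|_{s_0}+M(s_0)\|u\|_s$ for $u\in H^s$. For an integer $\rho\geq 3$, $\mathbb M^\gamma_A(s)\le M(s)$ means that, for $|b|\le\rho-2$ and $m_1,m_2\ge0$,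 the operators $\langle D_x\rangle^{m_1}\partial_\varphi^bA\langle D_x\rangle^{m_2}$ with $m_1+m_2=\rho-|b|$ and $\langle D_x\rangle^{m_1}[\partial_\varphi^bA,\partial_x]\langle D_x\rangle^{m_2}$ with $m_1+m_2=\rho-|b|-1$ are Lip-$0$-tame with constants $M(s)$. For a difference, $\mathbb M_{\Delta A}(p)\le N$ means that for $|b|\le\rho-3$ these operators, with $m_1+m_2$ smaller by one, are bounded on $H^p$ with norm at most $N$. **Regularized operators.** For functions $\omega\mapsto\mathfrak I(\omega)\in C^\infty(\mathbb T^{\nu+1},\mathbb R)$, Lipschitz on $\mathcal O_0$ and with $\|\mathfrak I\|^{\gamma,\mathcal O_0}_{s_0+\mu}\le1$, consider Hamiltonian operators, Töplitz in time, $$\mathcal L_\omega^+=\mathcal L_\omega^+(\mathfrak I)=\omega\cdot\partial_\varphi-m\,J+\mathcal R,\qquad \mathcal R=\mathrm{Op}(q)+\widehat{\mathcal R},\quad q\in S^{-1},$$ where $m=m(\omega,\mathfrak I)\in\mathbb R$ is defined on $\mathcal O_0$, $|m-1|^{\gamma,\mathcal O_0}\le K_m\varepsilon$, the remainder $\mathcal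 R$ is defined for $\omega$ in $$\Omega_1(\mathfrak I)=\{\omega\in\mathcal O_0:|\omega\cdot\ell-mj|\ge2\gamma\langle\ell\rangle^{-\tau}\ \forall\,\ell\in\mathbb Z^\nu,\ j\in\mathbb Z\setminus\{0\}\},$$ and, for some $\kappa>0$ and constants $K(s,\alpha)$, with $\Delta_{12}$ denoting the difference of the values at $\mathfrak I_1$ and $\mathfrak I_2$, $$|q|^{\gamma,\Omega_1}_{-1,s,\alpha}\le K(s,\alpha)\,\varepsilon\gamma^{-1}\|\mathfrak I\|^{\gamma,\mathcal O_0}_{s+\kappa},\qquad \mathbb M^\gamma_{\widehat{\mathcal R}}(s)\le K(s,0)\,\varepsilon\gamma^{-1}\|\mathfrak I\|^{\gamma,\mathcal O_0}_{s+\kappa}\qquad(s_0\le s\le \mathcal S+k_0),$$ and, for $\omega\in\Omega_1(\mathfrak I_1)\cap\Omega_1(\mathfrak I_2)$, $|\Delta_{12}m|\le K_m\varepsilon\|\mathfrak I_1-\mathfrak I_2\|_{s_0+\kappa}$ and $$|\Delta_{12}q|_{-1,p,\alpha}\le K(p,\alpha)\,\varepsilon\gamma^{-1}\|\mathfrak I_1-\mathfrak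 I_2\|_{s_0+\kappa},\qquad \mathbb M_{\Delta_{12}\widehat{\mathcal R}}(p)\le K(p,0)\,\varepsilon\gamma^{-1}\|\mathfrak I_1-\mathfrak I_2\|_{s_0+\kappa}\qquad(s_0\le p\le s_0+k_0).$$ **Theorem (Diagonalization).** There is an integer $k_0$, depending only on $\nu,\tau$, such that for all $\rho\ge k_0$, $\mathcal S>s_0$, $L,\kappa>0$ and all constants $K_m$, $K(\cdot,\cdot)$ there are $\delta_0\in(0,1)$, $N_0,C_0,C,\sigma>0$ and $C(s)$ (independent of $\gamma,\varepsilon,\mu,\mathfrak I$ and of the operators) such that, if $\mu\ge\mu_1:=\kappa+k_0$ and $$N_0^{C_0}\,\varepsilon\,\gamma^{-5/2}\le\delta_0,$$ then for every family of operators $\mathcal L^+_\omega(\mathfrak I)$ as above the following holds. (i) (Eigenvalues) For all $\omega\in\mathcal O_0$ there are real numbers $$d_j=m\,j\,\frac{4+j^2}{1+j^2}+r_j,\quad j\in\mathbb Z\setminus\{0\},\qquad r_j=-r_{-j},\qquad \sup_{j}\langle j\rangle|r_j|^{\gamma^{3/2},\mathcal O_0}<C\gamma^{-1}\varepsilon ;$$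 in particular all the $\mathrm i d_j$ are purely imaginary. (ii) (Conjugacy) Let $\mathcal O_\infty(\mathfrak I)=\Omega_1\cap\Omega_2$, where $$\Omega_2=\{\omega\in\mathcal O_0:|\omega\cdot\ell+d_j-d_k|\ge2\gamma^{3/2}\langle\ell\rangle^{-\tau}\ \forall\,\ell\in\mathbb Z^\nu,\ j,k\in\mathbb Z\setminus\{0\},\ (j,k,\ell)\ne(j,j,0)\}.$$ For $\omega\in\mathcal O_\infty$ there is a real, linear, invertible operator $\Phi_2(\omega)$, Töplitz in time, bounded on $H^s$ together with its inverse for $s_0\le s\le\mathcal S$, such that $\Phi_2^{\pm1}$ are symplectic and $$\Phi_2(\omega)\circ\mathcal L_\omega^+\circ\Phi_2(\omega)^{-1}=\omega\cdot\partial_\varphi-\mathrm{diag}_{j\ne0}\{\mathrm i\,d_j(\omega)\}.$$ For $s_0\le s\le\mathcal S$ and $h=h(\omega)\in H^s$, $$\|(\Phi_2^{\pm1}-\mathrm I)h\|_s^{\gamma^{3/2},\mathcal O_\infty}\le C(s)\Big(\big(\varepsilon\gamma^{-3/2}+\varepsilon\gamma^{-5/2}\|\mathfrak I\|^{\gamma,\mathcal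 O_0}_{s+\mu}\big)\|h\|_{s_0}^{\gamma^{3/2},\mathcal O_\infty}+\varepsilon\gamma^{-5/2}\|h\|_s^{\gamma^{3/2},\mathcal O_\infty}\Big).$$ Moreover, for $\omega\in\mathcal O_\infty(\mathfrak I_1)\cap\mathcal O_\infty(\mathfrak I_2)$, $$\sup_j\langle j\rangle|\Delta_{12}r_j|\le C\,\varepsilon\gamma^{-1}\|\mathfrak I_1-\mathfrak I_2\|_{s_0+\sigma}.$$ -/

import Mathlib

open scoped ENNReal ContDiff ComplexConjugate

namespace DP

noncomputable section

/-- Frequency vectors `ω ∈ ℝ^ν`, with the Euclidean distance. -/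
abbrev Freq (ν : ℕ) := EuclideanSpace ℝ (Fin ν)

/-- Arrays of Fourier coefficients `u_{ℓ j}`, `ℓ ∈ ℤ^ν`, `j ∈ ℤ`, of a function of
`(φ, x) ∈ 𝕋^{ν+1}`. -/
abbrev Coeffs (ν : ℕ) := (Fin ν → ℤ) → ℤ → ℂ

/-- Matrices of operators that are Töplitz in time: `A j j' ℓ` is the entry `A_j^{j'}(ℓ)`.
Only the entries with `j ≠ 0` and `j' ≠ 0` are relevant, since the operators act on functions
with zero average in `x`. -/
abbrev TMat (ν : ℕ) := ℤ → ℤ → (Fin ν → ℤ) → ℂ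

/-- Real functions of `(φ, x)`. -/
abbrev TorusFn (ν : ℕ) := (Fin ν → ℝ) → ℝ → ℝ

/-- Complex functions of `(φ, x, ξ)`. -/
abbrev Symb (ν : ℕ) := (Fin ν → ℝ) → ℝ → ℝ → ℂ

/-! ### Weights and Sobolev norms -/

/-- `⟨x⟩ = max {1, |x|}`. -/
def jap (x : ℝ) : ℝ := max 1 |x|

/-- `|ℓ| = ∑ᵢ |ℓᵢ|`. -/
def absL {ν : ℕ} (l : Fin ν → ℤ) : ℝ := ∑ i, |(l i : ℝ)|

/-- `⟨ℓ⟩ = max {1, |ℓ|}`. -/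
def japL {ν : ℕ} (l : Fin ν → ℤ) : ℝ := max 1 (absL l)

/-- `⟨ℓ, j⟩ = max {1, |ℓ|, |j|}`. -/
def japLJ {ν : ℕ} (l : Fin ν → ℤ) (j : ℤ) : ℝ := max 1 (max (absL l) |(j : ℝ)|)

/-- `ω · ℓ`. -/
def dotL {ν : ℕ} (w : Freq ν) (l : Fin ν → ℤ) : ℝ := ∑ i, w i * (l i : ℝ)

/-- `s₀ = [ν/2] + 3`. -/
def sZero (ν : ℕ) : ℝ := ((ν / 2 + 3 : ℕ) : ℝ)

/-- The Sobolev norm `‖u‖_s`, with values in `[0, ∞]`. -/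
def hsNorm {ν : ℕ} (s : ℝ) (u : Coeffs ν) : ℝ≥0∞ :=
  (∑' q : (Fin ν → ℤ) × ℤ,
    ENNReal.ofReal (‖u q.1 q.2‖ ^ 2 * japLJ q.1 q.2 ^ (2 * s))) ^ (1 / 2 : ℝ)

/-- `u` belongs to `H^s`: it is real valued, has zero average in `x`, and `‖u‖_s < ∞`. -/
def MemH {ν : ℕ} (s : ℝ) (u : Coeffs ν) : Prop :=
  (∀ l j, conj (u l j) = u (-l) (-j)) ∧ (∀ l, u l 0 = 0) ∧ hsNorm s u < ⊤

/-- The weighted Lipschitz norm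
`‖u‖_s^{γ,O} = sup_{ω ∈ O} ‖u(ω)‖_s + γ sup_{ω ≠ ω'} ‖u(ω) - u(ω')‖_{s-1} / |ω - ω'|`. -/
def lipHs {ν : ℕ} (γ : ℝ) (O : Set (Freq ν)) (s : ℝ) (u : Freq ν → Coeffs ν) : ℝ≥0∞ :=
  (⨆ w ∈ O, hsNorm s (u w)) +
    ENNReal.ofReal γ * ⨆ w ∈ O, ⨆ w' ∈ O, ⨆ (_ : w ≠ w'),
      hsNorm (s - 1) (u w - u w') / ENNReal.ofReal (dist w w')

/-- The weighted Lipschitz norm of a scalar function of `ω`. -/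
def lipScalar {ν : ℕ} (γ : ℝ) (O : Set (Freq ν)) (f : Freq ν → ℝ) : ℝ≥0∞ :=
  (⨆ w ∈ O, ENNReal.ofReal |f w|) +
    ENNReal.ofReal γ * ⨆ w ∈ O, ⨆ w' ∈ O, ⨆ (_ : w ≠ w'),
      ENNReal.ofReal |f w - f w'| / ENNReal.ofReal (dist w w')

/-! ### Functions and symbols on the torus `(ℝ/2πℤ)^{ν+1}` -/

/-- The Fourier coefficients `f_{ℓ j}` of a `2π`-periodic function of `(φ, x)`. -/
def torusCoeff {ν : ℕ} (f : (Fin ν → ℝ) → ℝ → ℂ) : Coeffs ν := fun l j =>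
  ((2 * Real.pi : ℝ) : ℂ)⁻¹ ^ (ν + 1) *
    ∫ φ in Set.Icc (0 : Fin ν → ℝ) (fun _ => 2 * Real.pi), ∫ x in (0 : ℝ)..(2 * Real.pi),
      f φ x * Complex.exp (-(Complex.I * (((∑ i, (l i : ℝ) * φ i) + (j : ℝ) * x : ℝ) : ℂ)))

/-- The Fourier coefficients of a real function. -/
def coeffR {ν : ℕ} (f : TorusFn ν) : Coeffs ν := torusCoeff fun φ x => (f φ x : ℂ)

/-- `f ∈ C^∞(𝕋^{ν+1}; ℝ)`. -/
def IsSmoothTorus {ν : ℕ} (f : TorusFn ν) : Prop :=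
  ContDiff ℝ ∞ (fun q : (Fin ν → ℝ) × ℝ => f q.1 q.2) ∧
  ∀ φ x (k : Fin ν → ℤ) (n : ℤ),
    f (fun i => φ i + 2 * Real.pi * k i) (x + 2 * Real.pi * n) = f φ x

/-- The class `S^m` of symbols `a(φ, x, ξ)`. -/
def IsSymbol {ν : ℕ} (m : ℝ) (a : Symb ν) : Prop :=
  ContDiff ℝ ∞ (fun q : (Fin ν → ℝ) × ℝ × ℝ => a q.1 q.2.1 q.2.2) ∧
  (∀ φ x ξ (k : Fin ν → ℤ) (n : ℤ),
    a (fun i => φ i + 2 * Real.pi * k i) (x + 2 * Real.pi * n) ξ = a φ x ξ) ∧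
  ∀ α β : ℕ, ∃ C : ℝ, ∀ φ x ξ,
    ‖iteratedDeriv α (fun y => iteratedDeriv β (fun ζ => a φ y ζ) ξ) x‖ ≤ C * jap ξ ^ (m - β)

/-- The norm `|a|_{m,s,α} = max_{β ≤ α} sup_ξ ‖∂_ξ^β a(·,·,ξ)‖_s ⟨ξ⟩^{-m+β}`. -/
def symNorm {ν : ℕ} (m s : ℝ) (α : ℕ) (a : Symb ν) : ℝ≥0∞ :=
  ⨆ β : ℕ, ⨆ (_ : β ≤ α), ⨆ ξ : ℝ,
    hsNorm s (torusCoeff fun φ x => iteratedDeriv β (fun ζ => a φ x ζ) ξ) *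
      ENNReal.ofReal (jap ξ ^ (-m + β))

/-- The weighted Lipschitz norm `|a|_{m,s,α}^{γ,O}` of a family of symbols. -/
def lipSym {ν : ℕ} (γ : ℝ) (O : Set (Freq ν)) (m s : ℝ) (α : ℕ) (a : Freq ν → Symb ν) : ℝ≥0∞ :=
  (⨆ w ∈ O, symNorm m s α (a w)) +
    ENNReal.ofReal γ * ⨆ w ∈ O, ⨆ w' ∈ O, ⨆ (_ : w ≠ w'),
      symNorm m (s - 1) α (a w - a w') / ENNReal.ofReal (dist w w')

/-! ### Operators -/

/-- `(A u)_{ℓ j} = ∑_{ℓ', j'} A_j^{j'}(ℓ - ℓ') u_{ℓ' j'}`, for `j ≠ 0`. -/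
def act {ν : ℕ} (A : TMat ν) (u : Coeffs ν) : Coeffs ν := fun l j =>
  if j = 0 then 0 else ∑' q : (Fin ν → ℤ) × ℤ, A j q.2 (l - q.1) * u q.1 q.2

/-- The series that define `A u` converge. -/
def ActsOn {ν : ℕ} (A : TMat ν) (u : Coeffs ν) : Prop :=
  ∀ l j, j ≠ 0 → Summable fun q : (Fin ν → ℤ) × ℤ => A j q.2 (l - q.1) * u q.1 q.2

/-- `A` is a bounded operator of `H^s` with norm at most `N`. -/
def BoundedBy {ν : ℕ} (s : ℝ) (N : ℝ≥0∞) (A : TMat ν) : Prop :=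
  ∀ u, MemH s u → ActsOn A u ∧ hsNorm s (act A u) ≤ N * hsNorm s u

/-- The matrix of `Op(a)`, `Op(a) u = ∑_j a(φ, x, j) u_j(φ) e^{i j x}`. -/
def opMat {ν : ℕ} (a : Symb ν) : TMat ν := fun j j' l =>
  torusCoeff (fun φ x => a φ x (j' : ℝ)) l (j - j')

/-- The matrix of `∂_φ^b A`. -/
def dPhi {ν : ℕ} (b : Fin ν → ℕ) (A : TMat ν) : TMat ν := fun j j' l =>
  (∏ i, (Complex.I * (l i : ℂ)) ^ b i) * A j j' l

/-- The matrix of the commutator `[A, ∂_x]`. -/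
def commDx {ν : ℕ} (A : TMat ν) : TMat ν := fun j j' l =>
  Complex.I * ((j' : ℂ) - (j : ℂ)) * A j j' l

/-- The matrix of `⟨D_x⟩^{m₁} A ⟨D_x⟩^{m₂}`. -/
def wDx {ν : ℕ} (m₁ m₂ : ℝ) (A : TMat ν) : TMat ν := fun j j' l =>
  ((jap j ^ m₁ : ℝ) : ℂ) * A j j' l * ((jap j' ^ m₂ : ℝ) : ℂ)

/-- The dispersion law `j (4 + j²) / (1 + j²)`: the operator
`J = (1 - ∂_xx)⁻¹ (4 - ∂_xx) ∂_x` is the Fourier multiplier `i j (4 + j²) / (1 + j²)`. -/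
def disp (j : ℤ) : ℝ := j * (4 + (j : ℝ) ^ 2) / (1 + (j : ℝ) ^ 2)

/-- `A` maps real functions to real functions. -/
def IsRealMat {ν : ℕ} (A : TMat ν) : Prop :=
  ∀ j j' : ℤ, j ≠ 0 → j' ≠ 0 → ∀ l, conj (A j j' l) = A (-j) (-j') (-l)

/-- `A` is Hamiltonian: `J⁻¹ A(φ)` is real and symmetric for all `φ`. -/
def IsHamMat {ν : ℕ} (A : TMat ν) : Prop :=
  IsRealMat A ∧ ∀ j j' : ℤ, j ≠ 0 → j' ≠ 0 → ∀ l,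
    A j j' l = -((disp j / disp j' : ℝ) : ℂ) * A (-j') (-j) l

/-! ### The phase space and its symplectic form -/

/-- `h` is the sequence of Fourier coefficients of a real function in `H^s(𝕋)` with zero
average. -/
def MemHx (s : ℝ) (h : ℤ → ℂ) : Prop :=
  (∀ j, conj (h j) = h (-j)) ∧ h 0 = 0 ∧ Summable fun j : ℤ => ‖h j‖ ^ 2 * jap j ^ (2 * s)

/-- The symplectic form `Ω(u, v) = ∫_𝕋 (J⁻¹ u) v dx` in Fourier coefficients. -/
def sympForm (u v : ℤ → ℂ) : ℂ :=
  2 * (Real.pi : ℂ) * ∑' j : ℤ, u j / (Complex.I * (disp j : ℂ)) * v (-j)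

/-- `A_j^{j'}(φ) = ∑_ℓ A_j^{j'}(ℓ) e^{i ℓ·φ}`. -/
def entryAt {ν : ℕ} (A : TMat ν) (φ : Fin ν → ℝ) (j j' : ℤ) : ℂ :=
  ∑' l : Fin ν → ℤ, A j j' l * Complex.exp (Complex.I * ((∑ i, (l i : ℝ) * φ i : ℝ) : ℂ))

/-- The action of `A(φ)` on functions of `x`. -/
def actAt {ν : ℕ} (A : TMat ν) (φ : Fin ν → ℝ) (h : ℤ → ℂ) : ℤ → ℂ := fun j =>
  if j = 0 then 0 else ∑' j' : ℤ, entryAt A φ j j' * h j'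

/-- For each `φ`, the operator `A(φ)` is well defined on `H^s(𝕋)`, maps it to itself and
preserves `Ω`. -/
def IsSymplecticFamily {ν : ℕ} (s : ℝ) (A : TMat ν) : Prop :=
  (∀ j j' : ℤ, j ≠ 0 → j' ≠ 0 → Summable fun l => ‖A j j' l‖) ∧
  ∀ φ : Fin ν → ℝ,
    (∀ h, MemHx s h →
      (∀ j, j ≠ 0 → Summable fun j' => entryAt A φ j j' * h j') ∧ MemHx s (actAt A φ h)) ∧
    ∀ u v, MemHx s u → MemHx s v → sympForm (actAt A φ u) (actAt A φ v) = sympForm u v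

/-! ### Tame operators and the class of smoothing remainders -/

/-- The family `A(ω)`, `ω ∈ O`, is Lip-`0`-tame for `s₀ ≤ s ≤ S`, with the non-decreasing tame
constants `M(s)`. -/
def LipTame {ν : ℕ} (γ : ℝ) (O : Set (Freq ν)) (S : ℝ) (A : Freq ν → TMat ν)
    (M : ℝ → ℝ≥0∞) : Prop :=
  MonotoneOn M (Set.Icc (sZero ν) S) ∧
  ∀ s ∈ Set.Icc (sZero ν) S, ∀ u : Coeffs ν, MemH s u →
    (∀ w ∈ O, ActsOn (A w) u ∧
      hsNorm s (act (A w) u) ≤ M s * hsNorm (sZero ν) u + M (sZero ν) * hsNorm s u) ∧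
    ∀ w ∈ O, ∀ w' ∈ O, w ≠ w' →
      ENNReal.ofReal γ * (hsNorm (s - 1) (act (A w - A w') u) / ENNReal.ofReal (dist w w')) ≤
        M s * hsNorm (sZero ν) u + M (sZero ν) * hsNorm s u

/-- `A` is a family of `ρ`-smoothing remainders on `O`, for `s₀ ≤ s ≤ S`, and `M(s)` bounds all the
tame constants of `⟨D_x⟩^{m₁} ∂_φ^b A ⟨D_x⟩^{m₂}` with `m₁ + m₂ = ρ - |b|` and of
`⟨D_x⟩^{m₁} [∂_φ^b A, ∂_x] ⟨D_x⟩^{m₂}` with `m₁ + m₂ = ρ - |b| - 1`, where `|b| ≤ ρ - 2`. -/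
def SmoothingTame {ν : ℕ} (γ : ℝ) (O : Set (Freq ν)) (S : ℝ) (ρ : ℕ) (A : Freq ν → TMat ν)
    (M : ℝ → ℝ≥0∞) : Prop :=
  ∀ b : Fin ν → ℕ, (∑ i, b i) + 2 ≤ ρ → ∀ m₁ m₂ : ℝ, 0 ≤ m₁ → 0 ≤ m₂ →
    (m₁ + m₂ = (ρ : ℝ) - (∑ i, (b i : ℝ)) →
      LipTame γ O S (fun w => wDx m₁ m₂ (dPhi b (A w))) M) ∧
    (m₁ + m₂ = (ρ : ℝ) - (∑ i, (b i : ℝ)) - 1 →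
      LipTame γ O S (fun w => wDx m₁ m₂ (commDx (dPhi b (A w)))) M)

/-- The corresponding bound by `N` on `H^p` for a difference `A` of two smoothing remainders: one
order of smoothing and one `φ`-derivative less. -/
def SmoothingDiff {ν : ℕ} (p : ℝ) (ρ : ℕ) (A : TMat ν) (N : ℝ≥0∞) : Prop :=
  ∀ b : Fin ν → ℕ, (∑ i, b i) + 3 ≤ ρ → ∀ m₁ m₂ : ℝ, 0 ≤ m₁ → 0 ≤ m₂ →
    (m₁ + m₂ = (ρ : ℝ) - (∑ i, (b i : ℝ)) - 1 → BoundedBy p N (wDx m₁ m₂ (dPhi b A))) ∧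
    (m₁ + m₂ = (ρ : ℝ) - (∑ i, (b i : ℝ)) - 2 → BoundedBy p N (wDx m₁ m₂ (commDx (dPhi b A))))

/-! ### Non-resonant frequencies -/

/-- The set `𝒪₀` of diophantine frequencies in `[L, 2L]^ν`. -/
def setO (ν : ℕ) (L γ : ℝ) : Set (Freq ν) :=
  {w | (∀ i, w i ∈ Set.Icc L (2 * L)) ∧
    ∀ l : Fin ν → ℤ, l ≠ 0 → 2 * γ / japL l ^ (ν : ℝ) ≤ |dotL w l|}

/-- First order Melnikov conditions. -/
def setOmega1 {ν : ℕ} (L γ τ : ℝ) (m : Freq ν → ℝ) : Set (Freq ν) :=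
  {w ∈ setO ν L γ | ∀ (l : Fin ν → ℤ) (j : ℤ), j ≠ 0 →
    2 * γ * japL l ^ (-τ) ≤ |dotL w l - m w * j|}

/-- The eigenvalues `d_j = m j (4 + j²) / (1 + j²) + r_j`. -/
def eig (m r : ℝ) (j : ℤ) : ℝ := m * disp j + r

/-- Second order Melnikov conditions. -/
def setOmega2 {ν : ℕ} (L γ τ : ℝ) (m : Freq ν → ℝ) (r : Freq ν → ℤ → ℝ) : Set (Freq ν) :=
  {w ∈ setO ν L γ | ∀ (l : Fin ν → ℤ) (j k : ℤ), j ≠ 0 → k ≠ 0 → ¬(j = k ∧ l = 0) →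
    2 * γ ^ (3 / 2 : ℝ) * japL l ^ (-τ) ≤ |dotL w l + eig (m w) (r w j) j - eig (m w) (r w k) k|}

/-- `𝒪_∞ = Ω₁ ∩ Ω₂`. -/
def setOinf {ν : ℕ} (L γ τ : ℝ) (m : Freq ν → ℝ) (r : Freq ν → ℤ → ℝ) : Set (Freq ν) :=
  setOmega1 L γ τ m ∩ setOmega2 L γ τ m r

/-! ### The regularized operators and their diagonal form -/

/-- `ω·∂_φ - m J + R`. -/
def opPlus {ν : ℕ} (w : Freq ν) (m : ℝ) (R : TMat ν) (u : Coeffs ν) : Coeffs ν := fun l j =>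
  Complex.I * (dotL w l : ℂ) * u l j - (m : ℂ) * (Complex.I * (disp j : ℂ)) * u l j + act R u l j

/-- `ω·∂_φ - diag_{j ≠ 0} (i d_j)`. -/
def opDiag {ν : ℕ} (w : Freq ν) (d : ℤ → ℝ) (u : Coeffs ν) : Coeffs ν := fun l j =>
  Complex.I * (dotL w l : ℂ) * u l j - Complex.I * (d j : ℂ) * u l j

/-- `ω ↦ 𝔍(ω)` is a Lipschitz function on `𝒪₀` with values in `C^∞(𝕋^{ν+1}; ℝ)`, and
`‖𝔍‖_{s₀+μ}^{γ,𝒪₀} ≤ 1`. -/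
def AdmissibleTorus {ν : ℕ} (L γ μ : ℝ) (f : Freq ν → TorusFn ν) : Prop :=
  (∀ w ∈ setO ν L γ, IsSmoothTorus (f w)) ∧
  (∀ s : ℝ, lipHs γ (setO ν L γ) s (fun w => coeffR (f w)) < ⊤) ∧
  lipHs γ (setO ν L γ) (sZero ν + μ) (fun w => coeffR (f w)) ≤ 1

/-- The operators `ω·∂_φ - m(𝔍) J + R(𝔍)`, with `R = Op(q) + Q`, `𝔍 ∈ F`, form a family of
regularized Hamiltonian operators: `q` is a symbol of order `-1` and `Q` a `ρ`-smoothing remainder,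
both defined for `ω ∈ Ω₁(𝔍)`; they satisfy tame bounds of size `ε γ⁻¹`, with loss of `κ`
derivatives, and depend on `𝔍` in a Lipschitz way. The bounds on high norms are required for
`s₀ ≤ s ≤ S`, those on differences for `s₀ ≤ p ≤ P`; the constants in the bounds are `Km` and
`K s α`. -/
structure IsRegularizedFamily {ν : ℕ} (L γ τ ε κ S P : ℝ) (ρ : ℕ) (Km : ℝ) (K : ℝ → ℕ → ℝ)
    (F : Set (Freq ν → TorusFn ν)) (m : (Freq ν → TorusFn ν) → Freq ν → ℝ)
    (q : (Freq ν → TorusFn ν) → Freq ν → Symb ν)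
    (Q : (Freq ν → TorusFn ν) → Freq ν → TMat ν) : Prop where
  bound_m : ∀ f ∈ F, lipScalar γ (setO ν L γ) (fun w => m f w - 1) ≤ ENNReal.ofReal (Km * ε)
  diff_m : ∀ f₁ ∈ F, ∀ f₂ ∈ F, ∀ w ∈ setOmega1 L γ τ (m f₁) ∩ setOmega1 L γ τ (m f₂),
    ENNReal.ofReal |m f₁ w - m f₂ w| ≤
      ENNReal.ofReal (Km * ε) * hsNorm (sZero ν + κ) (coeffR (f₁ w) - coeffR (f₂ w))
  symbol : ∀ f ∈ F, ∀ w ∈ setOmega1 L γ τ (m f), IsSymbol (-1) (q f w)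
  hamiltonian : ∀ f ∈ F, ∀ w ∈ setOmega1 L γ τ (m f), IsHamMat (opMat (q f w) + Q f w)
  bound_q : ∀ f ∈ F, ∀ s ∈ Set.Icc (sZero ν) S, ∀ α : ℕ,
    lipSym γ (setOmega1 L γ τ (m f)) (-1) s α (q f) ≤
      ENNReal.ofReal (K s α * ε * γ⁻¹) * lipHs γ (setO ν L γ) (s + κ) (fun w => coeffR (f w))
  bound_Q : ∀ f ∈ F, ∃ M : ℝ → ℝ≥0∞,
    SmoothingTame γ (setOmega1 L γ τ (m f)) S ρ (Q f) M ∧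
    ∀ s ∈ Set.Icc (sZero ν) S, M s ≤
      ENNReal.ofReal (K s 0 * ε * γ⁻¹) * lipHs γ (setO ν L γ) (s + κ) (fun w => coeffR (f w))
  diff_q : ∀ f₁ ∈ F, ∀ f₂ ∈ F, ∀ w ∈ setOmega1 L γ τ (m f₁) ∩ setOmega1 L γ τ (m f₂),
    ∀ p ∈ Set.Icc (sZero ν) P, ∀ α : ℕ, symNorm (-1) p α (q f₁ w - q f₂ w) ≤
      ENNReal.ofReal (K p α * ε * γ⁻¹) * hsNorm (sZero ν + κ) (coeffR (f₁ w) - coeffR (f₂ w))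
  diff_Q : ∀ f₁ ∈ F, ∀ f₂ ∈ F, ∀ w ∈ setOmega1 L γ τ (m f₁) ∩ setOmega1 L γ τ (m f₂),
    ∀ p ∈ Set.Icc (sZero ν) P, SmoothingDiff p ρ (Q f₁ w - Q f₂ w)
      (ENNReal.ofReal (K p 0 * ε * γ⁻¹) *
        hsNorm (sZero ν + κ) (coeffR (f₁ w) - coeffR (f₂ w)))

/-- `Φ` and `Ψ = Φ⁻¹` are real, bounded on `H^s` for `s₀ ≤ s ≤ S`, inverse to each other,
symplectic, and `Φ ∘ (ω·∂_φ - m J + R) ∘ Φ⁻¹ = ω·∂_φ - diag (i d_j)` on `H^{s₀+1}`. -/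
structure Diagonalizes {ν : ℕ} (S : ℝ) (w : Freq ν) (m : ℝ) (R : TMat ν) (d : ℤ → ℝ)
    (Φ Ψ : TMat ν) : Prop where
  real_map : IsRealMat Φ
  real_inv : IsRealMat Ψ
  bounded_map : ∀ s ∈ Set.Icc (sZero ν) S, ∃ N : ℝ≥0∞, N < ⊤ ∧ BoundedBy s N Φ
  bounded_inv : ∀ s ∈ Set.Icc (sZero ν) S, ∃ N : ℝ≥0∞, N < ⊤ ∧ BoundedBy s N Ψ
  left_inv : ∀ u, MemH (sZero ν) u → act Ψ (act Φ u) = u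
  right_inv : ∀ u, MemH (sZero ν) u → act Φ (act Ψ u) = u
  symplectic_map : IsSymplecticFamily (sZero ν) Φ
  symplectic_inv : IsSymplecticFamily (sZero ν) Ψ
  conjugates : ∀ u, MemH (sZero ν + 1) u →
    MemH (sZero ν + 1) (act Φ u) ∧ MemH (sZero ν + 1) (act Ψ u) ∧
    MemH (sZero ν) (opPlus w m R (act Ψ u)) ∧ act Φ (opPlus w m R (act Ψ u)) = opDiag w d u

/-- The tame bound on `A(ω) - I`, for `ω ∈ O`, `s₀ ≤ s ≤ S` and `h = h(ω) ∈ H^s`: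
`‖(A - I)h‖_s ≤ C(s) ((ε γ^{-3/2} + ε γ^{-5/2} T(s)) ‖h‖_{s₀} + ε γ^{-5/2} ‖h‖_s)`, all norms of
functions of `ω` being the Lipschitz ones with weight `γ^{3/2}` on `O`. -/
def NearIdTame {ν : ℕ} (γ ε : ℝ) (O : Set (Freq ν)) (S : ℝ) (C : ℝ → ℝ) (T : ℝ → ℝ≥0∞)
    (A : Freq ν → TMat ν) : Prop :=
  ∀ s ∈ Set.Icc (sZero ν) S, ∀ h : Freq ν → Coeffs ν, (∀ w ∈ O, MemH s (h w)) →
    lipHs (γ ^ (3 / 2 : ℝ)) O s (fun w => act (A w) (h w) - h w) ≤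
      ENNReal.ofReal (C s) *
        ((ENNReal.ofReal (ε * γ ^ (-(3 / 2) : ℝ)) + ENNReal.ofReal (ε * γ ^ (-(5 / 2) : ℝ)) * T s) *
            lipHs (γ ^ (3 / 2 : ℝ)) O (sZero ν) h +
          ENNReal.ofReal (ε * γ ^ (-(5 / 2) : ℝ)) * lipHs (γ ^ (3 / 2 : ℝ)) O s h)

end

end DP

open DP

namespace DP

noncomputable section

/-! ### The Banach algebra of infinite matrices with bounded columns -/

section MatrixAlgebra

variable {ι : Type*}

/-- The space `ℓ¹(ι; ℂ)`. -/
abbrev Seq1 (ι : Type*) := lp (fun _ : ι => ℂ) 1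

/-- Bounded operators of `ℓ¹`, i.e. matrices with uniformly summable columns. -/
abbrev MatOp (ι : Type*) := Seq1 ι →L[ℂ] Seq1 ι

open Classical in
/-- The vectors of the standard basis of `ℓ¹`. -/
def bas (k : ι) : Seq1 ι := lp.single 1 k (1 : ℂ)

/-- The matrix entries of an operator. -/
def ent (A : MatOp ι) (i k : ι) : ℂ := (A (bas k)) i

theorem hasSum_bas (f : Seq1 ι) : HasSum (fun k => f k • bas k) f := by
  classical
  have h := lp.hasSum_single (E := fun _ : ι => ℂ) (p := 1) ENNReal.one_ne_top f
  convert h using 1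
  funext k
  rw [bas, ← lp.single_smul, smul_eq_mul, mul_one]

theorem norm_bas (k : ι) : ‖bas k‖ = 1 := by
  classical
  simp [bas]

open Classical in
theorem bas_apply (k i : ι) : bas k i = if i = k then 1 else 0 := by
  rw [bas, lp.single_apply]
  by_cases h : i = k
  · subst h; simp
  · simp [h]

/-- A coordinate of an operator as a continuous linear functional of the operator. -/
def entCLM (i k : ι) : MatOp ι →L[ℂ] ℂ :=
  (lp.evalCLM ℂ (fun _ : ι => ℂ) 1 i).comp (ContinuousLinearMap.apply ℂ (Seq1 ι) (bas k))

theorem ent_add (A B : MatOp ι) (i k : ι) : ent (A + B) i k = ent A i k + ent B i k := rfl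

theorem ent_sub (A B : MatOp ι) (i k : ι) : ent (A - B) i k = ent A i k - ent B i k := rfl

theorem ent_neg (A : MatOp ι) (i k : ι) : ent (-A) i k = -ent A i k := rfl

theorem ent_zero (i k : ι) : ent (0 : MatOp ι) i k = 0 := rfl

theorem ent_smul (c : ℂ) (A : MatOp ι) (i k : ι) : ent (c • A) i k = c * ent A i k := rfl

open Classical in
theorem ent_one (i k : ι) : ent (1 : MatOp ι) i k = if i = k then 1 else 0 := bas_apply k i

theorem hasSum_ent_mul (A B : MatOp ι) (i k : ι) :
    HasSum (fun j => ent A i j * ent B j k) (ent (A * B) i k) := by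
  have h := ((hasSum_bas (B (bas k))).mapL A).mapL (lp.evalCLM ℂ (fun _ : ι => ℂ) 1 i)
  have he : (fun j => ent A i j * ent B j k) = fun j =>
      lp.evalCLM ℂ (fun _ : ι => ℂ) 1 i (A (B (bas k) j • bas j)) := by
    funext j
    simp only [map_smul, smul_eq_mul]
    exact mul_comm _ _
  rw [he]
  exact h

theorem ent_mul (A B : MatOp ι) (i k : ι) : ent (A * B) i k = ∑' j, ent A i j * ent B j k :=
  (hasSum_ent_mul A B i k).tsum_eq.symm

theorem ent_tsum {f : ℕ → MatOp ι} (hf : Summable f) (i k : ι) :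
    ent (∑' n, f n) i k = ∑' n, ent (f n) i k :=
  (entCLM i k).map_tsum hf

theorem MatOp.ext_ent {A B : MatOp ι} (h : ∀ i k, ent A i k = ent B i k) : A = B := by
  have hb : ∀ k, A (bas k) = B (bas k) := fun k => lp.ext (funext fun i => h i k)
  ext1 f
  have h1 := (hasSum_bas f).mapL A
  have h2 := (hasSum_bas f).mapL B
  simp only [map_smul, hb] at h1 h2
  exact h1.unique h2

theorem enorm_seq1 (f : Seq1 ι) : ‖f‖ₑ = ∑' i, ‖f i‖ₑ := by
  have h := lp.hasSum_norm (E := fun _ : ι => ℂ) (p := 1) (by norm_num) f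
  simp only [ENNReal.toReal_one, Real.rpow_one] at h
  rw [← ofReal_norm, ← h.tsum_eq, ENNReal.ofReal_tsum_of_nonneg
    (fun _ => norm_nonneg _) h.summable]
  simp

theorem memlp_one_of_tsum {f : ι → ℂ} (hf : ∑' i, ‖f i‖ₑ ≠ ⊤) : Memℓp f 1 := by
  refine memℓp_gen ?_
  simp only [ENNReal.toReal_one, Real.rpow_one]
  have := ENNReal.summable_toReal hf
  simpa using this

/-- A matrix has uniformly bounded columns. -/
def ColBdd (K : ι → ι → ℂ) : Prop := ∃ C : NNReal, ∀ k, ∑' i, ‖K i k‖ₑ ≤ C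

theorem ColBdd.ne_top {K : ι → ι → ℂ} (h : ColBdd K) (k : ι) : ∑' i, ‖K i k‖ₑ ≠ ⊤ := by
  obtain ⟨C, hC⟩ := h
  exact ne_top_of_le_ne_top ENNReal.coe_ne_top (hC k)

/-- A column of a matrix. -/
def colVec {K : ι → ι → ℂ} (h : ColBdd K) (k : ι) : Seq1 ι :=
  ⟨fun i => K i k, memlp_one_of_tsum (h.ne_top k)⟩

theorem enorm_colVec {K : ι → ι → ℂ} (h : ColBdd K) (k : ι) :
    ‖colVec h k‖ₑ = ∑' i, ‖K i k‖ₑ := enorm_seq1 _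

theorem exists_matOp_of_colBdd {K : ι → ι → ℂ} (h : ColBdd K) :
    ∃ A : MatOp ι, ∀ i k, ent A i k = K i k := by
  obtain ⟨C, hC⟩ := id h
  have hn : ∀ k, ‖colVec h k‖ ≤ C := by
    intro k
    have := hC k
    rw [← enorm_colVec h k] at this
    exact_mod_cast this
  have hs : ∀ f : Seq1 ι, Summable fun k => ‖f k‖ := by
    intro f
    have h := lp.hasSum_norm (E := fun _ : ι => ℂ) (p := 1) (by norm_num) f
    simpa using h.summable
  have hfn : ∀ f : Seq1 ι, ∑' k, ‖f k‖ = ‖f‖ := by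
    intro f
    have h := lp.hasSum_norm (E := fun _ : ι => ℂ) (p := 1) (by norm_num) f
    simpa using h.tsum_eq
  have hb : ∀ (f : Seq1 ι) k, ‖f k • colVec h k‖ ≤ ‖f k‖ * C := fun f k => by
    rw [norm_smul]; gcongr; exact hn k
  have hsum : ∀ f : Seq1 ι, Summable fun k => f k • colVec h k := fun f =>
    Summable.of_norm_bounded ((hs f).mul_right _) (hb f)
  let T : Seq1 ι →ₗ[ℂ] Seq1 ι :=
    { toFun := fun f => ∑' k, f k • colVec h k
      map_add' := fun f g => by
        rw [← (hsum f).tsum_add (hsum g)]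
        refine tsum_congr fun k => ?_
        rw [← add_smul]; rfl
      map_smul' := fun c f => by
        rw [RingHom.id_apply, ← (hsum f).tsum_const_smul]
        refine tsum_congr fun k => ?_
        rw [smul_smul]; rfl }
  refine ⟨T.mkContinuous C fun f => ?_, fun i k => ?_⟩
  · rw [mul_comm, ← hfn f, ← tsum_mul_right]
    exact tsum_of_norm_bounded ((hs f).mul_right _).hasSum (hb f)
  · change (∑' j, bas k j • colVec h j : Seq1 ι) i = _
    classical
    rw [tsum_eq_single k]
    · rw [bas_apply, if_pos rfl, one_smul]; rfl
    · intro j hj; rw [bas_apply, if_neg hj, zero_smul]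

open Classical in
/-- The operator with a given matrix (zero if the columns are not uniformly summable). -/
def ofKernel (K : ι → ι → ℂ) : MatOp ι :=
  if h : ColBdd K then (exists_matOp_of_colBdd h).choose else 0

theorem ent_ofKernel {K : ι → ι → ℂ} (h : ColBdd K) (i k : ι) : ent (ofKernel K) i k = K i k := by
  rw [ofKernel, dif_pos h]
  exact (exists_matOp_of_colBdd h).choose_spec i k

theorem tsum_enorm_ent_le (A : MatOp ι) (k : ι) : ∑' i, ‖ent A i k‖ₑ ≤ ‖A‖ₑ := by
  have h := enorm_seq1 (A (bas k))
  have h2 : ‖A (bas k)‖ ≤ ‖A‖ := by simpa [norm_bas] using A.le_opNorm (bas k)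
  have h3 : ‖A (bas k)‖ₑ ≤ ‖A‖ₑ := by
    rw [← ofReal_norm, ← ofReal_norm]
    exact ENNReal.ofReal_le_ofReal h2
  exact h ▸ h3

theorem enorm_matOp_le {A : MatOp ι} {C : ℝ≥0∞} (h : ∀ k, ∑' i, ‖ent A i k‖ₑ ≤ C) :
    ‖A‖ₑ ≤ C := by
  rcases eq_or_ne C ⊤ with rfl | hC
  · exact le_top
  lift C to NNReal using hC
  have hb : ∀ k, ‖A (bas k)‖ ≤ C := by
    intro k
    have : ‖A (bas k)‖ₑ ≤ C := enorm_seq1 (A (bas k)) ▸ h k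
    exact_mod_cast this
  have : ‖A‖ ≤ C := by
    refine A.opNorm_le_bound C.2 fun f => ?_
    have hf := lp.hasSum_norm (E := fun _ : ι => ℂ) (p := 1) (by norm_num) f
    simp only [ENNReal.toReal_one, Real.rpow_one] at hf
    have h1 := (hasSum_bas f).mapL A
    have h2 := hf.mul_left (C : ℝ)
    have := tsum_of_norm_bounded h2 (f := fun k => A (f k • bas k)) fun k => by
      rw [map_smul, norm_smul, mul_comm]; gcongr; exact hb k
    rwa [h1.tsum_eq] at this
  exact_mod_cast this

/-- The entrywise product of an operator with a bounded multiplier. -/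
def schur (φ : ι → ι → ℂ) (A : MatOp ι) : MatOp ι := ofKernel fun i k => φ i k * ent A i k

theorem ent_schur {φ : ι → ι → ℂ} {C : ℝ} (hφ : ∀ i k, ‖φ i k‖ ≤ C) (A : MatOp ι) (i k : ι) :
    ent (schur φ A) i k = φ i k * ent A i k := by
  refine ent_ofKernel ⟨C.toNNReal * ‖A‖₊, fun k => ?_⟩ i k
  calc ∑' i, ‖φ i k * ent A i k‖ₑ ≤ ∑' i, (C.toNNReal : ℝ≥0∞) * ‖ent A i k‖ₑ := by
        refine ENNReal.tsum_le_tsum fun i => ?_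
        rw [enorm_mul]
        gcongr
        rw [← ofReal_norm]
        exact ENNReal.ofReal_le_ofReal (hφ i k)
    _ ≤ _ := by
        rw [ENNReal.tsum_mul_left, ENNReal.coe_mul]
        gcongr
        exact tsum_enorm_ent_le A k

end MatrixAlgebra

/-! ### Weighted Schur norms of matrices and of pairs of matrices -/

section SchurNorm

variable {ι : Type*}

/-- The Schur norm with weight `w`: the larger of the suprema of the weighted row sums and of the
weighted column sums. -/
def schurN (w : ι → ι → ℝ≥0∞) (A : MatOp ι) : ℝ≥0∞ :=
  (⨆ i, ∑' k, w i k * ‖ent A i k‖ₑ) ⊔ ⨆ k, ∑' i, w i k * ‖ent A i k‖ₑ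

theorem row_le_schurN (w : ι → ι → ℝ≥0∞) (A : MatOp ι) (i : ι) :
    ∑' k, w i k * ‖ent A i k‖ₑ ≤ schurN w A :=
  (le_iSup (fun i => ∑' k, w i k * ‖ent A i k‖ₑ) i).trans le_sup_left

theorem col_le_schurN (w : ι → ι → ℝ≥0∞) (A : MatOp ι) (k : ι) :
    ∑' i, w i k * ‖ent A i k‖ₑ ≤ schurN w A :=
  (le_iSup (fun k => ∑' i, w i k * ‖ent A i k‖ₑ) k).trans le_sup_right

theorem schurN_le {w : ι → ι → ℝ≥0∞} {A : MatOp ι} {C : ℝ≥0∞}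
    (h1 : ∀ i, ∑' k, w i k * ‖ent A i k‖ₑ ≤ C) (h2 : ∀ k, ∑' i, w i k * ‖ent A i k‖ₑ ≤ C) :
    schurN w A ≤ C := sup_le (iSup_le h1) (iSup_le h2)

theorem ent_le_schurN (w : ι → ι → ℝ≥0∞) (A : MatOp ι) (i k : ι) :
    w i k * ‖ent A i k‖ₑ ≤ schurN w A :=
  (ENNReal.le_tsum (f := fun k => w i k * ‖ent A i k‖ₑ) k).trans (row_le_schurN w A i)

theorem schurN_zero (w : ι → ι → ℝ≥0∞) : schurN w (0 : MatOp ι) = 0 := by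
  refine le_antisymm (schurN_le ?_ ?_) zero_le <;> simp [ent_zero]

theorem schurN_add (w : ι → ι → ℝ≥0∞) (A B : MatOp ι) :
    schurN w (A + B) ≤ schurN w A + schurN w B := by
  have h : ∀ i k, w i k * ‖ent (A + B) i k‖ₑ ≤ w i k * ‖ent A i k‖ₑ + w i k * ‖ent B i k‖ₑ := by
    intro i k
    rw [← mul_add, ent_add]
    gcongr
    exact enorm_add_le _ _
  refine schurN_le (fun i => ?_) fun k => ?_
  · refine (ENNReal.tsum_le_tsum fun k => h i k).trans ?_
    rw [ENNReal.tsum_add]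
    exact add_le_add (row_le_schurN w A i) (row_le_schurN w B i)
  · refine (ENNReal.tsum_le_tsum fun i => h i k).trans ?_
    rw [ENNReal.tsum_add]
    exact add_le_add (col_le_schurN w A k) (col_le_schurN w B k)

theorem schurN_neg (w : ι → ι → ℝ≥0∞) (A : MatOp ι) : schurN w (-A) = schurN w A := by
  simp [schurN, ent_neg]

theorem schurN_smul (w : ι → ι → ℝ≥0∞) (c : ℂ) (A : MatOp ι) :
    schurN w (c • A) ≤ ‖c‖ₑ * schurN w A := by
  have h : ∀ i k, w i k * ‖ent (c • A) i k‖ₑ = ‖c‖ₑ * (w i k * ‖ent A i k‖ₑ) := by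
    intro i k
    rw [ent_smul, enorm_mul]; ring
  refine schurN_le (fun i => ?_) fun k => ?_
  · simp only [h, ENNReal.tsum_mul_left]
    gcongr
    exact row_le_schurN w A i
  · simp only [h, ENNReal.tsum_mul_left]
    gcongr
    exact col_le_schurN w A k

theorem schurN_mono {w w' : ι → ι → ℝ≥0∞} {g : ℝ≥0∞} {A B : MatOp ι}
    (h : ∀ i k, w' i k * ‖ent B i k‖ₑ ≤ g * (w i k * ‖ent A i k‖ₑ)) :
    schurN w' B ≤ g * schurN w A := by
  refine schurN_le (fun i => ?_) fun k => ?_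
  · refine (ENNReal.tsum_le_tsum fun k => h i k).trans ?_
    rw [ENNReal.tsum_mul_left]
    gcongr
    exact row_le_schurN w A i
  · refine (ENNReal.tsum_le_tsum fun i => h i k).trans ?_
    rw [ENNReal.tsum_mul_left]
    gcongr
    exact col_le_schurN w A k

/-- Submultiplicative weights. -/
def SubMul (w : ι → ι → ℝ≥0∞) : Prop := ∀ i j k, w i k ≤ w i j * w j k

theorem schurN_mul {w : ι → ι → ℝ≥0∞} (hw : SubMul w) (A B : MatOp ι) :
    schurN w (A * B) ≤ schurN w A * schurN w B := by
  have h : ∀ i k, w i k * ‖ent (A * B) i k‖ₑ ≤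
      ∑' j, (w i j * ‖ent A i j‖ₑ) * (w j k * ‖ent B j k‖ₑ) := by
    intro i k
    rw [ent_mul]
    refine (mul_le_mul_right (enorm_tsum_le_tsum_enorm) _).trans ?_
    rw [← ENNReal.tsum_mul_left]
    refine ENNReal.tsum_le_tsum fun j => ?_
    rw [enorm_mul]
    calc w i k * (‖ent A i j‖ₑ * ‖ent B j k‖ₑ)
        ≤ (w i j * w j k) * (‖ent A i j‖ₑ * ‖ent B j k‖ₑ) := by gcongr; exact hw i j k
      _ = _ := by ring
  refine schurN_le (fun i => ?_) fun k => ?_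
  · refine (ENNReal.tsum_le_tsum fun k => h i k).trans ?_
    rw [ENNReal.tsum_comm]
    calc ∑' j, ∑' k, (w i j * ‖ent A i j‖ₑ) * (w j k * ‖ent B j k‖ₑ)
        ≤ ∑' j, (w i j * ‖ent A i j‖ₑ) * schurN w B := by
          refine ENNReal.tsum_le_tsum fun j => ?_
          rw [ENNReal.tsum_mul_left]
          gcongr
          exact row_le_schurN w B j
      _ ≤ _ := by
          rw [ENNReal.tsum_mul_right]
          gcongr
          exact row_le_schurN w A i
  · refine (ENNReal.tsum_le_tsum fun i => h i k).trans ?_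
    rw [ENNReal.tsum_comm]
    calc ∑' j, ∑' i, (w i j * ‖ent A i j‖ₑ) * (w j k * ‖ent B j k‖ₑ)
        ≤ ∑' j, schurN w A * (w j k * ‖ent B j k‖ₑ) := by
          refine ENNReal.tsum_le_tsum fun j => ?_
          rw [ENNReal.tsum_mul_right]
          gcongr
          exact col_le_schurN w A j
      _ ≤ _ := by
          rw [ENNReal.tsum_mul_left]
          gcongr
          exact col_le_schurN w B k

theorem schurN_tsum (w : ι → ι → ℝ≥0∞) (f : ℕ → MatOp ι) :
    schurN w (∑' n, f n) ≤ ∑' n, schurN w (f n) := by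
  by_cases hf : Summable f
  · have h : ∀ i k, w i k * ‖ent (∑' n, f n) i k‖ₑ ≤ ∑' n, w i k * ‖ent (f n) i k‖ₑ := by
      intro i k
      rw [ent_tsum hf, ENNReal.tsum_mul_left]
      gcongr
      exact enorm_tsum_le_tsum_enorm
    refine schurN_le (fun i => ?_) fun k => ?_
    · refine (ENNReal.tsum_le_tsum fun k => h i k).trans ?_
      rw [ENNReal.tsum_comm]
      exact ENNReal.tsum_le_tsum fun n => row_le_schurN w (f n) i
    · refine (ENNReal.tsum_le_tsum fun i => h i k).trans ?_
      rw [ENNReal.tsum_comm]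
      exact ENNReal.tsum_le_tsum fun n => col_le_schurN w (f n) k
  · rw [tsum_eq_zero_of_not_summable hf, schurN_zero]
    exact zero_le

theorem enorm_le_schurN {w : ι → ι → ℝ≥0∞} (hw : ∀ i k, 1 ≤ w i k) (A : MatOp ι) :
    ‖A‖ₑ ≤ schurN w A := by
  refine enorm_matOp_le fun k => (ENNReal.tsum_le_tsum fun i => ?_).trans (col_le_schurN w A k)
  exact le_mul_of_one_le_left' (hw i k)

/-- The norm of a pair of matrices, which controls both of them and, with weight `c`, their
difference. -/
def pairN (c : ℝ≥0∞) (w : ι → ι → ℝ≥0∞) (A B : MatOp ι) : ℝ≥0∞ :=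
  (schurN w A ⊔ schurN w B) + c * schurN w (A - B)

variable {c : ℝ≥0∞} {w : ι → ι → ℝ≥0∞}

theorem left_le_pairN (c : ℝ≥0∞) (w : ι → ι → ℝ≥0∞) (A B : MatOp ι) :
    schurN w A ≤ pairN c w A B := le_sup_left.trans le_self_add

theorem right_le_pairN (c : ℝ≥0∞) (w : ι → ι → ℝ≥0∞) (A B : MatOp ι) :
    schurN w B ≤ pairN c w A B := le_sup_right.trans le_self_add

theorem diff_le_pairN (c : ℝ≥0∞) (w : ι → ι → ℝ≥0∞) (A B : MatOp ι) :
    c * schurN w (A - B) ≤ pairN c w A B := le_add_self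

theorem pairN_self (c : ℝ≥0∞) (w : ι → ι → ℝ≥0∞) (A : MatOp ι) :
    pairN c w A A = schurN w A := by simp [pairN, schurN_zero]

theorem pairN_zero : pairN c w (0 : MatOp ι) 0 = 0 := by
  rw [pairN_self, schurN_zero]

theorem pairN_add (A B A' B' : MatOp ι) :
    pairN c w (A + A') (B + B') ≤ pairN c w A B + pairN c w A' B' := by
  have h : A + A' - (B + B') = (A - B) + (A' - B') := by abel
  unfold pairN
  rw [h]
  calc _ ≤ ((schurN w A ⊔ schurN w B) + (schurN w A' ⊔ schurN w B')) +
        c * (schurN w (A - B) + schurN w (A' - B')) := by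
        gcongr
        · refine sup_le ?_ ?_
          · exact (schurN_add w A A').trans (add_le_add le_sup_left le_sup_left)
          · exact (schurN_add w B B').trans (add_le_add le_sup_right le_sup_right)
        · exact schurN_add w _ _
    _ = _ := by ring

theorem pairN_smul (a : ℂ) (A B : MatOp ι) :
    pairN c w (a • A) (a • B) ≤ ‖a‖ₑ * pairN c w A B := by
  unfold pairN
  rw [← smul_sub]
  calc _ ≤ ‖a‖ₑ * (schurN w A ⊔ schurN w B) + c * (‖a‖ₑ * schurN w (A - B)) := by
        gcongr
        · refine sup_le ?_ ?_
          · exact (schurN_smul w a A).trans (mul_le_mul_right le_sup_left _)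
          · exact (schurN_smul w a B).trans (mul_le_mul_right le_sup_right _)
        · exact schurN_smul w _ _
    _ = _ := by ring

theorem pairN_neg (A B : MatOp ι) : pairN c w (-A) (-B) = pairN c w A B := by
  have h : -A - -B = -(A - B) := by abel
  simp only [pairN, schurN_neg, h]

theorem pairN_sub (A B A' B' : MatOp ι) :
    pairN c w (A - A') (B - B') ≤ pairN c w A B + pairN c w A' B' := by
  rw [sub_eq_add_neg, sub_eq_add_neg, ← pairN_neg A' B']
  exact pairN_add _ _ _ _

theorem pairN_mul (hw : SubMul w) (A B A' B' : MatOp ι) :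
    pairN c w (A * A') (B * B') ≤ pairN c w A B * pairN c w A' B' := by
  have h : A * A' - B * B' = (A - B) * A' + B * (A' - B') := by noncomm_ring
  unfold pairN
  rw [h]
  set a := schurN w A ⊔ schurN w B with ha
  set a' := schurN w A' ⊔ schurN w B' with ha'
  calc _ ≤ a * a' + c * (schurN w (A - B) * a' + a * schurN w (A' - B')) := by
        gcongr
        · refine sup_le ?_ ?_
          · exact (schurN_mul hw A A').trans (mul_le_mul' le_sup_left le_sup_left)
          · exact (schurN_mul hw B B').trans (mul_le_mul' le_sup_right le_sup_right)
        · refine (schurN_add w _ _).trans (add_le_add ?_ ?_)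
          · exact (schurN_mul hw _ _).trans (mul_le_mul' le_rfl le_sup_left)
          · exact (schurN_mul hw _ _).trans (mul_le_mul' le_sup_right le_rfl)
    _ ≤ a * a' + c * (schurN w (A - B) * a' + a * schurN w (A' - B')) +
        (c * schurN w (A - B)) * (c * schurN w (A' - B')) := le_self_add
    _ = _ := by ring

theorem pairN_tsum {f g : ℕ → MatOp ι} (hf : Summable f) (hg : Summable g) :
    pairN c w (∑' n, f n) (∑' n, g n) ≤ ∑' n, pairN c w (f n) (g n) := by
  unfold pairN
  rw [← hf.tsum_sub hg, ENNReal.tsum_add, ENNReal.tsum_mul_left]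
  gcongr
  · refine sup_le ?_ ?_
    · exact (schurN_tsum w f).trans (ENNReal.tsum_le_tsum fun n => le_sup_left)
    · exact (schurN_tsum w g).trans (ENNReal.tsum_le_tsum fun n => le_sup_right)
  · exact schurN_tsum w _

theorem pairN_schur {w' : ι → ι → ℝ≥0∞} {φ ψ : ι → ι → ℂ} {C : ℝ} (hφ : ∀ i k, ‖φ i k‖ ≤ C)
    (hψ : ∀ i k, ‖ψ i k‖ ≤ C) {g : ℝ≥0∞} (h1 : ∀ i k, w' i k * ‖φ i k‖ₑ ≤ g * w i k)
    (h2 : ∀ i k, w' i k * ‖ψ i k‖ₑ ≤ g * w i k)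
    {g' : ℝ≥0∞} (h3 : ∀ i k, c * (w' i k * ‖φ i k - ψ i k‖ₑ) ≤ g' * w i k)
    (A B : MatOp ι) :
    pairN c w' (schur φ A) (schur ψ B) ≤ (g + g') * pairN c w A B := by
  set D : MatOp ι := schur (fun i k => φ i k - ψ i k) A with hD
  have hφψ : ∀ i k, ‖φ i k - ψ i k‖ ≤ C + C := fun i k =>
    (norm_sub_le _ _).trans (add_le_add (hφ i k) (hψ i k))
  have hsub : schur φ A - schur ψ B = D + schur ψ (A - B) := by
    refine MatOp.ext_ent fun i k => ?_
    rw [ent_sub, ent_add, hD, ent_schur hφ, ent_schur hψ, ent_schur hφψ, ent_schur hψ, ent_sub]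
    ring
  have hA : schurN w' (schur φ A) ≤ g * schurN w A := schurN_mono fun i k => by
    rw [ent_schur hφ, enorm_mul, ← mul_assoc, ← mul_assoc]
    exact mul_le_mul' (h1 i k) le_rfl
  have hB : ∀ B, schurN w' (schur ψ B) ≤ g * schurN w B := fun B => schurN_mono fun i k => by
    rw [ent_schur hψ, enorm_mul, ← mul_assoc, ← mul_assoc]
    exact mul_le_mul' (h2 i k) le_rfl
  have hDn : c * schurN w' D ≤ g' * schurN w A := by
    have he : ∀ i k, c * (w' i k * ‖ent D i k‖ₑ) ≤ g' * (w i k * ‖ent A i k‖ₑ) := fun i k => by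
      rw [hD, ent_schur hφψ, enorm_mul]
      calc _ = (c * (w' i k * ‖φ i k - ψ i k‖ₑ)) * ‖ent A i k‖ₑ := by ring
        _ ≤ (g' * w i k) * ‖ent A i k‖ₑ := mul_le_mul' (h3 i k) le_rfl
        _ = _ := by ring
    have h4 : c * schurN w' D = schurN (fun i k => c * w' i k) D := by
      simp only [schurN, mul_assoc, ENNReal.tsum_mul_left]
      rw [← ENNReal.mul_iSup, ← ENNReal.mul_iSup]
      exact (mul_right_mono (a := c)).map_sup _ _
    rw [h4]
    exact schurN_mono fun i k => by rw [mul_assoc]; exact he i k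
  unfold pairN
  rw [hsub]
  set a := schurN w A ⊔ schurN w B with ha
  have ha1 : schurN w A ≤ a := le_sup_left
  have ha2 : schurN w B ≤ a := le_sup_right
  calc _ ≤ g * a + c * (schurN w' D + g * schurN w (A - B)) := by
        gcongr
        · exact sup_le (hA.trans (mul_le_mul_right ha1 _)) ((hB B).trans (mul_le_mul_right ha2 _))
        · exact (schurN_add _ _ _).trans (add_le_add le_rfl (hB _))
    _ = g * a + (c * schurN w' D) + g * (c * schurN w (A - B)) := by ring
    _ ≤ g * a + g' * a + g * (c * schurN w (A - B)) :=
        add_le_add (add_le_add le_rfl (hDn.trans (mul_le_mul_right ha1 _))) le_rfl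
    _ ≤ g * a + g' * a + g * (c * schurN w (A - B)) + g' * (c * schurN w (A - B)) := le_self_add
    _ = _ := by ring

theorem pairN_mono_weight {w' : ι → ι → ℝ≥0∞} {g : ℝ≥0∞} (h : ∀ i k, w' i k ≤ g * w i k)
    (A B : MatOp ι) : pairN c w' A B ≤ g * pairN c w A B := by
  have hA : ∀ A : MatOp ι, schurN w' A ≤ g * schurN w A := fun A => schurN_mono fun i k => by
    rw [← mul_assoc]; gcongr; exact h i k
  unfold pairN
  calc _ ≤ g * (schurN w A ⊔ schurN w B) + c * (g * schurN w (A - B)) := by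
        gcongr
        · exact sup_le ((hA A).trans (mul_le_mul_right le_sup_left _))
            ((hA B).trans (mul_le_mul_right le_sup_right _))
        · exact hA _
    _ = _ := by ring

end SchurNorm

/-! ### The Cayley transform of a small matrix -/

section Cayley

variable {ι : Type*}

/-- `∑_{n ≥ 1} (X/2)^n`, so that `1 + halfSeries X = (1 - X/2)⁻¹` for small `X`. -/
def halfSeries (X : MatOp ι) : MatOp ι := ∑' n : ℕ, ((1 / 2 : ℂ) • X) ^ (n + 1)

/-- `(1 - X/2)⁻¹`. -/
def halfInv (X : MatOp ι) : MatOp ι := 1 + halfSeries X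

/-- The Cayley transform `(1 - X/2)⁻¹ (1 + X/2)`. -/
def cayley (X : MatOp ι) : MatOp ι := halfInv X * (1 + (1 / 2 : ℂ) • X)

theorem enorm_half : ‖(1 / 2 : ℂ)‖ₑ = 2⁻¹ := by
  rw [← ofReal_norm, show ‖(1 / 2 : ℂ)‖ = 2⁻¹ by norm_num, ENNReal.ofReal_inv_of_pos two_pos]
  norm_num

theorem norm_half_lt {X : MatOp ι} (hX : ‖X‖ ≤ 1) : ‖(1 / 2 : ℂ) • X‖ < 1 := by
  rw [norm_smul]
  norm_num
  linarith

theorem summable_half {X : MatOp ι} (hX : ‖X‖ ≤ 1) :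
    Summable fun n : ℕ => ((1 / 2 : ℂ) • X) ^ n :=
  summable_geometric_of_norm_lt_one (norm_half_lt hX)

theorem summable_half_succ {X : MatOp ι} (hX : ‖X‖ ≤ 1) :
    Summable fun n : ℕ => ((1 / 2 : ℂ) • X) ^ (n + 1) :=
  (summable_nat_add_iff 1).2 (summable_half hX)

theorem halfInv_eq_tsum {X : MatOp ι} (hX : ‖X‖ ≤ 1) :
    halfInv X = ∑' n : ℕ, ((1 / 2 : ℂ) • X) ^ n := by
  rw [(summable_half hX).tsum_eq_zero_add, pow_zero]
  rfl

theorem halfInv_mul {X : MatOp ι} (hX : ‖X‖ ≤ 1) :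
    halfInv X * (1 - (1 / 2 : ℂ) • X) = 1 := by
  rw [halfInv_eq_tsum hX]
  exact geom_series_mul_neg _ (norm_half_lt hX)

theorem mul_halfInv {X : MatOp ι} (hX : ‖X‖ ≤ 1) :
    (1 - (1 / 2 : ℂ) • X) * halfInv X = 1 := by
  rw [halfInv_eq_tsum hX]
  exact mul_neg_geom_series _ (norm_half_lt hX)

theorem halfInv_neg_mul {X : MatOp ι} (hX : ‖X‖ ≤ 1) :
    halfInv (-X) * (1 + (1 / 2 : ℂ) • X) = 1 := by
  have := halfInv_mul (X := -X) (by rwa [norm_neg])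
  rwa [smul_neg, sub_neg_eq_add] at this

theorem mul_halfInv_neg {X : MatOp ι} (hX : ‖X‖ ≤ 1) :
    (1 + (1 / 2 : ℂ) • X) * halfInv (-X) = 1 := by
  have := mul_halfInv (X := -X) (by rwa [norm_neg])
  rwa [smul_neg, sub_neg_eq_add] at this

theorem cayley_mul_cayley_neg {X : MatOp ι} (hX : ‖X‖ ≤ 1) : cayley X * cayley (-X) = 1 := by
  have h1 := halfInv_mul hX
  have h2 := mul_halfInv_neg hX
  rw [cayley, cayley, smul_neg, ← sub_eq_add_neg]
  calc halfInv X * (1 + (1 / 2 : ℂ) • X) * (halfInv (-X) * (1 - (1 / 2 : ℂ) • X))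
      = halfInv X * ((1 + (1 / 2 : ℂ) • X) * halfInv (-X)) * (1 - (1 / 2 : ℂ) • X) := by
        noncomm_ring
    _ = 1 := by rw [h2, mul_one, h1]

theorem cayley_sub_one {X : MatOp ι} (hX : ‖X‖ ≤ 1) : cayley X = 1 + halfInv X * X := by
  have h1 := halfInv_mul hX
  calc cayley X = halfInv X * (1 - (1 / 2 : ℂ) • X) + halfInv X * ((1 / 2 : ℂ) • X + (1 / 2 : ℂ) • X) := by
        rw [cayley]; noncomm_ring
    _ = _ := by rw [h1, ← add_smul]; norm_num

variable {c : ℝ≥0∞} {w : ι → ι → ℝ≥0∞}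

theorem pairN_half_pow (hw : SubMul w) {X X' : MatOp ι} (hX : pairN c w X X' ≤ 1) (n : ℕ) :
    pairN c w (((1 / 2 : ℂ) • X) ^ (n + 1)) (((1 / 2 : ℂ) • X') ^ (n + 1)) ≤ 2⁻¹ ^ (n + 1) := by
  have h1 : pairN c w ((1 / 2 : ℂ) • X) ((1 / 2 : ℂ) • X') ≤ 2⁻¹ := by
    refine (pairN_smul _ _ _).trans ?_
    rw [enorm_half]
    exact mul_le_of_le_one_right' hX
  induction n with
  | zero => simpa using h1
  | succ n ih =>
    rw [pow_succ, pow_succ ((1 / 2 : ℂ) • X'), pow_succ (2⁻¹ : ℝ≥0∞)]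
    exact (pairN_mul hw _ _ _ _).trans (mul_le_mul' ih h1)

theorem pairN_halfSeries (hw : SubMul w) {X X' : MatOp ι} (h : ‖X‖ ≤ 1) (h' : ‖X'‖ ≤ 1)
    (hX : pairN c w X X' ≤ 1) : pairN c w (halfSeries X) (halfSeries X') ≤ 1 := by
  refine (pairN_tsum (summable_half_succ h) (summable_half_succ h')).trans ?_
  refine (ENNReal.tsum_le_tsum fun n => pairN_half_pow hw hX n).trans ?_
  simp only [pow_succ, ENNReal.tsum_mul_right, ENNReal.tsum_geometric]
  norm_num

theorem pairN_halfInv_mul (hw : SubMul w) {X X' : MatOp ι} (h : ‖X‖ ≤ 1) (h' : ‖X'‖ ≤ 1)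
    (hX : pairN c w X X' ≤ 1) (Z Z' : MatOp ι) :
    pairN c w (halfInv X * Z) (halfInv X' * Z') ≤ 2 * pairN c w Z Z' := by
  rw [halfInv, halfInv, add_mul, add_mul, one_mul, one_mul]
  refine (pairN_add _ _ _ _).trans ?_
  rw [two_mul]
  gcongr
  exact (pairN_mul hw _ _ _ _).trans (mul_le_of_le_one_left' (pairN_halfSeries hw h h' hX))

theorem pairN_mul_halfInv (hw : SubMul w) {X X' : MatOp ι} (h : ‖X‖ ≤ 1) (h' : ‖X'‖ ≤ 1)
    (hX : pairN c w X X' ≤ 1) (Z Z' : MatOp ι) :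
    pairN c w (Z * halfInv X) (Z' * halfInv X') ≤ 2 * pairN c w Z Z' := by
  rw [halfInv, halfInv, mul_add, mul_add, mul_one, mul_one]
  have hX1 := pairN_halfSeries hw h h' hX
  refine (pairN_add _ _ _ _).trans ?_
  rw [two_mul]
  gcongr
  exact (pairN_mul hw _ _ _ _).trans (mul_le_of_le_one_right' hX1)

/-- The quadratic part of the remainder after a Cayley conjugation. -/
def quadPart (X R Y : MatOp ι) : MatOp ι :=
  halfInv X * (X * R - R * X - (1 / 2 : ℂ) • (X * Y - Y * X) - (1 / 4 : ℂ) • (X * Y * X)) *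
    halfInv (-X)

theorem pairN_quadPart (hw : SubMul w) {X X' R R' Y Y' : MatOp ι} (h : ‖X‖ ≤ 1) (h' : ‖X'‖ ≤ 1)
    (hX : pairN c w X X' ≤ 1) (hY : pairN c w Y Y' ≤ pairN c w R R') :
    pairN c w (quadPart X R Y) (quadPart X' R' Y') ≤ 16 * (pairN c w X X' * pairN c w R R') := by
  set x := pairN c w X X'
  set r := pairN c w R R'
  have e4 : ‖(1 / 4 : ℂ)‖ₑ ≤ 1 := by
    rw [← ofReal_norm]; norm_num
  have hXR : pairN c w (X * R) (X' * R') ≤ x * r := pairN_mul hw _ _ _ _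
  have hRX : pairN c w (R * X) (R' * X') ≤ x * r :=
    (pairN_mul hw _ _ _ _).trans_eq (mul_comm _ _)
  have hXY : pairN c w (X * Y) (X' * Y') ≤ x * r :=
    (pairN_mul hw _ _ _ _).trans (mul_le_mul' le_rfl hY)
  have hYX : pairN c w (Y * X) (Y' * X') ≤ x * r :=
    (pairN_mul hw _ _ _ _).trans ((mul_le_mul' hY le_rfl).trans_eq (mul_comm _ _))
  have hXYX : pairN c w (X * Y * X) (X' * Y' * X') ≤ x * r :=
    (pairN_mul hw _ _ _ _).trans ((mul_le_mul' hXY hX).trans_eq (mul_one _))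
  have h1 : pairN c w ((1 / 2 : ℂ) • (X * Y - Y * X)) ((1 / 2 : ℂ) • (X' * Y' - Y' * X')) ≤
      x * r := by
    refine (pairN_smul _ _ _).trans ?_
    calc _ ≤ 2⁻¹ * (x * r + x * r) := by
          rw [enorm_half]
          gcongr
          exact (pairN_sub _ _ _ _).trans (add_le_add hXY hYX)
      _ = x * r := by
          rw [← two_mul, ← mul_assoc, ENNReal.inv_mul_cancel (by norm_num) (by norm_num), one_mul]
  have h2 : pairN c w ((1 / 4 : ℂ) • (X * Y * X)) ((1 / 4 : ℂ) • (X' * Y' * X')) ≤ x * r :=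
    (pairN_smul _ _ _).trans ((mul_le_mul' e4 hXYX).trans_eq (one_mul _))
  have hXn : pairN c w (-X) (-X') ≤ 1 := by rwa [pairN_neg]
  have hq := pairN_mul_halfInv (c := c) hw (X := -X) (X' := -X') (by rwa [norm_neg])
    (by rwa [norm_neg]) hXn
    (halfInv X * (X * R - R * X - (1 / 2 : ℂ) • (X * Y - Y * X) - (1 / 4 : ℂ) • (X * Y * X)))
    (halfInv X' * (X' * R' - R' * X' - (1 / 2 : ℂ) • (X' * Y' - Y' * X') -
      (1 / 4 : ℂ) • (X' * Y' * X')))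
  refine hq.trans ?_
  calc _ ≤ 2 * (2 * (x * r + x * r + x * r + x * r)) := by
        gcongr
        refine (pairN_halfInv_mul hw h h' hX _ _).trans ?_
        gcongr
        refine (pairN_sub _ _ _ _).trans (add_le_add ?_ h2)
        refine (pairN_sub _ _ _ _).trans (add_le_add ?_ h1)
        exact (pairN_sub _ _ _ _).trans (add_le_add hXR hRX)
    _ = _ := by ring

theorem quadPart_eq {X R Y : MatOp ι} (hX : ‖X‖ ≤ 1) :
    R - Y + quadPart X R Y = halfInv X *
      ((1 + (1 / 2 : ℂ) • X) * R * (1 - (1 / 2 : ℂ) • X) - Y) * halfInv (-X) := by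
  have h1 := halfInv_mul hX
  have h2 := mul_halfInv_neg hX
  have key : (1 + (1 / 2 : ℂ) • X) * R * (1 - (1 / 2 : ℂ) • X) - Y =
      (1 - (1 / 2 : ℂ) • X) * (R - Y) * (1 + (1 / 2 : ℂ) • X) +
      (X * R - R * X - (1 / 2 : ℂ) • (X * Y - Y * X) - (1 / 4 : ℂ) • (X * Y * X)) := by
    simp only [mul_add, add_mul, mul_sub, sub_mul, one_mul, mul_one, smul_mul_assoc, mul_smul_comm,
      smul_smul, smul_sub, smul_add]
    module
  rw [key, mul_add, add_mul, quadPart]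
  congr 1
  calc R - Y = 1 * (R - Y) * 1 := by simp
    _ = halfInv X * (1 - (1 / 2 : ℂ) • X) * (R - Y) *
        ((1 + (1 / 2 : ℂ) • X) * halfInv (-X)) := by rw [h1, h2]
    _ = _ := by noncomm_ring

/-! ### Commutation with a diagonal matrix -/

/-- `D U - U D' = B`, entry by entry, for the diagonal matrices `D` and `D'`. -/
def Intertwines (D D' : ι → ℂ) (U B : MatOp ι) : Prop :=
  ∀ i k, D i * ent U i k - ent U i k * D' k = ent B i k

theorem Intertwines.mul {D D' D'' : ι → ℂ} {U B V C : MatOp ι} (h : Intertwines D D' U B)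
    (h' : Intertwines D' D'' V C) : Intertwines D D'' (U * V) (B * V + U * C) := by
  intro i k
  have h1 := (hasSum_ent_mul U V i k).mul_left (D i)
  have h2 := (hasSum_ent_mul U V i k).mul_right (D'' k)
  have h3 := (hasSum_ent_mul B V i k).add (hasSum_ent_mul U C i k)
  rw [ent_add]
  refine (h1.sub h2).unique ?_
  have he : (fun j => D i * (ent U i j * ent V j k) - ent U i j * ent V j k * D'' k) =
      fun j => ent B i j * ent V j k + ent U i j * ent C j k := by
    funext j
    rw [← h i j, ← h' j k]
    ring
  rw [he]
  exact h3

theorem Intertwines.add {D D' : ι → ℂ} {U B V C : MatOp ι} (h : Intertwines D D' U B)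
    (h' : Intertwines D D' V C) : Intertwines D D' (U + V) (B + C) := by
  intro i k
  rw [ent_add, ent_add, ← h i k, ← h' i k]
  ring

theorem Intertwines.smul {D D' : ι → ℂ} {U B : MatOp ι} (h : Intertwines D D' U B) (a : ℂ) :
    Intertwines D D' (a • U) (a • B) := by
  intro i k
  rw [ent_smul, ent_smul, ← h i k]
  ring

theorem intertwines_one (D : ι → ℂ) : Intertwines D D (1 : MatOp ι) 0 := by
  classical
  intro i k
  rw [ent_one, ent_zero]
  split_ifs with h
  · subst h; ring
  · ring

theorem Intertwines.tsum {D D' : ι → ℂ} {U B : ℕ → MatOp ι} (h : ∀ n, Intertwines D D' (U n) (B n))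
    (hU : Summable U) (hB : Summable B) : Intertwines D D' (∑' n, U n) (∑' n, B n) := by
  intro i k
  have h1 : HasSum (fun n => ent (U n) i k) (ent (∑' n, U n) i k) := hU.hasSum.mapL (entCLM i k)
  have h2 : HasSum (fun n => ent (B n) i k) (ent (∑' n, B n) i k) := hB.hasSum.mapL (entCLM i k)
  refine ((h1.mul_left (D i)).sub (h1.mul_right (D' k))).unique ?_
  have he : (fun n => D i * ent (U n) i k - ent (U n) i k * D' k) = fun n => ent (B n) i k :=
    funext fun n => h n i k
  rw [he]
  exact h2

/-- The commutator of a diagonal matrix with the powers of `Z`, when its commutator with `Z` is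
`Y`. -/
def powComm (Z Y : MatOp ι) : ℕ → MatOp ι
  | 0 => 0
  | n + 1 => powComm Z Y n * Z + Z ^ n * Y

theorem intertwines_pow {D : ι → ℂ} {Z Y : MatOp ι} (h : Intertwines D D Z Y) (n : ℕ) :
    Intertwines D D (Z ^ n) (powComm Z Y n) := by
  induction n with
  | zero => rw [pow_zero]; exact intertwines_one D
  | succ n ih => rw [pow_succ]; exact ih.mul h

theorem norm_powComm_le (Z Y : MatOp ι) (hZ : ‖Z‖ ≤ 1 / 2) (n : ℕ) :
    ‖powComm Z Y n‖ ≤ 2 * (n * (1 / 2) ^ n) * ‖Y‖ := by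
  induction n with
  | zero => simp [powComm]
  | succ n ih =>
    have hp : ‖Z ^ n * Y‖ ≤ (1 / 2) ^ n * ‖Y‖ := by
      refine (norm_mul_le _ _).trans ?_
      gcongr
      rcases Nat.eq_zero_or_pos n with rfl | hn
      · simp only [pow_zero]; exact ContinuousLinearMap.norm_id_le
      · exact (norm_pow_le' Z hn).trans (pow_le_pow_left₀ (norm_nonneg _) hZ n)
    calc ‖powComm Z Y (n + 1)‖ ≤ ‖powComm Z Y n‖ * ‖Z‖ + ‖Z ^ n * Y‖ :=
          (norm_add_le _ _).trans (add_le_add (norm_mul_le _ _) le_rfl)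
      _ ≤ (2 * (n * (1 / 2) ^ n) * ‖Y‖) * (1 / 2) + (1 / 2) ^ n * ‖Y‖ := by gcongr
      _ = _ := by push_cast; ring

theorem intertwines_halfInv {D : ι → ℂ} {X Y : MatOp ι} (hX : ‖X‖ ≤ 1)
    (h : Intertwines D D X Y) :
    Intertwines D D (halfInv X) (halfInv X * ((1 / 2 : ℂ) • Y) * halfInv X) := by
  set Z := (1 / 2 : ℂ) • X with hZ
  set Y' := (1 / 2 : ℂ) • Y with hY'
  have hZn : ‖Z‖ ≤ 1 / 2 := by
    rw [hZ, norm_smul]; norm_num; linarith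
  have hB : Summable (powComm Z Y') := by
    refine Summable.of_norm_bounded (g := fun n : ℕ => 2 * (n * (1 / 2 : ℝ) ^ n) * ‖Y'‖) ?_
      (norm_powComm_le Z Y' hZn)
    have := summable_pow_mul_geometric_of_norm_lt_one (R := ℝ) 1 (r := 1 / 2) (by norm_num)
    simp only [pow_one] at this
    exact (this.mul_left 2).mul_right _
  have hU := summable_half hX
  have hI := Intertwines.tsum (fun n => intertwines_pow (h.smul (1 / 2)) n) hU hB
  rw [← halfInv_eq_tsum hX] at hI
  have hW : (∑' n, powComm Z Y' n) = (∑' n, powComm Z Y' n) * Z + halfInv X * Y' := by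
    have h0 := hB.tsum_eq_zero_add
    rw [h0]
    conv_lhs => simp only [powComm, zero_add]
    rw [(hB.mul_right Z).tsum_add (hU.mul_right Y'), hB.tsum_mul_right, hU.tsum_mul_right,
      ← halfInv_eq_tsum hX]
    rw [← h0]
  have hW2 : (∑' n, powComm Z Y' n) * (1 - Z) = halfInv X * Y' := by
    rw [mul_sub, mul_one]
    exact sub_eq_of_eq_add' hW
  have hW3 : (∑' n, powComm Z Y' n) = halfInv X * Y' * halfInv X := by
    rw [← hW2, mul_assoc, mul_halfInv hX, mul_one]
  rwa [hW3] at hI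

theorem intertwines_cayley {D : ι → ℂ} {X Y R : MatOp ι} (hX : ‖X‖ ≤ 1)
    (h : Intertwines D D X Y) :
    Intertwines D D (cayley X) (cayley X * R - (R - Y + quadPart X R Y) * cayley X) := by
  have h1 := intertwines_halfInv hX h
  have h2 := h1.mul ((intertwines_one D).add (h.smul (1 / 2)))
  have e1 := halfInv_mul hX
  have e2 := mul_halfInv hX
  have e3 := halfInv_neg_mul hX
  set Z := (1 / 2 : ℂ) • X with hZ
  set V := halfInv X with hV
  have comm : V * (1 + Z) = (1 + Z) * V := by
    have : V * Z = Z * V := by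
      have a1 : V * Z = V - 1 := by
        rw [mul_sub, mul_one] at e1
        rw [← e1]; abel
      have a2 : Z * V = V - 1 := by
        rw [sub_mul, one_mul] at e2
        rw [← e2]; abel
      rw [a1, a2]
    rw [mul_add, add_mul, this]; simp
  rw [quadPart_eq hX]
  have f1 : V * ((1 + Z) * R * (1 - Z) - Y) * halfInv (-X) * (V * (1 + Z)) =
      V * (1 + Z) * R - V * Y * V := by
    calc _ = V * ((1 + Z) * R * (1 - Z) - Y) * halfInv (-X) * ((1 + Z) * V) := by rw [comm]
      _ = V * ((1 + Z) * R * (1 - Z) - Y) * (halfInv (-X) * (1 + Z)) * V := by noncomm_ring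
      _ = V * (1 + Z) * R * ((1 - Z) * V) - V * Y * V := by rw [e3]; noncomm_ring
      _ = _ := by rw [e2, mul_one]
  have f2 : V * ((1 / 2 : ℂ) • Y) * V * (1 + Z) + V * (0 + (1 / 2 : ℂ) • Y) = V * Y * V := by
    calc _ = (1 / 2 : ℂ) • (V * Y * (V * (1 + Z))) + (1 / 2 : ℂ) • (V * Y * 1) := by
          simp only [zero_add, mul_smul_comm, smul_mul_assoc, mul_one, mul_assoc]
      _ = (1 / 2 : ℂ) • (V * Y * (V * (1 + Z))) + (1 / 2 : ℂ) • (V * Y * (V * (1 - Z))) := by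
          rw [e1]
      _ = (1 / 2 : ℂ) • (V * Y * V + V * Y * V) := by rw [← smul_add]; congr 1; noncomm_ring
      _ = _ := by rw [← two_smul ℂ, smul_smul]; norm_num
  rw [f2] at h2
  rw [cayley, ← hV, ← hZ, f1, sub_sub_cancel]
  exact h2

end Cayley

/-! ### Töplitz, real and Hamiltonian matrices -/

section Structure

variable {ν : ℕ}

/-- The Fourier indices `(ℓ, j)`. -/
abbrev Idx (ν : ℕ) := (Fin ν → ℤ) × ℤ

/-- The dispersion law, with the value `1` instead of `0` at `j = 0`. -/
def dispOne (j : ℤ) : ℝ := if j = 0 then 1 else disp j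

theorem disp_neg (j : ℤ) : disp (-j) = -disp j := by
  simp only [disp]; push_cast; ring

theorem disp_ne_zero {j : ℤ} (hj : j ≠ 0) : disp j ≠ 0 := by
  have : (j : ℝ) ≠ 0 := by exact_mod_cast hj
  unfold disp
  positivity

theorem dispOne_ne_zero (j : ℤ) : dispOne j ≠ 0 := by
  unfold dispOne
  split_ifs with h
  · exact one_ne_zero
  · exact disp_ne_zero h

theorem dispOne_neg {j : ℤ} (hj : j ≠ 0) : dispOne (-j) = -dispOne j := by
  simp [dispOne, hj, disp_neg]

/-- Matrices that are Töplitz in time, real, and preserve the splitting into the zero mode and the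
functions with zero average in `x`. -/
structure IsStruct (A : MatOp (Idx ν)) : Prop where
  toep : ∀ (p : Fin ν → ℤ) (i k : Idx ν), ent A (i.1 + p, i.2) (k.1 + p, k.2) = ent A i k
  real : ∀ i k : Idx ν, conj (ent A i k) = ent A (-i) (-k)
  block : ∀ i k : Idx ν, ¬(i.2 = 0 ↔ k.2 = 0) → ent A i k = 0

/-- Matrices that vanish on the zero mode. -/
def VanishZero (A : MatOp (Idx ν)) : Prop := ∀ i k : Idx ν, i.2 = 0 ∨ k.2 = 0 → ent A i k = 0

/-- `B` is the transpose of `A` with respect to the symplectic form. -/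
def IsDual (A B : MatOp (Idx ν)) : Prop :=
  ∀ i k : Idx ν, ent B i k = ((dispOne i.2 / dispOne k.2 : ℝ) : ℂ) * ent A (-k) (-i)

theorem isStruct_zero : IsStruct (0 : MatOp (Idx ν)) :=
  ⟨fun _ _ _ => rfl, fun _ _ => by simp [ent_zero], fun _ _ _ => rfl⟩

theorem isStruct_one : IsStruct (1 : MatOp (Idx ν)) := by
  classical
  refine ⟨fun p i k => ?_, fun i k => ?_, fun i k h => ?_⟩
  · simp only [ent_one, Prod.ext_iff, add_left_inj]
  · simp only [ent_one, neg_inj]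
    split_ifs <;> simp
  · rw [ent_one, if_neg]
    rintro rfl
    exact h Iff.rfl

theorem IsStruct.add {A B : MatOp (Idx ν)} (hA : IsStruct A) (hB : IsStruct B) :
    IsStruct (A + B) := by
  refine ⟨fun p i k => ?_, fun i k => ?_, fun i k h => ?_⟩
  · rw [ent_add, ent_add, hA.toep, hB.toep]
  · rw [ent_add, ent_add, map_add, hA.real, hB.real]
  · rw [ent_add, hA.block i k h, hB.block i k h, add_zero]

theorem IsStruct.smul {A : MatOp (Idx ν)} (hA : IsStruct A) {c : ℂ} (hc : conj c = c) :
    IsStruct (c • A) := by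
  refine ⟨fun p i k => ?_, fun i k => ?_, fun i k h => ?_⟩
  · rw [ent_smul, ent_smul, hA.toep]
  · rw [ent_smul, ent_smul, map_mul, hA.real, hc]
  · rw [ent_smul, hA.block i k h, mul_zero]

theorem IsStruct.neg {A : MatOp (Idx ν)} (hA : IsStruct A) : IsStruct (-A) := by
  have := hA.smul (c := -1) (by simp)
  rwa [neg_one_smul] at this

theorem IsStruct.sub {A B : MatOp (Idx ν)} (hA : IsStruct A) (hB : IsStruct B) :
    IsStruct (A - B) := by
  rw [sub_eq_add_neg]; exact hA.add hB.neg

theorem IsStruct.mul {A B : MatOp (Idx ν)} (hA : IsStruct A) (hB : IsStruct B) :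
    IsStruct (A * B) := by
  refine ⟨fun p i k => ?_, fun i k => ?_, fun i k h => ?_⟩
  · rw [ent_mul, ent_mul]
    rw [← (Equiv.addRight ((p, 0) : Idx ν)).tsum_eq
      fun j => ent A (i.1 + p, i.2) j * ent B j (k.1 + p, k.2)]
    refine tsum_congr fun j => ?_
    have : (Equiv.addRight ((p, 0) : Idx ν)) j = (j.1 + p, j.2) := by
      ext <;> simp
    rw [this, hA.toep, hB.toep]
  · rw [ent_mul, ent_mul, Complex.conj_tsum]
    rw [← (Equiv.neg (Idx ν)).tsum_eq fun j => ent A (-i) j * ent B j (-k)]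
    refine tsum_congr fun j => ?_
    rw [map_mul, hA.real, hB.real]; rfl
  · rw [ent_mul]
    refine (tsum_congr fun j => ?_).trans tsum_zero
    by_cases hj : i.2 = 0 ↔ j.2 = 0
    · rw [hB.block j k (fun h' => h (hj.trans h')), mul_zero]
    · rw [hA.block i j hj, zero_mul]

theorem IsStruct.pow {A : MatOp (Idx ν)} (hA : IsStruct A) (n : ℕ) : IsStruct (A ^ n) := by
  induction n with
  | zero => rw [pow_zero]; exact isStruct_one
  | succ n ih => rw [pow_succ]; exact ih.mul hA

theorem IsStruct.tsum {A : ℕ → MatOp (Idx ν)} (hA : ∀ n, IsStruct (A n)) :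
    IsStruct (∑' n, A n) := by
  by_cases hs : Summable A
  · refine ⟨fun p i k => ?_, fun i k => ?_, fun i k h => ?_⟩
    · rw [ent_tsum hs, ent_tsum hs]
      exact tsum_congr fun n => (hA n).toep p i k
    · rw [ent_tsum hs, ent_tsum hs, Complex.conj_tsum]
      exact tsum_congr fun n => (hA n).real i k
    · rw [ent_tsum hs]
      exact (tsum_congr fun n => (hA n).block i k h).trans tsum_zero
  · rw [tsum_eq_zero_of_not_summable hs]
    exact isStruct_zero

theorem conj_half : conj (1 / 2 : ℂ) = 1 / 2 := Complex.conj_eq_iff_im.2 (by norm_num)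

theorem IsStruct.halfInv {A : MatOp (Idx ν)} (hA : IsStruct A) : IsStruct (halfInv A) :=
  isStruct_one.add (IsStruct.tsum fun _ => (hA.smul conj_half).pow _)

theorem IsStruct.cayley {A : MatOp (Idx ν)} (hA : IsStruct A) : IsStruct (cayley A) :=
  hA.halfInv.mul (isStruct_one.add (hA.smul conj_half))

theorem VanishZero.add {A B : MatOp (Idx ν)} (hA : VanishZero A) (hB : VanishZero B) :
    VanishZero (A + B) := fun i k h => by rw [ent_add, hA i k h, hB i k h, add_zero]

theorem VanishZero.sub {A B : MatOp (Idx ν)} (hA : VanishZero A) (hB : VanishZero B) :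
    VanishZero (A - B) := fun i k h => by rw [ent_sub, hA i k h, hB i k h, sub_zero]

theorem VanishZero.smul {A : MatOp (Idx ν)} (hA : VanishZero A) (c : ℂ) : VanishZero (c • A) :=
  fun i k h => by rw [ent_smul, hA i k h, mul_zero]

theorem VanishZero.mul {A B : MatOp (Idx ν)} (hA : VanishZero A) (hB : VanishZero B) :
    VanishZero (A * B) := fun i k h => by
  rw [ent_mul]
  refine (tsum_congr fun j => ?_).trans tsum_zero
  rcases h with h | h
  · rw [hA i j (Or.inl h), zero_mul]
  · rw [hB j k (Or.inr h), mul_zero]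

theorem VanishZero.struct_mul {A B : MatOp (Idx ν)} (hB : VanishZero B) (hA : IsStruct A) :
    VanishZero (A * B) := fun i k h => by
  rw [ent_mul]
  refine (tsum_congr fun j => ?_).trans tsum_zero
  rcases h with h | h
  · by_cases hj : j.2 = 0
    · rw [hB j k (Or.inl hj), mul_zero]
    · rw [hA.block i j (fun h' => hj (h'.1 h)), zero_mul]
  · rw [hB j k (Or.inr h), mul_zero]

theorem VanishZero.mul_struct {A B : MatOp (Idx ν)} (hA : VanishZero A) (hB : IsStruct B) :
    VanishZero (A * B) := fun i k h => by
  rw [ent_mul]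
  refine (tsum_congr fun j => ?_).trans tsum_zero
  rcases h with h | h
  · rw [hA i j (Or.inl h), zero_mul]
  · by_cases hj : j.2 = 0
    · rw [hA i j (Or.inr hj), zero_mul]
    · rw [hB.block j k (fun h' => hj (h'.2 h)), mul_zero]

theorem isDual_one : IsDual (1 : MatOp (Idx ν)) 1 := by
  classical
  intro i k
  rw [ent_one, ent_one]
  by_cases h : i = k
  · subst h
    rw [if_pos rfl, if_pos rfl, div_self (dispOne_ne_zero _)]; simp
  · rw [if_neg h, if_neg (fun h' => h (neg_injective h').symm), mul_zero]

theorem IsDual.add {A A' B B' : MatOp (Idx ν)} (h : IsDual A A') (h' : IsDual B B') :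
    IsDual (A + B) (A' + B') := fun i k => by
  rw [ent_add, ent_add, h i k, h' i k]; ring

theorem IsDual.smul {A A' : MatOp (Idx ν)} (h : IsDual A A') (c : ℂ) :
    IsDual (c • A) (c • A') := fun i k => by
  rw [ent_smul, ent_smul, h i k]; ring

theorem IsDual.neg {A A' : MatOp (Idx ν)} (h : IsDual A A') : IsDual (-A) (-A') := fun i k => by
  rw [ent_neg, ent_neg, h i k]; ring

theorem IsDual.sub {A A' B B' : MatOp (Idx ν)} (h : IsDual A A') (h' : IsDual B B') :
    IsDual (A - B) (A' - B') := fun i k => by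
  rw [ent_sub, ent_sub, h i k, h' i k]; ring

theorem IsDual.mul {A A' B B' : MatOp (Idx ν)} (h : IsDual A A') (h' : IsDual B B') :
    IsDual (A * B) (B' * A') := fun i k => by
  rw [ent_mul, ent_mul, ← (Equiv.neg (Idx ν)).tsum_eq fun j => ent A (-k) j * ent B j (-i),
    ← tsum_mul_left]
  refine tsum_congr fun j => ?_
  rw [h' i j, h j k, Equiv.neg_apply]
  have h1 : (dispOne j.2 : ℂ) ≠ 0 := by exact_mod_cast dispOne_ne_zero j.2
  have h2 : (dispOne k.2 : ℂ) ≠ 0 := by exact_mod_cast dispOne_ne_zero k.2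
  push_cast
  field_simp

theorem IsDual.pow {A A' : MatOp (Idx ν)} (h : IsDual A A') (n : ℕ) : IsDual (A ^ n) (A' ^ n) := by
  induction n with
  | zero => rw [pow_zero, pow_zero]; exact isDual_one
  | succ n ih => rw [pow_succ, pow_succ']; exact ih.mul h

theorem IsDual.tsum {A A' : ℕ → MatOp (Idx ν)} (h : ∀ n, IsDual (A n) (A' n)) (hA : Summable A)
    (hA' : Summable A') : IsDual (∑' n, A n) (∑' n, A' n) := fun i k => by
  rw [ent_tsum hA, ent_tsum hA', ← tsum_mul_left]
  exact tsum_congr fun n => h n i k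

theorem IsDual.halfInv {A A' : MatOp (Idx ν)} (h : IsDual A A') (hA : ‖A‖ ≤ 1) (hA' : ‖A'‖ ≤ 1) :
    IsDual (halfInv A) (halfInv A') :=
  isDual_one.add (IsDual.tsum (fun _ => (h.smul _).pow _) (summable_half_succ hA)
    (summable_half_succ hA'))

/-- Hamiltonian matrices that vanish on the zero mode. -/
structure IsHamOp (A : MatOp (Idx ν)) : Prop where
  struct : IsStruct A
  vanish : VanishZero A
  dual : IsDual A (-A)

theorem IsHamOp.add {A B : MatOp (Idx ν)} (hA : IsHamOp A) (hB : IsHamOp B) : IsHamOp (A + B) :=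
  ⟨hA.struct.add hB.struct, hA.vanish.add hB.vanish, by
    rw [neg_add]; exact hA.dual.add hB.dual⟩

theorem IsHamOp.dual_cayley {X : MatOp (Idx ν)} (h : IsHamOp X) (hX : ‖X‖ ≤ 1) :
    IsDual (cayley X) (cayley (-X)) := by
  have h1 : IsDual (1 + (1 / 2 : ℂ) • X) (1 + (1 / 2 : ℂ) • (-X)) := isDual_one.add (h.dual.smul _)
  have h2 := h1.mul (h.dual.halfInv hX (by rwa [norm_neg]))
  have h3 : (1 + (1 / 2 : ℂ) • X) * DP.halfInv X = cayley X := by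
    have e1 := halfInv_mul hX
    have e2 := mul_halfInv hX
    set Z := (1 / 2 : ℂ) • X
    have a1 : DP.halfInv X * Z = DP.halfInv X - 1 := by
      rw [mul_sub, mul_one] at e1
      rw [← e1]; abel
    have a2 : Z * DP.halfInv X = DP.halfInv X - 1 := by
      rw [sub_mul, one_mul] at e2
      rw [← e2]; abel
    rw [cayley, mul_add, add_mul, a1, a2]; simp
  rw [h3] at h2
  exact h2

theorem IsHamOp.quadPart {X R Y : MatOp (Idx ν)} (h : IsHamOp X) (hR : IsHamOp R)
    (hY : IsHamOp Y) (hX : ‖X‖ ≤ 1) : IsHamOp (quadPart X R Y) := by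
  have c4 : conj (1 / 4 : ℂ) = 1 / 4 := Complex.conj_eq_iff_im.2 (by norm_num)
  refine ⟨?_, ?_, ?_⟩
  · refine (h.struct.halfInv.mul ?_).mul h.struct.neg.halfInv
    refine ((h.struct.mul hR.struct).sub (hR.struct.mul h.struct)).sub ?_ |>.sub ?_
    · exact ((h.struct.mul hY.struct).sub (hY.struct.mul h.struct)).smul conj_half
    · exact ((h.struct.mul hY.struct).mul h.struct).smul c4
  · refine VanishZero.mul_struct (VanishZero.struct_mul ?_ h.struct.halfInv) h.struct.neg.halfInv
    refine ((h.vanish.mul hR.vanish).sub (hR.vanish.mul h.vanish)).sub ?_ |>.sub ?_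
    · exact ((h.vanish.mul hY.vanish).sub (hY.vanish.mul h.vanish)).smul _
    · exact ((h.vanish.mul hY.vanish).mul h.vanish).smul _
  · have d1 := h.dual.halfInv hX (by rwa [norm_neg])
    have hn : IsDual (-X) X := by simpa using h.dual.neg
    have d2 := hn.halfInv (by rwa [norm_neg]) hX
    have e1 := ((h.dual.mul hR.dual).sub (hR.dual.mul h.dual)).sub
      (((h.dual.mul hY.dual).sub (hY.dual.mul h.dual)).smul (1 / 2)) |>.sub
      (((h.dual.mul hY.dual).mul h.dual).smul (1 / 4))
    have e2 := (d1.mul e1).mul d2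
    have e3 : -R * -X - -X * -R - (1 / 2 : ℂ) • (-Y * -X - -X * -Y) -
        (1 / 4 : ℂ) • (-X * (-Y * -X)) =
        -(X * R - R * X - (1 / 2 : ℂ) • (X * Y - Y * X) - (1 / 4 : ℂ) • (X * Y * X)) := by
      simp only [neg_mul, mul_neg, neg_neg, smul_neg, smul_sub, mul_assoc]
      abel
    have e4 : -DP.quadPart X R Y = DP.halfInv X * ((-R * -X - -X * -R -
        (1 / 2 : ℂ) • (-Y * -X - -X * -Y) - (1 / 4 : ℂ) • (-X * (-Y * -X))) *
          DP.halfInv (-X)) := by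
      rw [e3, DP.quadPart, mul_assoc, neg_mul, mul_neg]
    rw [e4]
    exact e2

theorem IsHamOp.schur {A : MatOp (Idx ν)} (hA : IsHamOp A) {φ : Idx ν → Idx ν → ℂ} {C : ℝ}
    (hφ : ∀ i k, ‖φ i k‖ ≤ C)
    (h1 : ∀ (p : Fin ν → ℤ) (i k : Idx ν), φ (i.1 + p, i.2) (k.1 + p, k.2) = φ i k)
    (h2 : ∀ i k : Idx ν, i.2 ≠ 0 → k.2 ≠ 0 → conj (φ i k) = φ (-i) (-k))
    (h3 : ∀ i k : Idx ν, i.2 ≠ 0 → k.2 ≠ 0 → φ (-k) (-i) = φ i k) : IsHamOp (schur φ A) := by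
  refine ⟨⟨fun p i k => ?_, fun i k => ?_, fun i k h => ?_⟩, fun i k h => ?_, fun i k => ?_⟩
  · rw [ent_schur hφ, ent_schur hφ, h1, hA.struct.toep]
  · rw [ent_schur hφ, ent_schur hφ, map_mul, hA.struct.real]
    by_cases h : i.2 = 0 ∨ k.2 = 0
    · rw [hA.vanish (-i) (-k) (by simpa using h), mul_zero, mul_zero]
    · rw [not_or] at h
      rw [h2 i k h.1 h.2]
  · rw [ent_schur hφ, hA.struct.block i k h, mul_zero]
  · rw [ent_schur hφ, hA.vanish i k h, mul_zero]
  · have hd := hA.dual i k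
    rw [ent_neg] at hd
    rw [ent_neg, ent_schur hφ, ent_schur hφ]
    by_cases h : i.2 = 0 ∨ k.2 = 0
    · rw [hA.vanish i k h, hA.vanish (-k) (-i) (by simpa [or_comm] using h)]; simp
    · rw [not_or] at h
      rw [h3 i k h.1 h.2, ← mul_neg, hd]; ring

theorem IsHamOp.diag {A : MatOp (Idx ν)} (hA : IsHamOp A) (i : Idx ν) :
    ent A i i = Complex.I * ((ent A (0, i.2) (0, i.2)).im : ℂ) := by
  have h0 : ent A i i = ent A (0, i.2) (0, i.2) := by
    have := hA.struct.toep i.1 (0, i.2) (0, i.2)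
    simpa using this
  have h1 := hA.struct.real (0, i.2) (0, i.2)
  have h2 := hA.dual (0, i.2) (0, i.2)
  rw [div_self (dispOne_ne_zero _), Complex.ofReal_one, one_mul, ← h1, ent_neg] at h2
  rw [h0]
  set z := ent A (0, i.2) (0, i.2)
  have hre : z.re = 0 := by
    have := congrArg Complex.re h2
    simp at this
    linarith
  apply Complex.ext <;> simp [hre]

theorem IsHamOp.diag_odd {A : MatOp (Idx ν)} (hA : IsHamOp A) (j : ℤ) :
    (ent A (0, -j) (0, -j)).im = -(ent A (0, j) (0, j)).im := by
  have h1 := hA.struct.real (0, j) (0, j)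
  have h2 : (-((0, j) : Idx ν)) = (0, -j) := by simp
  rw [h2] at h1
  rw [← h1, Complex.conj_im]

end Structure

/-! ### The iterative step -/

section Step

variable {ν : ℕ}

/-- The parameters of the iteration: the frequency `w`, the coefficient `m` of the leading term,
and the constants `g`, `τ` of the second order Melnikov conditions. -/
structure KamPar (ν : ℕ) where
  /-- the frequency -/
  w : Freq ν
  /-- the coefficient of the leading term -/
  m : ℝ
  /-- the constant of the Melnikov conditions -/
  g : ℝ
  /-- the exponent of the Melnikov conditions -/
  τ : ℝ

/-- The divisors `ω·(ℓ - ℓ') - d_j + d_j'`. -/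
def divisor (P : KamPar ν) (r : ℤ → ℝ) (i k : Idx ν) : ℝ :=
  dotL P.w (i.1 - k.1) - eig P.m (r i.2) i.2 + eig P.m (r k.2) k.2

/-- A Lipschitz function that equals `1 / t` for `|t| ≥ a`. -/
def cutInv (a t : ℝ) : ℝ := t / (max a |t|) ^ 2

open Classical in
/-- The multiplier of the homological equation at scale `4 ^ (n + 1)`. -/
def homMult (P : KamPar ν) (r : ℤ → ℝ) (n : ℕ) (i k : Idx ν) : ℂ :=
  if absL (i.1 - k.1) ≤ 4 ^ (n + 1) ∧ i ≠ k then
    -Complex.I * (cutInv (P.g * japL (i.1 - k.1) ^ (-P.τ)) (divisor P r i k) : ℂ) else 0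

open Classical in
/-- Projection on the off-diagonal entries with `|ℓ - ℓ'| ≤ 4 ^ (n + 1)`. -/
def lowMult (n : ℕ) (i k : Idx ν) : ℂ := if absL (i.1 - k.1) ≤ 4 ^ (n + 1) ∧ i ≠ k then 1 else 0

open Classical in
/-- Projection on the entries with `|ℓ - ℓ'| > 4 ^ (n + 1)`. -/
def highMult (n : ℕ) (i k : Idx ν) : ℂ := if absL (i.1 - k.1) ≤ 4 ^ (n + 1) then 0 else 1

/-- The generator of the transformation of a step. -/
def kamGen (P : KamPar ν) (n : ℕ) (s : (ℤ → ℝ) × MatOp (Idx ν)) : MatOp (Idx ν) :=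
  schur (homMult P s.1 n) s.2

/-- One step of the iteration, for the corrections of the eigenvalues and the remainder. -/
def kamStep (P : KamPar ν) (n : ℕ) (s : (ℤ → ℝ) × MatOp (Idx ν)) : (ℤ → ℝ) × MatOp (Idx ν) :=
  (fun j => s.1 j - (ent s.2 (0, j) (0, j)).im,
    schur (highMult n) s.2 + quadPart (kamGen P n s) s.2 (schur (lowMult n) s.2))

/-- The sequence of eigenvalue corrections and remainders. -/
def kamSeq (P : KamPar ν) (R : MatOp (Idx ν)) : ℕ → (ℤ → ℝ) × MatOp (Idx ν)
  | 0 => (0, R)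
  | n + 1 => kamStep P n (kamSeq P R n)

theorem one_le_japL (l : Fin ν → ℤ) : 1 ≤ japL l := le_max_left _ _

theorem japL_pos (l : Fin ν → ℤ) : 0 < japL l := one_pos.trans_le (one_le_japL l)

theorem absL_nonneg (l : Fin ν → ℤ) : 0 ≤ absL l := Finset.sum_nonneg fun _ _ => abs_nonneg _

theorem absL_neg (l : Fin ν → ℤ) : absL (-l) = absL l := by simp [absL]

theorem japL_neg (l : Fin ν → ℤ) : japL (-l) = japL l := by simp [japL, absL_neg]

theorem absL_add_le (l l' : Fin ν → ℤ) : absL (l + l') ≤ absL l + absL l' := by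
  simp only [absL, ← Finset.sum_add_distrib]
  refine Finset.sum_le_sum fun i _ => ?_
  push_cast [Pi.add_apply]
  exact abs_add_le _ _

theorem dotL_neg (w : Freq ν) (l : Fin ν → ℤ) : dotL w (-l) = -dotL w l := by
  simp [dotL]

theorem dotL_sub (w : Freq ν) (l l' : Fin ν → ℤ) : dotL w (l - l') = dotL w l - dotL w l' := by
  simp [dotL, mul_sub]

theorem cutInv_neg (a t : ℝ) : cutInv a (-t) = -cutInv a t := by
  simp [cutInv, neg_div]

theorem abs_cutInv_le {a : ℝ} (ha : 0 < a) (t : ℝ) : |cutInv a t| ≤ a⁻¹ := by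
  set T := max a |t|
  have hT : a ≤ T := le_max_left _ _
  have hT0 : 0 < T := ha.trans_le hT
  rw [cutInv, abs_div, abs_of_nonneg (by positivity : 0 ≤ T ^ 2), div_le_iff₀ (by positivity)]
  have h1 : |t| ≤ T := le_max_right _ _
  calc |t| ≤ T := h1
    _ = a⁻¹ * (a * T) := by field_simp
    _ ≤ a⁻¹ * T ^ 2 := by rw [sq]; gcongr

theorem cutInv_of_le {a t : ℝ} (h : a ≤ |t|) : cutInv a t = t⁻¹ := by
  rw [cutInv, max_eq_right h, sq_abs]
  by_cases ht : t = 0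
  · simp [ht]
  · field_simp

theorem abs_cutInv_sub_le {a : ℝ} (ha : 0 < a) (t s : ℝ) :
    |cutInv a t - cutInv a s| ≤ |t - s| / (max a |t| * max a |s|) := by
  wlog hts : |t| ≤ |s| generalizing t s
  · rw [abs_sub_comm, abs_sub_comm t s, mul_comm]
    exact this s t (le_of_not_ge hts)
  rcases le_total a |t| with h1 | h1
  · have h2 := h1.trans hts
    have ht : t ≠ 0 := abs_pos.1 (ha.trans_le h1)
    have hs : s ≠ 0 := abs_pos.1 (ha.trans_le h2)
    rw [cutInv_of_le h1, cutInv_of_le h2, max_eq_right h1, max_eq_right h2, ← abs_mul, ← abs_div,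
      inv_sub_inv ht hs, abs_div, abs_div, abs_sub_comm]
  · rcases le_total a |s| with h2 | h2
    · have hs : s ≠ 0 := abs_pos.1 (ha.trans_le h2)
      rw [cutInv_of_le h2, cutInv, max_eq_left h1, max_eq_right h2, le_div_iff₀ (by positivity)]
      have e1 : t / a ^ 2 - s⁻¹ = (t * s - a ^ 2) / (a ^ 2 * s) := by field_simp
      rw [e1, abs_div, abs_mul, abs_of_nonneg (by positivity : 0 ≤ a ^ 2)]
      have e2 : |t * s - a ^ 2| / (a ^ 2 * |s|) * (a * |s|) = |t * s - a ^ 2| / a := by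
        have : |s| ≠ 0 := by positivity
        field_simp
      rw [e2, div_le_iff₀ ha, ← abs_of_pos ha, ← abs_mul, abs_of_pos ha]
      refine sq_le_sq.1 ?_
      have q1 : t ^ 2 ≤ a ^ 2 := by rw [← sq_abs t]; gcongr
      have q2 : a ^ 2 ≤ s ^ 2 := by rw [← sq_abs s]; gcongr
      nlinarith [mul_nonneg (sub_nonneg.2 q1) (sub_nonneg.2 q2)]
    · rw [cutInv, cutInv, max_eq_left h1, max_eq_left h2, ← sub_div, abs_div,
        abs_of_nonneg (by positivity : 0 ≤ a ^ 2), sq]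

theorem norm_homMult_le {P : KamPar ν} (hg : 0 < P.g) (hτ : 0 ≤ P.τ) (r : ℤ → ℝ) (n : ℕ)
    (i k : Idx ν) : ‖homMult P r n i k‖ ≤ P.g⁻¹ * (4 ^ (n + 1) : ℝ) ^ P.τ := by
  unfold homMult
  split_ifs with h
  · rw [norm_mul, norm_neg, Complex.norm_I, one_mul, Complex.norm_real, Real.norm_eq_abs]
    have hj := japL_pos (i.1 - k.1)
    refine (abs_cutInv_le (by positivity) _).trans ?_
    rw [mul_inv, ← Real.rpow_neg hj.le, neg_neg]
    gcongr
    exact max_le (one_le_pow₀ (by norm_num)) h.1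
  · rw [norm_zero]; positivity

theorem norm_lowMult_le (n : ℕ) (i k : Idx ν) : ‖lowMult n i k‖ ≤ 1 := by
  unfold lowMult; split_ifs <;> simp

theorem norm_highMult_le (n : ℕ) (i k : Idx ν) : ‖highMult n i k‖ ≤ 1 := by
  unfold highMult; split_ifs <;> simp

theorem isHamOp_schur_lowMult {R : MatOp (Idx ν)} (hR : IsHamOp R) (n : ℕ) :
    IsHamOp (schur (lowMult n) R) := by
  refine hR.schur (norm_lowMult_le n) (fun p i k => ?_) (fun i k _ _ => ?_) fun i k _ _ => ?_
  · simp [lowMult, Prod.ext_iff]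
  · have : (-i).1 - (-k).1 = -(i.1 - k.1) := by simp; abel
    simp only [lowMult, this, absL_neg, ne_eq, neg_inj]
    split_ifs <;> simp
  · have : (-k).1 - (-i).1 = i.1 - k.1 := by simp; abel
    simp only [lowMult, this, ne_eq, neg_inj, eq_comm]

theorem isHamOp_schur_highMult {R : MatOp (Idx ν)} (hR : IsHamOp R) (n : ℕ) :
    IsHamOp (schur (highMult n) R) := by
  refine hR.schur (norm_highMult_le n) (fun p i k => ?_) (fun i k _ _ => ?_) fun i k _ _ => ?_
  · simp [highMult]
  · have : (-i).1 - (-k).1 = -(i.1 - k.1) := by simp; abel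
    simp only [highMult, this, absL_neg]
    split_ifs <;> simp
  · have : (-k).1 - (-i).1 = i.1 - k.1 := by simp; abel
    simp only [highMult, this]

theorem eig_neg {m : ℝ} {r : ℤ → ℝ} (hr : ∀ j, r (-j) = -r j) (j : ℤ) :
    eig m (r (-j)) (-j) = -eig m (r j) j := by
  simp only [eig, disp_neg, hr]; ring

theorem isHamOp_kamGen {P : KamPar ν} (hg : 0 < P.g) (hτ : 0 ≤ P.τ) {s : (ℤ → ℝ) × MatOp (Idx ν)}
    (hr : ∀ j, s.1 (-j) = -s.1 j) (hR : IsHamOp s.2) (n : ℕ) : IsHamOp (kamGen P n s) := by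
  refine hR.schur (norm_homMult_le hg hτ s.1 n) (fun p i k => ?_) (fun i k _ _ => ?_)
    fun i k _ _ => ?_
  · simp [homMult, Prod.ext_iff, divisor]
  · have e : (-i).1 - (-k).1 = -(i.1 - k.1) := by simp; abel
    have hd : divisor P s.1 (-i) (-k) = -divisor P s.1 i k := by
      simp only [divisor, e, dotL_neg, Prod.snd_neg, eig_neg hr]; ring
    simp only [homMult, hd, cutInv_neg, e, absL_neg, japL_neg, ne_eq, neg_inj]
    split_ifs <;> simp
  · have e : (-k).1 - (-i).1 = i.1 - k.1 := by simp; abel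
    have hd : divisor P s.1 (-k) (-i) = divisor P s.1 i k := by
      simp only [divisor, e, Prod.snd_neg, eig_neg hr]; ring
    simp only [homMult, hd, e, ne_eq, neg_inj, eq_comm]

theorem kamStep_ham {P : KamPar ν} (hg : 0 < P.g) (hτ : 0 ≤ P.τ) {s : (ℤ → ℝ) × MatOp (Idx ν)}
    (hr : ∀ j, s.1 (-j) = -s.1 j) (hR : IsHamOp s.2) {n : ℕ} (hX : ‖kamGen P n s‖ ≤ 1) :
    (∀ j, (kamStep P n s).1 (-j) = -(kamStep P n s).1 j) ∧ IsHamOp (kamStep P n s).2 := by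
  refine ⟨fun j => ?_, ?_⟩
  · simp only [kamStep, hr, hR.diag_odd]; ring
  · exact (isHamOp_schur_highMult hR n).add
      ((isHamOp_kamGen hg hτ hr hR n).quadPart hR (isHamOp_schur_lowMult hR n) hX)

/-- The diagonal part `i (ω·ℓ - d_j)` of the operator. -/
def diagPart (P : KamPar ν) (r : ℤ → ℝ) (i : Idx ν) : ℂ :=
  Complex.I * (dotL P.w i.1 - eig P.m (r i.2) i.2 : ℝ)

theorem kamStep_intertwines {P : KamPar ν} (hg : 0 < P.g) (hτ : 0 ≤ P.τ)
    {s : (ℤ → ℝ) × MatOp (Idx ν)} (hR : IsHamOp s.2) {n : ℕ} (hX : ‖kamGen P n s‖ ≤ 1)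
    (hdiv : ∀ i k : Idx ν, i.2 ≠ 0 → k.2 ≠ 0 → i ≠ k → absL (i.1 - k.1) ≤ 4 ^ (n + 1) →
      P.g * japL (i.1 - k.1) ^ (-P.τ) ≤ |divisor P s.1 i k|) :
    Intertwines (diagPart P (kamStep P n s).1) (diagPart P s.1) (cayley (kamGen P n s))
      (cayley (kamGen P n s) * s.2 - (kamStep P n s).2 * cayley (kamGen P n s)) := by
  set X := kamGen P n s with hXdef
  set Y := schur (lowMult n) s.2 with hY
  have hXY : Intertwines (diagPart P s.1) (diagPart P s.1) X Y := by
    intro i k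
    rw [hXdef, kamGen, hY, ent_schur (norm_homMult_le hg hτ s.1 n), ent_schur (norm_lowMult_le n)]
    by_cases h0 : i.2 = 0 ∨ k.2 = 0
    · rw [hR.vanish i k h0]; ring
    rw [not_or] at h0
    unfold homMult lowMult
    split_ifs with h
    · have hd := hdiv i k h0.1 h0.2 h.2 h.1
      rw [cutInv_of_le hd]
      have hpos : 0 < |divisor P s.1 i k| :=
        lt_of_lt_of_le (mul_pos hg (Real.rpow_pos_of_pos (japL_pos _) _)) hd
      have hne : (divisor P s.1 i k : ℂ) ≠ 0 := by exact_mod_cast abs_pos.1 hpos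
      have e : diagPart P s.1 i - diagPart P s.1 k = Complex.I * (divisor P s.1 i k : ℂ) := by
        simp only [diagPart, divisor, dotL_sub]; push_cast; ring
      calc _ = (diagPart P s.1 i - diagPart P s.1 k) * (-Complex.I *
            ((divisor P s.1 i k)⁻¹ : ℝ)) * ent s.2 i k := by ring
        _ = _ := by
          rw [e]
          push_cast
          field_simp
          rw [Complex.I_sq]; ring
    · ring
  have h1 := intertwines_cayley (R := s.2) hX hXY
  have hdec : ∀ i k, ent (s.2 - Y + quadPart X s.2 Y) i k =
      (if i = k then diagPart P (kamStep P n s).1 i - diagPart P s.1 i else 0) +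
        ent (kamStep P n s).2 i k := by
    intro i k
    have e1 : (kamStep P n s).2 = schur (highMult n) s.2 + quadPart X s.2 Y := rfl
    rw [e1, ent_add, ent_add, ent_sub, hY, ent_schur (norm_lowMult_le n),
      ent_schur (norm_highMult_le n)]
    by_cases hik : i = k
    · subst hik
      have e2 : absL (0 : Fin ν → ℤ) ≤ 4 ^ (n + 1) := by simp [absL]
      have e3 : diagPart P (kamStep P n s).1 i - diagPart P s.1 i = ent s.2 i i := by
        rw [hR.diag i]
        simp only [diagPart, kamStep, eig]; push_cast; ring
      rw [if_pos rfl, e3]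
      simp [lowMult, highMult, e2]
    · by_cases h : absL (i.1 - k.1) ≤ 4 ^ (n + 1)
      · simp [lowMult, highMult, h, hik]
      · simp [lowMult, highMult, h, hik]
  intro i k
  have h2 := h1 i k
  rw [ent_sub] at h2 ⊢
  have h3 : ent ((s.2 - Y + quadPart X s.2 Y) * cayley X) i k =
      (diagPart P (kamStep P n s).1 i - diagPart P s.1 i) * ent (cayley X) i k +
        ent ((kamStep P n s).2 * cayley X) i k := by
    have q1 := hasSum_ent_mul (s.2 - Y + quadPart X s.2 Y) (cayley X) i k
    have q2 := hasSum_ent_mul (kamStep P n s).2 (cayley X) i k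
    have q3 := (hasSum_ite_eq i ((diagPart P (kamStep P n s).1 i - diagPart P s.1 i) *
      ent (cayley X) i k)).add q2
    refine q1.unique ?_
    convert q3 using 2 with j
    rw [hdec]
    by_cases hij : i = j
    · subst hij; simp; ring
    · rw [if_neg hij, if_neg (Ne.symm hij)]; ring
  rw [h3] at h2
  linear_combination h2

end Step

/-! ### Weights -/

section Weights

variable {ν : ℕ}

theorem one_le_jap (x : ℝ) : 1 ≤ jap x := le_max_left _ _

theorem jap_pos (x : ℝ) : 0 < jap x := one_pos.trans_le (one_le_jap x)

/-- The weight `(1 + |ℓ - ℓ'| / 4 ^ n) ^ b (W(i) / W(k)) ⟨j'⟩`. -/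
def kamW (W : Idx ν → ℝ) (b n : ℕ) (i k : Idx ν) : ℝ≥0∞ :=
  ENNReal.ofReal ((1 + absL (i.1 - k.1) / 4 ^ n) ^ b * (W i / W k) * jap k.2)

theorem one_add_absL_pos (l : Fin ν → ℤ) (n : ℕ) : 0 < 1 + absL l / 4 ^ n := by
  have := absL_nonneg l
  positivity

theorem kamW_le_mul {W : Idx ν → ℝ} (hW : ∀ i, 0 < W i) {b b' n n' : ℕ} {i k : Idx ν} {c : ℝ}
    (h : (1 + absL (i.1 - k.1) / 4 ^ n) ^ b ≤ c * (1 + absL (i.1 - k.1) / 4 ^ n') ^ b')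
    (hc : 0 ≤ c) : kamW W b n i k ≤ ENNReal.ofReal c * kamW W b' n' i k := by
  rw [kamW, kamW, ← ENNReal.ofReal_mul hc]
  refine ENNReal.ofReal_le_ofReal ?_
  have h1 := hW i
  have h2 := hW k
  have h3 := jap_pos k.2
  calc _ ≤ (c * (1 + absL (i.1 - k.1) / 4 ^ n') ^ b') * (W i / W k) * jap k.2 := by gcongr
    _ = _ := by ring

theorem subMul_kamW {W : Idx ν → ℝ} (hW : ∀ i, 0 < W i) (b n : ℕ) : SubMul (kamW W b n) := by
  intro i j k
  have h1 := hW i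
  have h2 := hW k
  have h4 := hW j
  have h3 := jap_pos k.2
  have h5 := one_le_jap j.2
  have p1 := one_add_absL_pos (i.1 - k.1) n
  have p2 := one_add_absL_pos (i.1 - j.1) n
  have p3 := one_add_absL_pos (j.1 - k.1) n
  rw [kamW, kamW, kamW, ← ENNReal.ofReal_mul (by positivity)]
  refine ENNReal.ofReal_le_ofReal ?_
  have htri : 1 + absL (i.1 - k.1) / 4 ^ n ≤
      (1 + absL (i.1 - j.1) / 4 ^ n) * (1 + absL (j.1 - k.1) / 4 ^ n) := by
    have e : i.1 - k.1 = (i.1 - j.1) + (j.1 - k.1) := by abel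
    have h := absL_add_le (i.1 - j.1) (j.1 - k.1)
    rw [← e] at h
    have a1 : 0 ≤ absL (i.1 - j.1) / 4 ^ n := div_nonneg (absL_nonneg _) (by positivity)
    have a2 : 0 ≤ absL (j.1 - k.1) / 4 ^ n := div_nonneg (absL_nonneg _) (by positivity)
    have a3 : absL (i.1 - k.1) / 4 ^ n ≤ absL (i.1 - j.1) / 4 ^ n + absL (j.1 - k.1) / 4 ^ n := by
      rw [← add_div]; gcongr
    nlinarith [mul_nonneg a1 a2]
  calc (1 + absL (i.1 - k.1) / 4 ^ n) ^ b * (W i / W k) * jap k.2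
      ≤ ((1 + absL (i.1 - j.1) / 4 ^ n) * (1 + absL (j.1 - k.1) / 4 ^ n)) ^ b *
        (W i / W k) * (jap j.2 * jap k.2) := by
        gcongr
        exact le_mul_of_one_le_left h3.le h5
    _ = _ := by rw [mul_pow]; field_simp

theorem one_le_kamW_one (b n : ℕ) (i k : Idx ν) : 1 ≤ kamW (fun _ => 1) b n i k := by
  rw [kamW, ENNReal.one_le_ofReal, div_self one_ne_zero, mul_one]
  refine one_le_mul_of_one_le_of_one_le (one_le_pow₀ ?_) (one_le_jap _)
  exact le_add_of_nonneg_right (div_nonneg (absL_nonneg _) (by positivity))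

theorem kamW_self {W : Idx ν → ℝ} (hW : ∀ i, 0 < W i) (b n : ℕ) (i : Idx ν) :
    kamW W b n i i = ENNReal.ofReal (jap i.2) := by
  rw [kamW, div_self (hW i).ne']
  simp [absL]

theorem kamW_succ_le {W : Idx ν → ℝ} (hW : ∀ i, 0 < W i) (b n : ℕ) (i k : Idx ν) :
    kamW W b (n + 1) i k ≤ kamW W b n i k := by
  have h := kamW_le_mul hW (b := b) (b' := b) (n := n + 1) (n' := n) (i := i) (k := k) (c := 1) ?_
    zero_le_one
  · simpa using h
  · rw [one_mul]
    have := absL_nonneg (i.1 - k.1)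
    gcongr
    · norm_num
    · omega

theorem kamW_zero_le {W : Idx ν → ℝ} (hW : ∀ i, 0 < W i) {b b' : ℕ} (hb : b' ≤ b) (n : ℕ)
    (i k : Idx ν) : kamW W b' 0 i k ≤ ENNReal.ofReal ((4 ^ n) ^ b') * kamW W b n i k := by
  refine kamW_le_mul hW ?_ (by positivity)
  have h0 := absL_nonneg (i.1 - k.1)
  have h1 : 1 + absL (i.1 - k.1) / 4 ^ 0 ≤ 4 ^ n * (1 + absL (i.1 - k.1) / 4 ^ n) := by
    have : (1 : ℝ) ≤ 4 ^ n := one_le_pow₀ (by norm_num)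
    field_simp
    linarith
  calc (1 + absL (i.1 - k.1) / 4 ^ 0) ^ b' ≤ (4 ^ n * (1 + absL (i.1 - k.1) / 4 ^ n)) ^ b' := by
        gcongr
    _ = (4 ^ n) ^ b' * (1 + absL (i.1 - k.1) / 4 ^ n) ^ b' := mul_pow _ _ _
    _ ≤ (4 ^ n) ^ b' * (1 + absL (i.1 - k.1) / 4 ^ n) ^ b := by
        gcongr
        exact le_add_of_nonneg_right (div_nonneg h0 (by positivity))

end Weights

/-! ### Estimates of a step, for two operators at once -/

section StepEstimates

variable {ν : ℕ}

/-- Two sets of parameters that differ by at most `1 / c`, in units of `g`. -/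
structure ParPair (L c : ℝ) (P P' : KamPar ν) : Prop where
  g_pos : 0 < P.g
  g_le : P.g ≤ 1
  g_eq : P'.g = P.g
  τ_nonneg : 0 ≤ P.τ
  τ_eq : P'.τ = P.τ
  L_nonneg : 0 ≤ L
  w_le : ∀ i, |P.w i| ≤ 2 * L
  w_le' : ∀ i, |P'.w i| ≤ 2 * L
  m_ge : 1 / 2 ≤ P.m
  m_ge' : 1 / 2 ≤ P'.m
  c_nonneg : 0 ≤ c
  diff_w : c * dist P.w P'.w ≤ P.g
  diff_m : c * |P.m - P'.m| ≤ P.g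

/-- Smallness conditions for the iteration: `e` is the size of the remainder, `4 ^ (-a)` the rate
of convergence and `b` the number of time derivatives that are used. -/
structure KamSmall (L g τ : ℝ) (t a b : ℕ) (e : ℝ) : Prop where
  τ_le : 2 * τ + 1 ≤ t
  t_le : t ≤ a
  a_pos : 1 ≤ a
  b_ge : 2 * a + 1 ≤ b
  e_nonneg : 0 ≤ e
  small : 32 * ((10 + 4 * L) * 4 ^ t) * 4 ^ a * e ≤ g

theorem abs_dotL_le {w : Freq ν} {M : ℝ} (hw : ∀ i, |w i| ≤ M) (l : Fin ν → ℤ) :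
    |dotL w l| ≤ M * absL l := by
  rw [dotL, absL, Finset.mul_sum]
  refine (Finset.abs_sum_le_sum_abs _ _).trans (Finset.sum_le_sum fun i _ => ?_)
  rw [abs_mul]
  gcongr
  exact hw i

theorem abs_dotL_sub_le (w w' : Freq ν) (l : Fin ν → ℤ) :
    |dotL w l - dotL w' l| ≤ dist w w' * absL l := by
  have h : dotL w l - dotL w' l = dotL (w - w') l := by
    simp [dotL, sub_mul]
  rw [h]
  refine abs_dotL_le (fun i => ?_) l
  rw [dist_eq_norm, ← Real.norm_eq_abs]
  exact PiLp.norm_apply_le (w - w') i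

theorem divisor_sub_le {L c : ℝ} {P P' : KamPar ν} (h : ParPair L c P P') {r r' : ℤ → ℝ}
    (hr' : ∀ j, |r' j| ≤ 1) (hrr : ∀ j, c * |r j - r' j| ≤ P.g) (i k : Idx ν) :
    c * |divisor P r i k - divisor P' r' i k| ≤
      P.g * ((1 + 4 * L) * absL (i.1 - k.1) + 2 * |divisor P' r' i k| + 6) := by
  set l := i.1 - k.1
  set t' := divisor P' r' i k with ht'
  set d := disp i.2 - disp k.2 with hd
  have hc := h.c_nonneg
  have hl := absL_nonneg l
  have hm' : 0 < P'.m := by linarith [h.m_ge']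
  have hdle : |d| ≤ 2 * (|t'| + 2 * L * absL l + 2) := by
    have e1 : P'.m * d = dotL P'.w l - t' - r' i.2 + r' k.2 := by
      rw [ht', hd]; simp only [divisor, eig]; ring
    have e2 : P'.m * |d| ≤ |t'| + 2 * L * absL l + 2 := by
      rw [← abs_of_pos hm', ← abs_mul, e1]
      have a1 := abs_dotL_le h.w_le' l
      have a2 := hr' i.2
      have a3 := hr' k.2
      rw [abs_le] at a1 a2 a3
      have a4 := abs_le.1 (le_refl |t'|)
      rw [abs_le]
      constructor <;> linarith
    have e3 : 1 / 2 * |d| ≤ P'.m * |d| := mul_le_mul_of_nonneg_right h.m_ge' (abs_nonneg _)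
    linarith
  have e4 : divisor P r i k - t' = (dotL P.w l - dotL P'.w l) - (P.m - P'.m) * d -
      (r i.2 - r' i.2) + (r k.2 - r' k.2) := by
    rw [ht', hd]; simp only [divisor, eig]; ring
  have e5 : |divisor P r i k - t'| ≤ dist P.w P'.w * absL l + |P.m - P'.m| * |d| +
      |r i.2 - r' i.2| + |r k.2 - r' k.2| := by
    rw [e4]
    have a1 := abs_dotL_sub_le P.w P'.w l
    have a2 : |(P.m - P'.m) * d| = |P.m - P'.m| * |d| := abs_mul _ _
    have b1 := abs_le.1 a1
    have b2 := abs_le.1 a2.le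
    have b3 := abs_le.1 (le_refl |r i.2 - r' i.2|)
    have b4 := abs_le.1 (le_refl |r k.2 - r' k.2|)
    rw [abs_le]
    constructor <;> linarith
  calc c * |divisor P r i k - t'| ≤ c * (dist P.w P'.w * absL l + |P.m - P'.m| * |d| +
      |r i.2 - r' i.2| + |r k.2 - r' k.2|) := by gcongr
    _ = (c * dist P.w P'.w) * absL l + (c * |P.m - P'.m|) * |d| + c * |r i.2 - r' i.2| +
        c * |r k.2 - r' k.2| := by ring
    _ ≤ P.g * absL l + P.g * (2 * (|t'| + 2 * L * absL l + 2)) + P.g + P.g := by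
        have g0 := h.g_pos.le
        gcongr
        · exact h.diff_w
        · exact h.diff_m
        · exact hrr _
        · exact hrr _
    _ = P.g * ((1 + 4 * L) * absL l + 2 * |t'| + 6) := by ring

theorem homMult_sub_le {L c : ℝ} {P P' : KamPar ν} (h : ParPair L c P P') {r r' : ℤ → ℝ}
    (hr' : ∀ j, |r' j| ≤ 1) (hrr : ∀ j, c * |r j - r' j| ≤ P.g) (n : ℕ) (i k : Idx ν) :
    c * ‖homMult P r n i k - homMult P' r' n i k‖ ≤
      (9 + 4 * L) * P.g⁻¹ * (4 ^ (n + 1) : ℝ) ^ (2 * P.τ + 1) := by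
  have g0 := h.g_pos
  have L0 := h.L_nonneg
  have hN1 : (1 : ℝ) ≤ 4 ^ (n + 1) := one_le_pow₀ (by norm_num)
  have hN0 : (0 : ℝ) < 4 ^ (n + 1) := by positivity
  set N : ℝ := 4 ^ (n + 1) with hN
  unfold homMult
  split_ifs with hik
  swap
  · simp only [sub_self, norm_zero, mul_zero]; positivity
  rw [← mul_sub, norm_mul, norm_neg, Complex.norm_I, one_mul, ← Complex.ofReal_sub,
    Complex.norm_real, Real.norm_eq_abs, h.g_eq, h.τ_eq]
  set l := i.1 - k.1
  have hl := absL_nonneg l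
  have hj := japL_pos l
  set A := P.g * japL l ^ (-P.τ) with hA
  have hA0 : 0 < A := by positivity
  set t := divisor P r i k
  set t' := divisor P' r' i k
  set T := max A |t|
  set T' := max A |t'|
  have hT : A ≤ T := le_max_left _ _
  have hT' : A ≤ T' := le_max_left _ _
  have hT0 : 0 < T := hA0.trans_le hT
  have hT0' : 0 < T' := hA0.trans_le hT'
  have ht' : |t'| ≤ T' := le_max_right _ _
  have hAinv : A⁻¹ ≤ P.g⁻¹ * N ^ P.τ := by
    rw [hA, mul_inv, ← Real.rpow_neg hj.le, neg_neg]
    have hτ := h.τ_nonneg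
    gcongr
    exact max_le hN1 hik.1
  have hdiv := divisor_sub_le h hr' hrr i k
  have hNt : 1 ≤ N ^ P.τ := Real.one_le_rpow hN1 h.τ_nonneg
  have hg1 : 1 ≤ P.g⁻¹ := (one_le_inv₀ g0).2 h.g_le
  calc c * |cutInv A t - cutInv A t'| ≤ c * (|t - t'| / (T * T')) := by
        have := h.c_nonneg
        gcongr
        exact abs_cutInv_sub_le hA0 t t'
    _ = (c * |t - t'|) / (T * T') := by ring
    _ ≤ (P.g * ((1 + 4 * L) * absL l + 2 * T' + 6)) / (T * T') := by
        refine div_le_div_of_nonneg_right (hdiv.trans ?_) (by positivity)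
        gcongr
    _ = P.g * (((1 + 4 * L) * absL l + 6) * (T⁻¹ * T'⁻¹) + 2 * T⁻¹) := by
        field_simp
        ring
    _ ≤ P.g * (((1 + 4 * L) * N + 6 * N) * (A⁻¹ * A⁻¹) + 2 * A⁻¹) := by
        gcongr
        · exact hik.1
        · linarith
    _ ≤ P.g * (((1 + 4 * L) * N + 6 * N) * ((P.g⁻¹ * N ^ P.τ) * (P.g⁻¹ * N ^ P.τ)) +
        2 * (P.g⁻¹ * N ^ P.τ)) := by gcongr
    _ = (7 + 4 * L) * P.g⁻¹ * (N * (N ^ P.τ * N ^ P.τ)) + 2 * (1 * (1 * (1 * N ^ P.τ))) := by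
        field_simp
        ring
    _ ≤ (7 + 4 * L) * P.g⁻¹ * (N * (N ^ P.τ * N ^ P.τ)) +
        2 * (P.g⁻¹ * (N * (N ^ P.τ * N ^ P.τ))) := by
        gcongr
    _ = _ := by
        rw [Real.rpow_add_one hN0.ne', two_mul P.τ, Real.rpow_add hN0]; ring

theorem KamSmall.scale {L g τ e : ℝ} {t a b : ℕ} (h : KamSmall L g τ t a b e) (n : ℕ) :
    (4 ^ (n + 1) : ℝ) ^ (2 * τ + 1) ≤ 4 ^ t * (4 ^ n) ^ t := by
  calc (4 ^ (n + 1) : ℝ) ^ (2 * τ + 1) ≤ (4 ^ (n + 1) : ℝ) ^ (t : ℝ) :=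
        Real.rpow_le_rpow_of_exponent_le (one_le_pow₀ (by norm_num)) h.τ_le
    _ = _ := by rw [Real.rpow_natCast, pow_succ, mul_pow, mul_comm]

variable {L c : ℝ} {P P' : KamPar ν} {t a b : ℕ} {e : ℝ} {W : Idx ν → ℝ}

theorem pairN_kamGen_le (h : ParPair L c P P') (hs : KamSmall L P.g P.τ t a b e)
    {s s' : (ℤ → ℝ) × MatOp (Idx ν)} (hr' : ∀ j, |s'.1 j| ≤ 1)
    (hrr : ∀ j, c * |s.1 j - s'.1 j| ≤ P.g) (n : ℕ) :
    pairN (ENNReal.ofReal c) (kamW W b n) (kamGen P n s) (kamGen P' n s') ≤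
      ENNReal.ofReal ((10 + 4 * L) * 4 ^ t * P.g⁻¹ * (4 ^ n) ^ t) *
        pairN (ENNReal.ofReal c) (kamW W b n) s.2 s'.2 := by
  have g0 := h.g_pos
  have L0 := h.L_nonneg
  have b1 := norm_homMult_le g0 h.τ_nonneg s.1 n
  have b2 : ∀ i k, ‖homMult P' s'.1 n i k‖ ≤ P.g⁻¹ * (4 ^ (n + 1) : ℝ) ^ P.τ := by
    have := norm_homMult_le (P := P') (by rw [h.g_eq]; exact g0) (by rw [h.τ_eq]; exact h.τ_nonneg)
      s'.1 n
    rwa [h.g_eq, h.τ_eq] at this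
  set M := 4 ^ t * P.g⁻¹ * (4 ^ n : ℝ) ^ t with hM
  have hM0 : 0 ≤ M := by positivity
  have hb : P.g⁻¹ * (4 ^ (n + 1) : ℝ) ^ P.τ ≤ M := by
    calc P.g⁻¹ * (4 ^ (n + 1) : ℝ) ^ P.τ ≤ P.g⁻¹ * (4 ^ (n + 1) : ℝ) ^ (2 * P.τ + 1) := by
          gcongr
          · exact one_le_pow₀ (by norm_num)
          · linarith [h.τ_nonneg]
      _ ≤ P.g⁻¹ * (4 ^ t * (4 ^ n) ^ t) := by gcongr; exact hs.scale n
      _ = M := by rw [hM]; ring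
  have hd : ∀ i k, c * ‖homMult P s.1 n i k - homMult P' s'.1 n i k‖ ≤ (9 + 4 * L) * M := by
    intro i k
    refine (homMult_sub_le h hr' hrr n i k).trans ?_
    calc _ ≤ (9 + 4 * L) * P.g⁻¹ * (4 ^ t * (4 ^ n) ^ t) := by gcongr; exact hs.scale n
      _ = _ := by rw [hM]; ring
  have key := pairN_schur (c := ENNReal.ofReal c) (w := kamW W b n) (w' := kamW W b n) b1 b2
    (g := ENNReal.ofReal M) (g' := ENNReal.ofReal ((9 + 4 * L) * M)) ?_ ?_ ?_ s.2 s'.2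
  · refine key.trans (le_of_eq ?_)
    rw [← ENNReal.ofReal_add hM0 (by positivity)]
    congr 2
    rw [hM]; ring
  · intro i k
    rw [mul_comm, ← ofReal_norm]
    gcongr
    exact (b1 i k).trans hb
  · intro i k
    rw [mul_comm, ← ofReal_norm]
    gcongr
    exact (b2 i k).trans hb
  · intro i k
    rw [mul_left_comm, mul_comm, ← ofReal_norm, ← ENNReal.ofReal_mul h.c_nonneg]
    exact mul_le_mul' (ENNReal.ofReal_le_ofReal (hd i k)) le_rfl

theorem pairN_highMult_le (hW : ∀ i, 0 < W i) (b n : ℕ) (R R' : MatOp (Idx ν)) (c : ℝ≥0∞) :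
    pairN c (kamW W b (n + 1)) (schur (highMult n) R) (schur (highMult n) R') ≤
      ENNReal.ofReal ((1 / 2) ^ b) * pairN c (kamW W b n) R R' := by
  have hb : ∀ i k : Idx ν, kamW W b (n + 1) i k * ‖highMult n i k‖ₑ ≤
      ENNReal.ofReal ((1 / 2) ^ b) * kamW W b n i k := by
    intro i k
    unfold highMult
    split_ifs with h
    · simp
    · rw [enorm_one, mul_one]
      refine kamW_le_mul hW ?_ (by positivity)
      rw [← mul_pow]
      have h0 := absL_nonneg (i.1 - k.1)
      gcongr
      rw [not_le] at h
      rw [pow_succ] at h ⊢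
      have hp : (0 : ℝ) < 4 ^ n := by positivity
      field_simp
      linarith
  have key := pairN_schur (c := c) (w := kamW W b n) (w' := kamW W b (n + 1)) (g' := 0)
    (norm_highMult_le (ν := ν) n) (norm_highMult_le n) hb hb (by simp) R R'
  rwa [add_zero] at key

theorem pairN_lowMult_le (b n : ℕ) (R R' : MatOp (Idx ν)) (c : ℝ≥0∞) :
    pairN c (kamW W b n) (schur (lowMult n) R) (schur (lowMult n) R') ≤
      pairN c (kamW W b n) R R' := by
  have hb : ∀ i k : Idx ν, kamW W b n i k * ‖lowMult n i k‖ₑ ≤ 1 * kamW W b n i k := by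
    intro i k
    unfold lowMult
    split_ifs <;> simp
  have key := pairN_schur (c := c) (w := kamW W b n) (w' := kamW W b n) (g' := 0)
    (norm_lowMult_le (ν := ν) n) (norm_lowMult_le n) hb hb (by simp) R R'
  simpa using key

/-- The bounds that are propagated along the iteration. -/
structure KamBound (c : ℝ) (W : Idx ν → ℝ) (a b : ℕ) (e : ℝ) (n : ℕ)
    (s s' : (ℤ → ℝ) × MatOp (Idx ν)) : Prop where
  norm_le : pairN (ENNReal.ofReal c) (kamW W b n) s.2 s'.2 ≤ ENNReal.ofReal (e * ((1 / 4) ^ a) ^ n)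
  r_le : ∀ j : ℤ, jap j * |s.1 j| ≤ 2 * e * (1 - ((1 / 4) ^ a) ^ n)
  r_le' : ∀ j : ℤ, jap j * |s'.1 j| ≤ 2 * e * (1 - ((1 / 4) ^ a) ^ n)
  r_diff : ∀ j : ℤ, c * (jap j * |s.1 j - s'.1 j|) ≤ 2 * e * (1 - ((1 / 4) ^ a) ^ n)

theorem KamSmall.rate (hs : KamSmall L P.g P.τ t a b e) : ((1 / 4 : ℝ)) ^ a ≤ 1 / 4 := by
  calc ((1 / 4 : ℝ)) ^ a ≤ (1 / 4) ^ 1 :=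
        pow_le_pow_of_le_one (by norm_num) (by norm_num) hs.a_pos
    _ = 1 / 4 := pow_one _

theorem KamSmall.two_e_le (h : ParPair L c P P') (hs : KamSmall L P.g P.τ t a b e) :
    2 * e ≤ P.g := by
  have h1 : (1 : ℝ) ≤ 4 ^ t := one_le_pow₀ (by norm_num)
  have h2 : (1 : ℝ) ≤ 4 ^ a := one_le_pow₀ (by norm_num)
  have h3 := h.L_nonneg
  have h4 := hs.e_nonneg
  refine le_trans ?_ hs.small
  gcongr
  calc (2 : ℝ) ≤ 32 * ((10 + 4 * 0) * 1) * 1 := by norm_num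
    _ ≤ 32 * ((10 + 4 * L) * 4 ^ t) * 4 ^ a := by gcongr

theorem KamBound.r_small (h : ParPair L c P P') (hs : KamSmall L P.g P.τ t a b e) {n : ℕ}
    {s s' : (ℤ → ℝ) × MatOp (Idx ν)} (hB : KamBound c W a b e n s s') :
    (∀ j, |s'.1 j| ≤ 1) ∧ (∀ j, c * |s.1 j - s'.1 j| ≤ P.g) := by
  have h2 := hs.two_e_le h
  have hx : (0 : ℝ) ≤ ((1 / 4) ^ a) ^ n := by positivity
  have he := hs.e_nonneg
  have hle : 2 * e * (1 - ((1 / 4) ^ a) ^ n) ≤ P.g := by nlinarith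
  have hg := h.g_le
  refine ⟨fun j => ?_, fun j => ?_⟩
  · have h3 : |s'.1 j| ≤ jap j * |s'.1 j| := le_mul_of_one_le_left (abs_nonneg _) (one_le_jap _)
    linarith [hB.r_le' j]
  · have h3 : |s.1 j - s'.1 j| ≤ jap j * |s.1 j - s'.1 j| :=
      le_mul_of_one_le_left (abs_nonneg _) (one_le_jap _)
    have := mul_le_mul_of_nonneg_left h3 h.c_nonneg
    linarith [hB.r_diff j]

/-- The bound on the generators of the transformations. -/
theorem KamBound.gen_le (h : ParPair L c P P') (hs : KamSmall L P.g P.τ t a b e) {n : ℕ}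
    {s s' : (ℤ → ℝ) × MatOp (Idx ν)} (hB : KamBound c W a b e n s s') :
    pairN (ENNReal.ofReal c) (kamW W b n) (kamGen P n s) (kamGen P' n s') ≤
      ENNReal.ofReal ((10 + 4 * L) * 4 ^ t * P.g⁻¹ * e * ((4 ^ t) ^ n * ((1 / 4) ^ a) ^ n)) := by
  obtain ⟨h1, h2⟩ := hB.r_small h hs
  have g0 := h.g_pos
  have L0 := h.L_nonneg
  refine (pairN_kamGen_le h hs h1 h2 n).trans ?_
  refine (mul_le_mul_right hB.norm_le _).trans ?_
  rw [← ENNReal.ofReal_mul (by positivity)]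
  refine le_of_eq (congrArg _ ?_)
  rw [← pow_mul, ← pow_mul, mul_comm n t]
  ring

theorem KamSmall.gen_const (h : ParPair L c P P') (hs : KamSmall L P.g P.τ t a b e) :
    (10 + 4 * L) * 4 ^ t * P.g⁻¹ * e ≤ (1 / 4) ^ a / 32 := by
  have g0 := h.g_pos
  have := hs.small
  rw [le_div_iff₀ (by norm_num), one_div, inv_pow, ← one_div ((4 : ℝ) ^ a),
    le_div_iff₀ (by positivity)]
  calc (10 + 4 * L) * 4 ^ t * P.g⁻¹ * e * 32 * 4 ^ a
      = P.g⁻¹ * (32 * ((10 + 4 * L) * 4 ^ t) * 4 ^ a * e) := by ring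
    _ ≤ P.g⁻¹ * P.g := by gcongr
    _ = 1 := inv_mul_cancel₀ g0.ne'

theorem pow_scale_le (hs : KamSmall L P.g P.τ t a b e) (n : ℕ) :
    (4 ^ t : ℝ) ^ n * ((1 / 4) ^ a) ^ n ≤ 1 := by
  rw [← mul_pow]
  refine pow_le_one₀ (by positivity) ?_
  rw [one_div, inv_pow, ← div_eq_mul_inv, div_le_one (by positivity)]
  exact pow_le_pow_right₀ (by norm_num) hs.t_le

theorem KamBound.gen_le_small (h : ParPair L c P P') (hs : KamSmall L P.g P.τ t a b e) {n : ℕ}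
    {s s' : (ℤ → ℝ) × MatOp (Idx ν)} (hB : KamBound c W a b e n s s') :
    pairN (ENNReal.ofReal c) (kamW W b n) (kamGen P n s) (kamGen P' n s') ≤
      ENNReal.ofReal ((1 / 4) ^ a / 32) := by
  refine (hB.gen_le h hs).trans (ENNReal.ofReal_le_ofReal ?_)
  have h1 := hs.gen_const h
  have h2 := pow_scale_le hs n
  have g0 := h.g_pos
  have L0 := h.L_nonneg
  have e0 := hs.e_nonneg
  calc _ ≤ (10 + 4 * L) * 4 ^ t * P.g⁻¹ * e * 1 := by gcongr
    _ ≤ _ := by rw [mul_one]; exact h1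

theorem ent_diag_le (hW : ∀ i, 0 < W i) (hc : 0 ≤ c) {b n : ℕ} {R R' : MatOp (Idx ν)} {ε : ℝ}
    (hε : 0 ≤ ε) (h : pairN (ENNReal.ofReal c) (kamW W b n) R R' ≤ ENNReal.ofReal ε) (i : Idx ν) :
    jap i.2 * |(ent R i i).im| ≤ ε ∧ jap i.2 * |(ent R' i i).im| ≤ ε ∧
      c * (jap i.2 * |(ent R i i).im - (ent R' i i).im|) ≤ ε := by
  have key : ∀ A : MatOp (Idx ν), ENNReal.ofReal (jap i.2 * |(ent A i i).im|) ≤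
      schurN (kamW W b n) A := by
    intro A
    refine le_trans ?_ (ent_le_schurN (kamW W b n) A i i)
    rw [kamW_self hW, ← ofReal_norm, ← ENNReal.ofReal_mul (jap_pos _).le]
    refine ENNReal.ofReal_le_ofReal ?_
    have := jap_pos (i.2 : ℝ)
    gcongr
    exact Complex.abs_im_le_norm _
  refine ⟨?_, ?_, ?_⟩
  · exact (ENNReal.ofReal_le_ofReal_iff hε).1 ((key R).trans ((left_le_pairN _ _ _ _).trans h))
  · exact (ENNReal.ofReal_le_ofReal_iff hε).1 ((key R').trans ((right_le_pairN _ _ _ _).trans h))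
  · refine (ENNReal.ofReal_le_ofReal_iff hε).1 ?_
    rw [ENNReal.ofReal_mul hc, ← Complex.sub_im, ← ent_sub]
    exact (mul_le_mul_right (key _) _).trans ((diff_le_pairN _ _ _ _).trans h)

theorem KamBound.step (hW : ∀ i, 0 < W i) (h : ParPair L c P P')
    (hs : KamSmall L P.g P.τ t a b e) {n : ℕ}
    {s s' : (ℤ → ℝ) × MatOp (Idx ν)} (hB : KamBound c W a b e n s s')
    (hX : ‖kamGen P n s‖ ≤ 1) (hX' : ‖kamGen P' n s'‖ ≤ 1) :
    KamBound c W a b e (n + 1) (kamStep P n s) (kamStep P' n s') := by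
  set x : ℝ := (1 / 4) ^ a with hx
  have hx0 : 0 < x := by positivity
  have hx4 : x ≤ 1 / 4 := hs.rate
  have e0 := hs.e_nonneg
  have hgen := hB.gen_le_small h hs
  have hxn : 0 < x ^ n := by positivity
  have hrstep : 2 * e * (1 - x ^ n) + e * x ^ n ≤ 2 * e * (1 - x ^ (n + 1)) := by
    rw [pow_succ]
    nlinarith [mul_nonneg e0 hxn.le]
  refine ⟨?_, fun j => ?_, fun j => ?_, fun j => ?_⟩
  · set X := kamGen P n s
    set X' := kamGen P' n s'
    have hX1 : pairN (ENNReal.ofReal c) (kamW W b n) X X' ≤ 1 := by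
      refine hgen.trans ?_
      rw [← ENNReal.ofReal_one]
      exact ENNReal.ofReal_le_ofReal (by linarith)
    have q1 := pairN_quadPart (c := ENNReal.ofReal c) (subMul_kamW hW b n) hX hX' hX1
      (pairN_lowMult_le (W := W) b n s.2 s'.2 (ENNReal.ofReal c))
    have q2 := pairN_mono_weight (c := ENNReal.ofReal c) (w := kamW W b n)
      (w' := kamW W b (n + 1)) (g := 1) (fun i k => by rw [one_mul]; exact kamW_succ_le hW b n i k)
      (quadPart X s.2 (schur (lowMult n) s.2)) (quadPart X' s'.2 (schur (lowMult n) s'.2))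
    have q3 := pairN_highMult_le hW b n s.2 s'.2 (ENNReal.ofReal c)
    refine (pairN_add _ _ _ _).trans ?_
    rw [one_mul] at q2
    have hb2 : ((1 / 2 : ℝ)) ^ b ≤ x / 2 := by
      calc ((1 / 2 : ℝ)) ^ b ≤ (1 / 2) ^ (2 * a + 1) :=
            pow_le_pow_of_le_one (by norm_num) (by norm_num) hs.b_ge
        _ = x / 2 := by rw [pow_succ, pow_mul, hx]; norm_num; ring
    calc _ ≤ ENNReal.ofReal ((1 / 2) ^ b) * ENNReal.ofReal (e * x ^ n) +
          16 * (ENNReal.ofReal (x / 32) * ENNReal.ofReal (e * x ^ n)) := by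
          refine add_le_add (q3.trans (mul_le_mul_right hB.norm_le _)) ((q2.trans q1).trans ?_)
          exact mul_le_mul_right (mul_le_mul' hgen hB.norm_le) _
      _ = ENNReal.ofReal ((1 / 2) ^ b * (e * x ^ n) + 16 * ((x / 32) * (e * x ^ n))) := by
          have hy : 0 ≤ e * x ^ n := by positivity
          generalize e * x ^ n = y at hy
          rw [ENNReal.ofReal_add (by positivity) (by positivity), ENNReal.ofReal_mul (by positivity),
            ENNReal.ofReal_mul (p := 16) (by positivity), ENNReal.ofReal_mul (p := x / 32)
            (by positivity), ENNReal.ofReal_ofNat]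
      _ ≤ _ := by
          refine ENNReal.ofReal_le_ofReal ?_
          calc _ ≤ x / 2 * (e * x ^ n) + 16 * ((x / 32) * (e * x ^ n)) := by gcongr
            _ = e * x ^ (n + 1) := by rw [pow_succ]; ring
  · have h1 := (ent_diag_le hW h.c_nonneg (by positivity) hB.norm_le (0, j)).1
    have h2 := hB.r_le j
    refine le_trans ?_ ((add_le_add h2 h1).trans hrstep)
    rw [← mul_add]
    have := jap_pos (j : ℝ)
    gcongr
    exact abs_sub _ _
  · have h1 := (ent_diag_le hW h.c_nonneg (by positivity) hB.norm_le (0, j)).2.1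
    have h2 := hB.r_le' j
    refine le_trans ?_ ((add_le_add h2 h1).trans hrstep)
    rw [← mul_add]
    have := jap_pos (j : ℝ)
    gcongr
    exact abs_sub _ _
  · have h1 := (ent_diag_le hW h.c_nonneg (by positivity) hB.norm_le (0, j)).2.2
    have h2 := hB.r_diff j
    refine le_trans ?_ ((add_le_add h2 h1).trans hrstep)
    rw [← mul_add, ← mul_add]
    have := jap_pos (j : ℝ)
    have := h.c_nonneg
    gcongr
    have e1 : (kamStep P n s).1 j - (kamStep P' n s').1 j =
      (s.1 j - s'.1 j) - ((ent s.2 (0, j) (0, j)).im - (ent s'.2 (0, j) (0, j)).im) := by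
      simp only [kamStep]; ring
    rw [e1]
    exact abs_sub _ _

theorem norm_le_one_of_pairN {X X' : MatOp (Idx ν)} {c : ℝ≥0∞} {n : ℕ}
    (h : pairN c (kamW (fun _ => 1) b n) X X' ≤ ENNReal.ofReal ((1 / 4) ^ a / 32)) :
    ‖X‖ ≤ 1 ∧ ‖X'‖ ≤ 1 := by
  have key : ∀ Y : MatOp (Idx ν), schurN (kamW (fun _ => 1) b n) Y ≤
      ENNReal.ofReal ((1 / 4) ^ a / 32) → ‖Y‖ ≤ 1 := by
    intro Y hY
    have h1 := (enorm_le_schurN (one_le_kamW_one b n) Y).trans hY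
    rw [← ofReal_norm, ENNReal.ofReal_le_ofReal_iff (by positivity)] at h1
    have : ((1 / 4 : ℝ)) ^ a ≤ 1 := pow_le_one₀ (by norm_num) (by norm_num)
    linarith
  exact ⟨key X ((left_le_pairN _ _ _ _).trans h), key X' ((right_le_pairN _ _ _ _).trans h)⟩

theorem kamBound_zero (hs : KamSmall L P.g P.τ t a b e) {R R' : MatOp (Idx ν)}
    (hR : pairN (ENNReal.ofReal c) (kamW W b 0) R R' ≤ ENNReal.ofReal e) :
    KamBound c W a b e 0 (kamSeq P R 0) (kamSeq P' R' 0) := by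
  have := hs.e_nonneg
  refine ⟨by simpa [kamSeq] using hR, fun j => ?_, fun j => ?_, fun j => ?_⟩ <;> simp [kamSeq]

/-- The bounds hold along the whole iteration, first for the trivial weight. -/
theorem kamBound_one (h : ParPair L c P P') (hs : KamSmall L P.g P.τ t a b e)
    {R R' : MatOp (Idx ν)}
    (hR : pairN (ENNReal.ofReal c) (kamW (fun _ => 1) b 0) R R' ≤ ENNReal.ofReal e) (n : ℕ) :
    KamBound c (fun _ => 1) a b e n (kamSeq P R n) (kamSeq P' R' n) := by
  induction n with
  | zero => exact kamBound_zero hs hR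
  | succ n ih =>
    obtain ⟨h1, h2⟩ := norm_le_one_of_pairN (ih.gen_le_small h hs)
    exact ih.step (fun _ => one_pos) h hs h1 h2

theorem kamGen_norm_le (h : ParPair L c P P') (hs : KamSmall L P.g P.τ t a b e)
    {R R' : MatOp (Idx ν)}
    (hR : pairN (ENNReal.ofReal c) (kamW (fun _ => 1) b 0) R R' ≤ ENNReal.ofReal e) (n : ℕ) :
    ‖kamGen P n (kamSeq P R n)‖ ≤ 1 ∧ ‖kamGen P' n (kamSeq P' R' n)‖ ≤ 1 :=
  norm_le_one_of_pairN ((kamBound_one h hs hR n).gen_le_small h hs)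

theorem kamBound_all (hW : ∀ i, 0 < W i) (h : ParPair L c P P')
    (hs : KamSmall L P.g P.τ t a b e) {R R' : MatOp (Idx ν)}
    (hX : ∀ n, ‖kamGen P n (kamSeq P R n)‖ ≤ 1) (hX' : ∀ n, ‖kamGen P' n (kamSeq P' R' n)‖ ≤ 1)
    (hRW : pairN (ENNReal.ofReal c) (kamW W b 0) R R' ≤ ENNReal.ofReal e) (n : ℕ) :
    KamBound c W a b e n (kamSeq P R n) (kamSeq P' R' n) := by
  induction n with
  | zero => exact kamBound_zero hs hRW
  | succ n ih => exact ih.step hW h hs (hX n) (hX' n)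

end StepEstimates

/-! ### Convergence of the iteration -/

section Limit

open Filter Topology

variable {ν : ℕ}

/-- The generators of the transformations. -/
def kamX (P : KamPar ν) (R : MatOp (Idx ν)) (n : ℕ) : MatOp (Idx ν) := kamGen P n (kamSeq P R n)

/-- The composition of the first `n` transformations. -/
def kamPhi (P : KamPar ν) (R : MatOp (Idx ν)) : ℕ → MatOp (Idx ν)
  | 0 => 1
  | n + 1 => cayley (kamX P R n) * kamPhi P R n

/-- The inverse of the composition of the first `n` transformations. -/
def kamPsi (P : KamPar ν) (R : MatOp (Idx ν)) : ℕ → MatOp (Idx ν)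
  | 0 => 1
  | n + 1 => kamPsi P R n * cayley (-kamX P R n)

/-- The limit of the transformations. -/
def phiLim (P : KamPar ν) (R : MatOp (Idx ν)) : MatOp (Idx ν) :=
  1 + ∑' n, (kamPhi P R (n + 1) - kamPhi P R n)

/-- The limit of the inverse transformations. -/
def psiLim (P : KamPar ν) (R : MatOp (Idx ν)) : MatOp (Idx ν) :=
  1 + ∑' n, (kamPsi P R (n + 1) - kamPsi P R n)

/-- The final corrections of the eigenvalues. -/
def rLim (P : KamPar ν) (R : MatOp (Idx ν)) (j : ℤ) : ℝ :=
  limUnder atTop fun n => (kamSeq P R n).1 j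

theorem pairN_increments {ι : Type*} {w : ι → ι → ℝ≥0∞} {c : ℝ≥0∞} {F F' : ℕ → MatOp ι}
    {p : ℝ} (hp : 0 ≤ p) (hp1 : p ≤ 1 / 32) (h0 : F 0 = 1) (h0' : F' 0 = 1)
    (hD : ∀ n, pairN c w (F (n + 1) - F n) (F' (n + 1) - F' n) ≤
      ENNReal.ofReal (2 * p * (1 / 4) ^ n) * (1 + pairN c w (F n - 1) (F' n - 1))) (n : ℕ) :
    pairN c w (F (n + 1) - F n) (F' (n + 1) - F' n) ≤ ENNReal.ofReal (4 * p * (1 / 4) ^ n) := by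
  have hb : ∀ n, pairN c w (F n - 1) (F' n - 1) ≤ ENNReal.ofReal (6 * p * (1 - (1 / 4) ^ n)) →
      pairN c w (F (n + 1) - F n) (F' (n + 1) - F' n) ≤ ENNReal.ofReal (4 * p * (1 / 4) ^ n) := by
    intro n hn
    have hq : (0 : ℝ) < (1 / 4) ^ n := by positivity
    have hq1 : (1 / 4 : ℝ) ^ n ≤ 1 := pow_le_one₀ (by norm_num) (by norm_num)
    refine (hD n).trans ?_
    calc _ ≤ ENNReal.ofReal (2 * p * (1 / 4) ^ n) * ENNReal.ofReal 2 := by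
          gcongr
          rw [show (2 : ℝ) = 1 + 1 by norm_num, ENNReal.ofReal_add one_pos.le one_pos.le,
            ENNReal.ofReal_one]
          gcongr
          refine hn.trans ?_
          rw [← ENNReal.ofReal_one]
          exact ENNReal.ofReal_le_ofReal (by nlinarith)
      _ = _ := by
          rw [← ENNReal.ofReal_mul (by positivity)]
          congr 1; ring
  refine hb n ?_
  induction n with
  | zero => simp [h0, h0', pairN_zero]
  | succ n ih =>
    have h1 : F (n + 1) - 1 = (F n - 1) + (F (n + 1) - F n) := by abel
    have h1' : F' (n + 1) - 1 = (F' n - 1) + (F' (n + 1) - F' n) := by abel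
    have hq : (0 : ℝ) < (1 / 4) ^ n := by positivity
    have hq1 : (1 / 4 : ℝ) ^ n ≤ 1 := pow_le_one₀ (by norm_num) (by norm_num)
    rw [h1, h1']
    refine (pairN_add _ _ _ _).trans ((add_le_add ih (hb n ih)).trans ?_)
    rw [← ENNReal.ofReal_add (by nlinarith) (by positivity)]
    refine ENNReal.ofReal_le_ofReal ?_
    rw [pow_succ]
    nlinarith [mul_nonneg hp hq.le]

variable {L c : ℝ} {P P' : KamPar ν} {t a b b' : ℕ} {e : ℝ} {W : Idx ν → ℝ}
  {R R' : MatOp (Idx ν)}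

/-- The size of the transformations. -/
def genSize (L g : ℝ) (t : ℕ) (e : ℝ) : ℝ := (10 + 4 * L) * 4 ^ t * g⁻¹ * e

theorem genSize_nonneg (h : ParPair L c P P') (hs : KamSmall L P.g P.τ t a b e) :
    0 ≤ genSize L P.g t e := by
  have g0 := h.g_pos
  have L0 := h.L_nonneg
  have e0 := hs.e_nonneg
  unfold genSize
  positivity

theorem genSize_le (h : ParPair L c P P') (hs : KamSmall L P.g P.τ t a b e) :
    genSize L P.g t e ≤ 1 / 32 := by
  have h1 := hs.gen_const h
  have : ((1 / 4 : ℝ)) ^ a ≤ 1 := pow_le_one₀ (by norm_num) (by norm_num)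
  unfold genSize
  linarith

theorem pairN_kamX_le (hW : ∀ i, 0 < W i) (h : ParPair L c P P')
    (hs : KamSmall L P.g P.τ t a b e) (hb : t + b' + 1 ≤ a)
    {n : ℕ} (hB : KamBound c W a b e n (kamSeq P R n) (kamSeq P' R' n)) :
    pairN (ENNReal.ofReal c) (kamW W b' 0) (kamX P R n) (kamX P' R' n) ≤
      ENNReal.ofReal (genSize L P.g t e * (1 / 4) ^ n) := by
  have hbb : b' ≤ b := by have := hs.b_ge; omega
  refine (pairN_mono_weight (kamW_zero_le hW hbb n) _ _).trans ?_
  refine (mul_le_mul_right (hB.gen_le h hs) _).trans ?_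
  rw [← ENNReal.ofReal_mul (by positivity)]
  refine ENNReal.ofReal_le_ofReal ?_
  have h1 := genSize_nonneg h hs
  have h2 : ((4 : ℝ) ^ n) ^ b' * ((4 ^ t) ^ n * ((1 / 4) ^ a) ^ n) ≤ (1 / 4) ^ n := by
    rw [← pow_mul, ← pow_mul, ← pow_mul, one_div, inv_pow, inv_pow, ← mul_assoc, ← pow_add,
      ← div_eq_mul_inv, div_le_iff₀ (by positivity), ← div_eq_inv_mul, le_div_iff₀ (by positivity),
      ← pow_add]
    refine pow_le_pow_right₀ (by norm_num) ?_
    nlinarith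
  calc _ = genSize L P.g t e * (((4 : ℝ) ^ n) ^ b' * ((4 ^ t) ^ n * ((1 / 4) ^ a) ^ n)) := by
        unfold genSize; ring
    _ ≤ _ := by gcongr

theorem phi_increments (hW : ∀ i, 0 < W i) (h : ParPair L c P P')
    (hs : KamSmall L P.g P.τ t a b e) (hb : t + b' + 1 ≤ a)
    (hX : ∀ n, ‖kamX P R n‖ ≤ 1) (hX' : ∀ n, ‖kamX P' R' n‖ ≤ 1)
    (hB : ∀ n, KamBound c W a b e n (kamSeq P R n) (kamSeq P' R' n)) (n : ℕ) :
    pairN (ENNReal.ofReal c) (kamW W b' 0) (kamPhi P R (n + 1) - kamPhi P R n)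
      (kamPhi P' R' (n + 1) - kamPhi P' R' n) ≤
      ENNReal.ofReal (4 * genSize L P.g t e * (1 / 4) ^ n) := by
  have hp := genSize_nonneg h hs
  have hp1 := genSize_le h hs
  have hw := subMul_kamW hW b' 0
  refine pairN_increments hp hp1 rfl rfl (fun n => ?_) n
  have e1 : ∀ (P : KamPar ν) R, ‖kamX P R n‖ ≤ 1 → kamPhi P R (n + 1) - kamPhi P R n =
      halfInv (kamX P R n) * (kamX P R n + kamX P R n * (kamPhi P R n - 1)) := by
    intro P R hX
    rw [kamPhi, cayley_sub_one hX]
    noncomm_ring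
  rw [e1 P R (hX n), e1 P' R' (hX' n)]
  have hx := pairN_kamX_le hW h hs hb (hB n)
  have hq1 : (1 / 4 : ℝ) ^ n ≤ 1 := pow_le_one₀ (by norm_num) (by norm_num)
  have hq0 : (0 : ℝ) < (1 / 4 : ℝ) ^ n := by positivity
  have hx1 : pairN (ENNReal.ofReal c) (kamW W b' 0) (kamX P R n) (kamX P' R' n) ≤ 1 := by
    refine hx.trans ?_
    rw [← ENNReal.ofReal_one]
    exact ENNReal.ofReal_le_ofReal (by nlinarith)
  refine (pairN_halfInv_mul hw (hX n) (hX' n) hx1 _ _).trans ?_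
  rw [show (2 : ℝ) * genSize L P.g t e * (1 / 4) ^ n = 2 * (genSize L P.g t e * (1 / 4) ^ n) by
    ring, ENNReal.ofReal_mul two_pos.le, ENNReal.ofReal_ofNat, mul_assoc, mul_add, mul_one]
  gcongr
  exact (pairN_add _ _ _ _).trans (add_le_add hx
    ((pairN_mul hw _ _ _ _).trans (mul_le_mul' hx le_rfl)))

theorem psi_increments (hW : ∀ i, 0 < W i) (h : ParPair L c P P')
    (hs : KamSmall L P.g P.τ t a b e) (hb : t + b' + 1 ≤ a)
    (hX : ∀ n, ‖kamX P R n‖ ≤ 1) (hX' : ∀ n, ‖kamX P' R' n‖ ≤ 1)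
    (hB : ∀ n, KamBound c W a b e n (kamSeq P R n) (kamSeq P' R' n)) (n : ℕ) :
    pairN (ENNReal.ofReal c) (kamW W b' 0) (kamPsi P R (n + 1) - kamPsi P R n)
      (kamPsi P' R' (n + 1) - kamPsi P' R' n) ≤
      ENNReal.ofReal (4 * genSize L P.g t e * (1 / 4) ^ n) := by
  have hp := genSize_nonneg h hs
  have hp1 := genSize_le h hs
  have hw := subMul_kamW hW b' 0
  refine pairN_increments hp hp1 rfl rfl (fun n => ?_) n
  have e1 : ∀ (P : KamPar ν) R, ‖kamX P R n‖ ≤ 1 → kamPsi P R (n + 1) - kamPsi P R n =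
      halfInv (-kamX P R n) * -kamX P R n +
        (kamPsi P R n - 1) * (halfInv (-kamX P R n) * -kamX P R n) := by
    intro P R hX
    rw [kamPsi, cayley_sub_one (by rwa [norm_neg])]
    noncomm_ring
  rw [e1 P R (hX n), e1 P' R' (hX' n)]
  have hx := pairN_kamX_le hW h hs hb (hB n)
  rw [← pairN_neg] at hx
  have hq1 : (1 / 4 : ℝ) ^ n ≤ 1 := pow_le_one₀ (by norm_num) (by norm_num)
  have hq0 : (0 : ℝ) < (1 / 4 : ℝ) ^ n := by positivity
  have hx1 : pairN (ENNReal.ofReal c) (kamW W b' 0) (-kamX P R n) (-kamX P' R' n) ≤ 1 := by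
    refine hx.trans ?_
    rw [← ENNReal.ofReal_one]
    exact ENNReal.ofReal_le_ofReal (by nlinarith)
  have hv := pairN_halfInv_mul hw (by rw [norm_neg]; exact hX n) (by rw [norm_neg]; exact hX' n)
    hx1 (-kamX P R n) (-kamX P' R' n)
  have hv2 : pairN (ENNReal.ofReal c) (kamW W b' 0) (halfInv (-kamX P R n) * -kamX P R n)
      (halfInv (-kamX P' R' n) * -kamX P' R' n) ≤
      ENNReal.ofReal (2 * genSize L P.g t e * (1 / 4) ^ n) := by
    rw [show (2 : ℝ) * genSize L P.g t e * (1 / 4) ^ n = 2 * (genSize L P.g t e * (1 / 4) ^ n) by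
      ring, ENNReal.ofReal_mul two_pos.le, ENNReal.ofReal_ofNat]
    exact hv.trans (by gcongr)
  rw [mul_add, mul_one]
  refine (pairN_add _ _ _ _).trans (add_le_add hv2
    ((pairN_mul hw _ _ _ _).trans ?_))
  rw [mul_comm]
  exact mul_le_mul' hv2 le_rfl

theorem tsum_ofReal_quarter {p : ℝ} (hp : 0 ≤ p) :
    ∑' n : ℕ, ENNReal.ofReal (4 * p * (1 / 4) ^ n) ≤ ENNReal.ofReal (6 * p) := by
  have hs : Summable fun n : ℕ => 4 * p * (1 / 4 : ℝ) ^ n :=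
    (summable_geometric_of_lt_one (by norm_num) (by norm_num)).mul_left _
  rw [← ENNReal.ofReal_tsum_of_nonneg (fun n => by positivity) hs, tsum_mul_left,
    tsum_geometric_of_lt_one (by norm_num) (by norm_num)]
  refine ENNReal.ofReal_le_ofReal ?_
  norm_num
  linarith

theorem summable_of_enorm_le {F : ℕ → MatOp (Idx ν)} {p : ℝ} (hp : 0 ≤ p)
    (h : ∀ n, ‖F n‖ₑ ≤ ENNReal.ofReal (4 * p * (1 / 4) ^ n)) : Summable F := by
  have hs : Summable fun n : ℕ => 4 * p * (1 / 4 : ℝ) ^ n :=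
    (summable_geometric_of_lt_one (by norm_num) (by norm_num)).mul_left _
  refine Summable.of_norm_bounded hs fun n => ?_
  have := h n
  rwa [← ofReal_norm, ENNReal.ofReal_le_ofReal_iff (by positivity)] at this

/-- The hypotheses of the iteration for one operator. -/
structure KamData (L : ℝ) (P : KamPar ν) (t a b b' : ℕ) (e : ℝ) (R : MatOp (Idx ν)) : Prop where
  par : ParPair L 0 P P
  small : KamSmall L P.g P.τ t a b e
  exps : t + b' + 1 ≤ a
  size : schurN (kamW (fun _ => 1) b 0) R ≤ ENNReal.ofReal e
  ham : IsHamOp R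

namespace KamData

theorem base (h : KamData L P t a b b' e R) :
    pairN (ENNReal.ofReal 0) (kamW (fun _ => 1) b 0) R R ≤ ENNReal.ofReal e := by
  rw [pairN_self]; exact h.size

theorem bound (h : KamData L P t a b b' e R) (n : ℕ) :
    KamBound 0 (fun _ => 1) a b e n (kamSeq P R n) (kamSeq P R n) :=
  kamBound_one h.par h.small h.base n

theorem norm_X (h : KamData L P t a b b' e R) (n : ℕ) : ‖kamX P R n‖ ≤ 1 :=
  (kamGen_norm_le h.par h.small h.base n).1

theorem summable_phi (h : KamData L P t a b b' e R) :
    Summable fun n => kamPhi P R (n + 1) - kamPhi P R n := by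
  refine summable_of_enorm_le (genSize_nonneg h.par h.small) fun n => ?_
  exact (enorm_le_schurN (one_le_kamW_one b' 0) _).trans ((left_le_pairN _ _ _ _).trans
    (phi_increments (fun _ => one_pos) h.par h.small h.exps h.norm_X h.norm_X h.bound n))

theorem summable_psi (h : KamData L P t a b b' e R) :
    Summable fun n => kamPsi P R (n + 1) - kamPsi P R n := by
  refine summable_of_enorm_le (genSize_nonneg h.par h.small) fun n => ?_
  exact (enorm_le_schurN (one_le_kamW_one b' 0) _).trans ((left_le_pairN _ _ _ _).trans
    (psi_increments (fun _ => one_pos) h.par h.small h.exps h.norm_X h.norm_X h.bound n))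

theorem tendsto_phi (h : KamData L P t a b b' e R) :
    Tendsto (kamPhi P R) atTop (𝓝 (phiLim P R)) := by
  have h1 := h.summable_phi.hasSum.tendsto_sum_nat
  simp only [Finset.sum_range_sub] at h1
  have h2 := h1.const_add 1
  simpa [phiLim, kamPhi] using h2

theorem tendsto_psi (h : KamData L P t a b b' e R) :
    Tendsto (kamPsi P R) atTop (𝓝 (psiLim P R)) := by
  have h1 := h.summable_psi.hasSum.tendsto_sum_nat
  simp only [Finset.sum_range_sub] at h1
  have h2 := h1.const_add 1
  simpa [psiLim, kamPsi] using h2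

theorem phi_mul_psi (h : KamData L P t a b b' e R) (n : ℕ) : kamPhi P R n * kamPsi P R n = 1 := by
  induction n with
  | zero => simp [kamPhi, kamPsi]
  | succ n ih =>
    rw [kamPhi, kamPsi]
    calc _ = cayley (kamX P R n) * (kamPhi P R n * kamPsi P R n) * cayley (-kamX P R n) := by
          noncomm_ring
      _ = 1 := by rw [ih, mul_one, cayley_mul_cayley_neg (h.norm_X n)]

theorem psi_mul_phi (h : KamData L P t a b b' e R) (n : ℕ) : kamPsi P R n * kamPhi P R n = 1 := by
  induction n with
  | zero => simp [kamPhi, kamPsi]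
  | succ n ih =>
    have h1 := cayley_mul_cayley_neg (X := -kamX P R n) (by rw [norm_neg]; exact h.norm_X n)
    rw [neg_neg] at h1
    rw [kamPhi, kamPsi]
    calc _ = kamPsi P R n * (cayley (-kamX P R n) * cayley (kamX P R n)) * kamPhi P R n := by
          noncomm_ring
      _ = 1 := by rw [h1, mul_one, ih]

theorem phiLim_mul_psiLim (h : KamData L P t a b b' e R) : phiLim P R * psiLim P R = 1 := by
  have h1 := h.tendsto_phi.mul h.tendsto_psi
  simp only [h.phi_mul_psi] at h1
  exact tendsto_nhds_unique h1 tendsto_const_nhds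

theorem psiLim_mul_phiLim (h : KamData L P t a b b' e R) : psiLim P R * phiLim P R = 1 := by
  have h1 := h.tendsto_psi.mul h.tendsto_phi
  simp only [h.psi_mul_phi] at h1
  exact tendsto_nhds_unique h1 tendsto_const_nhds

theorem ham_seq (h : KamData L P t a b b' e R) (n : ℕ) :
    (∀ j, (kamSeq P R n).1 (-j) = -(kamSeq P R n).1 j) ∧ IsHamOp (kamSeq P R n).2 := by
  induction n with
  | zero => exact ⟨fun j => by simp [kamSeq], h.ham⟩
  | succ n ih => exact kamStep_ham h.par.g_pos h.par.τ_nonneg ih.1 ih.2 (h.norm_X n)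

theorem ham_X (h : KamData L P t a b b' e R) (n : ℕ) : IsHamOp (kamX P R n) :=
  isHamOp_kamGen h.par.g_pos h.par.τ_nonneg (h.ham_seq n).1 (h.ham_seq n).2 n

theorem struct_phi (h : KamData L P t a b b' e R) (n : ℕ) : IsStruct (kamPhi P R n) := by
  induction n with
  | zero => exact isStruct_one
  | succ n ih => exact (h.ham_X n).struct.cayley.mul ih

theorem struct_psi (h : KamData L P t a b b' e R) (n : ℕ) : IsStruct (kamPsi P R n) := by
  induction n with
  | zero => exact isStruct_one
  | succ n ih => exact ih.mul (h.ham_X n).struct.neg.cayley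

theorem dual_phi (h : KamData L P t a b b' e R) (n : ℕ) :
    IsDual (kamPhi P R n) (kamPsi P R n) := by
  induction n with
  | zero => exact isDual_one
  | succ n ih => exact ((h.ham_X n).dual_cayley (h.norm_X n)).mul ih

theorem struct_phiLim (h : KamData L P t a b b' e R) : IsStruct (phiLim P R) :=
  isStruct_one.add (IsStruct.tsum fun n => (h.struct_phi (n + 1)).sub (h.struct_phi n))

theorem struct_psiLim (h : KamData L P t a b b' e R) : IsStruct (psiLim P R) :=
  isStruct_one.add (IsStruct.tsum fun n => (h.struct_psi (n + 1)).sub (h.struct_psi n))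

theorem dual_lim (h : KamData L P t a b b' e R) : IsDual (phiLim P R) (psiLim P R) :=
  isDual_one.add (IsDual.tsum (fun n => (h.dual_phi (n + 1)).sub (h.dual_phi n)) h.summable_phi
    h.summable_psi)

theorem r_step (h : KamData L P t a b b' e R) (n : ℕ) (j : ℤ) :
    dist ((kamSeq P R n).1 j) ((kamSeq P R (n + 1)).1 j) ≤ e * ((1 / 4) ^ a) ^ n := by
  have e0 := h.small.e_nonneg
  have h1 := (ent_diag_le (fun _ => one_pos) le_rfl (by positivity) (h.bound n).norm_le (0, j)).1
  rw [Real.dist_eq]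
  have h2 : (kamSeq P R n).1 j - (kamSeq P R (n + 1)).1 j =
      (ent (kamSeq P R n).2 (0, j) (0, j)).im := by
    simp [kamSeq, kamStep]
  rw [h2]
  exact (le_mul_of_one_le_left (abs_nonneg _) (one_le_jap _)).trans h1

theorem tendsto_r (h : KamData L P t a b b' e R) (j : ℤ) :
    Tendsto (fun n => (kamSeq P R n).1 j) atTop (𝓝 (rLim P R j)) := by
  have hx : ((1 / 4 : ℝ)) ^ a < 1 := h.small.rate.trans_lt (by norm_num)
  exact (cauchySeq_of_le_geometric _ _ hx fun n => h.r_step n j).tendsto_limUnder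

theorem r_dist (h : KamData L P t a b b' e R) (n : ℕ) (j : ℤ) :
    |(kamSeq P R n).1 j - rLim P R j| ≤ 2 * e * ((1 / 4) ^ a) ^ n := by
  have hx4 := h.small.rate
  have e0 := h.small.e_nonneg
  have h1 := dist_le_of_le_geometric_of_tendsto _ _ (hx4.trans_lt (by norm_num))
    (fun n => h.r_step n j) (h.tendsto_r j) n
  rw [Real.dist_eq] at h1
  refine h1.trans ?_
  rw [div_le_iff₀ (by linarith)]
  have : 0 ≤ e * ((1 / 4) ^ a) ^ n := by positivity
  nlinarith

theorem rLim_neg (h : KamData L P t a b b' e R) (j : ℤ) : rLim P R (-j) = -rLim P R j := by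
  have h1 := h.tendsto_r (-j)
  simp only [fun n => (h.ham_seq n).1 j] at h1
  exact tendsto_nhds_unique h1 (h.tendsto_r j).neg

theorem tendsto_rem (h : KamData L P t a b b' e R) :
    Tendsto (fun n => (kamSeq P R n).2) atTop (𝓝 0) := by
  have hx : ((1 / 4 : ℝ)) ^ a < 1 := h.small.rate.trans_lt (by norm_num)
  have e0 := h.small.e_nonneg
  refine squeeze_zero_norm (a := fun n => e * ((1 / 4 : ℝ) ^ a) ^ n) (fun n => ?_) ?_
  · have h1 := (enorm_le_schurN (one_le_kamW_one b n) _).trans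
      ((left_le_pairN _ _ _ _).trans (h.bound n).norm_le)
    rwa [← ofReal_norm, ENNReal.ofReal_le_ofReal_iff (by positivity)] at h1
  · have := (tendsto_pow_atTop_nhds_zero_of_lt_one (by positivity) hx).const_mul e
    simpa using this

theorem divisor_ge (h : KamData L P t a b b' e R) {i k : Idx ν}
    (hd : 2 * P.g * japL (i.1 - k.1) ^ (-P.τ) ≤ |divisor P (rLim P R) i k|) {n : ℕ}
    (hn : absL (i.1 - k.1) ≤ 4 ^ (n + 1)) :
    P.g * japL (i.1 - k.1) ^ (-P.τ) ≤ |divisor P (kamSeq P R n).1 i k| := by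
  set l := i.1 - k.1
  have g0 := h.par.g_pos
  have e0 := h.small.e_nonneg
  have τ0 := h.par.τ_nonneg
  have h1 := h.r_dist n i.2
  have h2 := h.r_dist n k.2
  have hjap : japL l ≤ 4 ^ (n + 1) := max_le (one_le_pow₀ (by norm_num)) hn
  have h3 : (4 ^ (n + 1) : ℝ) ^ (-P.τ) ≤ japL l ^ (-P.τ) :=
    Real.rpow_le_rpow_of_nonpos (japL_pos l) hjap (by linarith)
  have h4 : 4 * e * ((1 / 4) ^ a) ^ n ≤ P.g * (4 ^ (n + 1) : ℝ) ^ (-P.τ) := by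
    have hN0 : (0 : ℝ) < 4 ^ (n + 1) := by positivity
    rw [Real.rpow_neg hN0.le, ← div_eq_mul_inv, le_div_iff₀ (by positivity)]
    have hN : (4 ^ (n + 1) : ℝ) ^ P.τ ≤ 4 ^ t * (4 ^ n) ^ t := by
      refine le_trans ?_ (h.small.scale n)
      exact Real.rpow_le_rpow_of_exponent_le (one_le_pow₀ (by norm_num)) (by linarith)
    have h5 := pow_scale_le h.small n
    have h6 := h.par.L_nonneg
    have h7 : (1 : ℝ) ≤ 4 ^ a := one_le_pow₀ (by norm_num)
    calc 4 * e * ((1 / 4) ^ a) ^ n * (4 ^ (n + 1) : ℝ) ^ P.τ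
        ≤ 4 * e * ((1 / 4) ^ a) ^ n * (4 ^ t * (4 ^ n) ^ t) := by gcongr
      _ = 4 * 4 ^ t * 1 * e * ((4 ^ t) ^ n * ((1 / 4) ^ a) ^ n) := by
          rw [← pow_mul 4 n t, mul_comm n t, pow_mul]; ring
      _ ≤ (32 * (10 + 4 * L)) * 4 ^ t * 4 ^ a * e * 1 := by
          gcongr
          linarith
      _ = 32 * ((10 + 4 * L) * 4 ^ t) * 4 ^ a * e := by ring
      _ ≤ P.g := h.small.small
  have h5 : |divisor P (rLim P R) i k - divisor P (kamSeq P R n).1 i k| ≤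
      4 * e * ((1 / 4) ^ a) ^ n := by
    have e1 : divisor P (rLim P R) i k - divisor P (kamSeq P R n).1 i k =
        ((kamSeq P R n).1 i.2 - rLim P R i.2) - ((kamSeq P R n).1 k.2 - rLim P R k.2) := by
      simp only [divisor, eig]; ring
    rw [e1]
    exact (abs_sub _ _).trans (by linarith)
  have h6 := abs_sub_abs_le_abs_sub (divisor P (rLim P R) i k) (divisor P (kamSeq P R n).1 i k)
  have h7 : P.g * (4 ^ (n + 1) : ℝ) ^ (-P.τ) ≤ P.g * japL l ^ (-P.τ) := by gcongr
  linarith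

/-- The second order Melnikov conditions for the final eigenvalues. -/
def NonRes (P : KamPar ν) (R : MatOp (Idx ν)) : Prop :=
  ∀ i k : Idx ν, i.2 ≠ 0 → k.2 ≠ 0 → i ≠ k →
    2 * P.g * japL (i.1 - k.1) ^ (-P.τ) ≤ |divisor P (rLim P R) i k|

theorem intertwines_phi (h : KamData L P t a b b' e R) (hres : NonRes P R) (n : ℕ) :
    Intertwines (diagPart P (kamSeq P R n).1) (diagPart P 0) (kamPhi P R n)
      (kamPhi P R n * R - (kamSeq P R n).2 * kamPhi P R n) := by
  induction n with
  | zero =>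
    have : kamPhi P R 0 * R - (kamSeq P R 0).2 * kamPhi P R 0 = 0 := by simp [kamPhi, kamSeq]
    rw [this]
    exact intertwines_one _
  | succ n ih =>
    have h1 := kamStep_intertwines h.par.g_pos h.par.τ_nonneg (h.ham_seq n).2 (h.norm_X n)
      fun i k hi hk hik hn => h.divisor_ge (hres i k hi hk hik) hn
    have h2 := h1.mul ih
    have e1 : kamPhi P R (n + 1) * R - (kamSeq P R (n + 1)).2 * kamPhi P R (n + 1) =
        (cayley (kamX P R n) * (kamSeq P R n).2 -
          (kamSeq P R (n + 1)).2 * cayley (kamX P R n)) * kamPhi P R n +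
        cayley (kamX P R n) * (kamPhi P R n * R - (kamSeq P R n).2 * kamPhi P R n) := by
      change cayley (kamX P R n) * kamPhi P R n * R -
        (kamSeq P R (n + 1)).2 * (cayley (kamX P R n) * kamPhi P R n) = _
      noncomm_ring
    rw [e1]
    exact h2

theorem intertwines_phiLim (h : KamData L P t a b b' e R) (hres : NonRes P R) :
    Intertwines (diagPart P (rLim P R)) (diagPart P 0) (phiLim P R) (phiLim P R * R) := by
  intro i k
  have hent : ∀ {F : ℕ → MatOp (Idx ν)} {A : MatOp (Idx ν)}, Tendsto F atTop (𝓝 A) →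
      Tendsto (fun n => ent (F n) i k) atTop (𝓝 (ent A i k)) := fun hF =>
    ((entCLM i k).continuous.tendsto _).comp hF
  have h1 := hent h.tendsto_phi
  have h2 : Tendsto (fun n => kamPhi P R n * R - (kamSeq P R n).2 * kamPhi P R n) atTop
      (𝓝 (phiLim P R * R)) := by
    have := (h.tendsto_phi.mul_const R).sub (h.tendsto_rem.mul h.tendsto_phi)
    simpa using this
  have h3 : Tendsto (fun n => diagPart P (kamSeq P R n).1 i) atTop
      (𝓝 (diagPart P (rLim P R) i)) := by
    unfold diagPart
    refine Tendsto.const_mul _ ?_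
    refine (Complex.continuous_ofReal.tendsto _).comp ?_
    unfold eig
    exact tendsto_const_nhds.sub (tendsto_const_nhds.add (h.tendsto_r i.2))
  have h4 := (h3.mul h1).sub (h1.mul_const (diagPart P 0 k))
  refine tendsto_nhds_unique h4 ?_
  have h5 := hent h2
  refine h5.congr fun n => ?_
  exact (h.intertwines_phi hres n i k).symm

end KamData

/-- The bounds of the iteration for two operators, in a general weight. -/
theorem kam_pair_bounds (hW : ∀ i, 0 < W i) (hpar : ParPair L c P P')
    (h : KamData L P t a b b' e R) (h' : KamData L P' t a b b' e R')
    (hRW : pairN (ENNReal.ofReal c) (kamW W b 0) R R' ≤ ENNReal.ofReal e) :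
    pairN (ENNReal.ofReal c) (kamW W b' 0) (phiLim P R - 1) (phiLim P' R' - 1) ≤
      ENNReal.ofReal (6 * genSize L P.g t e) ∧
    pairN (ENNReal.ofReal c) (kamW W b' 0) (psiLim P R - 1) (psiLim P' R' - 1) ≤
      ENNReal.ofReal (6 * genSize L P.g t e) ∧
    ∀ j : ℤ, jap j * |rLim P R j| ≤ 2 * e ∧
      c * (jap j * |rLim P R j - rLim P' R' j|) ≤ 2 * e := by
  have hB := kamBound_all hW hpar h.small h.norm_X h'.norm_X hRW
  have hp := genSize_nonneg hpar h.small
  refine ⟨?_, ?_, fun j => ⟨?_, ?_⟩⟩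
  · rw [phiLim, phiLim, add_sub_cancel_left, add_sub_cancel_left]
    refine (pairN_tsum h.summable_phi h'.summable_phi).trans
      (le_trans (ENNReal.tsum_le_tsum fun n => ?_) (tsum_ofReal_quarter hp))
    exact phi_increments hW hpar h.small h.exps h.norm_X h'.norm_X hB n
  · rw [psiLim, psiLim, add_sub_cancel_left, add_sub_cancel_left]
    refine (pairN_tsum h.summable_psi h'.summable_psi).trans
      (le_trans (ENNReal.tsum_le_tsum fun n => ?_) (tsum_ofReal_quarter hp))
    exact psi_increments hW hpar h.small h.exps h.norm_X h'.norm_X hB n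
  · have h1 := ((h.tendsto_r j).abs.const_mul (jap j))
    refine le_of_tendsto h1 (Eventually.of_forall fun n => ((hB n).r_le j).trans ?_)
    have e0 := h.small.e_nonneg
    have : (0 : ℝ) ≤ ((1 / 4) ^ a) ^ n := by positivity
    nlinarith
  · have h1 := ((((h.tendsto_r j).sub (h'.tendsto_r j)).abs.const_mul (jap j)).const_mul c)
    refine le_of_tendsto h1 (Eventually.of_forall fun n => ((hB n).r_diff j).trans ?_)
    have e0 := h.small.e_nonneg
    have : (0 : ℝ) ≤ ((1 / 4) ^ a) ^ n := by positivity
    nlinarith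

end Limit

/-! ### The action of matrices on weighted `ℓ²` spaces -/

section Action

theorem ENNReal_two_mul_le (x y : ℝ≥0∞) : 2 * (x * y) ≤ x ^ 2 + y ^ 2 := by
  rcases eq_or_ne x ⊤ with rfl | hx
  · simp
  rcases eq_or_ne y ⊤ with rfl | hy
  · simp
  lift x to NNReal using hx
  lift y to NNReal using hy
  norm_cast
  rw [← mul_assoc]
  exact two_mul_le_add_sq x y

theorem sq_tsum_mul_le {κ : Type*} (a v : κ → ℝ≥0∞) :
    (∑' k, a k * v k) ^ 2 ≤ (∑' k, a k) * ∑' k, a k * v k ^ 2 := by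
  have h2 : 2 * (∑' k, a k * v k) ^ 2 ≤ 2 * ((∑' k, a k) * ∑' k, a k * v k ^ 2) := by
    calc 2 * (∑' k, a k * v k) ^ 2 = ∑' k, ∑' l, a k * a l * (2 * (v k * v l)) := by
          rw [sq, ← ENNReal.tsum_mul_right, ← ENNReal.tsum_mul_left]
          refine tsum_congr fun k => ?_
          rw [← ENNReal.tsum_mul_left, ← ENNReal.tsum_mul_left]
          refine tsum_congr fun l => ?_
          ring
      _ ≤ ∑' k, ∑' l, a k * a l * (v k ^ 2 + v l ^ 2) := by
          refine ENNReal.tsum_le_tsum fun k => ENNReal.tsum_le_tsum fun l => ?_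
          gcongr
          exact ENNReal_two_mul_le _ _
      _ = (∑' k, ∑' l, a k * v k ^ 2 * a l) + ∑' k, ∑' l, a k * (a l * v l ^ 2) := by
          rw [← ENNReal.tsum_add]
          refine tsum_congr fun k => ?_
          rw [← ENNReal.tsum_add]
          refine tsum_congr fun l => ?_
          ring
      _ = 2 * ((∑' k, a k) * ∑' k, a k * v k ^ 2) := by
          simp only [ENNReal.tsum_mul_left, ENNReal.tsum_mul_right]
          ring
  exact (ENNReal.mul_le_mul_iff_right (by norm_num) (by norm_num)).1 h2

/-- The Schur test. -/
theorem schur_test {ι κ : Type*} {a : ι → κ → ℝ≥0∞} {C : ℝ≥0∞} (h1 : ∀ i, ∑' k, a i k ≤ C)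
    (h2 : ∀ k, ∑' i, a i k ≤ C) (v : κ → ℝ≥0∞) :
    ∑' i, (∑' k, a i k * v k) ^ 2 ≤ C ^ 2 * ∑' k, v k ^ 2 := by
  calc ∑' i, (∑' k, a i k * v k) ^ 2 ≤ ∑' i, C * ∑' k, a i k * v k ^ 2 :=
        ENNReal.tsum_le_tsum fun i => (sq_tsum_mul_le _ _).trans (mul_le_mul' (h1 i) le_rfl)
    _ = C * ∑' k, ∑' i, a i k * v k ^ 2 := by rw [ENNReal.tsum_mul_left, ENNReal.tsum_comm]
    _ ≤ C * ∑' k, C * v k ^ 2 := by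
        gcongr with k
        rw [ENNReal.tsum_mul_right]
        gcongr
        exact h2 k
    _ = _ := by rw [ENNReal.tsum_mul_left]; ring

theorem sqrt_sq_eq (x : ℝ≥0∞) : (x ^ 2) ^ (1 / 2 : ℝ) = x := by
  rw [← ENNReal.rpow_natCast, ← ENNReal.rpow_mul]; norm_num

/-- The norm of `ℓ²` with weight `W`. -/
def wNorm {ι : Type*} (W : ι → ℝ) (v : ι → ℝ≥0∞) : ℝ≥0∞ :=
  (∑' q, (ENNReal.ofReal (W q) * v q) ^ 2) ^ (1 / 2 : ℝ)

section General

variable {ι : Type*} {W W' : ι → ℝ}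

theorem le_wNorm (W : ι → ℝ) (v : ι → ℝ≥0∞) (q : ι) : ENNReal.ofReal (W q) * v q ≤ wNorm W v := by
  rw [← sqrt_sq_eq (ENNReal.ofReal (W q) * v q), wNorm]
  gcongr
  exact ENNReal.le_tsum (f := fun q => (ENNReal.ofReal (W q) * v q) ^ 2) q

theorem wNorm_le_mul {v v' : ι → ℝ≥0∞} {C : ℝ≥0∞}
    (h : ∀ q, ENNReal.ofReal (W q) * v q ≤ C * (ENNReal.ofReal (W' q) * v' q)) :
    wNorm W v ≤ C * wNorm W' v' := by
  rw [wNorm, wNorm, ← sqrt_sq_eq C, ← ENNReal.mul_rpow_of_nonneg _ _ (by norm_num),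
    ← ENNReal.tsum_mul_left]
  gcongr with q
  rw [← mul_pow]
  exact pow_le_pow_left' (h q) 2

theorem wNorm_mono {v v' : ι → ℝ≥0∞} (h : ∀ q, v q ≤ v' q) : wNorm W v ≤ wNorm W v' := by
  have := wNorm_le_mul (W := W) (W' := W) (v := v) (v' := v') (C := 1)
    fun q => by rw [one_mul]; exact mul_le_mul' le_rfl (h q)
  rwa [one_mul] at this

theorem wNorm_le_add {W'' : ι → ℝ} {v v' v'' : ι → ℝ≥0∞}
    (h : ∀ q, ENNReal.ofReal (W q) * v q ≤
      ENNReal.ofReal (W' q) * v' q + ENNReal.ofReal (W'' q) * v'' q) :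
    wNorm W v ≤ 2 * (wNorm W' v' + wNorm W'' v'') := by
  have h1 : ∑' q, (ENNReal.ofReal (W q) * v q) ^ 2 ≤
      2 ^ 2 * (∑' q, (ENNReal.ofReal (W' q) * v' q) ^ 2 +
        ∑' q, (ENNReal.ofReal (W'' q) * v'' q) ^ 2) := by
    rw [← ENNReal.tsum_add, ← ENNReal.tsum_mul_left]
    refine ENNReal.tsum_le_tsum fun q => ?_
    set x := ENNReal.ofReal (W' q) * v' q
    set y := ENNReal.ofReal (W'' q) * v'' q
    calc (ENNReal.ofReal (W q) * v q) ^ 2 ≤ (x + y) ^ 2 := by gcongr; exact h q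
      _ = x ^ 2 + y ^ 2 + 2 * (x * y) := by ring
      _ ≤ x ^ 2 + y ^ 2 + (x ^ 2 + y ^ 2) := by gcongr; exact ENNReal_two_mul_le x y
      _ ≤ x ^ 2 + y ^ 2 + (x ^ 2 + y ^ 2) + 2 * (x ^ 2 + y ^ 2) := le_self_add
      _ = _ := by ring
  calc wNorm W v ≤ (2 ^ 2 * (∑' q, (ENNReal.ofReal (W' q) * v' q) ^ 2 +
        ∑' q, (ENNReal.ofReal (W'' q) * v'' q) ^ 2)) ^ (1 / 2 : ℝ) := by
        rw [wNorm]; gcongr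
    _ ≤ _ := by
        rw [ENNReal.mul_rpow_of_nonneg _ _ (by norm_num), sqrt_sq_eq]
        gcongr
        exact ENNReal.rpow_add_le_add_rpow _ _ (by norm_num) (by norm_num)

/-- The weight `W(i) / W(k)`. -/
def ratW (W : ι → ℝ) (i k : ι) : ℝ≥0∞ := ENNReal.ofReal (W i / W k)

theorem subMul_ratW (hW : ∀ i, 0 < W i) : SubMul (ratW W) := by
  intro i j k
  have h1 := hW i
  have h2 := hW j
  have h3 := hW k
  rw [ratW, ratW, ratW, ← ENNReal.ofReal_mul (by positivity)]
  refine le_of_eq (congrArg _ ?_)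
  field_simp

theorem schurN_ratW_one (hW : ∀ i, 0 < W i) : schurN (ratW W) (1 : MatOp ι) ≤ 1 := by
  classical
  refine schurN_le (fun i => ?_) fun k => ?_
  · rw [tsum_eq_single i]
    · simp [ent_one, ratW, div_self (hW i).ne']
    · intro k hk; simp [ent_one, hk.symm]
  · rw [tsum_eq_single k]
    · simp [ent_one, ratW, div_self (hW k).ne']
    · intro i hi; simp [ent_one, hi]

/-- The action of the absolute values of the entries. -/
def absAct (A : MatOp ι) (v : ι → ℝ≥0∞) (i : ι) : ℝ≥0∞ := ∑' k, ‖ent A i k‖ₑ * v k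

theorem wNorm_absAct (hW : ∀ i, 0 < W i) (A : MatOp ι) (v : ι → ℝ≥0∞) :
    wNorm W (absAct A v) ≤ schurN (ratW W) A * wNorm W v := by
  have h := schur_test (a := fun i k => ratW W i k * ‖ent A i k‖ₑ) (C := schurN (ratW W) A)
    (row_le_schurN _ A) (col_le_schurN _ A) fun k => ENNReal.ofReal (W k) * v k
  rw [wNorm, wNorm, ← sqrt_sq_eq (schurN (ratW W) A),
    ← ENNReal.mul_rpow_of_nonneg _ _ (by norm_num)]
  gcongr
  refine le_trans (le_of_eq (tsum_congr fun i => ?_)) h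
  congr 1
  rw [absAct, ← ENNReal.tsum_mul_left]
  refine tsum_congr fun k => ?_
  have h1 : ENNReal.ofReal (W i) = ratW W i k * ENNReal.ofReal (W k) := by
    rw [ratW, ← ENNReal.ofReal_mul (div_nonneg (hW i).le (hW k).le), div_mul_cancel₀ _ (hW k).ne']
  rw [h1]; ring

theorem absAct_lt_top (hW : ∀ i, 0 < W i) {A : MatOp ι} {v : ι → ℝ≥0∞}
    (hA : schurN (ratW W) A < ⊤) (hv : wNorm W v < ⊤) (i : ι) : absAct A v i < ⊤ := by
  have h1 := (le_wNorm W (absAct A v) i).trans (wNorm_absAct hW A v)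
  have h2 : ENNReal.ofReal (W i) * absAct A v i < ⊤ := h1.trans_lt (ENNReal.mul_lt_top hA hv)
  by_contra h
  rw [not_lt, top_le_iff] at h
  rw [h, ENNReal.mul_top (by simpa using hW i)] at h2
  exact lt_irrefl _ h2

/-- The action of a matrix on sequences. -/
def vecAct (A : MatOp ι) (u : ι → ℂ) (i : ι) : ℂ := ∑' k, ent A i k * u k

theorem summable_vecAct (hW : ∀ i, 0 < W i) {A : MatOp ι} {u : ι → ℂ}
    (hA : schurN (ratW W) A < ⊤) (hu : wNorm W (fun k => ‖u k‖ₑ) < ⊤) (i : ι) :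
    Summable fun k => ent A i k * u k := by
  have h := absAct_lt_top hW hA hu i
  refine Summable.of_norm ?_
  have h2 : ∑' k, ‖ent A i k * u k‖ₑ ≠ ⊤ := by
    simp only [enorm_mul]; exact h.ne
  have := ENNReal.summable_toReal h2
  simpa using this

theorem enorm_vecAct_le (A : MatOp ι) (u : ι → ℂ) (i : ι) :
    ‖vecAct A u i‖ₑ ≤ absAct A (fun k => ‖u k‖ₑ) i := by
  refine enorm_tsum_le_tsum_enorm.trans (le_of_eq ?_)
  simp only [enorm_mul, absAct]

theorem wNorm_vecAct (hW : ∀ i, 0 < W i) (A : MatOp ι) (u : ι → ℂ) :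
    wNorm W (fun i => ‖vecAct A u i‖ₑ) ≤ schurN (ratW W) A * wNorm W fun k => ‖u k‖ₑ :=
  (wNorm_mono (enorm_vecAct_le A u)).trans (wNorm_absAct hW A _)

theorem vecAct_mul (hW : ∀ i, 0 < W i) {A B : MatOp ι} {u : ι → ℂ}
    (hA : schurN (ratW W) A < ⊤) (hB : schurN (ratW W) B < ⊤)
    (hu : wNorm W (fun k => ‖u k‖ₑ) < ⊤) : vecAct (A * B) u = vecAct A (vecAct B u) := by
  funext i
  have hBu : wNorm W (absAct B fun k => ‖u k‖ₑ) < ⊤ :=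
    (wNorm_absAct hW B _).trans_lt (ENNReal.mul_lt_top hB hu)
  have hABu := absAct_lt_top hW hA hBu i
  have hs : Summable (Function.uncurry fun k j => ent A i j * ent B j k * u k) := by
    refine Summable.of_norm ?_
    have h2 : ∑' p : ι × ι, ‖Function.uncurry (fun k j => ent A i j * ent B j k * u k) p‖ₑ ≠ ⊤ := by
      rw [ENNReal.tsum_prod', ENNReal.tsum_comm]
      simp only [Function.uncurry, enorm_mul]
      refine ne_of_lt (lt_of_le_of_lt (le_of_eq ?_) hABu)
      rw [absAct]
      refine tsum_congr fun j => ?_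
      rw [absAct, ← ENNReal.tsum_mul_left]
      exact tsum_congr fun k => by ring
    have := ENNReal.summable_toReal h2
    simpa using this
  have h1 : vecAct (A * B) u i = ∑' k, ∑' j, ent A i j * ent B j k * u k := by
    refine tsum_congr fun k => ?_
    rw [ent_mul, tsum_mul_right]
  have h2 : vecAct A (vecAct B u) i = ∑' j, ∑' k, ent A i j * ent B j k * u k := by
    refine tsum_congr fun j => ?_
    rw [vecAct, ← tsum_mul_left]
    exact tsum_congr fun k => by ring
  rw [h1, h2]
  exact hs.tsum_comm.symm

theorem vecAct_one (u : ι → ℂ) : vecAct (1 : MatOp ι) u = u := by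
  classical
  funext i
  rw [vecAct, tsum_eq_single i]
  · simp [ent_one]
  · intro k hk; simp [ent_one, hk.symm]

theorem vecAct_add (hW : ∀ i, 0 < W i) {A : MatOp ι} {u v : ι → ℂ}
    (hA : schurN (ratW W) A < ⊤) (hu : wNorm W (fun k => ‖u k‖ₑ) < ⊤)
    (hv : wNorm W (fun k => ‖v k‖ₑ) < ⊤) : vecAct A (u + v) = vecAct A u + vecAct A v := by
  funext i
  rw [Pi.add_apply, vecAct, vecAct, vecAct,
    ← (summable_vecAct hW hA hu i).tsum_add (summable_vecAct hW hA hv i)]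
  exact tsum_congr fun k => by rw [Pi.add_apply]; ring

theorem vecAct_sub (hW : ∀ i, 0 < W i) {A : MatOp ι} {u v : ι → ℂ}
    (hA : schurN (ratW W) A < ⊤) (hu : wNorm W (fun k => ‖u k‖ₑ) < ⊤)
    (hv : wNorm W (fun k => ‖v k‖ₑ) < ⊤) : vecAct A (u - v) = vecAct A u - vecAct A v := by
  funext i
  rw [Pi.sub_apply, vecAct, vecAct, vecAct,
    ← (summable_vecAct hW hA hu i).tsum_sub (summable_vecAct hW hA hv i)]
  exact tsum_congr fun k => by rw [Pi.sub_apply]; ring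

theorem sub_vecAct (hW : ∀ i, 0 < W i) {A B : MatOp ι} {u : ι → ℂ}
    (hA : schurN (ratW W) A < ⊤) (hB : schurN (ratW W) B < ⊤)
    (hu : wNorm W (fun k => ‖u k‖ₑ) < ⊤) : vecAct (A - B) u = vecAct A u - vecAct B u := by
  funext i
  rw [Pi.sub_apply, vecAct, vecAct, vecAct,
    ← (summable_vecAct hW hA hu i).tsum_sub (summable_vecAct hW hB hu i)]
  exact tsum_congr fun k => by rw [ent_sub]; ring

/-- Conjugation of `D' + R` to the diagonal form `D`. -/
theorem vecAct_intertwines (hW : ∀ i, 0 < W i) {Φ R : MatOp ι} {D D' : ι → ℂ}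
    (h : Intertwines D D' Φ (Φ * R)) (hΦ : schurN (ratW W) Φ < ⊤) (hR : schurN (ratW W) R < ⊤)
    {v : ι → ℂ} (hv : wNorm W (fun k => ‖v k‖ₑ) < ⊤)
    (hDv : wNorm W (fun k => ‖D' k * v k‖ₑ) < ⊤) (i : ι) :
    vecAct Φ (fun k => D' k * v k + vecAct R v k) i = D i * vecAct Φ v i := by
  have hRv : wNorm W (fun k => ‖vecAct R v k‖ₑ) < ⊤ :=
    (wNorm_vecAct hW R v).trans_lt (ENNReal.mul_lt_top hR hv)
  have hΦR : schurN (ratW W) (Φ * R) < ⊤ :=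
    (schurN_mul (subMul_ratW hW) _ _).trans_lt (ENNReal.mul_lt_top hΦ hR)
  have h1 := congrFun (vecAct_add hW hΦ (u := fun k => D' k * v k) (v := vecAct R v) hDv hRv) i
  have h2 := congrFun (vecAct_mul hW hΦ hR hv) i
  change vecAct Φ ((fun k => D' k * v k) + vecAct R v) i = _
  rw [h1, Pi.add_apply, ← h2, vecAct, vecAct, vecAct, ← tsum_mul_left,
    ← (summable_vecAct hW hΦ hDv i).tsum_add (summable_vecAct hW hΦR hv i)]
  refine tsum_congr fun k => ?_
  rw [← h i k]; ring

end General

end Action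

/-! ### The action on arrays of Fourier coefficients -/

section Coefficients

variable {ν : ℕ}

/-- An array of Fourier coefficients as a function on the index set. -/
def flat (u : Coeffs ν) (q : Idx ν) : ℂ := u q.1 q.2

/-- The weight `⟨ℓ, j⟩ ^ s`. -/
def sobW (s : ℝ) (q : Idx ν) : ℝ := japLJ q.1 q.2 ^ s

theorem one_le_japLJ (l : Fin ν → ℤ) (j : ℤ) : 1 ≤ japLJ l j := le_max_left _ _

theorem japLJ_pos (l : Fin ν → ℤ) (j : ℤ) : 0 < japLJ l j := one_pos.trans_le (one_le_japLJ l j)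

theorem sobW_pos (s : ℝ) (q : Idx ν) : 0 < sobW s q := Real.rpow_pos_of_pos (japLJ_pos _ _) _

theorem sobW_mono {s s' : ℝ} (h : s ≤ s') (q : Idx ν) : sobW s q ≤ sobW s' q :=
  Real.rpow_le_rpow_of_exponent_le (one_le_japLJ _ _) h

theorem sobW_add (s s' : ℝ) (q : Idx ν) : sobW (s + s') q = sobW s q * sobW s' q :=
  Real.rpow_add (japLJ_pos _ _) _ _

theorem sobW_one (q : Idx ν) : sobW 1 q = japLJ q.1 q.2 := Real.rpow_one _

theorem hsNorm_eq (s : ℝ) (u : Coeffs ν) : hsNorm s u = wNorm (sobW s) fun q => ‖flat u q‖ₑ := by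
  unfold hsNorm wNorm
  congr 1
  refine tsum_congr fun q => ?_
  beta_reduce
  rw [← ofReal_norm, ← ENNReal.ofReal_mul (sobW_pos s q).le, ← ENNReal.ofReal_pow
    (mul_nonneg (sobW_pos s q).le (norm_nonneg _)), flat, mul_pow, mul_comm, sobW,
    ← Real.rpow_natCast (_ ^ s), ← Real.rpow_mul (japLJ_pos _ _).le, mul_comm s]
  norm_num

theorem hsNorm_mono {s s' : ℝ} (h : s ≤ s') (u : Coeffs ν) : hsNorm s u ≤ hsNorm s' u := by
  rw [hsNorm_eq, hsNorm_eq]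
  have := wNorm_le_mul (W := sobW (ν := ν) s) (W' := sobW s') (v := fun q => ‖flat u q‖ₑ)
    (v' := fun q => ‖flat u q‖ₑ) (C := 1) fun q => by
      rw [one_mul]; exact mul_le_mul' (ENNReal.ofReal_le_ofReal (sobW_mono h q)) le_rfl
  rwa [one_mul] at this

theorem MemH.mono {s s' : ℝ} (h : s ≤ s') {u : Coeffs ν} (hu : MemH s' u) : MemH s u :=
  ⟨hu.1, hu.2.1, (hsNorm_mono h u).trans_lt hu.2.2⟩

theorem MemH.wNorm_lt_top {s : ℝ} {u : Coeffs ν} (hu : MemH s u) :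
    wNorm (sobW s) (fun q => ‖flat u q‖ₑ) < ⊤ := hsNorm_eq s u ▸ hu.2.2

/-- The time-Töplitz matrix of an operator. -/
def toT (A : MatOp (Idx ν)) : TMat ν := fun j j' l => ent A (l, j) (0, j')

theorem toT_sub_apply {A : MatOp (Idx ν)} (hA : IsStruct A) (j j' : ℤ) (l l' : Fin ν → ℤ) :
    toT A j j' (l - l') = ent A (l, j) (l', j') := by
  have := hA.toep l' (l - l', j) (0, j')
  simpa [toT] using this.symm

theorem flat_act {A : MatOp (Idx ν)} (hA : IsStruct A) {u : Coeffs ν} (hu : ∀ l, u l 0 = 0) :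
    flat (act (toT A) u) = vecAct A (flat u) := by
  funext q
  obtain ⟨l, j⟩ := q
  simp only [flat, act, vecAct]
  split_ifs with hj
  · subst hj
    have : ∀ k : Idx ν, ent A (l, 0) k * u k.1 k.2 = 0 := fun k => by
      by_cases hk : k.2 = 0
      · rw [hk, hu, mul_zero]
      · rw [hA.block (l, 0) k (by simp [hk]), zero_mul]
    simp [this]
  · exact tsum_congr fun k => by rw [toT_sub_apply hA]

theorem isRealMat_toT {A : MatOp (Idx ν)} (hA : IsStruct A) : IsRealMat (toT A) := by
  intro j j' _ _ l
  have := hA.real (l, j) (0, j')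
  simpa [toT] using this

theorem actsOn_toT {A : MatOp (Idx ν)} (hA : IsStruct A) {s : ℝ}
    (hs : schurN (ratW (sobW s)) A < ⊤) {u : Coeffs ν} (hu : MemH s u) : ActsOn (toT A) u := by
  intro l j _
  refine (summable_vecAct (sobW_pos s) hs hu.wNorm_lt_top (l, j)).congr fun k => ?_
  rw [toT_sub_apply hA]; rfl

theorem hsNorm_act_le {A : MatOp (Idx ν)} (hA : IsStruct A) {s : ℝ} {u : Coeffs ν}
    (hu : ∀ l, u l 0 = 0) :
    hsNorm s (act (toT A) u) ≤ schurN (ratW (sobW s)) A * hsNorm s u := by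
  rw [hsNorm_eq, hsNorm_eq, flat_act hA hu]
  exact wNorm_vecAct (sobW_pos s) A _

theorem act_zero_mode (A : TMat ν) (u : Coeffs ν) (l : Fin ν → ℤ) : act A u l 0 = 0 := by
  simp [act]

theorem conj_vecAct {A : MatOp (Idx ν)} (hA : IsStruct A) {u : Idx ν → ℂ}
    (hu : ∀ q, conj (u q) = u (-q)) (q : Idx ν) : conj (vecAct A u q) = vecAct A u (-q) := by
  rw [vecAct, vecAct, Complex.conj_tsum, ← (Equiv.neg (Idx ν)).tsum_eq (fun k => ent A (-q) k * u k)]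
  refine tsum_congr fun k => ?_
  rw [map_mul, hA.real, hu]; rfl

theorem memH_act {A : MatOp (Idx ν)} (hA : IsStruct A) {s : ℝ}
    (hs : schurN (ratW (sobW s)) A < ⊤) {u : Coeffs ν} (hu : MemH s u) :
    MemH s (act (toT A) u) := by
  refine ⟨fun l j => ?_, act_zero_mode _ _, ?_⟩
  · have h := conj_vecAct hA (u := flat u) (fun q => hu.1 _ _) (l, j)
    rw [← flat_act hA hu.2.1] at h
    exact h
  · exact (hsNorm_act_le hA hu.2.1).trans_lt (ENNReal.mul_lt_top hs hu.2.2)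

theorem flat_injective {u v : Coeffs ν} (h : flat u = flat v) : u = v := by
  funext l j; exact congrFun h (l, j)

theorem act_act_of_mul_eq_one {A B : MatOp (Idx ν)} (hA : IsStruct A) (hB : IsStruct B) {s : ℝ}
    (hsA : schurN (ratW (sobW s)) A < ⊤) (hsB : schurN (ratW (sobW s)) B < ⊤) (h : A * B = 1)
    {u : Coeffs ν} (hu : MemH s u) : act (toT A) (act (toT B) u) = u := by
  refine flat_injective ?_
  rw [flat_act hA (act_zero_mode _ _), flat_act hB hu.2.1,
    ← vecAct_mul (sobW_pos s) hsA hsB hu.wNorm_lt_top, h, vecAct_one]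

/-! ### The matrix of the remainder -/

/-- The kernel of a time-Töplitz matrix, restricted to the functions with zero average. -/
def remKernel (R : TMat ν) (i k : Idx ν) : ℂ :=
  if i.2 = 0 ∨ k.2 = 0 then 0 else R i.2 k.2 (i.1 - k.1)

/-- The operator with the kernel `remKernel`. -/
def remOp (R : TMat ν) : MatOp (Idx ν) := ofKernel (remKernel R)

theorem flat_act_remOp {R : TMat ν} (hR : ColBdd (remKernel R)) {u : Coeffs ν}
    (hu : ∀ l, u l 0 = 0) : flat (act R u) = vecAct (remOp R) (flat u) := by
  funext q
  obtain ⟨l, j⟩ := q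
  simp only [flat, act, vecAct, remOp, ent_ofKernel hR, remKernel]
  split_ifs with hj
  · simp [hj]
  · refine tsum_congr fun k => ?_
    by_cases hk : k.2 = 0
    · simp [hk, hu]
    · simp [hk, hj]

theorem isHamOp_remOp {R : TMat ν} (hR : ColBdd (remKernel R)) (h : IsHamMat R) :
    IsHamOp (remOp R) := by
  refine ⟨⟨fun p i k => ?_, fun i k => ?_, fun i k hik => ?_⟩, fun i k hik => ?_, fun i k => ?_⟩
  · simp [remOp, ent_ofKernel hR, remKernel]
  · simp only [remOp, ent_ofKernel hR, remKernel, Prod.snd_neg, neg_eq_zero]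
    split_ifs with h0
    · simp
    · push Not at h0
      rw [h.1 _ _ h0.1 h0.2]
      congr 1
      simp [sub_eq_add_neg, add_comm]
  · have : i.2 = 0 ∨ k.2 = 0 := by tauto
    simp [remOp, ent_ofKernel hR, remKernel, this]
  · simp [remOp, ent_ofKernel hR, remKernel, hik]
  · simp only [ent_neg, remOp, ent_ofKernel hR, remKernel, Prod.snd_neg, neg_eq_zero]
    by_cases h0 : i.2 = 0 ∨ k.2 = 0
    · simp [h0, h0.symm]
    · have h0' : ¬(k.2 = 0 ∨ i.2 = 0) := fun h => h0 h.symm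
      rw [if_neg h0, if_neg h0']
      push Not at h0
      rw [h.2 _ _ h0.1 h0.2, dispOne, dispOne, if_neg h0.1, if_neg h0.2]
      have : (-k).1 - (-i).1 = i.1 - k.1 := by
        rw [Prod.fst_neg, Prod.fst_neg]; abel
      rw [this]; ring

theorem abs_disp_le (j : ℤ) : |disp j| ≤ 4 * |(j : ℝ)| := by
  have h1 : (0 : ℝ) < 1 + (j : ℝ) ^ 2 := by positivity
  have h2 : (0 : ℝ) < 4 + (j : ℝ) ^ 2 := by positivity
  rw [disp, abs_div, abs_mul, abs_of_pos h1, abs_of_pos h2, div_le_iff₀ h1]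
  nlinarith [abs_nonneg (j : ℝ), mul_nonneg (abs_nonneg (j : ℝ)) (sq_nonneg (j : ℝ))]

theorem absL_le_japLJ (l : Fin ν → ℤ) (j : ℤ) : absL l ≤ japLJ l j :=
  (le_max_left _ _).trans (le_max_right _ _)

theorem abs_le_japLJ (l : Fin ν → ℤ) (j : ℤ) : |(j : ℝ)| ≤ japLJ l j :=
  (le_max_right _ _).trans (le_max_right _ _)

theorem norm_diagPart_zero_le {L : ℝ} {P : KamPar ν} (hw : ∀ i, |P.w i| ≤ 2 * L) (q : Idx ν) :
    ‖diagPart P 0 q‖ ≤ (2 * |L| + 4 * |P.m|) * japLJ q.1 q.2 := by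
  rw [diagPart, norm_mul, Complex.norm_I, one_mul, Complex.norm_real, Real.norm_eq_abs]
  have h1 := abs_dotL_le hw q.1
  have h2 := absL_le_japLJ q.1 q.2
  have h3 := abs_le_japLJ q.1 q.2
  have h4 := abs_disp_le q.2
  have h5 := absL_nonneg q.1
  have h6 : |eig P.m ((0 : ℤ → ℝ) q.2) q.2| ≤ |P.m| * (4 * japLJ q.1 q.2) := by
    rw [eig, Pi.zero_apply, add_zero, abs_mul]
    gcongr
    linarith
  have h7 : |dotL P.w q.1| ≤ 2 * |L| * japLJ q.1 q.2 := by
    refine h1.trans ?_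
    have := le_abs_self L
    gcongr
  calc _ ≤ |dotL P.w q.1| + |eig P.m ((0 : ℤ → ℝ) q.2) q.2| := abs_sub _ _
    _ ≤ _ := by linarith

theorem flat_opPlus {P : KamPar ν} {R : TMat ν} (hR : ColBdd (remKernel R)) {v : Coeffs ν}
    (hv : ∀ l, v l 0 = 0) : flat (opPlus P.w P.m R v) =
      fun q => diagPart P 0 q * flat v q + vecAct (remOp R) (flat v) q := by
  rw [← flat_act_remOp hR hv]
  funext q
  simp only [flat, opPlus, diagPart, eig, Pi.zero_apply, add_zero]
  push_cast
  ring

theorem wNorm_diagPart_lt_top {L : ℝ} {P : KamPar ν} (hw : ∀ i, |P.w i| ≤ 2 * L) {s : ℝ}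
    {v : Coeffs ν} (hv : MemH (s + 1) v) :
    wNorm (sobW s) (fun q => ‖diagPart P 0 q * flat v q‖ₑ) < ⊤ := by
  refine lt_of_le_of_lt (wNorm_le_mul (C := ENNReal.ofReal (2 * |L| + 4 * |P.m|))
    (W' := sobW (s + 1)) (v' := fun q => ‖flat v q‖ₑ) fun q => ?_)
    (ENNReal.mul_lt_top ENNReal.ofReal_lt_top hv.wNorm_lt_top)
  rw [enorm_mul, ← ofReal_norm (diagPart P 0 q), ← mul_assoc, ← mul_assoc,
    ← ENNReal.ofReal_mul (sobW_pos _ _).le, ← ENNReal.ofReal_mul (by positivity)]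
  refine mul_le_mul' (ENNReal.ofReal_le_ofReal ?_) le_rfl
  rw [sobW_add, sobW_one]
  have := mul_le_mul_of_nonneg_left (norm_diagPart_zero_le hw q) (sobW_pos s q).le
  linarith

theorem memH_opPlus {L : ℝ} {P : KamPar ν} (hw : ∀ i, |P.w i| ≤ 2 * L) {R : TMat ν}
    (hR : ColBdd (remKernel R)) (hham : IsHamMat R) {s : ℝ}
    (hs : schurN (ratW (sobW s)) (remOp R) < ⊤) {v : Coeffs ν} (hv : MemH (s + 1) v) :
    MemH s (opPlus P.w P.m R v) := by
  have hf := flat_opPlus (P := P) hR hv.2.1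
  have hv' : MemH s v := hv.mono (by linarith)
  refine ⟨fun l j => ?_, fun l => ?_, ?_⟩
  · have h1 := congrFun hf (l, j)
    have h2 := congrFun hf (-l, -j)
    simp only [flat] at h1 h2
    rw [h1, h2, map_add, conj_vecAct (isHamOp_remOp hR hham).struct (u := flat v)
      (fun q => hv.1 _ _), map_mul, hv.1]
    congr 2
    rw [diagPart, diagPart, map_mul, Complex.conj_I, Complex.conj_ofReal]
    simp only [eig, Pi.zero_apply, dotL_neg, disp_neg]
    push_cast; ring
  · simp [opPlus, hv.2.1, act]
  · rw [hsNorm_eq, hf]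
    have h1 := wNorm_diagPart_lt_top hw hv
    have h2 := (wNorm_vecAct (sobW_pos s) (remOp R) (flat v)).trans_lt
      (ENNReal.mul_lt_top hs hv'.wNorm_lt_top)
    refine lt_of_le_of_lt (wNorm_le_add (W' := sobW s) (W'' := sobW s)
      (v' := fun q => ‖diagPart P 0 q * flat v q‖ₑ)
      (v'' := fun q => ‖vecAct (remOp R) (flat v) q‖ₑ) fun q => ?_)
      (ENNReal.mul_lt_top (by norm_num) (ENNReal.add_lt_top.2 ⟨h1, h2⟩))
    rw [← mul_add]
    exact mul_le_mul' le_rfl (enorm_add_le _ _)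

theorem act_opPlus {L : ℝ} {P : KamPar ν} (hw : ∀ i, |P.w i| ≤ 2 * L) {R : TMat ν}
    (hR : ColBdd (remKernel R)) {s : ℝ}
    (hs : schurN (ratW (sobW s)) (remOp R) < ⊤) {Φ Ψ : MatOp (Idx ν)} (hΦ : IsStruct Φ)
    (hΨ : IsStruct Ψ) (hΦs : schurN (ratW (sobW s)) Φ < ⊤) (hΨs : schurN (ratW (sobW s)) Ψ < ⊤)
    (hΨs' : schurN (ratW (sobW (s + 1))) Ψ < ⊤) (hinv : Φ * Ψ = 1)
    {r : ℤ → ℝ} (hinter : Intertwines (diagPart P r) (diagPart P 0) Φ (Φ * remOp R))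
    {u : Coeffs ν} (hu : MemH (s + 1) u) :
    act (toT Φ) (opPlus P.w P.m R (act (toT Ψ) u)) =
      opDiag P.w (fun j => eig P.m (r j) j) u := by
  have hv := memH_act hΨ hΨs' hu
  have hu' : MemH s u := hu.mono (by linarith)
  have hv' : MemH s (act (toT Ψ) u) := hv.mono (by linarith)
  refine flat_injective ?_
  rw [flat_act hΦ (fun l => by simp [opPlus, act]), flat_opPlus hR hv.2.1]
  funext q
  rw [vecAct_intertwines (sobW_pos s) hinter hΦs hs hv'.wNorm_lt_top (wNorm_diagPart_lt_top hw hv),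
    ← flat_act hΦ hv.2.1, act_act_of_mul_eq_one hΦ hΨ hΦs hΨs hinv hu']
  simp only [flat, opDiag, diagPart]
  push_cast
  ring

end Coefficients

/-! ### The operators at a fixed angle -/

section FixedAngle

variable {ν : ℕ}

/-- The character `e^{i ℓ·φ}`. -/
def chi (φ : Fin ν → ℝ) (l : Fin ν → ℤ) : ℂ :=
  Complex.exp (Complex.I * ((∑ i, (l i : ℝ) * φ i : ℝ) : ℂ))

theorem chi_add (φ : Fin ν → ℝ) (l p : Fin ν → ℤ) : chi φ (l + p) = chi φ l * chi φ p := by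
  rw [chi, chi, chi, ← Complex.exp_add, ← mul_add, ← Complex.ofReal_add, ← Finset.sum_add_distrib]
  congr 4
  funext i
  rw [Pi.add_apply, Int.cast_add, add_mul]

theorem chi_zero (φ : Fin ν → ℝ) : chi φ 0 = 1 := by simp [chi]

theorem conj_chi (φ : Fin ν → ℝ) (l : Fin ν → ℤ) : conj (chi φ l) = chi φ (-l) := by
  rw [chi, chi, ← Complex.exp_conj, map_mul, Complex.conj_I, Complex.conj_ofReal]
  congr 1
  simp

theorem norm_chi (φ : Fin ν → ℝ) (l : Fin ν → ℤ) : ‖chi φ l‖ = 1 := by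
  rw [chi, mul_comm, Complex.norm_exp_ofReal_mul_I]

theorem enorm_chi (φ : Fin ν → ℝ) (l : Fin ν → ℤ) : ‖chi φ l‖ₑ = 1 := by
  rw [← ofReal_norm, norm_chi, ENNReal.ofReal_one]

theorem summable_of_tsum_enorm_ne_top {α : Type*} {f : α → ℂ} (h : ∑' a, ‖f a‖ₑ ≠ ⊤) :
    Summable f := by
  refine Summable.of_norm ?_
  have := ENNReal.summable_toReal h
  simpa using this

theorem tsum_enorm_col_le (A : MatOp (Idx ν)) (j : ℤ) (k : Idx ν) :
    ∑' l : Fin ν → ℤ, ‖ent A (l, j) k‖ₑ ≤ ‖A‖ₑ := by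
  refine le_trans ?_ (tsum_enorm_ent_le A k)
  rw [ENNReal.tsum_prod', ENNReal.tsum_comm]
  exact ENNReal.le_tsum (f := fun j => ∑' l : Fin ν → ℤ, ‖ent A (l, j) k‖ₑ) j

theorem tsum_enorm_col_ne_top (A : MatOp (Idx ν)) (j : ℤ) (k : Idx ν) :
    ∑' l : Fin ν → ℤ, ‖ent A (l, j) k‖ₑ ≠ ⊤ :=
  ne_top_of_le_ne_top enorm_ne_top (tsum_enorm_col_le A j k)

theorem entryAt_eq (A : MatOp (Idx ν)) (φ : Fin ν → ℝ) (j j' : ℤ) :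
    entryAt (toT A) φ j j' = ∑' l, ent A (l, j) (0, j') * chi φ l := rfl

theorem enorm_entryAt_le (A : MatOp (Idx ν)) (φ : Fin ν → ℝ) (j j' : ℤ) :
    ‖entryAt (toT A) φ j j'‖ₑ ≤ ∑' l : Fin ν → ℤ, ‖ent A (l, j) (0, j')‖ₑ := by
  rw [entryAt_eq]
  refine enorm_tsum_le_tsum_enorm.trans (le_of_eq ?_)
  simp only [enorm_mul, enorm_chi, mul_one]

/-- The matrix of `A(φ)`. -/
def atPhi (A : MatOp (Idx ν)) (φ : Fin ν → ℝ) : MatOp ℤ := ofKernel (entryAt (toT A) φ)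

theorem ent_atPhi (A : MatOp (Idx ν)) (φ : Fin ν → ℝ) (j j' : ℤ) :
    ent (atPhi A φ) j j' = entryAt (toT A) φ j j' := by
  refine ent_ofKernel ⟨‖A‖₊, fun k => ?_⟩ j j'
  refine (ENNReal.tsum_le_tsum fun j => enorm_entryAt_le A φ j k).trans ?_
  rw [ENNReal.tsum_comm, ← ENNReal.tsum_prod (f := fun l j => ‖ent A (l, j) (0, k)‖ₑ)]
  exact tsum_enorm_ent_le A (0, k)

theorem tsum_shift_chi {A : MatOp (Idx ν)} (hA : IsStruct A) (φ : Fin ν → ℝ) (j : ℤ) (k : Idx ν) :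
    ∑' l, ent A (l, j) k * chi φ l = chi φ k.1 * entryAt (toT A) φ j k.2 := by
  rw [entryAt_eq, ← tsum_mul_left,
    ← (Equiv.addRight k.1).tsum_eq (fun l => ent A (l, j) k * chi φ l)]
  refine tsum_congr fun l => ?_
  rw [Equiv.coe_addRight, chi_add]
  have := hA.toep k.1 (l, j) (0, k.2)
  simp only [zero_add] at this
  rw [this]; ring

theorem atPhi_mul {A B : MatOp (Idx ν)} (hA : IsStruct A) (φ : Fin ν → ℝ) :
    atPhi (A * B) φ = atPhi A φ * atPhi B φ := by
  refine MatOp.ext_ent fun j j' => ?_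
  rw [ent_atPhi, ent_mul, entryAt_eq]
  set F : (Fin ν → ℤ) → Idx ν → ℂ := fun l k => ent A (l, j) k * ent B k (0, j') * chi φ l with hF
  have hne : ∑' p : Idx ν × (Fin ν → ℤ), ‖F p.2 p.1‖ₑ ≠ ⊤ := by
    rw [ENNReal.tsum_prod (f := fun k l => ‖F l k‖ₑ)]
    refine ne_top_of_le_ne_top (ENNReal.mul_ne_top (enorm_ne_top (x := A)) (enorm_ne_top (x := B))) ?_
    calc ∑' k, ∑' l, ‖F l k‖ₑ ≤ ∑' k, ‖A‖ₑ * ‖ent B k (0, j')‖ₑ := by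
          refine ENNReal.tsum_le_tsum fun k => ?_
          simp only [hF, enorm_mul, enorm_chi, mul_one]
          rw [ENNReal.tsum_mul_right]
          exact mul_le_mul' (tsum_enorm_col_le A j k) le_rfl
      _ ≤ _ := by
          rw [ENNReal.tsum_mul_left]
          exact mul_le_mul' le_rfl (tsum_enorm_ent_le B _)
  have hs := summable_of_tsum_enorm_ne_top hne
  have h1 : ∑' l, ent (A * B) (l, j) (0, j') * chi φ l = ∑' l, ∑' k, F l k := by
    refine tsum_congr fun l => ?_
    rw [ent_mul, ← tsum_mul_right]
  have h2 : ∀ k : Idx ν, ∑' l, F l k =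
      entryAt (toT A) φ j k.2 * (ent B k (0, j') * chi φ k.1) := fun k => by
    have h3 : ∀ l, F l k = (ent A (l, j) k * chi φ l) * ent B k (0, j') := fun l => by
      simp only [hF]; ring
    rw [tsum_congr h3, tsum_mul_right, tsum_shift_chi hA]; ring
  rw [h1, Summable.tsum_comm (f := fun k l => F l k) hs, tsum_congr h2]
  have hs2 : Summable fun k : Idx ν =>
      entryAt (toT A) φ j k.2 * (ent B k (0, j') * chi φ k.1) :=
    (hs.prod).congr h2
  have hs3 : Summable fun k : ℤ × (Fin ν → ℤ) =>
      entryAt (toT A) φ j k.1 * (ent B (k.2, k.1) (0, j') * chi φ k.2) :=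
    ((Equiv.prodComm ℤ (Fin ν → ℤ)).summable_iff.2 hs2)
  rw [← (Equiv.prodComm ℤ (Fin ν → ℤ)).tsum_eq]
  change ∑' k : ℤ × (Fin ν → ℤ),
      entryAt (toT A) φ j k.1 * (ent B (k.2, k.1) (0, j') * chi φ k.2) = _
  rw [hs3.tsum_prod]
  refine tsum_congr fun h => ?_
  dsimp only
  rw [tsum_mul_left, ent_atPhi, ent_atPhi, entryAt_eq B]

theorem atPhi_one (φ : Fin ν → ℝ) : atPhi (1 : MatOp (Idx ν)) φ = 1 := by
  classical
  refine MatOp.ext_ent fun j j' => ?_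
  rw [ent_atPhi, entryAt_eq, tsum_eq_single 0]
  · rw [ent_one, ent_one, chi_zero, mul_one]; simp
  · intro l hl; rw [ent_one]; simp [hl]

theorem conj_entryAt {A : MatOp (Idx ν)} (hA : IsStruct A) (φ : Fin ν → ℝ) (j j' : ℤ) :
    conj (entryAt (toT A) φ j j') = entryAt (toT A) φ (-j) (-j') := by
  rw [entryAt_eq, entryAt_eq, Complex.conj_tsum,
    ← (Equiv.neg (Fin ν → ℤ)).tsum_eq (fun l => ent A (l, -j) (0, -j') * chi φ l)]
  refine tsum_congr fun l => ?_
  rw [map_mul, hA.real, conj_chi]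
  simp

theorem entryAt_dual {A B : MatOp (Idx ν)} (hA : IsStruct A) (h : IsDual A B) (φ : Fin ν → ℝ)
    (j j' : ℤ) : entryAt (toT B) φ j j' =
      ((dispOne j / dispOne j' : ℝ) : ℂ) * entryAt (toT A) φ (-j') (-j) := by
  rw [entryAt_eq, entryAt_eq, ← tsum_mul_left]
  refine tsum_congr fun l => ?_
  rw [h (l, j) (0, j')]
  have := hA.toep l (-(0, j')) (-(l, j))
  simp only [Prod.fst_neg, Prod.snd_neg, neg_zero, zero_add, neg_add_cancel] at this
  have h2 : ent A (-(0, j')) (-(l, j)) = ent A (l, -j') (0, -j) := by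
    rw [this]
  rw [h2]; ring

theorem IsDual.symm {A B : MatOp (Idx ν)} (hA : IsStruct A) (h : IsDual A B) : IsDual B A := by
  intro i k
  rw [h (-k) (-i), neg_neg, neg_neg]
  by_cases hb : i.2 = 0 ↔ k.2 = 0
  · by_cases hi : i.2 = 0
    · simp [dispOne, hi, hb.1 hi]
    · have hk : k.2 ≠ 0 := fun h => hi (hb.2 h)
      have h1 := dispOne_ne_zero i.2
      have h2 := dispOne_ne_zero k.2
      rw [Prod.snd_neg, Prod.snd_neg, dispOne_neg hi, dispOne_neg hk, ← mul_assoc,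
        ← Complex.ofReal_mul, neg_div_neg_eq, div_mul_div_comm, mul_comm (dispOne k.2),
        div_self (mul_ne_zero h1 h2), Complex.ofReal_one, one_mul]
  · rw [hA.block i k hb, mul_zero, mul_zero]

/-- The weight `⟨j⟩ ^ s` on `ℤ`. -/
def spaceW (s : ℝ) (j : ℤ) : ℝ := jap j ^ s

theorem spaceW_pos (s : ℝ) (j : ℤ) : 0 < spaceW s j := Real.rpow_pos_of_pos (jap_pos _) _

theorem schurN_atPhi_le {A : MatOp (Idx ν)} (hA : IsStruct A) (s : ℝ) (φ : Fin ν → ℝ) :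
    schurN (ratW (spaceW s)) (atPhi A φ) ≤ schurN (ratW fun i : Idx ν => spaceW s i.2) A := by
  refine schurN_le (fun j => ?_) fun j' => ?_
  · refine le_trans ?_ (row_le_schurN _ A (0, j))
    calc ∑' j', ratW (spaceW s) j j' * ‖ent (atPhi A φ) j j'‖ₑ
        ≤ ∑' j', ∑' l : Fin ν → ℤ, ratW (spaceW s) j j' * ‖ent A (0, j) (l, j')‖ₑ := by
          refine ENNReal.tsum_le_tsum fun j' => ?_
          rw [ent_atPhi, ENNReal.tsum_mul_left]
          refine mul_le_mul' le_rfl ((enorm_entryAt_le A φ j j').trans (le_of_eq ?_))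
          rw [← (Equiv.neg (Fin ν → ℤ)).tsum_eq]
          refine tsum_congr fun l => ?_
          have := hA.toep l (-l, j) (0, j')
          simp only [neg_add_cancel, zero_add] at this
          rw [Equiv.neg_apply, this]
      _ = _ := by rw [ENNReal.tsum_comm, ENNReal.tsum_prod']; rfl
  · refine le_trans ?_ (col_le_schurN _ A (0, j'))
    calc ∑' j, ratW (spaceW s) j j' * ‖ent (atPhi A φ) j j'‖ₑ
        ≤ ∑' j, ∑' l : Fin ν → ℤ, ratW (spaceW s) j j' * ‖ent A (l, j) (0, j')‖ₑ := by
          refine ENNReal.tsum_le_tsum fun j => ?_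
          rw [ent_atPhi, ENNReal.tsum_mul_left]
          exact mul_le_mul' le_rfl (enorm_entryAt_le A φ j j')
      _ = _ := by rw [ENNReal.tsum_comm, ENNReal.tsum_prod']; rfl

theorem summable_iff_wNorm (s : ℝ) (h : ℤ → ℂ) :
    (Summable fun j : ℤ => ‖h j‖ ^ 2 * jap j ^ (2 * s)) ↔
      wNorm (spaceW s) (fun j => ‖h j‖ₑ) < ⊤ := by
  have h1 : ∀ j : ℤ, (ENNReal.ofReal (spaceW s j) * ‖h j‖ₑ) ^ 2 =
      ENNReal.ofReal (‖h j‖ ^ 2 * jap j ^ (2 * s)) := fun j => by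
    rw [← ofReal_norm, ← ENNReal.ofReal_mul (spaceW_pos s j).le, ← ENNReal.ofReal_pow
      (mul_nonneg (spaceW_pos s j).le (norm_nonneg _)), mul_pow, mul_comm, spaceW,
      ← Real.rpow_natCast (_ ^ s), ← Real.rpow_mul (jap_pos _).le, mul_comm s]
    norm_num
  have h0 : ∀ j : ℤ, 0 ≤ ‖h j‖ ^ 2 * jap j ^ (2 * s) := fun j => by
    have := Real.rpow_nonneg (jap_pos j).le (2 * s)
    positivity
  rw [wNorm, ENNReal.rpow_lt_top_iff_of_pos (by norm_num), tsum_congr h1, lt_top_iff_ne_top]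
  constructor
  · intro hs; exact hs.tsum_ofReal_ne_top
  · intro hs
    have := ENNReal.summable_toReal hs
    refine this.congr fun j => ENNReal.toReal_ofReal (h0 j)

theorem MemHx.wNorm_lt_top {s : ℝ} {h : ℤ → ℂ} (hh : MemHx s h) :
    wNorm (spaceW s) (fun j => ‖h j‖ₑ) < ⊤ := (summable_iff_wNorm s h).1 hh.2.2

theorem entryAt_zero_row {A : MatOp (Idx ν)} (hA : IsStruct A) (φ : Fin ν → ℝ) {j' : ℤ}
    (hj : j' ≠ 0) : entryAt (toT A) φ 0 j' = 0 := by
  rw [entryAt_eq]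
  have : ∀ l, ent A (l, 0) (0, j') * chi φ l = 0 := fun l => by
    rw [hA.block (l, 0) (0, j') (by simp [hj]), zero_mul]
  simp [this]

theorem actAt_eq {A : MatOp (Idx ν)} (hA : IsStruct A) (φ : Fin ν → ℝ) {h : ℤ → ℂ}
    (h0 : h 0 = 0) : actAt (toT A) φ h = vecAct (atPhi A φ) h := by
  funext j
  rw [actAt, vecAct]
  split_ifs with hj
  · subst hj
    have : ∀ j', ent (atPhi A φ) 0 j' * h j' = 0 := fun j' => by
      by_cases hj' : j' = 0
      · rw [hj', h0, mul_zero]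
      · rw [ent_atPhi, entryAt_zero_row hA φ hj', zero_mul]
    simp [this]
  · exact tsum_congr fun j' => by rw [ent_atPhi]

theorem memHx_actAt {A : MatOp (Idx ν)} (hA : IsStruct A) {s : ℝ}
    (hs : schurN (ratW fun i : Idx ν => spaceW s i.2) A < ⊤) (φ : Fin ν → ℝ) {h : ℤ → ℂ}
    (hh : MemHx s h) : MemHx s (actAt (toT A) φ h) := by
  refine ⟨fun j => ?_, by simp [actAt], ?_⟩
  · rw [actAt_eq hA φ hh.2.1, vecAct, vecAct, Complex.conj_tsum,
      ← (Equiv.neg ℤ).tsum_eq (fun k => ent (atPhi A φ) (-j) k * h k)]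
    refine tsum_congr fun k => ?_
    rw [map_mul, ent_atPhi, conj_entryAt hA, hh.1, ent_atPhi]; rfl
  · rw [summable_iff_wNorm, actAt_eq hA φ hh.2.1]
    exact (wNorm_vecAct (spaceW_pos s) _ _).trans_lt
      (ENNReal.mul_lt_top ((schurN_atPhi_le hA s φ).trans_lt hs) hh.wNorm_lt_top)

theorem tsum_sq_lt_top {s : ℝ} (hs : 0 ≤ s) {v : ℤ → ℝ≥0∞} (hv : wNorm (spaceW s) v < ⊤) :
    ∑' j, v j ^ 2 < ⊤ := by
  rw [wNorm, ENNReal.rpow_lt_top_iff_of_pos (by norm_num)] at hv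
  refine lt_of_le_of_lt (ENNReal.tsum_le_tsum fun j => ?_) hv
  refine pow_le_pow_left' ?_ 2
  refine le_mul_of_one_le_left' ?_
  rw [ENNReal.one_le_ofReal]
  exact Real.one_le_rpow (one_le_jap _) hs

theorem one_le_abs_disp {j : ℤ} (hj : j ≠ 0) : 1 ≤ |disp j| := by
  have h1 : (0 : ℝ) < 1 + (j : ℝ) ^ 2 := by positivity
  have h2 : (0 : ℝ) < 4 + (j : ℝ) ^ 2 := by positivity
  have h3 : (1 : ℝ) ≤ |(j : ℝ)| := by exact_mod_cast Int.one_le_abs hj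
  rw [disp, abs_div, abs_mul, abs_of_pos h1, abs_of_pos h2, le_div_iff₀ h1]
  nlinarith

theorem sympForm_actAt {A B : MatOp (Idx ν)} (hA : IsStruct A) (hB : IsStruct B) (hd : IsDual A B)
    (hinv : B * A = 1) {s : ℝ} (h0 : 0 ≤ s)
    (hsA : schurN (ratW fun i : Idx ν => spaceW s i.2) A < ⊤)
    (hsB : schurN (ratW fun i : Idx ν => spaceW s i.2) B < ⊤) (φ : Fin ν → ℝ) {u v : ℤ → ℂ}
    (hu : MemHx s u) (hv : MemHx s v) :
    sympForm (actAt (toT A) φ u) (actAt (toT A) φ v) = sympForm u v := by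
  have hsA' := (schurN_atPhi_le hA s φ).trans_lt hsA
  have hsB' := (schurN_atPhi_le hB s φ).trans_lt hsB
  have hu' := memHx_actAt hA hsA φ hu
  set u' := actAt (toT A) φ u with hu'def
  have hback : vecAct (atPhi B φ) u' = u := by
    rw [hu'def, actAt_eq hA φ hu.2.1,
      ← vecAct_mul (spaceW_pos s) hsB' hsA' hu.wNorm_lt_top, ← atPhi_mul hB, hinv, atPhi_one,
      vecAct_one]
  have hterm : ∀ j k : ℤ, u' j / (Complex.I * (disp j : ℂ)) * (ent (atPhi A φ) (-j) k * v k) =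
      v k / (Complex.I * (disp (-k) : ℂ)) * (ent (atPhi B φ) (-k) j * u' j) := by
    intro j k
    by_cases hj : j = 0
    · have : u' j = 0 := by rw [hj]; exact hu'.2.1
      simp [this]
    by_cases hk : k = 0
    · have : v k = 0 := by rw [hk]; exact hv.2.1
      simp [this]
    have h1 := entryAt_dual hA hd φ (-k) j
    rw [neg_neg, dispOne, dispOne, if_neg (neg_ne_zero.2 hk), if_neg hj] at h1
    rw [ent_atPhi, ent_atPhi, h1]
    have h2 : (disp j : ℂ) ≠ 0 := by exact_mod_cast disp_ne_zero hj
    have h3 : (disp (-k) : ℂ) ≠ 0 := by exact_mod_cast disp_ne_zero (neg_ne_zero.2 hk)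
    push_cast
    field_simp
  have hs : Summable (Function.uncurry fun j k : ℤ =>
      u' j / (Complex.I * (disp j : ℂ)) * (ent (atPhi A φ) (-j) k * v k)) := by
    refine summable_of_tsum_enorm_ne_top ?_
    rw [ENNReal.tsum_prod']
    set y : ℤ → ℝ≥0∞ := absAct (atPhi A φ) fun k => ‖v k‖ₑ with hy
    have hy2 : ∑' j, y j ^ 2 < ⊤ := tsum_sq_lt_top h0
      ((wNorm_absAct (spaceW_pos s) _ _).trans_lt (ENNReal.mul_lt_top hsA' hv.wNorm_lt_top))
    have hu2 : ∑' j, ‖u' j‖ₑ ^ 2 < ⊤ := tsum_sq_lt_top h0 hu'.wNorm_lt_top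
    refine ne_top_of_le_ne_top (b := ∑' j, (‖u' j‖ₑ ^ 2 + y (-j) ^ 2)) ?_
      (ENNReal.tsum_le_tsum fun j => ?_)
    · rw [ENNReal.tsum_add]
      refine ENNReal.add_ne_top.2 ⟨hu2.ne, ?_⟩
      have := (Equiv.neg ℤ).tsum_eq (fun j => y j ^ 2)
      simp only [Equiv.neg_apply] at this
      rw [this]; exact hy2.ne
    · have h1 : ‖u' j / (Complex.I * (disp j : ℂ))‖ₑ ≤ ‖u' j‖ₑ := by
        rw [← ofReal_norm, ← ofReal_norm]
        refine ENNReal.ofReal_le_ofReal ?_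
        by_cases hj : j = 0
        · simp [hj, disp]
        rw [norm_div, norm_mul, Complex.norm_I, one_mul, Complex.norm_real, Real.norm_eq_abs]
        exact div_le_self (norm_nonneg _) (one_le_abs_disp hj)
      calc _ = ‖u' j / (Complex.I * (disp j : ℂ))‖ₑ * y (-j) := by
            rw [hy, absAct, ← ENNReal.tsum_mul_left]
            refine tsum_congr fun k => ?_
            simp only [Function.uncurry, enorm_mul]
        _ ≤ ‖u' j‖ₑ * y (-j) := mul_le_mul' h1 le_rfl
        _ ≤ 2 * (‖u' j‖ₑ * y (-j)) := le_mul_of_one_le_left' (by norm_num)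
        _ ≤ _ := ENNReal_two_mul_le _ _
  rw [sympForm, sympForm]
  congr 1
  calc ∑' j, u' j / (Complex.I * (disp j : ℂ)) * actAt (toT A) φ v (-j)
      = ∑' j, ∑' k, u' j / (Complex.I * (disp j : ℂ)) * (ent (atPhi A φ) (-j) k * v k) := by
        refine tsum_congr fun j => ?_
        rw [actAt_eq hA φ hv.2.1, vecAct, tsum_mul_left]
    _ = ∑' k, ∑' j, u' j / (Complex.I * (disp j : ℂ)) * (ent (atPhi A φ) (-j) k * v k) :=
        hs.tsum_comm.symm
    _ = ∑' k, v k / (Complex.I * (disp (-k) : ℂ)) * u (-k) := by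
        refine tsum_congr fun k => ?_
        rw [tsum_congr fun j => hterm j k, tsum_mul_left]
        congr 1
        exact congrFun hback (-k)
    _ = ∑' k, u k / (Complex.I * (disp k : ℂ)) * v (-k) := by
        rw [← (Equiv.neg ℤ).tsum_eq]
        refine tsum_congr fun k => ?_
        rw [Equiv.neg_apply, neg_neg]
        ring

theorem isSymplecticFamily_toT {A B : MatOp (Idx ν)} (hA : IsStruct A) (hB : IsStruct B)
    (hd : IsDual A B) (hinv : B * A = 1) {s : ℝ} (h0 : 0 ≤ s)
    (hsA : schurN (ratW fun i : Idx ν => spaceW s i.2) A < ⊤)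
    (hsB : schurN (ratW fun i : Idx ν => spaceW s i.2) B < ⊤) : IsSymplecticFamily s (toT A) := by
  refine ⟨fun j j' _ _ => ?_, fun φ => ⟨fun h hh => ⟨fun j _ => ?_, memHx_actAt hA hsA φ hh⟩,
    fun u v hu hv => sympForm_actAt hA hB hd hinv h0 hsA hsB φ hu hv⟩⟩
  · exact (summable_of_tsum_enorm_ne_top (tsum_enorm_col_ne_top A j (0, j'))).norm
  · refine (summable_vecAct (spaceW_pos s) ((schurN_atPhi_le hA s φ).trans_lt hsA)
      hh.wNorm_lt_top j).congr fun k => ?_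
    rw [ent_atPhi]

end FixedAngle

/-! ### Matrices with decaying entries -/

section Decay

variable {ν : ℕ}

theorem tsum_pi_prod_eq (g : ℤ → ℝ≥0∞) (n : ℕ) :
    ∑' p : Fin n → ℤ, ∏ i, g (p i) = (∑' k, g k) ^ n := by
  induction n with
  | zero => simp
  | succ n ih =>
    rw [← (Fin.consEquiv fun _ : Fin (n + 1) => ℤ).tsum_eq, ENNReal.tsum_prod', pow_succ', ← ih,
      ← ENNReal.tsum_mul_right]
    refine tsum_congr fun a => ?_
    rw [← ENNReal.tsum_mul_left]
    refine tsum_congr fun p => ?_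
    rw [Fin.prod_univ_succ]
    simp [Fin.consEquiv]

theorem tsum_jap_sq_lt_top : ∑' k : ℤ, ENNReal.ofReal ((jap k ^ 2)⁻¹) < ⊤ := by
  have h1 : Summable fun k : ℤ => 1 / (k : ℝ) ^ 2 := Real.summable_one_div_int_pow.2 (by norm_num)
  have h2 : Summable fun k : ℤ => if k = 0 then (1 : ℝ) else 0 :=
    summable_of_ne_finset_zero (s := {0}) fun k hk => by
      rw [if_neg]; simpa using hk
  have h3 : Summable fun k : ℤ => (jap k ^ 2)⁻¹ := by
    refine Summable.of_nonneg_of_le (fun k => by have := jap_pos k; positivity) (fun k => ?_)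
      (h1.add h2)
    by_cases hk : k = 0
    · simp [hk, jap]
    · have : (1 : ℝ) ≤ |(k : ℝ)| := by exact_mod_cast Int.one_le_abs hk
      rw [if_neg hk, add_zero, jap, max_eq_right this, sq_abs, one_div]
  exact lt_top_iff_ne_top.2 h3.tsum_ofReal_ne_top

theorem jap_le_japLJ (l : Fin ν → ℤ) (j : ℤ) : jap j ≤ japLJ l j :=
  max_le (le_max_left _ _) (abs_le_japLJ l j)

theorem abs_le_absL (l : Fin ν → ℤ) (i : Fin ν) : |(l i : ℝ)| ≤ absL l :=
  Finset.single_le_sum (f := fun i => |(l i : ℝ)|) (fun _ _ => abs_nonneg _) (Finset.mem_univ i)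

theorem jap_apply_le_japLJ (l : Fin ν → ℤ) (j : ℤ) (i : Fin ν) : jap (l i) ≤ japLJ l j :=
  max_le (le_max_left _ _) ((abs_le_absL l i).trans (absL_le_japLJ l j))

theorem japLJ_add_le (i k : Idx ν) :
    japLJ (i + k).1 (i + k).2 ≤ japLJ i.1 i.2 + japLJ k.1 k.2 := by
  have h1 := one_le_japLJ i.1 i.2
  have h2 := one_le_japLJ k.1 k.2
  refine max_le (by linarith) (max_le ?_ ?_)
  · exact (absL_add_le _ _).trans (add_le_add (absL_le_japLJ _ _) (absL_le_japLJ _ _))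
  · rw [Prod.snd_add, Int.cast_add]
    exact (abs_add_le _ _).trans (add_le_add (abs_le_japLJ _ _) (abs_le_japLJ _ _))

theorem japLJ_neg (i : Idx ν) : japLJ (-i).1 (-i).2 = japLJ i.1 i.2 := by
  simp [japLJ, absL_neg]

theorem japLJ_sub_comm (i k : Idx ν) : japLJ (i - k).1 (i - k).2 = japLJ (k - i).1 (k - i).2 := by
  rw [← japLJ_neg, neg_sub]

/-- The sum of `⟨ℓ, j⟩ ^ (-(2 ν + 2))`. -/
def latticeSum (ν : ℕ) : ℝ := (∑' q : Idx ν, ENNReal.ofReal ((japLJ q.1 q.2 ^ (2 * ν + 2))⁻¹)).toReal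

theorem latticeSum_nonneg (ν : ℕ) : 0 ≤ latticeSum ν := ENNReal.toReal_nonneg

theorem tsum_japLJ_eq (ν : ℕ) :
    ∑' q : Idx ν, ENNReal.ofReal ((japLJ q.1 q.2 ^ (2 * ν + 2))⁻¹) =
      ENNReal.ofReal (latticeSum ν) := by
  rw [latticeSum, ENNReal.ofReal_toReal]
  refine ne_top_of_le_ne_top (b := (∑' k : ℤ, ENNReal.ofReal ((jap k ^ 2)⁻¹)) ^ ν *
    ∑' k : ℤ, ENNReal.ofReal ((jap k ^ 2)⁻¹)) (ENNReal.mul_ne_top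
      (ENNReal.pow_ne_top tsum_jap_sq_lt_top.ne) tsum_jap_sq_lt_top.ne) ?_
  rw [← tsum_pi_prod_eq, ← ENNReal.tsum_mul_right, ENNReal.tsum_prod']
  refine ENNReal.tsum_le_tsum fun l => ?_
  rw [← ENNReal.tsum_mul_left]
  refine ENNReal.tsum_le_tsum fun j => ?_
  rw [← ENNReal.ofReal_prod_of_nonneg (fun i _ => by have := jap_pos (l i); positivity),
    ← ENNReal.ofReal_mul (Finset.prod_nonneg fun i _ => by have := jap_pos (l i); positivity)]
  refine ENNReal.ofReal_le_ofReal ?_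
  rw [Finset.prod_inv_distrib, ← mul_inv]
  have h0 := jap_pos j
  have h1 : 0 < ∏ i, jap (l i) ^ 2 := Finset.prod_pos fun i _ => by
    have := jap_pos (l i); positivity
  have h2 : ∏ i, jap (l i) ^ 2 ≤ ∏ _i : Fin ν, japLJ l j ^ 2 :=
    Finset.prod_le_prod (fun i _ => by positivity) fun i _ =>
      pow_le_pow_left₀ (jap_pos _).le (jap_apply_le_japLJ l j i) 2
  rw [Finset.prod_const, Finset.card_univ, Fintype.card_fin] at h2
  refine inv_anti₀ (by positivity) ?_
  calc (∏ i, jap (l i) ^ 2) * jap j ^ 2 ≤ (japLJ l j ^ 2) ^ ν * japLJ l j ^ 2 := by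
        have := japLJ_pos l j
        gcongr
        exact jap_le_japLJ l j
    _ = _ := by ring

theorem tsum_japLJ_row (i : Idx ν) :
    ∑' k : Idx ν, ENNReal.ofReal ((japLJ (i - k).1 (i - k).2 ^ (2 * ν + 2))⁻¹) =
      ENNReal.ofReal (latticeSum ν) := by
  rw [← tsum_japLJ_eq]
  exact (Equiv.subLeft i).tsum_eq
    (fun q : Idx ν => ENNReal.ofReal ((japLJ q.1 q.2 ^ (2 * ν + 2))⁻¹))

theorem tsum_japLJ_col (k : Idx ν) :
    ∑' i : Idx ν, ENNReal.ofReal ((japLJ (i - k).1 (i - k).2 ^ (2 * ν + 2))⁻¹) =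
      ENNReal.ofReal (latticeSum ν) := by
  rw [← tsum_japLJ_eq]
  exact (Equiv.subRight k).tsum_eq
    (fun q : Idx ν => ENNReal.ofReal ((japLJ q.1 q.2 ^ (2 * ν + 2))⁻¹))

/-- The entries of `M` decay like `⟨i - k⟩ ^ (-B) ⟨j'⟩⁻¹ W(k) / W(i)`, with the constant `D`. -/
def Decays (W : Idx ν → ℝ) (B : ℕ) (D : ℝ) (M : TMat ν) : Prop :=
  ∀ i k : Idx ν, i.2 ≠ 0 → k.2 ≠ 0 →
    japLJ (i - k).1 (i - k).2 ^ B * (W i / W k) * jap k.2 * ‖M i.2 k.2 (i.1 - k.1)‖ ≤ D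

theorem Decays.kernel_le {W : Idx ν → ℝ} (hW : ∀ i, 0 < W i) {b : ℕ} {D : ℝ} {M : TMat ν}
    (hD : 0 ≤ D) (h : Decays W (b + (2 * ν + 2)) D M) (i k : Idx ν) :
    kamW W b 0 i k * ‖remKernel M i k‖ₑ ≤
      ENNReal.ofReal (2 ^ b * D) * ENNReal.ofReal ((japLJ (i - k).1 (i - k).2 ^ (2 * ν + 2))⁻¹) := by
  rw [remKernel]
  split_ifs with h0
  · simp
  push Not at h0
  have h1 := h i k h0.1 h0.2
  set J := japLJ (i - k).1 (i - k).2 with hJ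
  have hJ1 : 1 ≤ J := one_le_japLJ _ _
  have hW1 := hW i
  have hW2 := hW k
  have hj := jap_pos k.2
  have ha : absL (i.1 - k.1) ≤ J := absL_le_japLJ _ _
  have ha0 := absL_nonneg (i.1 - k.1)
  rw [kamW, ← ofReal_norm, ← ENNReal.ofReal_mul (by positivity), ← ENNReal.ofReal_mul (by positivity)]
  refine ENNReal.ofReal_le_ofReal ?_
  rw [← div_eq_mul_inv, le_div_iff₀ (by positivity)]
  calc (1 + absL (i.1 - k.1) / 4 ^ 0) ^ b * (W i / W k) * jap k.2 * ‖M i.2 k.2 (i.1 - k.1)‖ *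
        J ^ (2 * ν + 2)
      ≤ (2 * J) ^ b * (W i / W k) * jap k.2 * ‖M i.2 k.2 (i.1 - k.1)‖ * J ^ (2 * ν + 2) := by
        gcongr
        rw [pow_zero, div_one]; linarith
    _ = 2 ^ b * (J ^ (b + (2 * ν + 2)) * (W i / W k) * jap k.2 * ‖M i.2 k.2 (i.1 - k.1)‖) := by
        rw [mul_pow, pow_add]; ring
    _ ≤ _ := by gcongr

theorem Decays.colBdd {b : ℕ} {D : ℝ} {M : TMat ν} (hD : 0 ≤ D)
    (h : Decays (fun _ => 1) (b + (2 * ν + 2)) D M) : ColBdd (remKernel M) := by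
  refine ⟨(2 ^ b * D * latticeSum ν).toNNReal, fun k => ?_⟩
  calc ∑' i, ‖remKernel M i k‖ₑ ≤ ∑' i, ENNReal.ofReal (2 ^ b * D) *
        ENNReal.ofReal ((japLJ (i - k).1 (i - k).2 ^ (2 * ν + 2))⁻¹) :=
        ENNReal.tsum_le_tsum fun i => le_trans (le_mul_of_one_le_left'
          (one_le_kamW_one b 0 i k)) (h.kernel_le (fun _ => one_pos) hD i k)
    _ = _ := by
        rw [ENNReal.tsum_mul_left, tsum_japLJ_col, ← ENNReal.ofReal_mul (by positivity)]; rfl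

theorem Decays.schurN_le {W : Idx ν → ℝ} (hW : ∀ i, 0 < W i) {b : ℕ} {D : ℝ} {M : TMat ν}
    (hD : 0 ≤ D) (hM : ColBdd (remKernel M)) (h : Decays W (b + (2 * ν + 2)) D M) :
    schurN (kamW W b 0) (remOp M) ≤ ENNReal.ofReal (2 ^ b * D * latticeSum ν) := by
  have hk := h.kernel_le hW hD
  rw [ENNReal.ofReal_mul (by positivity)]
  refine DP.schurN_le (fun i => ?_) fun k => ?_
  · rw [← tsum_japLJ_row i, ← ENNReal.tsum_mul_left]
    refine ENNReal.tsum_le_tsum fun k => ?_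
    rw [remOp, ent_ofKernel hM]; exact hk i k
  · rw [← tsum_japLJ_col k, ← ENNReal.tsum_mul_left]
    refine ENNReal.tsum_le_tsum fun i => ?_
    rw [remOp, ent_ofKernel hM]; exact hk i k

theorem remKernel_smul_sub (c : ℂ) (M M' : TMat ν) (i k : Idx ν) :
    remKernel (c • (M - M')) i k = c * (remKernel M i k - remKernel M' i k) := by
  simp only [remKernel]
  split_ifs <;> simp

theorem Decays.pairN_le {W : Idx ν → ℝ} (hW : ∀ i, 0 < W i) {b : ℕ} {D c : ℝ} {M M' : TMat ν}
    (hD : 0 ≤ D) (hc : 0 ≤ c) (hM : ColBdd (remKernel M)) (hM' : ColBdd (remKernel M'))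
    (hMM : ColBdd (remKernel ((c : ℂ) • (M - M'))))
    (h : Decays W (b + (2 * ν + 2)) D M) (h' : Decays W (b + (2 * ν + 2)) D M')
    (hd : Decays W (b + (2 * ν + 2)) D ((c : ℂ) • (M - M'))) :
    pairN (ENNReal.ofReal c) (kamW W b 0) (remOp M) (remOp M') ≤
      ENNReal.ofReal (2 * (2 ^ b * D * latticeSum ν)) := by
  have h1 := h.schurN_le hW hD hM
  have h2 := h'.schurN_le hW hD hM'
  have h3 := hd.schurN_le hW hD hMM
  have h4 : remOp ((c : ℂ) • (M - M')) = (c : ℂ) • (remOp M - remOp M') := by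
    refine MatOp.ext_ent fun i k => ?_
    rw [remOp, ent_ofKernel hMM, ent_smul, ent_sub, remOp, remOp, ent_ofKernel hM,
      ent_ofKernel hM', remKernel_smul_sub]
  have h5 : ENNReal.ofReal c * schurN (kamW W b 0) (remOp M - remOp M') ≤
      schurN (kamW W b 0) ((c : ℂ) • (remOp M - remOp M')) := by
    rcases hc.eq_or_lt with rfl | hc
    · simp
    have h6 := schurN_smul (kamW W b 0) ((c⁻¹ : ℝ) : ℂ) ((c : ℂ) • (remOp M - remOp M'))
    rw [smul_smul, ← Complex.ofReal_mul, inv_mul_cancel₀ hc.ne', Complex.ofReal_one, one_smul,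
      ← ofReal_norm, Complex.norm_real, Real.norm_of_nonneg (inv_pos.2 hc).le] at h6
    refine (mul_le_mul' le_rfl h6).trans (le_of_eq ?_)
    rw [← mul_assoc, ← ENNReal.ofReal_mul hc.le, mul_inv_cancel₀ hc.ne', ENNReal.ofReal_one,
      one_mul]
  rw [h4] at h3
  replace h3 := h5.trans h3
  have := latticeSum_nonneg ν
  rw [two_mul, ENNReal.ofReal_add (by positivity) (by positivity), pairN]
  exact add_le_add (max_le h1 h2) h3

/-- Tame decay of the entries:
`⟨i - k⟩ ^ (s + B) ⟨j'⟩ |M| ≤ a₁ + a₀ ⟨j'⟩ ^ s`. -/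
def TameDecay (B : ℕ) (s a₁ a₀ : ℝ) (M : TMat ν) : Prop :=
  ∀ i k : Idx ν, i.2 ≠ 0 → k.2 ≠ 0 →
    sobW s (i - k) * (japLJ (i - k).1 (i - k).2 ^ B * jap k.2 * ‖M i.2 k.2 (i.1 - k.1)‖) ≤
      a₁ + a₀ * jap k.2 ^ s

theorem add_rpow_le_two_rpow {x y s : ℝ} (hx : 0 ≤ x) (hy : 0 ≤ y) (hs : 0 ≤ s) :
    (x + y) ^ s ≤ 2 ^ s * (x ^ s + y ^ s) := by
  have h1 : x + y ≤ 2 * max x y := by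
    have := le_max_left x y
    have := le_max_right x y
    linarith
  have h2 : (max x y) ^ s ≤ x ^ s + y ^ s := by
    rcases le_total x y with h | h
    · rw [max_eq_right h]; have := Real.rpow_nonneg hx s; linarith
    · rw [max_eq_left h]; have := Real.rpow_nonneg hy s; linarith
  calc (x + y) ^ s ≤ (2 * max x y) ^ s := Real.rpow_le_rpow (by positivity) h1 hs
    _ = 2 ^ s * (max x y) ^ s := Real.mul_rpow (by norm_num) (by positivity)
    _ ≤ _ := by gcongr

theorem Decays.one_mono {B : ℕ} {δ D : ℝ} {M : TMat ν} (h : Decays (fun _ => 1) B δ M) (hD : δ ≤ D) :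
    Decays (fun _ => 1) B D M := fun i k hi hk => (h i k hi hk).trans hD

theorem Decays.of_le_pow {W : Idx ν → ℝ} {B B' : ℕ} (hB : B' ≤ B) (hW : ∀ i, 0 < W i) {D : ℝ}
    {M : TMat ν} (h : Decays W B D M) : Decays W B' D M := fun i k hi hk => by
  refine le_trans ?_ (h i k hi hk)
  have := hW i
  have := hW k
  have := jap_pos k.2
  have := one_le_japLJ (i - k).1 (i - k).2
  gcongr

/-- Decay in the weight `n ^ s + Λ n ^ s'`. -/
theorem TameDecay.decays {B : ℕ} {s s' δ Λ S : ℝ} (hs : 0 ≤ s) (hs' : 0 ≤ s') (hsS : s ≤ S)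
    (hs'S : s' ≤ S) (hδ : 0 ≤ δ) (hΛ : 0 < Λ) {M : TMat ν} {n : Idx ν → ℝ}
    (hn : ∀ i k, n i ≤ japLJ (i - k).1 (i - k).2 + n k) (hn1 : ∀ k, jap k.2 ≤ n k)
    (h0 : Decays (fun _ => 1) B δ M) (h : TameDecay B s (Λ * δ) δ M) (h' : TameDecay B s' δ δ M) :
    Decays (fun i => n i ^ s + Λ * n i ^ s') B (5 * 2 ^ S * δ) M := by
  intro i k hi hk
  set X := japLJ (i - k).1 (i - k).2 ^ B * jap k.2 * ‖M i.2 k.2 (i.1 - k.1)‖ with hX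
  have hjk := jap_pos k.2
  have hJ : 0 < japLJ (i - k).1 (i - k).2 := japLJ_pos _ _
  have hX0 : 0 ≤ X := by positivity
  have hnk : 1 ≤ n k := (one_le_jap _).trans (hn1 k)
  have hni : 1 ≤ n i := (one_le_jap _).trans (hn1 i)
  have e0 : X ≤ δ := by
    have := h0 i k hi hk
    rw [div_one, mul_one] at this
    exact this
  have e1 : sobW s (i - k) * X ≤ Λ * δ + δ * n k ^ s := (h i k hi hk).trans (by
    gcongr; exact hn1 k)
  have e2 : sobW s' (i - k) * X ≤ δ + δ * n k ^ s' := (h' i k hi hk).trans (by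
    gcongr; exact hn1 k)
  have hpow : ∀ {p : ℝ}, 0 ≤ p → p ≤ S → n i ^ p ≤ 2 ^ S * (sobW p (i - k) + n k ^ p) := by
    intro p hp hpS
    have h1 : n i ^ p ≤ 2 ^ p * (sobW p (i - k) + n k ^ p) :=
      (Real.rpow_le_rpow (by linarith) (hn i k) hp).trans
        (add_rpow_le_two_rpow hJ.le (by linarith) hp)
    refine h1.trans ?_
    have h2 := sobW_pos p (i - k)
    have h3 : (0 : ℝ) ≤ n k ^ p := Real.rpow_nonneg (by linarith) _
    gcongr
    norm_num
  have hks : 1 ≤ n k ^ s' := Real.one_le_rpow hnk hs'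
  have hks0 : 0 ≤ n k ^ s := Real.rpow_nonneg (by linarith) _
  have f1 : n i ^ s * X ≤ 2 ^ S * (Λ * δ + 2 * δ * n k ^ s) := by
    calc n i ^ s * X ≤ 2 ^ S * (sobW s (i - k) + n k ^ s) * X := by gcongr; exact hpow hs hsS
      _ = 2 ^ S * (sobW s (i - k) * X + n k ^ s * X) := by ring
      _ ≤ 2 ^ S * ((Λ * δ + δ * n k ^ s) + n k ^ s * δ) := by gcongr
      _ = _ := by ring
  have f2 : n i ^ s' * X ≤ 2 ^ S * (3 * δ * n k ^ s') := by
    calc n i ^ s' * X ≤ 2 ^ S * (sobW s' (i - k) + n k ^ s') * X := by gcongr; exact hpow hs' hs'S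
      _ = 2 ^ S * (sobW s' (i - k) * X + n k ^ s' * X) := by ring
      _ ≤ 2 ^ S * ((δ + δ * n k ^ s') + n k ^ s' * δ) := by gcongr
      _ ≤ _ := by gcongr; nlinarith
  have hWk : 0 < n k ^ s + Λ * n k ^ s' := by positivity
  have hfin : (n i ^ s + Λ * n i ^ s') * X ≤ 5 * 2 ^ S * δ * (n k ^ s + Λ * n k ^ s') := by
    calc (n i ^ s + Λ * n i ^ s') * X = n i ^ s * X + Λ * (n i ^ s' * X) := by ring
      _ ≤ 2 ^ S * (Λ * δ + 2 * δ * n k ^ s) + Λ * (2 ^ S * (3 * δ * n k ^ s')) := by gcongr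
      _ ≤ 2 ^ S * (Λ * δ * n k ^ s' + 2 * δ * n k ^ s) + Λ * (2 ^ S * (3 * δ * n k ^ s')) := by
          have : Λ * δ ≤ Λ * δ * n k ^ s' := le_mul_of_one_le_right (by positivity) hks
          gcongr
      _ = 2 ^ S * δ * (4 * (Λ * n k ^ s') + 2 * n k ^ s) := by ring
      _ ≤ 2 ^ S * δ * (5 * (Λ * n k ^ s') + 5 * n k ^ s) := by
          have : 0 ≤ Λ * n k ^ s' := by positivity
          gcongr <;> norm_num
      _ = _ := by ring
  calc _ = (n i ^ s + Λ * n i ^ s') * X / (n k ^ s + Λ * n k ^ s') := by rw [hX]; ring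
    _ ≤ _ := by rwa [div_le_iff₀ hWk]

theorem japLJ_le_mul (i k : Idx ν) :
    japLJ k.1 k.2 ≤ 2 * japLJ (i - k).1 (i - k).2 * japLJ i.1 i.2 := by
  have h1 := japLJ_add_le (k - i) i
  rw [sub_add_cancel, japLJ_sub_comm] at h1
  have h2 := one_le_japLJ (i - k).1 (i - k).2
  have h3 := one_le_japLJ i.1 i.2
  nlinarith

/-- Decay in the weight `W(i) / ⟨i⟩`. -/
theorem Decays.div_japLJ {W : Idx ν → ℝ} (hW : ∀ i, 0 < W i) {B : ℕ} {D : ℝ} {M : TMat ν}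
    (h : Decays W (B + 1) D M) : Decays (fun i => W i / japLJ i.1 i.2) B (2 * D) M := by
  intro i k hi hk
  have h1 := h i k hi hk
  have hWi := hW i
  have hWk := hW k
  have hJ := japLJ_pos (i - k).1 (i - k).2
  have hi0 := japLJ_pos i.1 i.2
  have hk0 := japLJ_pos k.1 k.2
  have hj := jap_pos k.2
  have h2 : japLJ k.1 k.2 / japLJ i.1 i.2 ≤ 2 * japLJ (i - k).1 (i - k).2 := by
    rw [div_le_iff₀ hi0]; exact japLJ_le_mul i k
  calc _ = japLJ (i - k).1 (i - k).2 ^ B * (W i / W k) * (japLJ k.1 k.2 / japLJ i.1 i.2) *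
        jap k.2 * ‖M i.2 k.2 (i.1 - k.1)‖ := by
        field_simp
    _ ≤ japLJ (i - k).1 (i - k).2 ^ B * (W i / W k) * (2 * japLJ (i - k).1 (i - k).2) *
        jap k.2 * ‖M i.2 k.2 (i.1 - k.1)‖ := by gcongr
    _ = 2 * (japLJ (i - k).1 (i - k).2 ^ (B + 1) * (W i / W k) * jap k.2 *
        ‖M i.2 k.2 (i.1 - k.1)‖) := by ring
    _ ≤ _ := by gcongr

theorem TameDecay.add {B : ℕ} {s a₁ a₀ a₁' a₀' : ℝ} {M M' : TMat ν} (h : TameDecay B s a₁ a₀ M)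
    (h' : TameDecay B s a₁' a₀' M') : TameDecay B s (a₁ + a₁') (a₀ + a₀') (M + M') := by
  intro i k hi hk
  have h1 := h i k hi hk
  have h2 := h' i k hi hk
  have h3 := sobW_pos s (i - k)
  have hJ := japLJ_pos (i - k).1 (i - k).2
  have hj := jap_pos k.2
  calc _ ≤ sobW s (i - k) * (japLJ (i - k).1 (i - k).2 ^ B * jap k.2 *
        (‖M i.2 k.2 (i.1 - k.1)‖ + ‖M' i.2 k.2 (i.1 - k.1)‖)) := by
        gcongr; exact norm_add_le _ _
    _ ≤ _ := by linarith

theorem TameDecay.mono {B : ℕ} {s a₁ a₀ a₁' a₀' : ℝ} {M : TMat ν} (h : TameDecay B s a₁ a₀ M)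
    (h1 : a₁ ≤ a₁') (h0 : a₀ ≤ a₀') : TameDecay B s a₁' a₀' M := fun i k hi hk =>
  (h i k hi hk).trans (by
    have : (0 : ℝ) ≤ jap k.2 ^ s := Real.rpow_nonneg (jap_pos _).le _
    gcongr)

theorem Decays.add_one {B : ℕ} {D D' : ℝ} {M M' : TMat ν} (h : Decays (fun _ => 1) B D M)
    (h' : Decays (fun _ => 1) B D' M') : Decays (fun _ => 1) B (D + D') (M + M') := by
  intro i k hi hk
  have h1 := h i k hi hk
  have h2 := h' i k hi hk
  have hJ := japLJ_pos (i - k).1 (i - k).2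
  have hj := jap_pos k.2
  calc _ ≤ japLJ (i - k).1 (i - k).2 ^ B * (1 / 1) * jap k.2 *
        (‖M i.2 k.2 (i.1 - k.1)‖ + ‖M' i.2 k.2 (i.1 - k.1)‖) := by
        gcongr; exact norm_add_le _ _
    _ ≤ _ := by linarith

end Decay

/-! ### Decay of the entries of pseudo-differential operators -/

section Symbols

variable {ν : ℕ}

theorem IsSymbol.continuous {m : ℝ} {a : Symb ν} (ha : IsSymbol m a) (ξ : ℝ) :
    Continuous fun q : (Fin ν → ℝ) × ℝ => a q.1 q.2 ξ :=
  ha.1.continuous.comp (f := fun q : (Fin ν → ℝ) × ℝ => (q.1, q.2, ξ)) (by fun_prop)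

theorem torusCoeff_sub {f g : (Fin ν → ℝ) → ℝ → ℂ}
    (hf : Continuous fun q : (Fin ν → ℝ) × ℝ => f q.1 q.2)
    (hg : Continuous fun q : (Fin ν → ℝ) × ℝ => g q.1 q.2) (l : Fin ν → ℤ) (j : ℤ) :
    torusCoeff (fun φ x => f φ x - g φ x) l j = torusCoeff f l j - torusCoeff g l j := by
  set E : (Fin ν → ℝ) → ℝ → ℂ := fun φ x =>
    Complex.exp (-(Complex.I * (((∑ i, (l i : ℝ) * φ i) + (j : ℝ) * x : ℝ) : ℂ))) with hE
  have hEc : Continuous fun q : (Fin ν → ℝ) × ℝ => E q.1 q.2 := by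
    simp only [hE]; fun_prop
  have key : ∀ {h : (Fin ν → ℝ) → ℝ → ℂ}, (Continuous fun q : (Fin ν → ℝ) × ℝ => h q.1 q.2) →
      (∀ φ, IntervalIntegrable (fun x => h φ x * E φ x) MeasureTheory.volume 0 (2 * Real.pi)) ∧
      MeasureTheory.IntegrableOn (fun φ => ∫ x in (0 : ℝ)..(2 * Real.pi), h φ x * E φ x)
        (Set.Icc (0 : Fin ν → ℝ) (fun _ => 2 * Real.pi)) := by
    intro h hh
    have hc : Continuous fun q : (Fin ν → ℝ) × ℝ => h q.1 q.2 * E q.1 q.2 := hh.mul hEc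
    refine ⟨fun φ => ?_, ?_⟩
    · have : Continuous fun x => h φ x * E φ x :=
        hc.comp (f := fun x : ℝ => (φ, x)) (by fun_prop)
      exact this.intervalIntegrable _ _
    · have : Continuous fun φ => ∫ x in (0 : ℝ)..(2 * Real.pi), h φ x * E φ x :=
        intervalIntegral.continuous_parametric_intervalIntegral_of_continuous' hc _ _
      exact this.continuousOn.integrableOn_compact isCompact_Icc
  rw [torusCoeff, torusCoeff, torusCoeff, ← mul_sub,
    ← MeasureTheory.integral_sub (key hf).2 (key hg).2]
  congr 1
  refine MeasureTheory.integral_congr_ae (Filter.Eventually.of_forall fun φ => ?_)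
  change ∫ x in (0 : ℝ)..(2 * Real.pi), (f φ x - g φ x) * E φ x =
    (∫ x in (0 : ℝ)..(2 * Real.pi), f φ x * E φ x) - ∫ x in (0 : ℝ)..(2 * Real.pi), g φ x * E φ x
  rw [← intervalIntegral.integral_sub ((key hf).1 φ) ((key hg).1 φ)]
  simp only [sub_mul]

theorem opMat_sub {m m' : ℝ} {a a' : Symb ν} (ha : IsSymbol m a) (ha' : IsSymbol m' a') :
    opMat (a - a') = opMat a - opMat a' := by
  funext j j' l
  exact torusCoeff_sub (ha.continuous j') (ha'.continuous j') l (j - j')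

theorem opMat_entry_le {p N : ℝ} (hN : 0 ≤ N) {a : Symb ν}
    (h : symNorm (-1) p 0 a ≤ ENNReal.ofReal N) (j j' : ℤ) (l : Fin ν → ℤ) :
    sobW p (l, j - j') * jap j' * ‖opMat a j j' l‖ ≤ N := by
  have h1 : hsNorm p (torusCoeff fun φ x => a φ x (j' : ℝ)) * ENNReal.ofReal (jap j') ≤
      ENNReal.ofReal N := by
    refine le_trans ?_ h
    have h2 := le_iSup₂_of_le (f := fun (β : ℕ) (_ : β ≤ 0) => ⨆ ξ : ℝ,
      hsNorm p (torusCoeff fun φ x => iteratedDeriv β (fun ζ => a φ x ζ) ξ) *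
      ENNReal.ofReal (jap ξ ^ (-(-1 : ℝ) + β))) 0 le_rfl (le_iSup_of_le (j' : ℝ) le_rfl)
    simpa [symNorm] using h2
  have h3 := le_wNorm (sobW p) (fun q => ‖flat (torusCoeff fun φ x => a φ x (j' : ℝ)) q‖ₑ) (l, j - j')
  rw [← hsNorm_eq] at h3
  have h4 := (mul_le_mul' h3 (le_refl (ENNReal.ofReal (jap j')))).trans h1
  have hp := sobW_pos p (l, j - j')
  have hj := jap_pos j'
  rw [← ofReal_norm, ← ENNReal.ofReal_mul hp.le, ← ENNReal.ofReal_mul (by positivity),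
    ENNReal.ofReal_le_ofReal_iff hN] at h4
  calc _ = sobW p (l, j - j') * ‖flat (torusCoeff fun φ x => a φ x (j' : ℝ)) (l, j - j')‖ *
        jap j' := by rw [flat, opMat]; ring
    _ ≤ N := h4

theorem sobW_natCast (B : ℕ) (q : Idx ν) : sobW (B : ℝ) q = japLJ q.1 q.2 ^ B :=
  Real.rpow_natCast _ _

theorem tameDecay_opMat {s N : ℝ} {B : ℕ} (hN : 0 ≤ N) {a : Symb ν}
    (h : symNorm (-1) (s + B) 0 a ≤ ENNReal.ofReal N) : TameDecay B s N 0 (opMat a) := by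
  intro i k _ _
  have := opMat_entry_le hN h i.2 k.2 (i.1 - k.1)
  rw [sobW_add, sobW_natCast] at this
  rw [zero_mul, add_zero]
  calc _ = sobW s (i.1 - k.1, i.2 - k.2) * japLJ (i.1 - k.1, i.2 - k.2).1 (i.1 - k.1, i.2 - k.2).2 ^ B *
      jap k.2 * ‖opMat a i.2 k.2 (i.1 - k.1)‖ := by
        simp only [Prod.fst_sub, Prod.snd_sub]
        rw [← mul_assoc, ← mul_assoc]; rfl
    _ ≤ N := this

theorem TameDecay.decays_one {s a : ℝ} (hs : 0 ≤ s) {B : ℕ} {M : TMat ν}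
    (h : TameDecay B s a 0 M) : Decays (fun _ => 1) B a M := by
  intro i k hi hk
  have h1 := h i k hi hk
  rw [zero_mul, add_zero] at h1
  have h2 : 1 ≤ sobW s (i - k) := Real.one_le_rpow (one_le_japLJ _ _) hs
  have hJ := japLJ_pos (i - k).1 (i - k).2
  have hj := jap_pos k.2
  rw [div_one, mul_one]
  refine le_trans (le_mul_of_one_le_left (by positivity) h2) h1

end Symbols

/-! ### Decay of the entries of smoothing operators -/

section Smoothing

variable {ν : ℕ}

/-- The real function `z e^{i j' x} + c.c.` -/
def testFn (z : ℂ) (j' : ℤ) : Coeffs ν := fun l j =>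
  (if (l, j) = (0, j') then z else 0) + if (l, j) = (0, -j') then conj z else 0

theorem wNorm_single {ι : Type*} [DecidableEq ι] (W : ι → ℝ) (q₀ : ι) (x : ℝ≥0∞) :
    wNorm W (fun q => if q = q₀ then x else 0) = ENNReal.ofReal (W q₀) * x := by
  rw [wNorm, tsum_eq_single q₀]
  · simp only [if_true]; rw [sqrt_sq_eq]
  · intro q hq; simp [hq]

theorem hsNorm_testFn_le (s : ℝ) {z : ℂ} (hz : ‖z‖ = 1) (j' : ℤ) :
    hsNorm s (testFn z j' : Coeffs ν) ≤ ENNReal.ofReal (4 * jap j' ^ s) := by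
  have hz' : ‖z‖ₑ = 1 := by rw [← ofReal_norm, hz, ENNReal.ofReal_one]
  have hz'' : ‖conj z‖ₑ = 1 := by rw [← ofReal_norm, RCLike.norm_conj, hz, ENNReal.ofReal_one]
  rw [hsNorm_eq]
  refine (wNorm_le_add (W' := sobW s) (W'' := sobW s)
    (v' := fun q : Idx ν => if q = (0, j') then 1 else 0)
    (v'' := fun q : Idx ν => if q = (0, -j') then 1 else 0) fun q => ?_).trans ?_
  · rw [← mul_add]
    refine mul_le_mul' le_rfl ?_
    rw [flat, testFn]
    refine (enorm_add_le _ _).trans (add_le_add ?_ ?_)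
    · split_ifs with h <;> simp [hz']
    · split_ifs with h
      · rw [hz'']
      · simp
  · rw [wNorm_single, wNorm_single, mul_one, mul_one]
    have h1 : ∀ j : ℤ, sobW s ((0, j) : Idx ν) = jap j ^ s := fun j => by
      rw [sobW, japLJ, jap]; congr 2; simp [absL]
    have h2 : jap ((-j' : ℤ) : ℝ) = jap j' := by simp [jap]
    have h3 : (0 : ℝ) ≤ jap j' ^ s := Real.rpow_nonneg (jap_pos _).le _
    rw [h1, h1, h2, ← ENNReal.ofReal_add h3 h3, ← ENNReal.ofReal_ofNat,
      ← ENNReal.ofReal_mul (by norm_num)]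
    refine ENNReal.ofReal_le_ofReal (by linarith)

theorem memH_testFn (s : ℝ) {z : ℂ} (hz : ‖z‖ = 1) {j' : ℤ} (hj' : j' ≠ 0) :
    MemH s (testFn z j' : Coeffs ν) := by
  refine ⟨fun l j => ?_, fun l => ?_, (hsNorm_testFn_le s hz j').trans_lt ENNReal.ofReal_lt_top⟩
  · simp only [testFn, Prod.mk.injEq, map_add, neg_eq_zero, neg_inj]
    rw [add_comm]
    congr 1
    · by_cases h : l = 0 ∧ j = -j'
      · simp [h]
      · have h2 : ¬(l = 0 ∧ -j = j') := fun h2 => h ⟨h2.1, by omega⟩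
        simp only [if_neg h, if_neg h2, map_zero]
    · split_ifs <;> simp
  · have h1 : ¬((l, (0 : ℤ)) = ((0 : Fin ν → ℤ), j')) := by simp [hj'.symm]
    have h2 : ¬((l, (0 : ℤ)) = ((0 : Fin ν → ℤ), -j')) := by
      simp only [Prod.mk.injEq, not_and]; intro _; omega
    simp only [testFn, if_neg h1, if_neg h2, add_zero]

theorem act_testFn (A : TMat ν) (z : ℂ) {j j' : ℤ} (hj : j ≠ 0) (l : Fin ν → ℤ) :
    act A (testFn z j') l j = A j j' l * z + A j (-j') l * conj z := by
  rw [act, if_neg hj]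
  have h1 : ∀ (m : ℤ) (x : ℂ), HasSum (fun q : Idx ν =>
      A j q.2 (l - q.1) * if (q.1, q.2) = (0, m) then x else 0) (A j m l * x) := fun m x => by
    have := hasSum_single (f := fun q : Idx ν =>
      A j q.2 (l - q.1) * if (q.1, q.2) = (0, m) then x else 0) (0, m) fun q hq => by
        rw [if_neg hq, mul_zero]
    simpa using this
  rw [← ((h1 j' z).add (h1 (-j') (conj z))).tsum_eq]
  exact tsum_congr fun q => by rw [testFn, mul_add]

theorem entry_le_of_test {A : TMat ν} {s N : ℝ} (hN : 0 ≤ N) {j j' : ℤ} (hj : j ≠ 0)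
    (h : ∀ z : ℂ, ‖z‖ = 1 → hsNorm s (act A (testFn z j')) ≤ ENNReal.ofReal N) (l : Fin ν → ℤ) :
    sobW s (l, j) * ‖A j j' l‖ ≤ N := by
  have h1 : ∀ z : ℂ, ‖z‖ = 1 → sobW s (l, j) * ‖A j j' l * z + A j (-j') l * conj z‖ ≤ N := by
    intro z hz
    have h2 := (le_wNorm (sobW s) (fun q => ‖flat (act A (testFn z j')) q‖ₑ) (l, j))
    rw [← hsNorm_eq] at h2
    replace h2 := h2.trans (h z hz)
    rw [← ofReal_norm, ← ENNReal.ofReal_mul (sobW_pos _ _).le, ENNReal.ofReal_le_ofReal_iff hN,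
      flat, act_testFn A z hj] at h2
    exact h2
  have e1 := h1 1 (by simp)
  have e2 := h1 Complex.I (by simp)
  have h3 : ‖A j j' l‖ * 2 ≤ ‖A j j' l * 1 + A j (-j') l * conj (1 : ℂ)‖ +
      ‖A j j' l * Complex.I + A j (-j') l * conj Complex.I‖ := by
    have h4 : A j j' l * 2 = (A j j' l * 1 + A j (-j') l * conj (1 : ℂ)) -
        Complex.I * (A j j' l * Complex.I + A j (-j') l * conj Complex.I) := by
      rw [map_one, Complex.conj_I]
      linear_combination (A j j' l - A j (-j') l) * Complex.I_mul_I
    have h5 : ‖A j j' l * 2‖ = ‖A j j' l‖ * 2 := by rw [norm_mul]; norm_num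
    rw [← h5, h4]
    refine (norm_sub_le _ _).trans (add_le_add le_rfl ?_)
    rw [norm_mul, Complex.norm_I, one_mul]
  have hp := sobW_pos s (l, j)
  nlinarith

/-- Bounds on the entries of a smoothing operator. -/
def SmoothEntries (B E : ℕ) (s : ℝ) (N : ℤ → ℝ) (A : TMat ν) : Prop :=
  ∀ (j j' : ℤ) (l : Fin ν → ℤ), j ≠ 0 → j' ≠ 0 →
    sobW s (l, j) * (japLJ l (j - j') ^ B * jap j' ^ E * ‖A j j' l‖) ≤ N j'

theorem exists_japLJ_le {B : ℕ} (l : Fin ν → ℤ) (j j' : ℤ) :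
    japLJ l (j - j') ^ B ≤ ((ν : ℝ) + 2) ^ B * (jap j' ^ B * jap j ^ B) ∨
      ∃ i, japLJ l (j - j') ^ B ≤ ((ν : ℝ) + 2) ^ B * (jap j' ^ B * |(l i : ℝ)| ^ B) := by
  have h1 := one_le_jap j
  have h2 := one_le_jap j'
  have hν : (0 : ℝ) ≤ ν := Nat.cast_nonneg _
  have hJ := japLJ_pos l (j - j')
  by_cases hc : japLJ l (j - j') ≤ ((ν : ℝ) + 2) * (jap j' * jap j)
  · left
    calc _ ≤ (((ν : ℝ) + 2) * (jap j' * jap j)) ^ B := pow_le_pow_left₀ hJ.le hc B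
      _ = _ := by rw [mul_pow, mul_pow]
  · right
    push Not at hc
    have h12 : 1 ≤ jap j' * jap j := one_le_mul_of_one_le_of_one_le h2 h1
    have hsub : |((j - j' : ℤ) : ℝ)| ≤ 2 * (jap j' * jap j) := by
      have h3 : |(j : ℝ)| ≤ jap j := le_max_right _ _
      have h4 : |(j' : ℝ)| ≤ jap j' := le_max_right _ _
      rw [Int.cast_sub]
      refine (abs_sub _ _).trans ?_
      nlinarith
    have habs : japLJ l (j - j') = absL l := by
      have h5 : ((ν : ℝ) + 2) * (jap j' * jap j) ≥ 2 * (jap j' * jap j) := by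
        nlinarith [mul_nonneg hν (zero_le_one.trans h12)]
      rw [japLJ] at hc ⊢
      rcases le_total (absL l) |((j - j' : ℤ) : ℝ)| with h6 | h6
      · rw [max_eq_right h6] at hc
        rcases max_choice 1 |((j - j' : ℤ) : ℝ)| with h7 | h7 <;> rw [h7] at hc <;> linarith
      · rw [max_eq_left h6] at hc ⊢
        rcases max_choice 1 (absL l) with h7 | h7
        · rw [h7] at hc; linarith
        · exact h7
    have hpos : 0 < absL l := habs ▸ hJ
    have hne : (Finset.univ : Finset (Fin ν)).Nonempty := by
      rw [Finset.univ_nonempty_iff]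
      by_contra hem
      rw [not_nonempty_iff] at hem
      simp [absL] at hpos
    obtain ⟨i, _, hi⟩ := Finset.exists_max_image Finset.univ (fun i => |(l i : ℝ)|) hne
    refine ⟨i, ?_⟩
    have h8 : absL l ≤ ν * |(l i : ℝ)| := by
      have := Finset.sum_le_card_nsmul Finset.univ (fun i => |(l i : ℝ)|) _ hi
      simpa [absL] using this
    have h9 : japLJ l (j - j') ≤ ((ν : ℝ) + 2) * (jap j' * |(l i : ℝ)|) := by
      rw [habs]
      have := abs_nonneg (l i : ℝ)
      have : |(l i : ℝ)| ≤ jap j' * |(l i : ℝ)| := le_mul_of_one_le_left this h2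
      nlinarith
    calc _ ≤ (((ν : ℝ) + 2) * (jap j' * |(l i : ℝ)|)) ^ B := pow_le_pow_left₀ hJ.le h9 B
      _ = _ := by rw [mul_pow, mul_pow]

theorem smoothEntries_of_test {A : TMat ν} {s : ℝ} {B E : ℕ} {N : ℤ → ℝ} (hN : ∀ j, 0 ≤ N j)
    (h0 : ∀ j', j' ≠ 0 → ∀ z : ℂ, ‖z‖ = 1 →
      hsNorm s (act (wDx B ((E + B : ℕ) : ℝ) (dPhi 0 A)) (testFn z j')) ≤ ENNReal.ofReal (N j'))
    (hi : ∀ i, ∀ j', j' ≠ 0 → ∀ z : ℂ, ‖z‖ = 1 →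
      hsNorm s (act (wDx 0 ((E + B : ℕ) : ℝ) (dPhi (Pi.single i B) A)) (testFn z j')) ≤
        ENNReal.ofReal (N j')) :
    SmoothEntries B E s (fun j' => ((ν : ℝ) + 2) ^ B * N j') A := by
  intro j j' l hj hj'
  have hjp := jap_pos j
  have hjp' := jap_pos j'
  have hp := sobW_pos s (l, j)
  have hν : (0 : ℝ) ≤ ν := Nat.cast_nonneg _
  rcases exists_japLJ_le (B := B) l j j' with hc | ⟨i, hc⟩
  · have h1 := entry_le_of_test (hN j') hj (h0 j' hj') l
    have h2 : ‖wDx B ((E + B : ℕ) : ℝ) (dPhi 0 A) j j' l‖ =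
        jap j ^ B * ‖A j j' l‖ * jap j' ^ (E + B) := by
      rw [wDx, norm_mul, norm_mul, Complex.norm_real, Complex.norm_real, dPhi,
        Real.rpow_natCast, Real.rpow_natCast, Real.norm_of_nonneg (by positivity),
        Real.norm_of_nonneg (by positivity)]
      simp
    rw [h2] at h1
    calc _ ≤ sobW s (l, j) * (((ν : ℝ) + 2) ^ B * (jap j' ^ B * jap j ^ B) * jap j' ^ E *
          ‖A j j' l‖) := by gcongr
      _ = ((ν : ℝ) + 2) ^ B * (sobW s (l, j) * (jap j ^ B * ‖A j j' l‖ * jap j' ^ (E + B))) := by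
          ring
      _ ≤ _ := mul_le_mul_of_nonneg_left h1 (by positivity)
  · have h1 := entry_le_of_test (hN j') hj (hi i j' hj') l
    have h3 : ‖∏ i', (Complex.I * (l i' : ℂ)) ^ (Pi.single i B : Fin ν → ℕ) i'‖ =
        |(l i : ℝ)| ^ B := by
      rw [Finset.prod_eq_single i]
      · rw [Pi.single_eq_same, norm_pow, norm_mul, Complex.norm_I, one_mul, Complex.norm_intCast]
      · intro i' _ hne; rw [Pi.single_eq_of_ne hne, pow_zero]
      · intro hne; exact absurd (Finset.mem_univ i) hne
    have h2 : ‖wDx 0 ((E + B : ℕ) : ℝ) (dPhi (Pi.single i B) A) j j' l‖ =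
        |(l i : ℝ)| ^ B * ‖A j j' l‖ * jap j' ^ (E + B) := by
      rw [wDx, norm_mul, norm_mul, Complex.norm_real, Complex.norm_real, dPhi,
        Real.rpow_natCast, Real.rpow_zero, norm_one, one_mul, Real.norm_of_nonneg (by positivity),
        norm_mul, h3]
    rw [h2] at h1
    calc _ ≤ sobW s (l, j) * (((ν : ℝ) + 2) ^ B * (jap j' ^ B * |(l i : ℝ)| ^ B) * jap j' ^ E *
          ‖A j j' l‖) := by gcongr
      _ = ((ν : ℝ) + 2) ^ B * (sobW s (l, j) *
          (|(l i : ℝ)| ^ B * ‖A j j' l‖ * jap j' ^ (E + B))) := by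
          ring
      _ ≤ _ := mul_le_mul_of_nonneg_left h1 (by positivity)

theorem SmoothEntries.smul {B E : ℕ} {s : ℝ} {N N' : ℤ → ℝ} {A : TMat ν}
    (h : SmoothEntries B E s N A) {c : ℝ} (hc : 0 ≤ c) (hN : ∀ j, c * N j ≤ N' j) :
    SmoothEntries B E s N' ((c : ℂ) • A) := by
  intro j j' l hj hj'
  have h1 := mul_le_mul_of_nonneg_left (h j j' l hj hj') hc
  refine le_trans (le_of_eq ?_) (h1.trans (hN j'))
  simp only [Pi.smul_apply, smul_eq_mul, norm_mul, Complex.norm_real, Real.norm_of_nonneg hc]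
  ring

theorem SmoothEntries.decays {B E n : ℕ} (hE : n + 1 ≤ E) {s : ℝ} (hs : 0 ≤ s) {C : ℝ}
    {A : TMat ν} (h : SmoothEntries B E s (fun j' => C * jap j' ^ n) A) :
    Decays (fun _ => 1) B C A := by
  intro i k hi hk
  have h1 := h i.2 k.2 (i.1 - k.1) hi hk
  have hj := one_le_jap k.2
  have hj0 := jap_pos k.2
  have hJ := japLJ_pos (i.1 - k.1) (i.2 - k.2)
  have h2 : 1 ≤ sobW s (i.1 - k.1, i.2) := Real.one_le_rpow (one_le_japLJ _ _) hs
  rw [div_one, mul_one]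
  refine le_of_mul_le_mul_right ?_ (pow_pos hj0 n)
  refine le_trans ?_ h1
  calc japLJ (i - k).1 (i - k).2 ^ B * jap k.2 * ‖A i.2 k.2 (i.1 - k.1)‖ * jap k.2 ^ n
      = 1 * (japLJ (i.1 - k.1) (i.2 - k.2) ^ B * jap k.2 ^ (n + 1) *
        ‖A i.2 k.2 (i.1 - k.1)‖) := by
        rw [Prod.fst_sub, Prod.snd_sub]; ring
    _ ≤ _ := by
        gcongr

theorem SmoothEntries.tameDecay {B E n : ℕ} (hE : n + 1 ≤ E) {s : ℝ} (hs : 0 ≤ s)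
    {A₁ A₀ δ : ℝ} {A : TMat ν}
    (h : SmoothEntries B E s (fun j' => (A₁ + A₀ * jap j' ^ s) * jap j' ^ n) A)
    (hd : Decays (fun _ => 1) B δ A) : TameDecay B s (2 ^ s * A₁) (2 ^ s * (A₀ + δ)) A := by
  intro i k hi hk
  have h1 := h i.2 k.2 (i.1 - k.1) hi hk
  have h0 := hd i k hi hk
  rw [div_one, mul_one] at h0
  have hj := one_le_jap k.2
  have hj0 := jap_pos k.2
  have hJ := japLJ_pos (i.1 - k.1) (i.2 - k.2)
  have hJi := japLJ_pos (i.1 - k.1) i.2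
  set X := japLJ (i - k).1 (i - k).2 ^ B * jap k.2 * ‖A i.2 k.2 (i.1 - k.1)‖ with hX
  have hJ' : 0 < japLJ (i - k).1 (i - k).2 := hJ
  have hX0 : 0 ≤ X := by positivity
  have h2 : sobW s (i.1 - k.1, i.2) * X ≤ A₁ + A₀ * jap k.2 ^ s := by
    refine le_of_mul_le_mul_right ?_ (pow_pos hj0 n)
    refine le_trans ?_ h1
    have hp := sobW_pos s (i.1 - k.1, i.2)
    calc sobW s (i.1 - k.1, i.2) * X * jap k.2 ^ n
        = sobW s (i.1 - k.1, i.2) * (japLJ (i.1 - k.1) (i.2 - k.2) ^ B * jap k.2 ^ (n + 1) *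
          ‖A i.2 k.2 (i.1 - k.1)‖) := by
          rw [hX, Prod.fst_sub, Prod.snd_sub]; ring
      _ ≤ _ := by gcongr
  have h3 : sobW s (i - k) ≤ 2 ^ s * (sobW s (i.1 - k.1, i.2) + jap k.2 ^ s) := by
    have h4 : japLJ (i - k).1 (i - k).2 ≤ japLJ (i.1 - k.1) i.2 + jap k.2 := by
      have e1 := one_le_japLJ (i.1 - k.1) i.2
      have e2 := absL_le_japLJ (i.1 - k.1) i.2
      have e3 := abs_le_japLJ (i.1 - k.1) i.2
      have e4 : |(k.2 : ℝ)| ≤ jap k.2 := le_max_right _ _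
      refine max_le (by linarith) (max_le (by rw [Prod.fst_sub]; linarith) ?_)
      rw [Prod.snd_sub, Int.cast_sub]
      exact (abs_sub _ _).trans (by linarith)
    exact (Real.rpow_le_rpow hJ'.le h4 hs).trans (add_rpow_le_two_rpow hJi.le hj0.le hs)
  have h5 : (0 : ℝ) ≤ jap k.2 ^ s := Real.rpow_nonneg hj0.le _
  have h6 : (0 : ℝ) ≤ 2 ^ s := by positivity
  calc sobW s (i - k) * X ≤ 2 ^ s * (sobW s (i.1 - k.1, i.2) + jap k.2 ^ s) * X := by gcongr
    _ = 2 ^ s * (sobW s (i.1 - k.1, i.2) * X + jap k.2 ^ s * X) := by ring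
    _ ≤ 2 ^ s * ((A₁ + A₀ * jap k.2 ^ s) + jap k.2 ^ s * δ) := by gcongr
    _ = _ := by ring

end Smoothing

/-! ### Bounds on the remainders -/

section Remainders

variable {ν : ℕ}

/-- The decay of the entries in all the weights used for the iteration. -/
structure TameEntries (B : ℕ) (s δ Λ : ℝ) (M : TMat ν) : Prop where
  base : Decays (fun _ => 1) B δ M
  high : TameDecay B s (Λ * δ) δ M
  low : TameDecay B (sZero ν) δ δ M

theorem sZero_nonneg (ν : ℕ) : 0 ≤ sZero ν := Nat.cast_nonneg _

theorem le_of_lip_le {γ d y : ℝ} (hγ : 0 < γ) (hd : 0 < d) {x : ℝ≥0∞}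
    (h : ENNReal.ofReal γ * (x / ENNReal.ofReal d) ≤ ENNReal.ofReal y) :
    x ≤ ENNReal.ofReal (y * (d / γ)) := by
  have hg : ENNReal.ofReal γ ≠ 0 := by simpa using hγ
  have hd' : ENNReal.ofReal d ≠ 0 := by simpa using hd
  rw [ENNReal.ofReal_mul' (by positivity), ENNReal.ofReal_div_of_pos hγ]
  calc x = ENNReal.ofReal γ * (x / ENNReal.ofReal d) * (ENNReal.ofReal d / ENNReal.ofReal γ) := by
        rw [ENNReal.div_eq_inv_mul, ENNReal.div_eq_inv_mul]
        calc x = (ENNReal.ofReal γ * (ENNReal.ofReal γ)⁻¹) *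
              ((ENNReal.ofReal d)⁻¹ * ENNReal.ofReal d) * x := by
              rw [ENNReal.mul_inv_cancel hg ENNReal.ofReal_ne_top,
                ENNReal.inv_mul_cancel hd' ENNReal.ofReal_ne_top, one_mul, one_mul]
          _ = _ := by ring
    _ ≤ _ := mul_le_mul' h le_rfl

theorem SmoothingTame.smoothEntries {γ S : ℝ} {O : Set (Freq ν)} {ρ B E : ℕ}
    {A : Freq ν → TMat ν} {M : ℝ → ℝ≥0∞} (hγ : 0 < γ) (h : SmoothingTame γ O S ρ A M)
    (hE : E + 2 * B = ρ) (hE2 : 2 ≤ E) {s M₀ M₁ : ℝ} (hs : sZero ν ≤ s) (hsS : s + 1 ≤ S)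
    (hM₀ : 0 ≤ M₀) (hM₁ : 0 ≤ M₁) (h₀ : M (sZero ν) ≤ ENNReal.ofReal M₀)
    (h₁ : M (s + 1) ≤ ENNReal.ofReal M₁) :
    (∀ w ∈ O, SmoothEntries B E s (fun j' => ((ν : ℝ) + 2) ^ B *
      ((4 * M₁ + 4 * M₀ * jap j' ^ s) * jap j' ^ (ν / 2 + 3 + 1))) (A w)) ∧
    ∀ w ∈ O, ∀ w' ∈ O, ∀ c : ℝ, 0 ≤ c → c * dist w w' ≤ γ →
      SmoothEntries B E s (fun j' => ((ν : ℝ) + 2) ^ B *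
        ((4 * M₁ + 4 * M₀ * jap j' ^ s) * jap j' ^ (ν / 2 + 3 + 1))) ((c : ℂ) • (A w - A w')) := by
  set N : ℤ → ℝ := fun j' => (4 * M₁ + 4 * M₀ * jap j' ^ s) * jap j' ^ (ν / 2 + 3 + 1) with hN
  have hp : ∀ j' : ℤ, (0 : ℝ) ≤ jap j' ^ s := fun j' => Real.rpow_nonneg (jap_pos _).le _
  have hN0 : ∀ j', 0 ≤ N j' := fun j' => by
    have := hp j'
    have := jap_pos j'
    positivity
  have hbound : ∀ σ, σ = s ∨ σ = s + 1 → ∀ (j' : ℤ) (z : ℂ), ‖z‖ = 1 →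
      M σ * hsNorm (sZero ν) (testFn z j' : Coeffs ν) + M (sZero ν) * hsNorm σ (testFn z j' : Coeffs ν) ≤
        ENNReal.ofReal (N j') := by
    intro σ hσ j' z hz
    have hMσ : M σ ≤ ENNReal.ofReal M₁ := by
      rcases hσ with rfl | rfl
      · refine le_trans ?_ h₁
        exact ((h 0 (by simp; omega) ρ 0 (Nat.cast_nonneg _) le_rfl).1 (by simp)).1
          ⟨hs, by linarith⟩ ⟨by linarith, hsS⟩ (by linarith)
      · exact h₁
    have hj1 := one_le_jap j'
    have hj := jap_pos j'
    have hσs : jap j' ^ σ ≤ jap j' ^ s * jap j' := by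
      rw [← Real.rpow_add_one hj.ne']
      refine Real.rpow_le_rpow_of_exponent_le hj1 ?_
      rcases hσ with rfl | rfl <;> linarith
    have hn1 : jap j' ≤ jap j' ^ (ν / 2 + 3 + 1) := le_self_pow₀ hj1 (by omega)
    have hn0 : jap j' ^ sZero ν ≤ jap j' ^ (ν / 2 + 3 + 1) := by
      rw [sZero, Real.rpow_natCast]
      exact pow_le_pow_right₀ hj1 (by omega)
    have hq := hp j'
    calc _ ≤ ENNReal.ofReal M₁ * ENNReal.ofReal (4 * jap j' ^ sZero ν) +
          ENNReal.ofReal M₀ * ENNReal.ofReal (4 * jap j' ^ σ) :=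
          add_le_add (mul_le_mul' hMσ (hsNorm_testFn_le _ hz j'))
            (mul_le_mul' h₀ (hsNorm_testFn_le _ hz j'))
      _ = ENNReal.ofReal (M₁ * (4 * jap j' ^ sZero ν) + M₀ * (4 * jap j' ^ σ)) := by
          have := Real.rpow_nonneg hj.le (sZero ν)
          have := Real.rpow_nonneg hj.le σ
          rw [← ENNReal.ofReal_mul hM₁, ← ENNReal.ofReal_mul hM₀,
            ENNReal.ofReal_add (by positivity) (by positivity)]
      _ ≤ _ := by
          refine ENNReal.ofReal_le_ofReal ?_
          have e1 : M₁ * (4 * jap j' ^ sZero ν) ≤ M₁ * (4 * jap j' ^ (ν / 2 + 3 + 1)) := by gcongr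
          have e2 : M₀ * (4 * jap j' ^ σ) ≤ M₀ * (4 * (jap j' ^ s * jap j' ^ (ν / 2 + 3 + 1))) := by
            have : jap j' ^ s * jap j' ≤ jap j' ^ s * jap j' ^ (ν / 2 + 3 + 1) := by gcongr
            have := hσs.trans this
            gcongr
          rw [hN]; linarith
  have hρ : ((E + B : ℕ) : ℝ) + B = ρ := by rw [← hE]; push_cast; ring
  have hT0 := (h 0 (by simp; omega) B ((E + B : ℕ) : ℝ) (Nat.cast_nonneg _) (Nat.cast_nonneg _)).1
    (by simp only [Pi.zero_apply, Nat.cast_zero, Finset.sum_const_zero]; linarith)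
  have hTi := fun i => (h (Pi.single i B) (by rw [Finset.sum_pi_single']; simp; omega) 0
    ((E + B : ℕ) : ℝ) le_rfl (Nat.cast_nonneg _)).1 (by
      rw [← Nat.cast_sum, Finset.sum_pi_single']; simp only [Finset.mem_univ, if_true]; linarith)
  have hsI : s ∈ Set.Icc (sZero ν) S := ⟨hs, by linarith⟩
  have hsI' : s + 1 ∈ Set.Icc (sZero ν) S := ⟨by linarith, hsS⟩
  refine ⟨fun w hw => smoothEntries_of_test hN0 (fun j' hj' z hz => ?_)
    fun i j' hj' z hz => ?_, fun w hw w' hw' c hc hcd => ?_⟩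
  · exact ((hT0.2 s hsI _ (memH_testFn s hz hj')).1 w hw).2.trans (hbound s (Or.inl rfl) j' z hz)
  · exact (((hTi i).2 s hsI _ (memH_testFn s hz hj')).1 w hw).2.trans
      (hbound s (Or.inl rfl) j' z hz)
  · have hν : (0 : ℝ) ≤ ((ν : ℝ) + 2) ^ B := by positivity
    by_cases hww : w = w'
    · subst hww
      intro j j' l _ _
      simpa using mul_nonneg hν (hN0 j')
    have hd : 0 < dist w w' := dist_pos.2 hww
    have hsub : ∀ (m₁ m₂ : ℝ) (b : Fin ν → ℕ), wDx m₁ m₂ (dPhi b (A w - A w')) =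
        wDx m₁ m₂ (dPhi b (A w)) - wDx m₁ m₂ (dPhi b (A w')) := fun m₁ m₂ b => by
      funext j j' l
      simp only [wDx, dPhi, Pi.sub_apply]; ring
    have hN0' : ∀ j', 0 ≤ N j' * (dist w w' / γ) := fun j' => mul_nonneg (hN0 j') (by positivity)
    refine (smoothEntries_of_test (A := A w - A w') (s := s) (B := B) (E := E) hN0'
      (fun j' hj' z hz => ?_) fun i j' hj' z hz => ?_).smul hc fun j' => ?_
    · rw [hsub]
      have := ((hT0.2 (s + 1) hsI' _ (memH_testFn _ hz hj')).2 w hw w' hw' hww).trans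
        (hbound (s + 1) (Or.inr rfl) j' z hz)
      rw [add_sub_cancel_right] at this
      exact le_of_lip_le hγ hd this
    · rw [hsub]
      have := (((hTi i).2 (s + 1) hsI' _ (memH_testFn _ hz hj')).2 w hw w' hw' hww).trans
        (hbound (s + 1) (Or.inr rfl) j' z hz)
      rw [add_sub_cancel_right] at this
      exact le_of_lip_le hγ hd this
    · have h5 : c * dist w w' / γ ≤ 1 := (div_le_one hγ).2 hcd
      calc c * (((ν : ℝ) + 2) ^ B * (N j' * (dist w w' / γ)))
          = ((ν : ℝ) + 2) ^ B * N j' * (c * dist w w' / γ) := by ring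
        _ ≤ ((ν : ℝ) + 2) ^ B * N j' * 1 := mul_le_mul_of_nonneg_left h5 (mul_nonneg hν (hN0 j'))
        _ = _ := mul_one _

theorem SmoothEntries.mono {B E : ℕ} {s : ℝ} {N N' : ℤ → ℝ} {A : TMat ν}
    (h : SmoothEntries B E s N A) (hN : ∀ j, N j ≤ N' j) : SmoothEntries B E s N' A :=
  fun j j' l hj hj' => (h j j' l hj hj').trans (hN j')

theorem tameEntries_of_smooth {B E : ℕ} (hE : 2 * (ν / 2 + 3) + 2 ≤ E) {s M₀ M₁ C S : ℝ}
    (hC : 0 ≤ C) (hM₀ : 0 ≤ M₀) (hM₁ : 0 ≤ M₁) (hs : sZero ν ≤ s) (hsS : s ≤ S) {A : TMat ν}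
    (h₀ : SmoothEntries B E (sZero ν) (fun j' => C *
      ((4 * M₀ + 4 * M₀ * jap j' ^ sZero ν) * jap j' ^ (ν / 2 + 3 + 1))) A)
    (h₁ : SmoothEntries B E s (fun j' => C *
      ((4 * M₁ + 4 * M₀ * jap j' ^ s) * jap j' ^ (ν / 2 + 3 + 1))) A) :
    Decays (fun _ => 1) B (2 ^ S * (12 * C * M₀)) A ∧
    TameDecay B s (2 ^ S * (4 * C * M₁)) (2 ^ S * (12 * C * M₀)) A ∧
    TameDecay B (sZero ν) (2 ^ S * (12 * C * M₀)) (2 ^ S * (12 * C * M₀)) A := by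
  have h0 := sZero_nonneg ν
  have hd : Decays (fun _ => 1) B (8 * C * M₀) A := by
    refine SmoothEntries.decays (n := 2 * (ν / 2 + 3) + 1) (by omega) h0 (h₀.mono fun j => ?_)
    have hj := one_le_jap j
    have hj0 := jap_pos j
    have h1 : 4 * M₀ + 4 * M₀ * jap j ^ sZero ν ≤ 8 * M₀ * jap j ^ (ν / 2 + 3) := by
      rw [sZero, Real.rpow_natCast]
      have := one_le_pow₀ hj (n := ν / 2 + 3)
      nlinarith
    calc _ ≤ C * ((8 * M₀ * jap j ^ (ν / 2 + 3)) * jap j ^ (ν / 2 + 3 + 1)) := by gcongr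
      _ = _ := by ring
  have h2 : (1 : ℝ) ≤ 2 ^ S := Real.one_le_rpow (by norm_num) (by linarith)
  have hmono : ∀ {p : ℝ}, p ≤ S → (2 : ℝ) ^ p ≤ 2 ^ S := fun hp =>
    Real.rpow_le_rpow_of_exponent_le (by norm_num) hp
  have hCM : 0 ≤ C * M₀ := by positivity
  have hCM1 : 0 ≤ C * M₁ := by positivity
  refine ⟨hd.one_mono (by nlinarith), ?_, ?_⟩
  · refine (SmoothEntries.tameDecay (n := ν / 2 + 3 + 1) (A₁ := 4 * C * M₁) (A₀ := 4 * C * M₀)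
      (by omega) (by linarith) (h₁.mono fun j => le_of_eq (by ring)) hd).mono ?_ ?_
    · exact mul_le_mul_of_nonneg_right (hmono hsS) (by linarith)
    · calc _ ≤ 2 ^ S * (4 * C * M₀ + 8 * C * M₀) :=
            mul_le_mul_of_nonneg_right (hmono hsS) (by linarith)
        _ = _ := by ring
  · refine (SmoothEntries.tameDecay (n := ν / 2 + 3 + 1) (A₁ := 4 * C * M₀) (A₀ := 4 * C * M₀)
      (by omega) h0 (h₀.mono fun j => le_of_eq (by ring)) hd).mono ?_ ?_
    · calc _ ≤ 2 ^ S * (4 * C * M₀) :=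
            mul_le_mul_of_nonneg_right (hmono (by linarith)) (by linarith)
        _ ≤ _ := by gcongr; norm_num
    · calc _ ≤ 2 ^ S * (4 * C * M₀ + 8 * C * M₀) :=
            mul_le_mul_of_nonneg_right (hmono (by linarith)) (by linarith)
        _ = _ := by ring

theorem symNorm_mono {m p p' : ℝ} (h : p ≤ p') (α : ℕ) (a : Symb ν) :
    symNorm m p α a ≤ symNorm m p' α a := by
  unfold symNorm
  gcongr
  exact hsNorm_mono h _

theorem lipHs_mono {γ : ℝ} {O : Set (Freq ν)} {s s' : ℝ} (h : s ≤ s') (u : Freq ν → Coeffs ν) :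
    lipHs γ O s u ≤ lipHs γ O s' u := by
  unfold lipHs
  gcongr
  · exact hsNorm_mono h _
  · exact hsNorm_mono (by linarith) _

theorem symNorm_le_of_lipSym {γ p N : ℝ} {O : Set (Freq ν)} {q : Freq ν → Symb ν}
    (h : lipSym γ O (-1) p 0 q ≤ ENNReal.ofReal N) {w : Freq ν} (hw : w ∈ O) :
    symNorm (-1) p 0 (q w) ≤ ENNReal.ofReal N := by
  refine le_trans ?_ h
  refine le_trans ?_ le_self_add
  exact le_iSup₂_of_le (f := fun w (_ : w ∈ O) => symNorm (-1) p 0 (q w)) w hw le_rfl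

theorem symNorm_sub_le_of_lipSym {γ p N : ℝ} (hγ : 0 < γ) {O : Set (Freq ν)} {q : Freq ν → Symb ν}
    (h : lipSym γ O (-1) p 0 q ≤ ENNReal.ofReal N) {w w' : Freq ν} (hw : w ∈ O) (hw' : w' ∈ O)
    (hne : w ≠ w') :
    symNorm (-1) (p - 1) 0 (q w - q w') ≤ ENNReal.ofReal (N * (dist w w' / γ)) := by
  refine le_of_lip_le hγ (dist_pos.2 hne) (le_trans ?_ h)
  refine le_trans ?_ le_add_self
  refine mul_le_mul' le_rfl ?_
  exact le_iSup₂_of_le w hw (le_iSup₂_of_le w' hw' (le_iSup_of_le hne le_rfl))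

theorem TameDecay.smul {B : ℕ} {s a a' c : ℝ} {M : TMat ν} (h : TameDecay B s a 0 M) (hc : 0 ≤ c)
    (ha : c * a ≤ a') : TameDecay B s a' 0 ((c : ℂ) • M) := by
  intro i k hi hk
  have h1 := mul_le_mul_of_nonneg_left (h i k hi hk) hc
  rw [zero_mul, add_zero] at h1 ⊢
  refine le_trans (le_of_eq ?_) (h1.trans ha)
  simp only [Pi.smul_apply, smul_eq_mul, norm_mul, Complex.norm_real, Real.norm_of_nonneg hc]
  ring

theorem tameDecay_opMat_family {γ p N : ℝ} (hγ : 0 < γ) {O : Set (Freq ν)} {B : ℕ}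
    {q : Freq ν → Symb ν} (hN : 0 ≤ N) (hsym : ∀ w ∈ O, IsSymbol (-1) (q w))
    (h : lipSym γ O (-1) (p + B + 1) 0 q ≤ ENNReal.ofReal N) :
    (∀ w ∈ O, TameDecay B p N 0 (opMat (q w))) ∧
    ∀ w ∈ O, ∀ w' ∈ O, ∀ c : ℝ, 0 ≤ c → c * dist w w' ≤ γ →
      TameDecay B p N 0 ((c : ℂ) • (opMat (q w) - opMat (q w'))) := by
  refine ⟨fun w hw => tameDecay_opMat hN
    ((symNorm_mono (by linarith) _ _).trans (symNorm_le_of_lipSym h hw)),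
    fun w hw w' hw' c hc hcd => ?_⟩
  by_cases hww : w = w'
  · subst hww
    intro i k _ _
    simpa using hN
  have hd : 0 < dist w w' := dist_pos.2 hww
  have h1 := symNorm_sub_le_of_lipSym hγ h hw hw' hww
  rw [add_sub_cancel_right] at h1
  rw [← opMat_sub (hsym w hw) (hsym w' hw')]
  refine (tameDecay_opMat (mul_nonneg hN (by positivity)) h1).smul hc ?_
  have h5 : c * dist w w' / γ ≤ 1 := (div_le_one hγ).2 hcd
  calc c * (N * (dist w w' / γ)) = N * (c * dist w w' / γ) := by ring
    _ ≤ N * 1 := by gcongr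
    _ = N := mul_one N

/-- The entries of the remainders `Op(q) + Q` and of their Lipschitz quotients. -/
theorem tameEntries_family {γ S S' : ℝ} (hγ : 0 < γ) {O : Set (Freq ν)} {ρ B E : ℕ}
    {q : Freq ν → Symb ν} {Q : Freq ν → TMat ν} {M : ℝ → ℝ≥0∞}
    (hsym : ∀ w ∈ O, IsSymbol (-1) (q w)) (hQ : SmoothingTame γ O S ρ Q M)
    (hE : E + 2 * B = ρ) (hE2 : 2 * (ν / 2 + 3) + 2 ≤ E) {s N₀ N₁ M₀ M₁ δ Λ : ℝ}
    (hs : sZero ν ≤ s) (hsS : s + 1 ≤ S) (hsS' : s ≤ S')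
    (hN₀ : 0 ≤ N₀) (hN₁ : 0 ≤ N₁) (hM₀ : 0 ≤ M₀) (hM₁ : 0 ≤ M₁)
    (hq₀ : lipSym γ O (-1) (sZero ν + B + 1) 0 q ≤ ENNReal.ofReal N₀)
    (hq₁ : lipSym γ O (-1) (s + B + 1) 0 q ≤ ENNReal.ofReal N₁)
    (h₀ : M (sZero ν) ≤ ENNReal.ofReal M₀) (h₀' : M (sZero ν + 1) ≤ ENNReal.ofReal M₀)
    (h₁ : M (s + 1) ≤ ENNReal.ofReal M₁)
    (hδ : N₀ + 2 ^ S' * (12 * ((ν : ℝ) + 2) ^ B * M₀) ≤ δ)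
    (hΛ : N₁ + 2 ^ S' * (4 * ((ν : ℝ) + 2) ^ B * M₁) ≤ Λ * δ) :
    (∀ w ∈ O, TameEntries B s δ Λ (opMat (q w) + Q w)) ∧
    ∀ w ∈ O, ∀ w' ∈ O, ∀ c : ℝ, 0 ≤ c → c * dist w w' ≤ γ →
      TameEntries B s δ Λ ((c : ℂ) • ((opMat (q w) + Q w) - (opMat (q w') + Q w'))) := by
  have hC : (0 : ℝ) ≤ ((ν : ℝ) + 2) ^ B := by positivity
  obtain ⟨a0, a0'⟩ := tameDecay_opMat_family hγ hN₀ hsym hq₀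
  obtain ⟨a1, a1'⟩ := tameDecay_opMat_family hγ hN₁ hsym hq₁
  obtain ⟨b0, b0'⟩ := hQ.smoothEntries hγ hE (by omega) le_rfl (by linarith) hM₀ hM₀ h₀ h₀'
  obtain ⟨b1, b1'⟩ := hQ.smoothEntries hγ hE (by omega) hs hsS hM₀ hM₁ h₀ h₁
  have comb : ∀ {X Y : TMat ν}, TameDecay B (sZero ν) N₀ 0 X → TameDecay B s N₁ 0 X →
      SmoothEntries B E (sZero ν) (fun j' => ((ν : ℝ) + 2) ^ B *
        ((4 * M₀ + 4 * M₀ * jap j' ^ sZero ν) * jap j' ^ (ν / 2 + 3 + 1))) Y →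
      SmoothEntries B E s (fun j' => ((ν : ℝ) + 2) ^ B *
        ((4 * M₁ + 4 * M₀ * jap j' ^ s) * jap j' ^ (ν / 2 + 3 + 1))) Y →
      TameEntries B s δ Λ (X + Y) := by
    intro X Y x0 x1 y0 y1
    obtain ⟨z0, z1, z2⟩ := tameEntries_of_smooth hE2 hC hM₀ hM₁ hs hsS' y0 y1
    exact ⟨((x0.decays_one (sZero_nonneg ν)).add_one z0).one_mono hδ,
      (x1.add z1).mono hΛ (by linarith), (x0.add z2).mono hδ (by linarith)⟩
  refine ⟨fun w hw => comb (a0 w hw) (a1 w hw) (b0 w hw) (b1 w hw), fun w hw w' hw' c hc hcd => ?_⟩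
  have h1 := comb (a0' w hw w' hw' c hc hcd) (a1' w hw w' hw' c hc hcd) (b0' w hw w' hw' c hc hcd)
    (b1' w hw w' hw' c hc hcd)
  have h2 : (c : ℂ) • ((opMat (q w) + Q w) - (opMat (q w') + Q w')) =
      (c : ℂ) • (opMat (q w) - opMat (q w')) + (c : ℂ) • (Q w - Q w') := by
    rw [← smul_add]; congr 1; abel
  rw [h2]; exact h1

theorem SmoothingDiff.decays {ρ B E : ℕ} {A : TMat ν} {N : ℝ} (hN : 0 ≤ N)
    (h : SmoothingDiff (sZero ν) ρ A (ENNReal.ofReal N)) (hE : E + 2 * B + 1 = ρ)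
    (hE2 : ν / 2 + 3 + 2 ≤ E) : Decays (fun _ => 1) B (((ν : ℝ) + 2) ^ B * (4 * N)) A := by
  have hρ : ((E + B : ℕ) : ℝ) + B + 1 = ρ := by rw [← hE]; push_cast; ring
  have hT0 := (h 0 (by simp; omega) B ((E + B : ℕ) : ℝ) (Nat.cast_nonneg _) (Nat.cast_nonneg _)).1
    (by simp only [Pi.zero_apply, Nat.cast_zero, Finset.sum_const_zero]; linarith)
  have hTi := fun i => (h (Pi.single i B) (by rw [Finset.sum_pi_single']; simp; omega) 0
    ((E + B : ℕ) : ℝ) le_rfl (Nat.cast_nonneg _)).1 (by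
      rw [← Nat.cast_sum, Finset.sum_pi_single']; simp only [Finset.mem_univ, if_true]; linarith)
  have hb : ∀ (j' : ℤ) (z : ℂ), ‖z‖ = 1 →
      ENNReal.ofReal N * hsNorm (sZero ν) (testFn z j' : Coeffs ν) ≤
        ENNReal.ofReal (4 * N * jap j' ^ (ν / 2 + 3)) := fun j' z hz => by
    refine (mul_le_mul' le_rfl (hsNorm_testFn_le _ hz j')).trans (le_of_eq ?_)
    rw [← ENNReal.ofReal_mul hN, sZero, Real.rpow_natCast]
    congr 1; ring
  have h1 := smoothEntries_of_test (A := A) (s := sZero ν) (B := B) (E := E)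
    (N := fun j' => 4 * N * jap j' ^ (ν / 2 + 3))
    (fun j => by have := jap_pos j; positivity)
    (fun j' hj' z hz => (hT0 _ (memH_testFn _ hz hj')).2.trans (hb j' z hz))
    fun i j' hj' z hz => (hTi i _ (memH_testFn _ hz hj')).2.trans (hb j' z hz)
  exact SmoothEntries.decays (n := ν / 2 + 3) (by omega) (sZero_nonneg ν)
    (h1.mono fun j => le_of_eq (by ring))

end Remainders

/-! ### Families of operators -/

section Family

variable {ν : ℕ}

/-- The weight `⟨i⟩ ^ s + Λ ⟨i⟩ ^ s₀`. -/
def tameW (s Λ : ℝ) (i : Idx ν) : ℝ := sobW s i + Λ * sobW (sZero ν) i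

/-- The weight `⟨i⟩ ^ (s - 1) + Λ ⟨i⟩ ^ (s₀ - 1)`. -/
def tameLowW (s Λ : ℝ) (i : Idx ν) : ℝ := tameW s Λ i / japLJ i.1 i.2

theorem tameW_pos {s Λ : ℝ} (hΛ : 0 < Λ) (i : Idx ν) : 0 < tameW s Λ i := by
  have := sobW_pos s i
  have := sobW_pos (sZero ν) i
  unfold tameW
  positivity

theorem tameLowW_pos {s Λ : ℝ} (hΛ : 0 < Λ) (i : Idx ν) : 0 < tameLowW s Λ i :=
  div_pos (tameW_pos hΛ i) (japLJ_pos _ _)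

theorem sobW_sub_one (s : ℝ) (i : Idx ν) : sobW (s - 1) i = sobW s i / japLJ i.1 i.2 := by
  rw [sobW, Real.rpow_sub (japLJ_pos _ _), Real.rpow_one]; rfl

theorem tameLowW_eq (s Λ : ℝ) (i : Idx ν) :
    tameLowW s Λ i = sobW (s - 1) i + Λ * sobW (sZero ν - 1) i := by
  rw [tameLowW, tameW, sobW_sub_one, sobW_sub_one]; ring

theorem sobW_le_tameW {s Λ : ℝ} (hΛ : 0 < Λ) (i : Idx ν) : sobW s i ≤ tameW s Λ i := by
  have := sobW_pos (sZero ν) i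
  have := mul_pos hΛ this
  unfold tameW; linarith

theorem sobW_le_tameLowW {s Λ : ℝ} (hΛ : 0 < Λ) (i : Idx ν) :
    sobW (s - 1) i ≤ tameLowW s Λ i := by
  rw [tameLowW_eq]
  have := mul_pos hΛ (sobW_pos (sZero ν - 1) i)
  linarith

theorem tameW_le {s Λ : ℝ} (hs : sZero ν ≤ s) (hΛ : 0 < Λ) (i : Idx ν) :
    tameW s Λ i ≤ (1 + Λ) * sobW s i := by
  have := mul_le_mul_of_nonneg_left (sobW_mono hs i) hΛ.le
  unfold tameW; linarith

theorem wNorm_tameW_le {s s' Λ : ℝ} (hΛ : 0 < Λ) {W : Idx ν → ℝ}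
    (hW : ∀ i, W i = sobW s i + Λ * sobW s' i) (u : Coeffs ν) :
    wNorm W (fun q => ‖flat u q‖ₑ) ≤
      2 * (hsNorm s u + ENNReal.ofReal Λ * hsNorm s' u) := by
  rw [hsNorm_eq, hsNorm_eq]
  refine (wNorm_le_add (W' := sobW s) (W'' := fun i => Λ * sobW s' i)
    (v' := fun q => ‖flat u q‖ₑ) (v'' := fun q => ‖flat u q‖ₑ) fun q => ?_).trans ?_
  · rw [hW, ENNReal.ofReal_add (sobW_pos _ _).le (mul_pos hΛ (sobW_pos _ _)).le, add_mul]
  · refine mul_le_mul' le_rfl (add_le_add le_rfl (wNorm_le_mul fun q => ?_))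
    rw [ENNReal.ofReal_mul hΛ.le, mul_assoc]

theorem schurN_ratW_le_kamW {W : Idx ν → ℝ} (hW : ∀ i, 0 < W i) (b : ℕ) (A : MatOp (Idx ν)) :
    schurN (ratW W) A ≤ schurN (kamW W b 0) A := by
  have := schurN_mono (w' := ratW W) (w := kamW W b 0) (g := 1) (A := A) (B := A) fun i k => by
    rw [one_mul]
    refine mul_le_mul' (ENNReal.ofReal_le_ofReal ?_) le_rfl
    have h1 := hW i
    have h2 := hW k
    have h3 := one_le_jap k.2
    have h4 := absL_nonneg (i.1 - k.1)
    have h5 : (1 : ℝ) ≤ (1 + absL (i.1 - k.1) / 4 ^ 0) ^ b :=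
      one_le_pow₀ (by rw [pow_zero, div_one]; linarith)
    calc W i / W k = 1 * (W i / W k) * 1 := by ring
      _ ≤ _ := by gcongr
  rwa [one_mul] at this

theorem schurN_sobW_le {s Λ : ℝ} (hs : sZero ν ≤ s) (hΛ : 0 < Λ) (A : MatOp (Idx ν)) :
    schurN (ratW (sobW s)) A ≤ ENNReal.ofReal (1 + Λ) * schurN (ratW (tameW s Λ)) A := by
  refine schurN_mono fun i k => ?_
  rw [← mul_assoc]
  refine mul_le_mul' ?_ le_rfl
  rw [ratW, ratW, ← ENNReal.ofReal_mul (by linarith)]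
  refine ENNReal.ofReal_le_ofReal ?_
  have h1 := sobW_pos s i
  have h2 := sobW_pos s k
  have h3 := tameW_pos (s := s) hΛ k
  have h4 := sobW_le_tameW (s := s) hΛ i
  have h5 := tameW_le hs hΛ k
  have h6 := h1.le.trans h4
  rw [mul_div_assoc', div_le_div_iff₀ h2 h3]
  calc sobW s i * tameW s Λ k ≤ tameW s Λ i * ((1 + Λ) * sobW s k) := by gcongr
    _ = _ := by ring

theorem schurN_lt_top_of_sub_one {W : Idx ν → ℝ} (hW : ∀ i, 0 < W i) {A : MatOp (Idx ν)}
    (h : schurN (ratW W) (A - 1) < ⊤) : schurN (ratW W) A < ⊤ := by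
  have h1 := schurN_add (ratW W) (A - 1) 1
  rw [sub_add_cancel] at h1
  exact h1.trans_lt (ENNReal.add_lt_top.2 ⟨h, (schurN_ratW_one hW).trans_lt ENNReal.one_lt_top⟩)

theorem ofReal_mul_div_eq {g d : ℝ} (hd : 0 < d) (x : ℝ≥0∞) :
    ENNReal.ofReal g * (x / ENNReal.ofReal d) = ENNReal.ofReal (g / d) * x := by
  rw [ENNReal.ofReal_div_of_pos hd, ENNReal.div_eq_inv_mul, ENNReal.div_eq_inv_mul]; ring

theorem hsNorm_le_iSup {O : Set (Freq ν)} {s : ℝ} (h : Freq ν → Coeffs ν) {w : Freq ν}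
    (hw : w ∈ O) : hsNorm s (h w) ≤ ⨆ w ∈ O, hsNorm s (h w) :=
  le_iSup₂_of_le (f := fun w (_ : w ∈ O) => hsNorm s (h w)) w hw le_rfl

theorem hsNorm_sub_le_iSup {g : ℝ} {O : Set (Freq ν)} {s : ℝ} (h : Freq ν → Coeffs ν)
    {w w' : Freq ν} (hw : w ∈ O) (hw' : w' ∈ O) (hne : w ≠ w') :
    ENNReal.ofReal (g / dist w w') * hsNorm s (h w - h w') ≤
      ENNReal.ofReal g * ⨆ w ∈ O, ⨆ w' ∈ O, ⨆ (_ : w ≠ w'),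
        hsNorm s (h w - h w') / ENNReal.ofReal (dist w w') := by
  rw [← ofReal_mul_div_eq (dist_pos.2 hne)]
  refine mul_le_mul' le_rfl ?_
  exact le_iSup₂_of_le w hw (le_iSup₂_of_le w' hw' (le_iSup_of_le hne le_rfl))

/-- A family of matrices close to the identity is close to the identity in the Sobolev norms. -/
theorem lipHs_act_sub_le {g s Λ D : ℝ} {b : ℕ} {O : Set (Freq ν)} (hs : sZero ν ≤ s) (hΛ : 0 < Λ)
    (hg : 0 ≤ g) {A : Freq ν → MatOp (Idx ν)} (hA : ∀ w ∈ O, IsStruct (A w))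
    (h1 : ∀ w ∈ O, ∀ w' ∈ O, ∀ c : ℝ, 0 ≤ c → c * dist w w' ≤ g →
      pairN (ENNReal.ofReal c) (kamW (tameW s Λ) b 0) (A w - 1) (A w' - 1) ≤ ENNReal.ofReal D)
    (h2 : ∀ w ∈ O, ∀ w' ∈ O, ∀ c : ℝ, 0 ≤ c → c * dist w w' ≤ g →
      pairN (ENNReal.ofReal c) (kamW (tameLowW s Λ) b 0) (A w - 1) (A w' - 1) ≤ ENNReal.ofReal D)
    {h : Freq ν → Coeffs ν} (hh : ∀ w ∈ O, MemH s (h w)) :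
    lipHs g O s (fun w => act (toT (A w)) (h w) - h w) ≤
      ENNReal.ofReal (6 * D) * (lipHs g O s h + ENNReal.ofReal Λ * lipHs g O (sZero ν) h) := by
  have hWp := fun i : Idx ν => tameW_pos (s := s) hΛ i
  have hLp := fun i : Idx ν => tameLowW_pos (s := s) hΛ i
  have hself : ∀ w ∈ O, schurN (ratW (tameW s Λ)) (A w - 1) ≤ ENNReal.ofReal D := fun w hw =>
    (schurN_ratW_le_kamW hWp b _).trans ((left_le_pairN _ _ _ _).trans
      (h1 w hw w hw 0 le_rfl (by simpa using hg)))
  have hselfL : ∀ w ∈ O, schurN (ratW (tameLowW s Λ)) (A w - 1) ≤ ENNReal.ofReal D := fun w hw =>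
    (schurN_ratW_le_kamW hLp b _).trans ((left_le_pairN _ _ _ _).trans
      (h2 w hw w hw 0 le_rfl (by simpa using hg)))
  have hX : ∀ w ∈ O, schurN (ratW (sobW s)) (A w - 1) < ⊤ := fun w hw =>
    (schurN_sobW_le hs hΛ _).trans_lt (ENNReal.mul_lt_top ENNReal.ofReal_lt_top
      ((hself w hw).trans_lt ENNReal.ofReal_lt_top))
  have hAs := fun w hw => schurN_lt_top_of_sub_one (sobW_pos s) (hX w hw)
  have h1s : schurN (ratW (sobW s)) (1 : MatOp (Idx ν)) < ⊤ :=
    (schurN_ratW_one (sobW_pos s)).trans_lt ENNReal.one_lt_top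
  have hflat : ∀ w ∈ O, flat (act (toT (A w)) (h w) - h w) = vecAct (A w - 1) (flat (h w)) :=
    fun w hw => by
      rw [sub_vecAct (sobW_pos s) (hAs w hw) h1s (hh w hw).wNorm_lt_top, vecAct_one,
        ← flat_act (hA w hw) (hh w hw).2.1]
      rfl
  set Ss := ⨆ w ∈ O, hsNorm s (h w) with hSs
  set S0 := ⨆ w ∈ O, hsNorm (sZero ν) (h w) with hS0
  set Ls := ENNReal.ofReal g * ⨆ w ∈ O, ⨆ w' ∈ O, ⨆ (_ : w ≠ w'),
        hsNorm (s - 1) (h w - h w') / ENNReal.ofReal (dist w w') with hLs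
  set L0 := ENNReal.ofReal g * ⨆ w ∈ O, ⨆ w' ∈ O, ⨆ (_ : w ≠ w'),
        hsNorm (sZero ν - 1) (h w - h w') / ENNReal.ofReal (dist w w') with hL0
  have hnorm : ∀ w ∈ O, wNorm (tameW s Λ) (fun q => ‖flat (h w) q‖ₑ) ≤
      2 * (Ss + ENNReal.ofReal Λ * S0) := fun w hw =>
    (wNorm_tameW_le hΛ (fun _ => rfl) (h w)).trans (mul_le_mul' le_rfl (add_le_add
      (hsNorm_le_iSup h hw) (mul_le_mul' le_rfl (hsNorm_le_iSup h hw))))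
  have hsup : ∀ w ∈ O, hsNorm s (act (toT (A w)) (h w) - h w) ≤
      ENNReal.ofReal D * (2 * (Ss + ENNReal.ofReal Λ * S0)) := fun w hw => by
    rw [hsNorm_eq, hflat w hw]
    have e1 := wNorm_le_mul (W := sobW s) (W' := tameW s Λ) (C := 1)
      (v := fun q => ‖vecAct (A w - 1) (flat (h w)) q‖ₑ)
      (v' := fun q => ‖vecAct (A w - 1) (flat (h w)) q‖ₑ) fun q => by
        rw [one_mul]
        exact mul_le_mul' (ENNReal.ofReal_le_ofReal (sobW_le_tameW hΛ q)) le_rfl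
    rw [one_mul] at e1
    exact e1.trans ((wNorm_vecAct hWp _ _).trans (mul_le_mul' (hself w hw) (hnorm w hw)))
  have hlip : ∀ w ∈ O, ∀ w' ∈ O, w ≠ w' → ENNReal.ofReal (g / dist w w') *
      hsNorm (s - 1) ((act (toT (A w)) (h w) - h w) - (act (toT (A w')) (h w') - h w')) ≤
      ENNReal.ofReal D * (4 * (Ss + ENNReal.ofReal Λ * S0) + 4 * (Ls + ENNReal.ofReal Λ * L0)) := by
    intro w hw w' hw' hne
    have hd : 0 < dist w w' := dist_pos.2 hne
    set c := g / dist w w' with hc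
    have hc0 : 0 ≤ c := by positivity
    have hcd : c * dist w w' ≤ g := by rw [hc, div_mul_cancel₀ _ hd.ne']
    have hfl : flat ((act (toT (A w)) (h w) - h w) - (act (toT (A w')) (h w') - h w')) =
        vecAct (A w - 1 - (A w' - 1)) (flat (h w)) + vecAct (A w' - 1) (flat (h w - h w')) := by
      have e1 : flat (h w - h w') = flat (h w) - flat (h w') := rfl
      rw [e1, sub_vecAct (sobW_pos s) (hX w hw) (hX w' hw') (hh w hw).wNorm_lt_top,
        vecAct_sub (sobW_pos s) (hX w' hw') (hh w hw).wNorm_lt_top (hh w' hw').wNorm_lt_top,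
        sub_add_sub_cancel, ← hflat w hw, ← hflat w' hw']
      rfl
    have e2 : hsNorm (s - 1) ((act (toT (A w)) (h w) - h w) - (act (toT (A w')) (h w') - h w')) ≤
        2 * (wNorm (tameW s Λ) (fun q => ‖vecAct (A w - 1 - (A w' - 1)) (flat (h w)) q‖ₑ) +
          wNorm (tameLowW s Λ) (fun q => ‖vecAct (A w' - 1) (flat (h w - h w')) q‖ₑ)) := by
      rw [hsNorm_eq, hfl]
      refine wNorm_le_add fun q => ?_
      have f1 : sobW (s - 1) q ≤ tameW s Λ q :=
        (sobW_mono (by linarith) q).trans (sobW_le_tameW hΛ q)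
      calc _ ≤ ENNReal.ofReal (sobW (s - 1) q) *
            (‖vecAct (A w - 1 - (A w' - 1)) (flat (h w)) q‖ₑ +
              ‖vecAct (A w' - 1) (flat (h w - h w')) q‖ₑ) := mul_le_mul' le_rfl (enorm_add_le _ _)
        _ ≤ _ := by
          rw [mul_add]
          exact add_le_add (mul_le_mul' (ENNReal.ofReal_le_ofReal f1) le_rfl)
            (mul_le_mul' (ENNReal.ofReal_le_ofReal (sobW_le_tameLowW hΛ q)) le_rfl)
    have e3 : ENNReal.ofReal c *
        wNorm (tameW s Λ) (fun q => ‖vecAct (A w - 1 - (A w' - 1)) (flat (h w)) q‖ₑ) ≤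
        ENNReal.ofReal D * (2 * (Ss + ENNReal.ofReal Λ * S0)) := by
      refine (mul_le_mul' le_rfl (wNorm_vecAct hWp _ _)).trans ?_
      rw [← mul_assoc]
      refine mul_le_mul' ?_ (hnorm w hw)
      refine (mul_le_mul' le_rfl (schurN_ratW_le_kamW hWp b _)).trans ?_
      exact (diff_le_pairN _ _ _ _).trans (h1 w hw w' hw' c hc0 hcd)
    have e4 : ENNReal.ofReal c *
        wNorm (tameLowW s Λ) (fun q => ‖vecAct (A w' - 1) (flat (h w - h w')) q‖ₑ) ≤
        ENNReal.ofReal D * (2 * (Ls + ENNReal.ofReal Λ * L0)) := by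
      refine (mul_le_mul' le_rfl ((wNorm_vecAct hLp _ _).trans (mul_le_mul' (hselfL w' hw')
        (wNorm_tameW_le hΛ (tameLowW_eq s Λ) (h w - h w'))))).trans ?_
      calc ENNReal.ofReal c * (ENNReal.ofReal D * (2 * (hsNorm (s - 1) (h w - h w') +
            ENNReal.ofReal Λ * hsNorm (sZero ν - 1) (h w - h w'))))
          = ENNReal.ofReal D * (2 * (ENNReal.ofReal c * hsNorm (s - 1) (h w - h w') +
            ENNReal.ofReal Λ * (ENNReal.ofReal c * hsNorm (sZero ν - 1) (h w - h w')))) := by ring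
        _ ≤ _ := mul_le_mul' le_rfl (mul_le_mul' le_rfl (add_le_add
            (hsNorm_sub_le_iSup h hw hw' hne)
            (mul_le_mul' le_rfl (hsNorm_sub_le_iSup h hw hw' hne))))
    calc _ ≤ ENNReal.ofReal c * (2 * (_ + _)) := mul_le_mul' le_rfl e2
      _ = 2 * (ENNReal.ofReal c * _ + ENNReal.ofReal c * _) := by rw [← mul_add]; ring
      _ ≤ 2 * (_ + _) := mul_le_mul' le_rfl (add_le_add e3 e4)
      _ = _ := by ring
  have hfin1 : (⨆ w ∈ O, hsNorm s (act (toT (A w)) (h w) - h w)) ≤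
      ENNReal.ofReal D * (2 * (Ss + ENNReal.ofReal Λ * S0)) := iSup₂_le hsup
  have hfin2 : ENNReal.ofReal g * (⨆ w ∈ O, ⨆ w' ∈ O, ⨆ (_ : w ≠ w'),
      hsNorm (s - 1) ((act (toT (A w)) (h w) - h w) - (act (toT (A w')) (h w') - h w')) /
        ENNReal.ofReal (dist w w')) ≤
      ENNReal.ofReal D * (4 * (Ss + ENNReal.ofReal Λ * S0) + 4 * (Ls + ENNReal.ofReal Λ * L0)) := by
    simp only [ENNReal.mul_iSup]
    refine iSup₂_le fun w hw => iSup₂_le fun w' hw' => iSup_le fun hne => ?_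
    rw [ofReal_mul_div_eq (dist_pos.2 hne)]
    exact hlip w hw w' hw' hne
  have e6 : ENNReal.ofReal (6 * D) = 6 * ENNReal.ofReal D := by
    rw [ENNReal.ofReal_mul (by norm_num)]; norm_num
  unfold lipHs
  rw [← hSs, ← hS0, ← hLs, ← hL0, e6]
  calc _ ≤ ENNReal.ofReal D * (2 * (Ss + ENNReal.ofReal Λ * S0)) +
        ENNReal.ofReal D * (4 * (Ss + ENNReal.ofReal Λ * S0) + 4 * (Ls + ENNReal.ofReal Λ * L0)) :=
        add_le_add hfin1 hfin2
    _ ≤ ENNReal.ofReal D * (2 * (Ss + ENNReal.ofReal Λ * S0)) +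
        ENNReal.ofReal D * (4 * (Ss + ENNReal.ofReal Λ * S0) + 4 * (Ls + ENNReal.ofReal Λ * L0)) +
        ENNReal.ofReal D * (2 * (Ls + ENNReal.ofReal Λ * L0)) := le_self_add
    _ = _ := by ring

end Family

/-! ### Diagonalization of a family of operators -/

section Diagonalization

variable {ν : ℕ}

/-- The parameters of the iteration at the frequency `w`. -/
def parOf (γ τ : ℝ) (m : Freq ν → ℝ) (w : Freq ν) : KamPar ν := ⟨w, m w, γ ^ (3 / 2 : ℝ), τ⟩

/-- The hypotheses of the iteration for a family of operators. -/
structure KamFamily (L γ τ S : ℝ) (t a b b' : ℕ) (e : ℝ) (O : Set (Freq ν)) (m : Freq ν → ℝ)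
    (R : Freq ν → TMat ν) (Λ : ℝ → ℝ) : Prop where
  g_pos : 0 < γ ^ (3 / 2 : ℝ)
  size_pos : ∀ s, 0 < Λ s
  ham : ∀ w ∈ O, IsHamMat (R w)
  col : ∀ w ∈ O, ColBdd (remKernel (R w))
  data : ∀ w ∈ O, KamData L (parOf γ τ m w) t a b b' e (remOp (R w))
  par : ∀ w ∈ O, ∀ w' ∈ O, ∀ c : ℝ, 0 ≤ c → c * dist w w' ≤ γ ^ (3 / 2 : ℝ) →
    ParPair L c (parOf γ τ m w) (parOf γ τ m w')
  pair_one : ∀ w ∈ O, ∀ w' ∈ O, ∀ c : ℝ, 0 ≤ c → c * dist w w' ≤ γ ^ (3 / 2 : ℝ) →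
    pairN (ENNReal.ofReal c) (kamW (fun _ => 1) b 0) (remOp (R w)) (remOp (R w')) ≤ ENNReal.ofReal e
  pair_space : ∀ w ∈ O, ∀ w' ∈ O, ∀ c : ℝ, 0 ≤ c → c * dist w w' ≤ γ ^ (3 / 2 : ℝ) →
    pairN (ENNReal.ofReal c) (kamW (fun i => spaceW (sZero ν) i.2) b 0) (remOp (R w)) (remOp (R w')) ≤
      ENNReal.ofReal e
  pair_tame : ∀ s ∈ Set.Icc (sZero ν) S, ∀ w ∈ O, ∀ w' ∈ O, ∀ c : ℝ, 0 ≤ c →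
    c * dist w w' ≤ γ ^ (3 / 2 : ℝ) →
    pairN (ENNReal.ofReal c) (kamW (tameW s (Λ s)) b 0) (remOp (R w)) (remOp (R w')) ≤
      ENNReal.ofReal e
  pair_low : ∀ s ∈ Set.Icc (sZero ν) S, ∀ w ∈ O, ∀ w' ∈ O, ∀ c : ℝ, 0 ≤ c →
    c * dist w w' ≤ γ ^ (3 / 2 : ℝ) →
    pairN (ENNReal.ofReal c) (kamW (tameLowW s (Λ s)) b 0) (remOp (R w)) (remOp (R w')) ≤
      ENNReal.ofReal e

namespace KamFamily

variable {L γ τ S e : ℝ} {t a b b' : ℕ} {O : Set (Freq ν)} {m : Freq ν → ℝ} {R : Freq ν → TMat ν}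
  {Λ : ℝ → ℝ}

/-- The diagonalizing matrix. -/
def phi (γ τ : ℝ) (m : Freq ν → ℝ) (R : Freq ν → TMat ν) (w : Freq ν) : MatOp (Idx ν) :=
  phiLim (parOf γ τ m w) (remOp (R w))

/-- The inverse of the diagonalizing matrix. -/
def psi (γ τ : ℝ) (m : Freq ν → ℝ) (R : Freq ν → TMat ν) (w : Freq ν) : MatOp (Idx ν) :=
  psiLim (parOf γ τ m w) (remOp (R w))

/-- The corrections to the eigenvalues. -/
def corr (γ τ : ℝ) (m : Freq ν → ℝ) (R : Freq ν → TMat ν) (w : Freq ν) (j : ℤ) : ℝ :=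
  rLim (parOf γ τ m w) (remOp (R w)) j

theorem bounds (h : KamFamily L γ τ S t a b b' e O m R Λ) {W : Idx ν → ℝ} (hW : ∀ i, 0 < W i)
    {w w' : Freq ν} (hw : w ∈ O) (hw' : w' ∈ O) {c : ℝ} (hc : 0 ≤ c)
    (hcd : c * dist w w' ≤ γ ^ (3 / 2 : ℝ))
    (hp : pairN (ENNReal.ofReal c) (kamW W b 0) (remOp (R w)) (remOp (R w')) ≤ ENNReal.ofReal e) :
    pairN (ENNReal.ofReal c) (kamW W b' 0) (phi γ τ m R w - 1) (phi γ τ m R w' - 1) ≤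
      ENNReal.ofReal (6 * genSize L (γ ^ (3 / 2 : ℝ)) t e) ∧
    pairN (ENNReal.ofReal c) (kamW W b' 0) (psi γ τ m R w - 1) (psi γ τ m R w' - 1) ≤
      ENNReal.ofReal (6 * genSize L (γ ^ (3 / 2 : ℝ)) t e) ∧
    ∀ j : ℤ, jap j * |corr γ τ m R w j| ≤ 2 * e ∧
      c * (jap j * |corr γ τ m R w j - corr γ τ m R w' j|) ≤ 2 * e :=
  kam_pair_bounds hW (h.par w hw w' hw' c hc hcd) (h.data w hw) (h.data w' hw') hp

theorem schurN_lt_top (h : KamFamily L γ τ S t a b b' e O m R Λ) {W : Idx ν → ℝ}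
    (hW : ∀ i, 0 < W i) {w : Freq ν} (hw : w ∈ O)
    (hp : pairN (ENNReal.ofReal 0) (kamW W b 0) (remOp (R w)) (remOp (R w)) ≤ ENNReal.ofReal e) :
    schurN (ratW W) (phi γ τ m R w) < ⊤ ∧ schurN (ratW W) (psi γ τ m R w) < ⊤ := by
  obtain ⟨h1, h2, -⟩ := h.bounds hW hw hw le_rfl (by simpa using h.g_pos.le) hp
  exact ⟨schurN_lt_top_of_sub_one hW ((schurN_ratW_le_kamW hW b' _).trans_lt
      ((left_le_pairN _ _ _ _).trans_lt (h1.trans_lt ENNReal.ofReal_lt_top))),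
    schurN_lt_top_of_sub_one hW ((schurN_ratW_le_kamW hW b' _).trans_lt
      ((left_le_pairN _ _ _ _).trans_lt (h2.trans_lt ENNReal.ofReal_lt_top)))⟩

theorem schurN_sobW_lt_top (h : KamFamily L γ τ S t a b b' e O m R Λ) {s : ℝ}
    (hs : s ∈ Set.Icc (sZero ν) S) {w : Freq ν} (hw : w ∈ O) :
    schurN (ratW (sobW s)) (phi γ τ m R w) < ⊤ ∧ schurN (ratW (sobW s)) (psi γ τ m R w) < ⊤ ∧
      schurN (ratW (sobW s)) (remOp (R w)) < ⊤ := by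
  have hW := fun i : Idx ν => tameW_pos (s := s) (h.size_pos s) i
  have hp := h.pair_tame s hs w hw w hw 0 le_rfl (by simpa using h.g_pos.le)
  obtain ⟨h1, h2⟩ := h.schurN_lt_top hW hw hp
  refine ⟨(schurN_sobW_le hs.1 (h.size_pos s) _).trans_lt
      (ENNReal.mul_lt_top ENNReal.ofReal_lt_top h1),
    (schurN_sobW_le hs.1 (h.size_pos s) _).trans_lt (ENNReal.mul_lt_top ENNReal.ofReal_lt_top h2),
    (schurN_sobW_le hs.1 (h.size_pos s) _).trans_lt (ENNReal.mul_lt_top ENNReal.ofReal_lt_top ?_)⟩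
  exact (schurN_ratW_le_kamW hW b _).trans_lt
    ((left_le_pairN _ _ _ _).trans_lt (hp.trans_lt ENNReal.ofReal_lt_top))

theorem boundedBy_toT {A : MatOp (Idx ν)} (hA : IsStruct A) {s : ℝ}
    (hs : schurN (ratW (sobW s)) A < ⊤) : ∃ N : ℝ≥0∞, N < ⊤ ∧ BoundedBy s N (toT A) :=
  ⟨_, hs, fun _ hu => ⟨actsOn_toT hA hs hu, hsNorm_act_le hA hu.2.1⟩⟩

theorem diagonalizes (h : KamFamily L γ τ S t a b b' e O m R Λ) {S' : ℝ} (hS : S' ≤ S)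
    (hS1 : sZero ν + 1 ≤ S) {w : Freq ν} (hw : w ∈ O)
    (hres : KamData.NonRes (parOf γ τ m w) (remOp (R w))) :
    Diagonalizes S' w (m w) (R w) (fun j => eig (m w) (corr γ τ m R w j) j)
      (toT (phi γ τ m R w)) (toT (psi γ τ m R w)) := by
  have hd := h.data w hw
  have hΦ : IsStruct (phi γ τ m R w) := hd.struct_phiLim
  have hΨ : IsStruct (psi γ τ m R w) := hd.struct_psiLim
  have h12 : phi γ τ m R w * psi γ τ m R w = 1 := hd.phiLim_mul_psiLim
  have h21 : psi γ τ m R w * phi γ τ m R w = 1 := hd.psiLim_mul_phiLim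
  have hdual : IsDual (phi γ τ m R w) (psi γ τ m R w) := hd.dual_lim
  have hb : ∀ s ∈ Set.Icc (sZero ν) S', s ∈ Set.Icc (sZero ν) S := fun s hs =>
    ⟨hs.1, hs.2.trans hS⟩
  have h0 : sZero ν ∈ Set.Icc (sZero ν) S := ⟨le_rfl, by linarith⟩
  have h1 : sZero ν + 1 ∈ Set.Icc (sZero ν) S := ⟨by linarith, hS1⟩
  obtain ⟨p0, q0, r0⟩ := h.schurN_sobW_lt_top h0 hw
  obtain ⟨p1, q1, r1⟩ := h.schurN_sobW_lt_top h1 hw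
  obtain ⟨px, qx⟩ := h.schurN_lt_top (fun i => spaceW_pos (sZero ν) i.2) hw
    (h.pair_space w hw w hw 0 le_rfl (by simpa using h.g_pos.le))
  have hwL : ∀ i, |(parOf γ τ m w).w i| ≤ 2 * L := hd.par.w_le
  exact {
    real_map := isRealMat_toT hΦ
    real_inv := isRealMat_toT hΨ
    bounded_map := fun s hs => boundedBy_toT hΦ (h.schurN_sobW_lt_top (hb s hs) hw).1
    bounded_inv := fun s hs => boundedBy_toT hΨ (h.schurN_sobW_lt_top (hb s hs) hw).2.1
    left_inv := fun u hu => act_act_of_mul_eq_one hΨ hΦ q0 p0 h21 hu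
    right_inv := fun u hu => act_act_of_mul_eq_one hΦ hΨ p0 q0 h12 hu
    symplectic_map := isSymplecticFamily_toT hΦ hΨ hdual h21 (sZero_nonneg ν) px qx
    symplectic_inv := isSymplecticFamily_toT hΨ hΦ (hdual.symm hΦ) h12 (sZero_nonneg ν) qx px
    conjugates := fun u hu => ⟨memH_act hΦ p1 hu, memH_act hΨ q1 hu,
      memH_opPlus (P := parOf γ τ m w) hwL (h.col w hw) (h.ham w hw) r0 (memH_act hΨ q1 hu),
      act_opPlus (P := parOf γ τ m w) hwL (h.col w hw) r0 hΦ hΨ p0 q0 q1 h12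
        (hd.intertwines_phiLim hres) hu⟩ }

theorem lipHs_le (h : KamFamily L γ τ S t a b b' e O m R Λ) {s : ℝ}
    (hs : s ∈ Set.Icc (sZero ν) S) {O' : Set (Freq ν)} (hO : O' ⊆ O) {u : Freq ν → Coeffs ν}
    (hu : ∀ w ∈ O', MemH s (u w)) :
    lipHs (γ ^ (3 / 2 : ℝ)) O' s (fun w => act (toT (phi γ τ m R w)) (u w) - u w) ≤
      ENNReal.ofReal (6 * (6 * genSize L (γ ^ (3 / 2 : ℝ)) t e)) *
        (lipHs (γ ^ (3 / 2 : ℝ)) O' s u +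
          ENNReal.ofReal (Λ s) * lipHs (γ ^ (3 / 2 : ℝ)) O' (sZero ν) u) ∧
    lipHs (γ ^ (3 / 2 : ℝ)) O' s (fun w => act (toT (psi γ τ m R w)) (u w) - u w) ≤
      ENNReal.ofReal (6 * (6 * genSize L (γ ^ (3 / 2 : ℝ)) t e)) *
        (lipHs (γ ^ (3 / 2 : ℝ)) O' s u +
          ENNReal.ofReal (Λ s) * lipHs (γ ^ (3 / 2 : ℝ)) O' (sZero ν) u) := by
  have hΛ := h.size_pos s
  have hW := fun i : Idx ν => tameW_pos (s := s) hΛ i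
  have hL := fun i : Idx ν => tameLowW_pos (s := s) hΛ i
  have k1 := fun w (hw : w ∈ O') w' (hw' : w' ∈ O') c hc hcd =>
    h.bounds hW (hO hw) (hO hw') hc hcd (h.pair_tame s hs w (hO hw) w' (hO hw') c hc hcd)
  have k2 := fun w (hw : w ∈ O') w' (hw' : w' ∈ O') c hc hcd =>
    h.bounds hL (hO hw) (hO hw') hc hcd (h.pair_low s hs w (hO hw) w' (hO hw') c hc hcd)
  exact ⟨lipHs_act_sub_le hs.1 hΛ h.g_pos.le (fun w hw => (h.data w (hO hw)).struct_phiLim)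
      (fun w hw w' hw' c hc hcd => (k1 w hw w' hw' c hc hcd).1)
      (fun w hw w' hw' c hc hcd => (k2 w hw w' hw' c hc hcd).1) hu,
    lipHs_act_sub_le hs.1 hΛ h.g_pos.le (fun w hw => (h.data w (hO hw)).struct_psiLim)
      (fun w hw w' hw' c hc hcd => (k1 w hw w' hw' c hc hcd).2.1)
      (fun w hw w' hw' c hc hcd => (k2 w hw w' hw' c hc hcd).2.1) hu⟩

theorem corr_bounds (h : KamFamily L γ τ S t a b b' e O m R Λ) {w w' : Freq ν} (hw : w ∈ O)
    (hw' : w' ∈ O) (j : ℤ) : jap j * |corr γ τ m R w j| ≤ 2 * e ∧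
      γ ^ (3 / 2 : ℝ) * (jap j * |corr γ τ m R w j - corr γ τ m R w' j|) ≤ 2 * e * dist w w' := by
  refine ⟨((h.bounds (fun _ => one_pos) hw hw le_rfl (by simpa using h.g_pos.le)
    (h.pair_one w hw w hw 0 le_rfl (by simpa using h.g_pos.le))).2.2 j).1, ?_⟩
  by_cases hne : w = w'
  · simp [hne]
  have hd : 0 < dist w w' := dist_pos.2 hne
  have hc : 0 ≤ γ ^ (3 / 2 : ℝ) / dist w w' := div_nonneg h.g_pos.le hd.le
  have hcd : γ ^ (3 / 2 : ℝ) / dist w w' * dist w w' ≤ γ ^ (3 / 2 : ℝ) := by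
    rw [div_mul_cancel₀ _ hd.ne']
  have := ((h.bounds (fun _ => one_pos) hw hw' hc hcd (h.pair_one w hw w' hw' _ hc hcd)).2.2 j).2
  rwa [div_mul_eq_mul_div, div_le_iff₀ hd] at this

theorem corr_neg (h : KamFamily L γ τ S t a b b' e O m R Λ) {w : Freq ν} (hw : w ∈ O) (j : ℤ) :
    corr γ τ m R w (-j) = -corr γ τ m R w j := (h.data w hw).rLim_neg j

end KamFamily

end Diagonalization

section Construction

variable {ν : ℕ}

/-! ### Extension of the eigenvalues to all frequencies -/

theorem exists_lipschitz_extension {X : Type*} [PseudoMetricSpace X] {O : Set X} {f : X → ℝ}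
    {M K : ℝ} (hM : 0 ≤ M) (hK : 0 ≤ K) (h1 : ∀ x ∈ O, |f x| ≤ M)
    (h2 : ∀ x ∈ O, ∀ y ∈ O, |f x - f y| ≤ K * dist x y) :
    ∃ g : X → ℝ, (∀ x ∈ O, g x = f x) ∧ (∀ x, |g x| ≤ M) ∧ ∀ x y, |g x - g y| ≤ K * dist x y := by
  have hL : LipschitzOnWith K.toNNReal f O := LipschitzOnWith.of_dist_le_mul fun x hx y hy => by
    rw [Real.dist_eq, Real.coe_toNNReal K hK]; exact h2 x hx y hy
  obtain ⟨g, hg, hgf⟩ := hL.extend_real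
  have hcl := (LipschitzWith.id (α := ℝ)).const_min M |>.const_max (-M)
  refine ⟨fun x => max (-M) (min M (g x)), fun x hx => ?_, fun x => ?_, fun x y => ?_⟩
  · have := abs_le.1 (h1 x hx)
    beta_reduce
    rw [← hgf hx, min_eq_right this.2, max_eq_right this.1]
  · exact abs_le.2 ⟨le_max_left _ _, max_le (by linarith) (min_le_left _ _)⟩
  · have e1 := hcl.dist_le_mul (g x) (g y)
    have e2 := hg.dist_le_mul x y
    rw [Real.coe_toNNReal K hK] at e2
    rw [NNReal.coe_one, one_mul] at e1
    rw [← Real.dist_eq]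
    exact e1.trans e2

theorem exists_odd_extension {X : Type*} [PseudoMetricSpace X] {O : Set X} {f : X → ℤ → ℝ}
    {M g : ℝ} (hg : 0 < g) (hM : 0 ≤ M) (hodd : ∀ x ∈ O, ∀ j, f x (-j) = -f x j)
    (h1 : ∀ x ∈ O, ∀ j : ℤ, jap j * |f x j| ≤ M)
    (h2 : ∀ x ∈ O, ∀ y ∈ O, ∀ j : ℤ, g * (jap j * |f x j - f y j|) ≤ M * dist x y) :
    ∃ r : X → ℤ → ℝ, (∀ x ∈ O, ∀ j, r x j = f x j) ∧ (∀ x j, j ≠ 0 → r x j = -r x (-j)) ∧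
      (∀ x (j : ℤ), jap j * |r x j| ≤ M) ∧
      ∀ x y (j : ℤ), g * (jap j * |r x j - r y j|) ≤ M * dist x y := by
  have hext : ∀ j : ℤ, ∃ G : X → ℝ, (∀ x ∈ O, G x = f x j) ∧ (∀ x, |G x| ≤ M / jap j) ∧
      ∀ x y, |G x - G y| ≤ M / (g * jap j) * dist x y := fun j => by
    have hj := jap_pos j
    refine exists_lipschitz_extension (by positivity) (by positivity) (fun x hx => ?_)
      fun x hx y hy => ?_
    · rw [le_div_iff₀ hj, mul_comm]; exact h1 x hx j
    · rw [div_mul_eq_mul_div, le_div_iff₀ (by positivity)]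
      linarith [h2 x hx y hy j]
  choose G hG1 hG2 hG3 using hext
  have hb1 : ∀ x (j : ℤ), jap j * |G j x| ≤ M := fun x j => by
    have := hG2 j x
    rwa [le_div_iff₀ (jap_pos j), mul_comm] at this
  have hb2 : ∀ x y (j : ℤ), g * (jap j * |G j x - G j y|) ≤ M * dist x y := fun x y j => by
    have hj := jap_pos j
    have := hG3 j x y
    rw [div_mul_eq_mul_div, le_div_iff₀ (by positivity)] at this
    linarith
  have hjn : ∀ j : ℤ, jap ((-j : ℤ) : ℝ) = jap j := fun j => by simp [jap]
  refine ⟨fun x j => if j < 0 then -G (-j) x else G j x, fun x hx j => ?_, fun x j hj => ?_,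
    fun x j => ?_, fun x y j => ?_⟩
  · dsimp only
    split_ifs with h
    · rw [hG1 _ x hx, hodd x hx, neg_neg]
    · exact hG1 _ x hx
  · dsimp only
    rcases lt_or_gt_of_ne hj with h | h
    · rw [if_pos h, if_neg (by omega)]
    · rw [if_neg (by omega), if_pos (by omega), neg_neg, neg_neg]
  · dsimp only
    split_ifs with h
    · rw [abs_neg, ← hjn]; exact hb1 x (-j)
    · exact hb1 x j
  · dsimp only
    split_ifs with h
    · rw [neg_sub_neg, abs_sub_comm, ← hjn]; exact hb2 x y (-j)
    · exact hb2 x y j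

theorem lipScalar_le {g M : ℝ} (hg : 0 < g) (hM : 0 ≤ M) {O : Set (Freq ν)} {r : Freq ν → ℝ} {p : ℝ}
    (hp : 0 < p) (h1 : ∀ w ∈ O, p * |r w| ≤ M)
    (h2 : ∀ w ∈ O, ∀ w' ∈ O, g * (p * |r w - r w'|) ≤ M * dist w w') :
    ENNReal.ofReal p * lipScalar g O r ≤ ENNReal.ofReal (2 * M) := by
  rw [lipScalar, mul_add, two_mul, ENNReal.ofReal_add hM hM]
  refine add_le_add ?_ ?_
  · simp only [ENNReal.mul_iSup]
    refine iSup₂_le fun w hw => ?_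
    rw [← ENNReal.ofReal_mul hp.le]
    exact ENNReal.ofReal_le_ofReal (h1 w hw)
  · simp only [ENNReal.mul_iSup]
    refine iSup₂_le fun w hw => iSup₂_le fun w' hw' => iSup_le fun hne => ?_
    have hd := dist_pos.2 hne
    rw [ofReal_mul_div_eq hd, ← ENNReal.ofReal_mul (by positivity), ← ENNReal.ofReal_mul hp.le]
    refine ENNReal.ofReal_le_ofReal ?_
    calc p * (g / dist w w' * |r w - r w'|) = g * (p * |r w - r w'|) / dist w w' := by ring
      _ ≤ M := by rw [div_le_iff₀ hd]; exact h2 w hw w' hw'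

/-! ### Families with tame entries -/

theorem jap_snd_le (i k : Idx ν) : jap i.2 ≤ japLJ (i - k).1 (i - k).2 + jap k.2 := by
  have h1 := one_le_jap k.2
  have h2 := abs_le_japLJ (i - k).1 (i - k).2
  have h3 := japLJ_pos (i - k).1 (i - k).2
  have h4 : |(k.2 : ℝ)| ≤ jap k.2 := le_max_right _ _
  refine max_le (by linarith) ?_
  have h5 : (i.2 : ℝ) = ((i - k).2 : ℤ) + (k.2 : ℝ) := by rw [Prod.snd_sub]; push_cast; ring
  rw [h5]
  exact (abs_add_le _ _).trans (add_le_add h2 h4)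

theorem japLJ_le_add (i k : Idx ν) :
    japLJ i.1 i.2 ≤ japLJ (i - k).1 (i - k).2 + japLJ k.1 k.2 := by
  have := japLJ_add_le (i - k) k
  rwa [sub_add_cancel] at this

/-- The size of the remainder in the iteration. -/
def remSize (ν b : ℕ) (S δ : ℝ) : ℝ := 2 * (2 ^ b * (10 * 2 ^ S * δ) * latticeSum ν)

theorem TameEntries.weights {b : ℕ} {s S δ Λ : ℝ} {M : TMat ν} (hδ : 0 ≤ δ) (hΛ : 0 < Λ)
    (hs : sZero ν ≤ s) (hsS : s ≤ S) (h : TameEntries (b + 1 + (2 * ν + 2)) s δ Λ M) :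
    Decays (fun _ => 1) (b + (2 * ν + 2)) (10 * 2 ^ S * δ) M ∧
    Decays (fun i => spaceW (sZero ν) i.2) (b + (2 * ν + 2)) (10 * 2 ^ S * δ) M ∧
    Decays (tameW s Λ) (b + (2 * ν + 2)) (10 * 2 ^ S * δ) M ∧
    Decays (tameLowW s Λ) (b + (2 * ν + 2)) (10 * 2 ^ S * δ) M := by
  have h0 := sZero_nonneg ν
  have h2 : (1 : ℝ) ≤ 2 ^ S := Real.one_le_rpow (by norm_num) (by linarith)
  have hle : 5 * 2 ^ S * δ ≤ 10 * 2 ^ S * δ := by gcongr; norm_num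
  have hB : b + (2 * ν + 2) ≤ b + 1 + (2 * ν + 2) := by omega
  have hT : Decays (tameW s Λ) (b + 1 + (2 * ν + 2)) (5 * 2 ^ S * δ) M :=
    TameDecay.decays (by linarith) h0 hsS (by linarith) hδ hΛ (n := fun i => japLJ i.1 i.2)
      japLJ_le_add (fun k => jap_le_japLJ _ _) h.base h.high h.low
  have hX := TameDecay.decays (n := fun i : Idx ν => jap i.2) (Λ := 1) h0 h0 (S := S)
    (by linarith) (by linarith) hδ one_pos jap_snd_le (fun _ => le_rfl) h.base
    (by rw [one_mul]; exact h.low) h.low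
  refine ⟨(h.base.of_le_pow hB (fun _ => one_pos)).one_mono ?_, fun i k hi hk => ?_,
    fun i k hi hk => ?_, ?_⟩
  · nlinarith
  · refine le_trans (le_of_eq ?_) ((hX.of_le_pow hB (fun i => by
      have := spaceW_pos (sZero ν) i.2
      unfold spaceW at this
      positivity) i k hi hk).trans hle)
    congr 3
    have := spaceW_pos (sZero ν) k.2
    unfold spaceW at this ⊢
    field_simp
  · exact (hT.of_le_pow hB (tameW_pos hΛ) i k hi hk).trans hle
  · have := Decays.div_japLJ (B := b + (2 * ν + 2)) (tameW_pos hΛ) (D := 5 * 2 ^ S * δ)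
      (M := M) (by
        rw [show b + (2 * ν + 2) + 1 = b + 1 + (2 * ν + 2) by ring]; exact hT)
    intro i k hi hk
    exact (this i k hi hk).trans (le_of_eq (by ring))

theorem kamFamily_of_tameEntries {L γ τ S δ : ℝ} {t a b b' : ℕ} {O : Set (Freq ν)}
    {m : Freq ν → ℝ} {R : Freq ν → TMat ν} {Λ : ℝ → ℝ} (hL : 0 ≤ L) (hγ : 0 < γ) (hγ1 : γ ≤ 1)
    (hτ : 0 ≤ τ) (hS : sZero ν ≤ S) (hδ : 0 ≤ δ) (hΛ : ∀ s, 0 < Λ s)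
    (hw : ∀ w ∈ O, ∀ i, |w i| ≤ 2 * L) (hm : ∀ w ∈ O, 1 / 2 ≤ m w)
    (hm' : ∀ w ∈ O, ∀ w' ∈ O, |m w - m w'| ≤ dist w w') (ham : ∀ w ∈ O, IsHamMat (R w))
    (h1 : ∀ s ∈ Set.Icc (sZero ν) S, ∀ w ∈ O, TameEntries (b + 1 + (2 * ν + 2)) s δ (Λ s) (R w))
    (h2 : ∀ s ∈ Set.Icc (sZero ν) S, ∀ w ∈ O, ∀ w' ∈ O, ∀ c : ℝ, 0 ≤ c → c * dist w w' ≤ γ →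
      TameEntries (b + 1 + (2 * ν + 2)) s δ (Λ s) ((c : ℂ) • (R w - R w')))
    (hsmall : KamSmall L (γ ^ (3 / 2 : ℝ)) τ t a b (remSize ν b S δ)) (hexp : t + b' + 1 ≤ a) :
    KamFamily L γ τ S t a b b' (remSize ν b S δ) O m R Λ := by
  have hg : 0 < γ ^ (3 / 2 : ℝ) := Real.rpow_pos_of_pos hγ _
  have hg1 : γ ^ (3 / 2 : ℝ) ≤ 1 := Real.rpow_le_one hγ.le hγ1 (by norm_num)
  have hgγ : γ ^ (3 / 2 : ℝ) ≤ γ := by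
    have := Real.rpow_le_rpow_of_exponent_ge hγ hγ1 (by norm_num : (1 : ℝ) ≤ 3 / 2)
    rwa [Real.rpow_one] at this
  have hD : 0 ≤ 10 * 2 ^ S * δ := by positivity
  have hs0 : sZero ν ∈ Set.Icc (sZero ν) S := ⟨le_rfl, hS⟩
  have hd1 := fun s (hs : s ∈ Set.Icc (sZero ν) S) w hw =>
    (h1 s hs w hw).weights hδ (hΛ s) hs.1 hs.2
  have hd2 := fun s (hs : s ∈ Set.Icc (sZero ν) S) w hw w' hw' c hc
      (hcd : c * dist w w' ≤ γ ^ (3 / 2 : ℝ)) =>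
    (h2 s hs w hw w' hw' c hc (hcd.trans hgγ)).weights hδ (hΛ s) hs.1 hs.2
  have col : ∀ w ∈ O, ColBdd (remKernel (R w)) := fun w hw =>
    Decays.colBdd hD (hd1 _ hs0 w hw).1
  have col2 : ∀ w ∈ O, ∀ w' ∈ O, ∀ c : ℝ, 0 ≤ c → c * dist w w' ≤ γ ^ (3 / 2 : ℝ) →
      ColBdd (remKernel ((c : ℂ) • (R w - R w'))) := fun w hw w' hw' c hc hcd =>
    Decays.colBdd hD (hd2 _ hs0 w hw w' hw' c hc hcd).1
  have par : ∀ w ∈ O, ∀ w' ∈ O, ∀ c : ℝ, 0 ≤ c → c * dist w w' ≤ γ ^ (3 / 2 : ℝ) →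
      ParPair L c (parOf γ τ m w) (parOf γ τ m w') := fun w hO w' hO' c hc hcd =>
    ⟨hg, hg1, rfl, hτ, rfl, hL, hw w hO, hw w' hO', hm w hO, hm w' hO', hc, hcd,
      (mul_le_mul_of_nonneg_left (hm' w hO w' hO') hc).trans hcd⟩
  have pair_one : ∀ w ∈ O, ∀ w' ∈ O, ∀ c : ℝ, 0 ≤ c → c * dist w w' ≤ γ ^ (3 / 2 : ℝ) →
      pairN (ENNReal.ofReal c) (kamW (fun _ => 1) b 0) (remOp (R w)) (remOp (R w')) ≤
        ENNReal.ofReal (remSize ν b S δ) := fun w hw w' hw' c hc hcd =>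
    Decays.pairN_le (fun _ => one_pos) hD hc (col w hw) (col w' hw') (col2 w hw w' hw' c hc hcd)
      (hd1 _ hs0 w hw).1 (hd1 _ hs0 w' hw').1 (hd2 _ hs0 w hw w' hw' c hc hcd).1
  have h00 : ∀ w : Freq ν, (0 : ℝ) * dist w w ≤ γ ^ (3 / 2 : ℝ) := fun w => by simpa using hg.le
  exact {
    g_pos := hg
    size_pos := hΛ
    ham := ham
    col := col
    data := fun w hw => ⟨par w hw w hw 0 le_rfl (h00 w), hsmall, hexp,
      (left_le_pairN _ _ _ _).trans (pair_one w hw w hw 0 le_rfl (h00 w)),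
      isHamOp_remOp (col w hw) (ham w hw)⟩
    par := par
    pair_one := pair_one
    pair_space := fun w hw w' hw' c hc hcd =>
      Decays.pairN_le (fun i => spaceW_pos _ i.2) hD hc (col w hw) (col w' hw')
        (col2 w hw w' hw' c hc hcd) (hd1 _ hs0 w hw).2.1 (hd1 _ hs0 w' hw').2.1
        (hd2 _ hs0 w hw w' hw' c hc hcd).2.1
    pair_tame := fun s hs w hw w' hw' c hc hcd =>
      Decays.pairN_le (tameW_pos (hΛ s)) hD hc (col w hw) (col w' hw')
        (col2 w hw w' hw' c hc hcd) (hd1 s hs w hw).2.2.1 (hd1 s hs w' hw').2.2.1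
        (hd2 s hs w hw w' hw' c hc hcd).2.2.1
    pair_low := fun s hs w hw w' hw' c hc hcd =>
      Decays.pairN_le (tameLowW_pos (hΛ s)) hD hc (col w hw) (col w' hw')
        (col2 w hw w' hw' c hc hcd) (hd1 s hs w hw).2.2.2 (hd1 s hs w' hw').2.2.2
        (hd2 s hs w hw w' hw' c hc hcd).2.2.2 }

theorem nonRes_of_mem_setOmega2 {L γ τ : ℝ} {m : Freq ν → ℝ} {R : Freq ν → TMat ν}
    {r : Freq ν → ℤ → ℝ} {w : Freq ν} (hw : w ∈ setOmega2 L γ τ m r)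
    (hr : ∀ j, r w j = KamFamily.corr γ τ m R w j) :
    KamData.NonRes (parOf γ τ m w) (remOp (R w)) := by
  intro i k hi hk hik
  have h := hw.2 (i.1 - k.1) k.2 i.2 hk hi fun h => hik (Prod.ext (sub_eq_zero.1 h.2) h.1.symm)
  rw [hr, hr] at h
  refine h.trans (le_of_eq (congrArg _ ?_))
  simp only [divisor, parOf, KamFamily.corr]
  ring

end Construction

section Regularized

variable {ν : ℕ}

/-! ### Regularized families -/

/-- The constant in the low norms of the remainders. -/
def lowConst (ν B : ℕ) (S : ℝ) (K : ℝ → ℕ → ℝ) : ℝ :=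
  1 + |K (sZero ν + B + 1) 0| +
    2 ^ (S + 1) * (12 * ((ν : ℝ) + 2) ^ B * (|K (sZero ν) 0| + |K (sZero ν + 1) 0|)) +
    (|K (sZero ν + B) 0| + ((ν : ℝ) + 2) ^ B * (4 * |K (sZero ν) 0|))

/-- The constant in the high norms of the remainders. -/
def highConst (ν B : ℕ) (S : ℝ) (K : ℝ → ℕ → ℝ) (s : ℝ) : ℝ :=
  |K (s + B + 1) 0| + 2 ^ (S + 1) * (4 * ((ν : ℝ) + 2) ^ B * |K (s + 1) 0|)

theorem one_le_lowConst (ν B : ℕ) (S : ℝ) (K : ℝ → ℕ → ℝ) : 1 ≤ lowConst ν B S K := by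
  unfold lowConst
  have h1 := abs_nonneg (K (sZero ν + B + 1) 0)
  have h2 := abs_nonneg (K (sZero ν) 0)
  have h3 := abs_nonneg (K (sZero ν + 1) 0)
  have h4 := abs_nonneg (K (sZero ν + B) 0)
  have h5 : 0 ≤ (2 : ℝ) ^ (S + 1) *
    (12 * ((ν : ℝ) + 2) ^ B * (|K (sZero ν) 0| + |K (sZero ν + 1) 0|)) := by positivity
  have h6 : 0 ≤ ((ν : ℝ) + 2) ^ B * (4 * |K (sZero ν) 0|) := by positivity
  linarith

theorem highConst_nonneg (ν B : ℕ) (S : ℝ) (K : ℝ → ℕ → ℝ) (s : ℝ) : 0 ≤ highConst ν B S K s := by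
  unfold highConst
  positivity

theorem ofReal_coeff_mul_le {k ε γ T' : ℝ} (hε : 0 < ε) (hγ : 0 < γ) {T : ℝ≥0∞}
    (hT : T ≤ ENNReal.ofReal T') :
    ENNReal.ofReal (k * ε * γ⁻¹) * T ≤ ENNReal.ofReal (|k| * (ε * γ⁻¹) * T') := by
  have hγ' : 0 < γ⁻¹ := inv_pos.2 hγ
  have h : ENNReal.ofReal (|k| * (ε * γ⁻¹) * T') =
      ENNReal.ofReal (|k| * (ε * γ⁻¹)) * ENNReal.ofReal T' := ENNReal.ofReal_mul (by positivity)
  rw [h]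
  refine mul_le_mul' (ENNReal.ofReal_le_ofReal ?_) hT
  rw [mul_assoc]
  exact mul_le_mul_of_nonneg_right (le_abs_self k) (by positivity)

theorem abs_le_of_lipScalar {γ N : ℝ} (hN : 0 ≤ N) {O : Set (Freq ν)} {f : Freq ν → ℝ}
    (h : lipScalar γ O f ≤ ENNReal.ofReal N) {w : Freq ν} (hw : w ∈ O) : |f w| ≤ N := by
  rw [← ENNReal.ofReal_le_ofReal_iff hN]
  refine le_trans ?_ (le_self_add.trans h)
  exact le_iSup₂_of_le (f := fun w (_ : w ∈ O) => ENNReal.ofReal |f w|) w hw le_rfl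

theorem abs_sub_le_of_lipScalar {γ N : ℝ} (hγ : 0 < γ) (hN : 0 ≤ N) {O : Set (Freq ν)}
    {f : Freq ν → ℝ} (h : lipScalar γ O f ≤ ENNReal.ofReal N) {w w' : Freq ν} (hw : w ∈ O)
    (hw' : w' ∈ O) : |f w - f w'| ≤ N * (dist w w' / γ) := by
  by_cases hne : w = w'
  · simp [hne]
  rw [← ENNReal.ofReal_le_ofReal_iff (by positivity)]
  refine le_of_lip_le hγ (dist_pos.2 hne) (le_trans ?_ (le_add_self.trans h))
  refine mul_le_mul' le_rfl ?_
  exact le_iSup₂_of_le w hw (le_iSup₂_of_le w' hw' (le_iSup_of_le hne le_rfl))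

/-- The remainder of a regularized operator. -/
abbrev remOf (q : (Freq ν → TorusFn ν) → Freq ν → Symb ν)
    (Q : (Freq ν → TorusFn ν) → Freq ν → TMat ν) (f : Freq ν → TorusFn ν) (w : Freq ν) : TMat ν :=
  opMat (q f w) + Q f w

/-- The weight `Λ(s)` of the low norm in the tame estimates. -/
def tameSize (L γ μ S : ℝ) (B : ℕ) (K : ℝ → ℕ → ℝ) (f : Freq ν → TorusFn ν) (s : ℝ) : ℝ :=
  1 + highConst ν B S K s * (lipHs γ (setO ν L γ) (s + μ) (fun w => coeffR (f w))).toReal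

theorem tameSize_pos (L γ μ S : ℝ) (B : ℕ) (K : ℝ → ℕ → ℝ) (f : Freq ν → TorusFn ν) (s : ℝ) :
    0 < tameSize L γ μ S B K f s := by
  have := highConst_nonneg ν B S K s
  unfold tameSize
  positivity

variable {L γ τ ε κ μ S Km : ℝ} {ρ k₀ : ℕ} {K : ℝ → ℕ → ℝ}
  {F : Set (Freq ν → TorusFn ν)} {m : (Freq ν → TorusFn ν) → Freq ν → ℝ}
  {q : (Freq ν → TorusFn ν) → Freq ν → Symb ν} {Q : (Freq ν → TorusFn ν) → Freq ν → TMat ν}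

theorem IsRegularizedFamily.abs_m_sub_one_le
    (h : IsRegularizedFamily L γ τ ε κ (S + k₀) (sZero ν + k₀) ρ Km K F m q Q) (hε : 0 < ε)
    {f : Freq ν → TorusFn ν} (hf : f ∈ F) :
    lipScalar γ (setO ν L γ) (fun w => m f w - 1) ≤ ENNReal.ofReal (|Km| * ε) :=
  (h.bound_m f hf).trans (ENNReal.ofReal_le_ofReal
    (mul_le_mul_of_nonneg_right (le_abs_self Km) hε.le))

theorem IsRegularizedFamily.half_le_m
    (h : IsRegularizedFamily L γ τ ε κ (S + k₀) (sZero ν + k₀) ρ Km K F m q Q) (hε : 0 < ε)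
    (hKm : |Km| * ε ≤ 1 / 2) {f : Freq ν → TorusFn ν} (hf : f ∈ F) {w : Freq ν}
    (hw : w ∈ setO ν L γ) : 1 / 2 ≤ m f w := by
  have h1 := abs_le_of_lipScalar (by positivity) (h.abs_m_sub_one_le hε hf) hw
  have := (abs_le.1 (h1.trans hKm)).1
  linarith

theorem abs_le_of_mem_setO (hL : 0 < L) {w : Freq ν} (hw : w ∈ setO ν L γ) (i : Fin ν) :
    |w i| ≤ 2 * L := by
  have := hw.1 i
  rw [abs_of_nonneg (hL.le.trans this.1)]
  exact this.2

theorem IsRegularizedFamily.tameEntries {B E : ℕ}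
    (h : IsRegularizedFamily L γ τ ε κ (S + k₀) (sZero ν + k₀) ρ Km K F m q Q) (hε : 0 < ε)
    (hγ : 0 < γ) (hμ : κ + k₀ ≤ μ) (hk : B + 2 ≤ k₀) (hE : E + 2 * B = ρ)
    (hE2 : 2 * (ν / 2 + 3) + 2 ≤ E) (hS : sZero ν < S)
    {f : Freq ν → TorusFn ν} (hf : f ∈ F) (ha : AdmissibleTorus L γ μ f) {s : ℝ}
    (hs : s ∈ Set.Icc (sZero ν) (S + 1)) :
    (∀ w ∈ setOmega1 L γ τ (m f), TameEntries B s (lowConst ν B S K * (ε * γ⁻¹))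
      (tameSize L γ μ S B K f s) (remOf q Q f w)) ∧
    ∀ w ∈ setOmega1 L γ τ (m f), ∀ w' ∈ setOmega1 L γ τ (m f), ∀ c : ℝ, 0 ≤ c →
      c * dist w w' ≤ γ → TameEntries B s (lowConst ν B S K * (ε * γ⁻¹))
        (tameSize L γ μ S B K f s) ((c : ℂ) • (remOf q Q f w - remOf q Q f w')) := by
  obtain ⟨M, hM, hMs⟩ := h.bound_Q f hf
  have hγ' : 0 < γ⁻¹ := inv_pos.2 hγ
  have hx : 0 < ε * γ⁻¹ := by positivity
  have hk' : (B : ℝ) + 2 ≤ k₀ := by exact_mod_cast hk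
  have hB : (0 : ℝ) ≤ B := Nat.cast_nonneg _
  have hs1 := hs.1
  have hs2 := hs.2
  set T := lipHs γ (setO ν L γ) (s + μ) (fun w => coeffR (f w)) with hT
  have hTtop : T ≠ ⊤ := (ha.2.1 _).ne
  have hlow : ∀ p : ℝ, p ≤ k₀ → lipHs γ (setO ν L γ) (sZero ν + p + κ) (fun w => coeffR (f w)) ≤
      ENNReal.ofReal 1 := fun p hp => by
    rw [ENNReal.ofReal_one]
    exact (lipHs_mono (by linarith) _).trans ha.2.2
  have hhigh : ∀ p : ℝ, p ≤ k₀ → lipHs γ (setO ν L γ) (s + p + κ) (fun w => coeffR (f w)) ≤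
      ENNReal.ofReal T.toReal := fun p hp => by
    rw [ENNReal.ofReal_toReal hTtop]
    exact lipHs_mono (by linarith) _
  have hq : ∀ σ p : ℝ, σ = sZero ν ∨ σ = s → p = (B : ℝ) + 1 →
      lipSym γ (setOmega1 L γ τ (m f)) (-1) (σ + p) 0 (q f) ≤
        ENNReal.ofReal (K (σ + p) 0 * ε * γ⁻¹) *
          lipHs γ (setO ν L γ) (σ + p + κ) (fun w => coeffR (f w)) := fun σ p hσ hp =>
    h.bound_q f hf (σ + p) (by
      rcases hσ with rfl | rfl
      · exact ⟨by linarith, by linarith⟩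
      · exact ⟨by linarith, by linarith⟩) 0
  have hMb : ∀ σ p : ℝ, σ = sZero ν ∨ σ = s → p = 0 ∧ σ = sZero ν ∨ p = 1 →
      M (σ + p) ≤ ENNReal.ofReal (K (σ + p) 0 * ε * γ⁻¹) *
          lipHs γ (setO ν L γ) (σ + p + κ) (fun w => coeffR (f w)) := fun σ p hσ hp =>
    hMs (σ + p) (by
      rcases hσ with rfl | rfl <;> rcases hp with ⟨rfl, hp⟩ | rfl <;>
        exact ⟨by linarith, by linarith⟩)
  have hT0 : 0 ≤ T.toReal := ENNReal.toReal_nonneg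
  set Kq0 := |K (sZero ν + B + 1) 0|
  set Kq1 := |K (s + B + 1) 0| with hKq1
  set Km0 := |K (sZero ν) 0|
  set Km1 := |K (sZero ν + 1) 0|
  set Kms := |K (s + 1) 0| with hKms
  have hKq0 : 0 ≤ Kq0 := abs_nonneg _
  have hKq1' : 0 ≤ Kq1 := abs_nonneg _
  have hKm0 : 0 ≤ Km0 := abs_nonneg _
  have hKm1 : 0 ≤ Km1 := abs_nonneg _
  have hKms' : 0 ≤ Kms := abs_nonneg _
  have hC : (0 : ℝ) ≤ ((ν : ℝ) + 2) ^ B := by positivity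
  refine tameEntries_family (S' := S + 1) (N₀ := Kq0 * (ε * γ⁻¹)) (N₁ := Kq1 * (ε * γ⁻¹) * T.toReal)
    (M₀ := (Km0 + Km1) * (ε * γ⁻¹)) (M₁ := Kms * (ε * γ⁻¹) * T.toReal) hγ (h.symbol f hf) hM hE hE2
    hs.1 (by linarith) hs.2 (by positivity) (by positivity) (by positivity) (by positivity)
    ?_ ?_ ?_ ?_ ?_ ?_ ?_
  · have := (hq (sZero ν) (B + 1) (Or.inl rfl) rfl).trans
      (ofReal_coeff_mul_le hε hγ (hlow (B + 1) (by linarith)))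
    rw [← add_assoc, mul_one] at this
    exact this
  · have := (hq s (B + 1) (Or.inr rfl) rfl).trans
      (ofReal_coeff_mul_le hε hγ (hhigh (B + 1) (by linarith)))
    rw [← add_assoc] at this
    exact this
  · have := (hMb (sZero ν) 0 (Or.inl rfl) (Or.inl ⟨rfl, rfl⟩)).trans
      (ofReal_coeff_mul_le hε hγ (hlow 0 (by linarith)))
    rw [add_zero, mul_one] at this
    refine this.trans (ENNReal.ofReal_le_ofReal ?_)
    exact mul_le_mul_of_nonneg_right (by linarith) hx.le
  · have := (hMb (sZero ν) 1 (Or.inl rfl) (Or.inr rfl)).trans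
      (ofReal_coeff_mul_le hε hγ (hlow 1 (by linarith)))
    rw [mul_one] at this
    refine this.trans (ENNReal.ofReal_le_ofReal ?_)
    exact mul_le_mul_of_nonneg_right (by linarith) hx.le
  · exact (hMb s 1 (Or.inr rfl) (Or.inr rfl)).trans
      (ofReal_coeff_mul_le hε hγ (hhigh 1 (by linarith)))
  · have h1 : Kq0 + 2 ^ (S + 1) * (12 * ((ν : ℝ) + 2) ^ B * (Km0 + Km1)) ≤ lowConst ν B S K := by
      have h2 : 0 ≤ |K (sZero ν + B) 0| + ((ν : ℝ) + 2) ^ B * (4 * Km0) := by positivity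
      unfold lowConst
      linarith
    calc _ = (Kq0 + 2 ^ (S + 1) * (12 * ((ν : ℝ) + 2) ^ B * (Km0 + Km1))) * (ε * γ⁻¹) := by ring
      _ ≤ _ := mul_le_mul_of_nonneg_right h1 hx.le
  · have h1 := one_le_lowConst ν B S K
    have h2 : Kq1 * (ε * γ⁻¹) * T.toReal +
        2 ^ (S + 1) * (4 * ((ν : ℝ) + 2) ^ B * (Kms * (ε * γ⁻¹) * T.toReal)) =
        highConst ν B S K s * T.toReal * (ε * γ⁻¹) := by
      rw [highConst, ← hKq1, ← hKms]; ring
    have h3 := tameSize_pos L γ μ S B K f s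
    have h4 : highConst ν B S K s * T.toReal ≤ tameSize L γ μ S B K f s := by
      rw [tameSize]; linarith
    rw [h2]
    calc highConst ν B S K s * T.toReal * (ε * γ⁻¹)
        ≤ tameSize L γ μ S B K f s * (ε * γ⁻¹) := mul_le_mul_of_nonneg_right h4 hx.le
      _ ≤ tameSize L γ μ S B K f s * (lowConst ν B S K * (ε * γ⁻¹)) :=
          mul_le_mul_of_nonneg_left (le_mul_of_one_le_left hx.le h1) h3.le

theorem IsRegularizedFamily.kamFamily {t a b b' : ℕ}
    (h : IsRegularizedFamily L γ τ ε κ (S + k₀) (sZero ν + k₀) ρ Km K F m q Q) (hε : 0 < ε)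
    (hL : 0 < L) (hτ : 0 ≤ τ) (hγ : 0 < γ) (hγ1 : γ ≤ 1) (hμ : κ + k₀ ≤ μ)
    (hk : 2 * (b + 1 + (2 * ν + 2)) + 2 * (ν / 2 + 3) + 2 ≤ k₀) (hρ : k₀ ≤ ρ) (hS : sZero ν < S)
    (hKm : |Km| * ε ≤ 1 / 2) (hKm' : |Km| * (ε * γ⁻¹) ≤ 1)
    (hsmall : KamSmall L (γ ^ (3 / 2 : ℝ)) τ t a b
      (remSize ν b (S + 1) (lowConst ν (b + 1 + (2 * ν + 2)) S K * (ε * γ⁻¹))))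
    (hexp : t + b' + 1 ≤ a) {f : Freq ν → TorusFn ν} (hf : f ∈ F) (ha : AdmissibleTorus L γ μ f) :
    KamFamily L γ τ (S + 1) t a b b'
      (remSize ν b (S + 1) (lowConst ν (b + 1 + (2 * ν + 2)) S K * (ε * γ⁻¹)))
      (setOmega1 L γ τ (m f)) (m f) (remOf q Q f)
      (tameSize L γ μ S (b + 1 + (2 * ν + 2)) K f) := by
  set B := b + 1 + (2 * ν + 2) with hB
  have hγ' : 0 < γ⁻¹ := inv_pos.2 hγ
  have hE : (ρ - 2 * B) + 2 * B = ρ := by omega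
  have he := fun s hs => h.tameEntries hε hγ hμ (by omega) hE (by omega) hS hf ha (s := s) hs
  have hsub : ∀ w ∈ setOmega1 L γ τ (m f), w ∈ setO ν L γ := fun w hw => hw.1
  refine kamFamily_of_tameEntries hL.le hγ hγ1 hτ (by linarith)
    (mul_nonneg (zero_le_one.trans (one_le_lowConst ν B S K)) (by positivity))
    (tameSize_pos L γ μ S B K f) (fun w hw => abs_le_of_mem_setO hL (hsub w hw))
    (fun w hw => h.half_le_m hε hKm hf (hsub w hw)) (fun w hw w' hw' => ?_)
    (h.hamiltonian f hf) (fun s hs => (he s hs).1) (fun s hs => (he s hs).2) hsmall hexp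
  have h1 := abs_sub_le_of_lipScalar hγ (by positivity) (h.abs_m_sub_one_le hε hf) (hsub w hw)
    (hsub w' hw')
  rw [sub_sub_sub_cancel_right] at h1
  refine h1.trans ?_
  calc |Km| * ε * (dist w w' / γ) = |Km| * (ε * γ⁻¹) * dist w w' := by ring
    _ ≤ 1 * dist w w' := by gcongr
    _ = _ := one_mul _

/-- The dependence of the eigenvalues on the torus. -/
theorem IsRegularizedFamily.corr_sub_le {t a b b' : ℕ}
    (h : IsRegularizedFamily L γ τ ε κ (S + k₀) (sZero ν + k₀) ρ Km K F m q Q) (hε : 0 < ε)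
    (hγ : 0 < γ) (hk : 2 * (b + 1 + (2 * ν + 2)) + 2 * (ν / 2 + 3) + 6 ≤ k₀) (hρ : k₀ ≤ ρ)
    (hS : sZero ν < S) (hKm : |Km| * ε ≤ γ ^ (3 / 2 : ℝ)) {f₁ f₂ : Freq ν → TorusFn ν}
    (hf₁ : f₁ ∈ F) (hf₂ : f₂ ∈ F) {Λ₁ Λ₂ : ℝ → ℝ}
    (hA₁ : KamFamily L γ τ (S + 1) t a b b'
      (remSize ν b (S + 1) (lowConst ν (b + 1 + (2 * ν + 2)) S K * (ε * γ⁻¹)))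
      (setOmega1 L γ τ (m f₁)) (m f₁) (remOf q Q f₁) Λ₁)
    (hA₂ : KamFamily L γ τ (S + 1) t a b b'
      (remSize ν b (S + 1) (lowConst ν (b + 1 + (2 * ν + 2)) S K * (ε * γ⁻¹)))
      (setOmega1 L γ τ (m f₂)) (m f₂) (remOf q Q f₂) Λ₂)
    (hd₁ : ∀ w ∈ setOmega1 L γ τ (m f₁), Decays (fun _ => 1) (b + (2 * ν + 2))
      (10 * 2 ^ (S + 1) * (lowConst ν (b + 1 + (2 * ν + 2)) S K * (ε * γ⁻¹))) (remOf q Q f₁ w))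
    (hd₂ : ∀ w ∈ setOmega1 L γ τ (m f₂), Decays (fun _ => 1) (b + (2 * ν + 2))
      (10 * 2 ^ (S + 1) * (lowConst ν (b + 1 + (2 * ν + 2)) S K * (ε * γ⁻¹))) (remOf q Q f₂ w))
    {w : Freq ν} (hw₁ : w ∈ setOmega1 L γ τ (m f₁)) (hw₂ : w ∈ setOmega1 L γ τ (m f₂)) {x : ℝ}
    (hx : hsNorm (sZero ν + κ) (coeffR (f₁ w) - coeffR (f₂ w)) ≤ ENNReal.ofReal x) (hx0 : 0 < x)
    (j : ℤ) :
    jap j * |KamFamily.corr γ τ (m f₁) (remOf q Q f₁) w j -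
      KamFamily.corr γ τ (m f₂) (remOf q Q f₂) w j| ≤
      2 * remSize ν b (S + 1) (lowConst ν (b + 1 + (2 * ν + 2)) S K * (ε * γ⁻¹)) * x := by
  set B := b + 1 + (2 * ν + 2) with hB
  set δ := lowConst ν B S K * (ε * γ⁻¹) with hδ
  have hγ' : 0 < γ⁻¹ := inv_pos.2 hγ
  have hy : 0 < ε * γ⁻¹ := by positivity
  have hδ0 : 0 ≤ δ := mul_nonneg (zero_le_one.trans (one_le_lowConst ν B S K)) hy.le
  have hD : 0 ≤ 10 * 2 ^ (S + 1) * δ := by positivity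
  have hkB : (B : ℝ) ≤ k₀ := by exact_mod_cast (by omega : B ≤ k₀)
  have hBn : (0 : ℝ) ≤ B := Nat.cast_nonneg _
  set Kq := |K (sZero ν + B) 0| with hKq
  set K0 := |K (sZero ν) 0| with hK0
  have hKq' : 0 ≤ Kq := abs_nonneg _
  have hK0' : 0 ≤ K0 := abs_nonneg _
  have hdq : Decays (fun _ => 1) B (Kq * (ε * γ⁻¹) * x) (opMat (q f₁ w) - opMat (q f₂ w)) := by
    rw [← opMat_sub (h.symbol f₁ hf₁ w hw₁) (h.symbol f₂ hf₂ w hw₂)]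
    refine (tameDecay_opMat (s := sZero ν) (by positivity) ?_).decays_one (sZero_nonneg ν)
    exact (h.diff_q f₁ hf₁ f₂ hf₂ w ⟨hw₁, hw₂⟩ (sZero ν + B) ⟨by linarith, by linarith⟩ 0).trans
      (ofReal_coeff_mul_le hε hγ hx)
  have hdQ : Decays (fun _ => 1) B (((ν : ℝ) + 2) ^ B * (4 * (K0 * (ε * γ⁻¹) * x)))
      (Q f₁ w - Q f₂ w) := by
    refine SmoothingDiff.decays (E := ρ - 2 * B - 1) (ρ := ρ) (by positivity) ?_ (by omega)
      (by omega)
    intro b hb m₁ m₂ h₁ h₂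
    have h3 := h.diff_Q f₁ hf₁ f₂ hf₂ w ⟨hw₁, hw₂⟩ (sZero ν) ⟨le_rfl, by linarith⟩ b hb m₁ m₂ h₁ h₂
    have h4 := ofReal_coeff_mul_le (k := K (sZero ν) 0) hε hγ hx
    refine ⟨fun h5 u hu => ?_, fun h5 u hu => ?_⟩
    · obtain ⟨h6, h7⟩ := h3.1 h5 u hu
      exact ⟨h6, h7.trans (mul_le_mul' h4 le_rfl)⟩
    · obtain ⟨h6, h7⟩ := h3.2 h5 u hu
      exact ⟨h6, h7.trans (mul_le_mul' h4 le_rfl)⟩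
  have hdec : Decays (fun _ => 1) (b + (2 * ν + 2)) (10 * 2 ^ (S + 1) * δ)
      (((x⁻¹ : ℝ) : ℂ) • (remOf q Q f₁ w - remOf q Q f₂ w)) := by
    intro i k hi hk
    have h1 := ((hdq.add_one hdQ).of_le_pow (B' := b + (2 * ν + 2)) (by omega)
      (fun _ => one_pos)) i k hi hk
    have h2 : opMat (q f₁ w) - opMat (q f₂ w) + (Q f₁ w - Q f₂ w) =
        remOf q Q f₁ w - remOf q Q f₂ w := by simp only [remOf]; abel
    rw [h2] at h1
    have h3 := mul_le_mul_of_nonneg_left h1 (inv_pos.2 hx0).le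
    have h4 : x⁻¹ * (Kq * (ε * γ⁻¹) * x + ((ν : ℝ) + 2) ^ B * (4 * (K0 * (ε * γ⁻¹) * x))) =
        (Kq + ((ν : ℝ) + 2) ^ B * (4 * K0)) * (ε * γ⁻¹) := by
      field_simp
    have h5 : Kq + ((ν : ℝ) + 2) ^ B * (4 * K0) ≤ lowConst ν B S K := by
      have e1 := abs_nonneg (K (sZero ν + B + 1) 0)
      have e2 : 0 ≤ (2 : ℝ) ^ (S + 1) * (12 * ((ν : ℝ) + 2) ^ B *
        (|K (sZero ν) 0| + |K (sZero ν + 1) 0|)) := by positivity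
      unfold lowConst
      linarith
    have h6 : (Kq + ((ν : ℝ) + 2) ^ B * (4 * K0)) * (ε * γ⁻¹) ≤ δ :=
      mul_le_mul_of_nonneg_right h5 hy.le
    have h7 : δ ≤ 10 * 2 ^ (S + 1) * δ := by
      have : (1 : ℝ) ≤ 2 ^ (S + 1) :=
        Real.one_le_rpow (by norm_num) (by linarith [sZero_nonneg ν])
      nlinarith
    rw [h4] at h3
    refine le_trans (le_of_eq ?_) (h3.trans (h6.trans h7))
    simp only [Pi.smul_apply, smul_eq_mul, norm_mul, Complex.norm_real,
      Real.norm_of_nonneg (inv_pos.2 hx0).le]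
    ring
  have hd1 := hA₁.data w hw₁
  have hd2 := hA₂.data w hw₂
  have hpar : ParPair L x⁻¹ (parOf γ τ (m f₁) w) (parOf γ τ (m f₂) w) := by
    have hg := hA₁.g_pos
    refine ⟨hg, hd1.par.g_le, rfl, hd1.par.τ_nonneg, rfl, hd1.par.L_nonneg, hd1.par.w_le,
      hd2.par.w_le, hd1.par.m_ge, hd2.par.m_ge, (inv_pos.2 hx0).le, ?_, ?_⟩
    · simpa [parOf] using hg.le
    · have h1 := (h.diff_m f₁ hf₁ f₂ hf₂ w ⟨hw₁, hw₂⟩).trans (mul_le_mul' (ENNReal.ofReal_le_ofReal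
        (mul_le_mul_of_nonneg_right (le_abs_self Km) hε.le)) hx)
      rw [← ENNReal.ofReal_mul (by positivity), ENNReal.ofReal_le_ofReal_iff (by positivity)] at h1
      refine le_trans ?_ hKm
      change x⁻¹ * |m f₁ w - m f₂ w| ≤ _
      rw [inv_mul_le_iff₀ hx0]
      linarith
  have hp := Decays.pairN_le (W := fun _ : Idx ν => (1 : ℝ)) (fun _ => one_pos) hD
    (inv_pos.2 hx0).le (hA₁.col w hw₁) (hA₂.col w hw₂) (Decays.colBdd hD hdec) (hd₁ w hw₁)
    (hd₂ w hw₂) hdec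
  have := ((kam_pair_bounds (fun _ => one_pos) hpar hd1 hd2 hp).2.2 j).2
  rw [inv_mul_le_iff₀ hx0] at this
  calc _ ≤ _ := this
    _ = _ := by ring

theorem remSize_mul (ν b : ℕ) (S δ x : ℝ) : remSize ν b S (δ * x) = remSize ν b S δ * x := by
  unfold remSize; ring

theorem remSize_nonneg (ν b : ℕ) (S : ℝ) {δ : ℝ} (hδ : 0 ≤ δ) : 0 ≤ remSize ν b S δ := by
  have := latticeSum_nonneg ν
  unfold remSize
  positivity

/-- The tame estimate in terms of the size `T(s)` of the torus. -/
theorem KamFamily.nearIdTame_bound {y H A : ℝ} (hH : 0 ≤ H) (hA : 0 ≤ A) {z : ℝ}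
    {T a₀ a₁ : ℝ≥0∞} (hT : T ≠ ⊤) (ha : a₀ ≤ a₁) :
    ENNReal.ofReal (A * y) * (a₁ + ENNReal.ofReal (1 + H * T.toReal) * a₀) ≤
      ENNReal.ofReal (A * (2 + H)) *
        ((ENNReal.ofReal z + ENNReal.ofReal y * T) * a₀ + ENNReal.ofReal y * a₁) := by
  have e1 : ENNReal.ofReal (1 + H * T.toReal) = 1 + ENNReal.ofReal H * T := by
    rw [ENNReal.ofReal_add zero_le_one (by positivity), ENNReal.ofReal_one, ENNReal.ofReal_mul hH,
      ENNReal.ofReal_toReal hT]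
  have e2 : ENNReal.ofReal (A * (2 + H)) = ENNReal.ofReal A * (2 + ENNReal.ofReal H) := by
    rw [ENNReal.ofReal_mul hA, ENNReal.ofReal_add (by norm_num) hH]; norm_num
  rw [e1, e2, ENNReal.ofReal_mul hA]
  set A' := ENNReal.ofReal A
  set y' := ENNReal.ofReal y
  set H' := ENNReal.ofReal H
  set z' := ENNReal.ofReal z
  calc A' * y' * (a₁ + (1 + H' * T) * a₀) = A' * y' * (a₁ + a₀ + H' * T * a₀) := by ring
    _ ≤ A' * y' * (a₁ + a₁ + H' * T * a₀) := by gcongr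
    _ ≤ A' * y' * (a₁ + a₁ + H' * T * a₀) +
        (A' * (2 + H') * z' * a₀ + A' * y' * (2 * T * a₀ + H' * a₁)) := le_self_add
    _ = _ := by ring

end Regularized

end

end DP

theorem mainTheorem5 (ν : ℕ) (hν : 1 ≤ ν) (τ : ℝ) (hτ : 2 * (ν : ℝ) + 6 ≤ τ) :
    ∃ k₀ : ℕ, ∀ (L : ℝ), 0 < L → ∀ (ρ : ℕ), k₀ ≤ ρ → ∀ (κ : ℝ), 0 < κ →
      ∀ (S : ℝ), sZero ν < S → ∀ (Km : ℝ) (K : ℝ → ℕ → ℝ),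
    ∃ (δ₀ N₀ C₀ C σ : ℝ) (Cs : ℝ → ℝ),
      (0 < δ₀ ∧ δ₀ < 1 ∧ 0 < N₀ ∧ 0 < C₀ ∧ 0 < C ∧ 0 < σ) ∧
      ∀ (γ ε μ : ℝ), 0 < γ → γ < 1 → 0 < ε → κ + k₀ ≤ μ →
        N₀ ^ C₀ * ε * γ ^ (-(5 / 2) : ℝ) ≤ δ₀ →
      ∀ (F : Set (Freq ν → TorusFn ν)) (m : (Freq ν → TorusFn ν) → Freq ν → ℝ)
        (q : (Freq ν → TorusFn ν) → Freq ν → Symb ν)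
        (Q : (Freq ν → TorusFn ν) → Freq ν → TMat ν),
        (∀ f ∈ F, AdmissibleTorus L γ μ f) →
        IsRegularizedFamily L γ τ ε κ (S + k₀) (sZero ν + k₀) ρ Km K F m q Q →
      ∃ r : (Freq ν → TorusFn ν) → Freq ν → ℤ → ℝ,
        (∀ f ∈ F,
          (⨆ (j : ℤ) (_ : j ≠ 0), ENNReal.ofReal (jap j) *
            lipScalar (γ ^ (3 / 2 : ℝ)) (setO ν L γ) (fun w => r f w j)) <
              ENNReal.ofReal (C * ε * γ⁻¹) ∧
          (∀ w ∈ setO ν L γ, ∀ j : ℤ, j ≠ 0 → r f w j = -r f w (-j)) ∧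
          ∃ Φ Ψ : Freq ν → TMat ν,
            (∀ w ∈ setOinf L γ τ (m f) (r f),
              Diagonalizes S w (m f w) (opMat (q f w) + Q f w)
                (fun j => eig (m f w) (r f w j) j) (Φ w) (Ψ w)) ∧
            NearIdTame γ ε (setOinf L γ τ (m f) (r f)) S Cs
              (fun s => lipHs γ (setO ν L γ) (s + μ) (fun w => coeffR (f w))) Φ ∧
            NearIdTame γ ε (setOinf L γ τ (m f) (r f)) S Cs
              (fun s => lipHs γ (setO ν L γ) (s + μ) (fun w => coeffR (f w))) Ψ) ∧
        ∀ f₁ ∈ F, ∀ f₂ ∈ F,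
          ∀ w ∈ setOinf L γ τ (m f₁) (r f₁) ∩ setOinf L γ τ (m f₂) (r f₂),
            (⨆ (j : ℤ) (_ : j ≠ 0), ENNReal.ofReal (jap j * |r f₁ w j - r f₂ w j|)) ≤
              ENNReal.ofReal (C * ε * γ⁻¹) *
                hsNorm (sZero ν + σ) (coeffR (f₁ w) - coeffR (f₂ w)) := by
  set t : ℕ := ⌈2 * τ + 1⌉₊ with ht
  set a : ℕ := t + 1 with ha
  set b : ℕ := 2 * a + 1 with hb
  refine ⟨2 * (b + 1 + (2 * ν + 2)) + 2 * (ν / 2 + 3) + 6, fun L hL ρ hρ κ hκ S hS Km K => ?_⟩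
  set B : ℕ := b + 1 + (2 * ν + 2) with hB
  set k₀ : ℕ := 2 * B + 2 * (ν / 2 + 3) + 6 with hk₀
  have hτ0 : 0 ≤ τ := le_trans (by positivity) hτ
  set C₁ := lowConst ν B S K with hC₁
  have hC₁1 : 1 ≤ C₁ := one_le_lowConst ν B S K
  set C₂ := remSize ν b (S + 1) C₁ with hC₂
  have hC₂0 : 0 ≤ C₂ := remSize_nonneg ν b (S + 1) (by linarith)
  set C₃ := 32 * ((10 + 4 * L) * 4 ^ t) * 4 ^ a * C₂ with hC₃
  have hC₃0 : 0 ≤ C₃ := by positivity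
  have hKm0 := abs_nonneg Km
  set A := 36 * ((10 + 4 * L) * 4 ^ t) * C₂ with hA
  have hA0 : 0 ≤ A := by positivity
  refine ⟨1 / (2 * (1 + C₃ + |Km|)), 4, 1, 4 * C₂ + 1, κ, fun s => A * (2 + highConst ν B S K s),
    ⟨by positivity, ?_, by norm_num, one_pos, by positivity, hκ⟩, ?_⟩
  · rw [div_lt_one (by positivity)]; linarith
  intro γ ε μ hγ hγ1 hε hμ hsmall F m q Q hF hR
  set δ₀ := 1 / (2 * (1 + C₃ + |Km|)) with hδ₀
  set g := γ ^ (3 / 2 : ℝ) with hg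
  set y := ε * γ ^ (-(5 / 2) : ℝ) with hy
  set x := ε * γ⁻¹ with hx
  have hg0 : 0 < g := Real.rpow_pos_of_pos hγ _
  have hg1 : g ≤ 1 := Real.rpow_le_one hγ.le hγ1.le (by norm_num)
  have hy0 : 0 < y := mul_pos hε (Real.rpow_pos_of_pos hγ _)
  have hγi : 0 < γ⁻¹ := inv_pos.2 hγ
  have hx0 : 0 < x := mul_pos hε hγi
  have hxy : x = y * g := by
    rw [hx, hy, hg, mul_assoc, ← Real.rpow_add hγ]
    rw [show (-(5 / 2) : ℝ) + 3 / 2 = -1 by norm_num, Real.rpow_neg_one]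
  have hyδ : y ≤ δ₀ := by
    rw [Real.rpow_one, mul_assoc] at hsmall
    linarith
  have hxδ : x ≤ δ₀ * g := by rw [hxy]; gcongr
  have hεx : ε ≤ x := by
    rw [hx]
    exact le_mul_of_one_le_right hε.le (by rw [one_le_inv₀ hγ]; exact hγ1.le)
  have hδC : δ₀ * (2 * (1 + C₃ + |Km|)) = 1 := by
    rw [hδ₀]; exact one_div_mul_cancel (by positivity)
  have hδ₀0 : 0 < δ₀ := by positivity
  have hC₃x : C₃ * x ≤ g := by
    have h1 : C₃ * δ₀ ≤ 1 := by linarith [mul_nonneg hKm0 hδ₀0.le, mul_nonneg hC₃0 hδ₀0.le]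
    calc C₃ * x ≤ C₃ * (δ₀ * g) := by gcongr
      _ = C₃ * δ₀ * g := by ring
      _ ≤ 1 * g := by gcongr
      _ = g := one_mul g
  have hKmx : |Km| * x ≤ g / 2 := by
    have h1 : |Km| * δ₀ ≤ 1 / 2 := by linarith [mul_nonneg hC₃0 hδ₀0.le]
    calc |Km| * x ≤ |Km| * (δ₀ * g) := by gcongr
      _ = |Km| * δ₀ * g := by ring
      _ ≤ 1 / 2 * g := by gcongr
      _ = g / 2 := by ring
  have hKmε : |Km| * ε ≤ |Km| * x := by gcongr
  have he : remSize ν b (S + 1) (C₁ * x) = C₂ * x := remSize_mul _ _ _ _ _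
  have hKam : KamSmall L g τ t a b (remSize ν b (S + 1) (C₁ * x)) := by
    rw [he]
    refine ⟨Nat.le_ceil _, by omega, by omega, by omega, by positivity, ?_⟩
    calc _ = C₃ * x := by rw [hC₃]; ring
      _ ≤ g := hC₃x
  have hfam : ∀ f ∈ F, KamFamily L γ τ (S + 1) t a b 0 (remSize ν b (S + 1) (C₁ * x))
      (setOmega1 L γ τ (m f)) (m f) (remOf q Q f) (tameSize L γ μ S B K f) := fun f hf =>
    hR.kamFamily hε hL hτ0 hγ hγ1.le hμ (by omega) hρ hS (by linarith) (by linarith) hKam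
      (by omega) hf (hF f hf)
  have hext : ∀ f, ∃ r : Freq ν → ℤ → ℝ, f ∈ F →
      (∀ w ∈ setOmega1 L γ τ (m f), ∀ j, r w j = KamFamily.corr γ τ (m f) (remOf q Q f) w j) ∧
      (∀ w j, j ≠ 0 → r w j = -r w (-j)) ∧ (∀ w (j : ℤ), jap j * |r w j| ≤ 2 * (C₂ * x)) ∧
      ∀ w w' (j : ℤ), g * (jap j * |r w j - r w' j|) ≤ 2 * (C₂ * x) * dist w w' := fun f => by
    by_cases hf : f ∈ F
    · have h := hfam f hf
      rw [he] at h
      obtain ⟨r, hr⟩ := exists_odd_extension (f := KamFamily.corr γ τ (m f) (remOf q Q f)) hg0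
        (by positivity) (fun w hw j => h.corr_neg hw j) (fun w hw j => (h.corr_bounds hw hw j).1)
        fun w hw w' hw' j => (h.corr_bounds hw hw' j).2
      exact ⟨r, fun _ => hr⟩
    · exact ⟨0, fun h => absurd h hf⟩
  choose r hr using hext
  refine ⟨r, fun f hf => ⟨?_, fun w _ j hj => (hr f hf).2.1 w j hj, ?_⟩, ?_⟩
  · refine lt_of_le_of_lt (iSup₂_le fun j _ => lipScalar_le hg0 (by positivity) (jap_pos j)
      (fun w _ => (hr f hf).2.2.1 w j) fun w _ w' _ => (hr f hf).2.2.2 w w' j) ?_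
    rw [mul_assoc, ← hx, ENNReal.ofReal_lt_ofReal_iff (by positivity)]
    linarith
  · have h := hfam f hf
    have hO : setOinf L γ τ (m f) (r f) ⊆ setOmega1 L γ τ (m f) := fun w hw => hw.1
    have hgen : 6 * (6 * genSize L g t (remSize ν b (S + 1) (C₁ * x))) = A * y := by
      have : g⁻¹ * x = y := by rw [hxy]; field_simp
      rw [genSize, he, hA, ← this]; ring
    have hnear : ∀ s ∈ Set.Icc (sZero ν) S, s ∈ Set.Icc (sZero ν) (S + 1) := fun s hs =>
      ⟨hs.1, by linarith [hs.2]⟩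
    refine ⟨fun w => toT (KamFamily.phi γ τ (m f) (remOf q Q f) w),
      fun w => toT (KamFamily.psi γ τ (m f) (remOf q Q f) w), fun w hw => ?_,
      fun s hs u hu => ?_, fun s hs u hu => ?_⟩
    · have hd := h.diagonalizes (S' := S) (by linarith) (by linarith) (hO hw)
        (nonRes_of_mem_setOmega2 hw.2 fun j => (hr f hf).1 w (hO hw) j)
      have hrw : (fun j => eig (m f w) (r f w j) j) =
          fun j => eig (m f w) (KamFamily.corr γ τ (m f) (remOf q Q f) w j) j := by
        funext j; rw [(hr f hf).1 w (hO hw) j]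
      rw [hrw]
      exact hd
    · have h1 := (h.lipHs_le (hnear s hs) hO hu).1
      rw [hgen] at h1
      exact h1.trans (KamFamily.nearIdTame_bound (highConst_nonneg ν B S K s) hA0
        ((hF f hf).2.1 _).ne (lipHs_mono hs.1 u))
    · have h1 := (h.lipHs_le (hnear s hs) hO hu).2
      rw [hgen] at h1
      exact h1.trans (KamFamily.nearIdTame_bound (highConst_nonneg ν B S K s) hA0
        ((hF f hf).2.1 _).ne (lipHs_mono hs.1 u))
  · intro f₁ hf₁ f₂ hf₂ w hw
    have hw₁ : w ∈ setOmega1 L γ τ (m f₁) := hw.1.1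
    have hw₂ : w ∈ setOmega1 L γ τ (m f₂) := hw.2.1
    set X := hsNorm (sZero ν + κ) (coeffR (f₁ w) - coeffR (f₂ w)) with hX
    by_cases hXt : X = ⊤
    · rw [hXt, ENNReal.mul_top]
      · exact le_top
      · rw [mul_assoc, ← hx]
        simp only [ne_eq, ENNReal.ofReal_eq_zero, not_le]
        positivity
    have hXr : 0 ≤ X.toReal := ENNReal.toReal_nonneg
    have hdec : ∀ f ∈ F, ∀ w ∈ setOmega1 L γ τ (m f), Decays (fun _ => 1) (b + (2 * ν + 2))
        (10 * 2 ^ (S + 1) * (C₁ * x)) (remOf q Q f w) := fun f hf w hw =>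
      (((hR.tameEntries (B := B) (E := ρ - 2 * B) hε hγ hμ (by omega) (by omega) (by omega) hS hf
        (hF f hf) (s := sZero ν) ⟨le_rfl, by linarith⟩).1 w hw).weights (by positivity)
        (tameSize_pos _ _ _ _ _ _ _ _) le_rfl (by linarith)).1
    refine iSup₂_le fun j _ => ?_
    rw [(hr f₁ hf₁).1 w hw₁ j, (hr f₂ hf₂).1 w hw₂ j, ← ENNReal.ofReal_toReal hXt,
      ← ENNReal.ofReal_mul (by positivity)]
    refine ENNReal.ofReal_le_ofReal ?_
    set e := C₂ * x with hedef
    have he0 : 0 ≤ e := by positivity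
    have hmain : jap j * |KamFamily.corr γ τ (m f₁) (remOf q Q f₁) w j -
        KamFamily.corr γ τ (m f₂) (remOf q Q f₂) w j| ≤ 2 * e * X.toReal := by
      refine le_of_forall_pos_le_add fun η hη => ?_
      have h1 := hR.corr_sub_le hε hγ (by omega) hρ hS (by linarith) hf₁ hf₂ (hfam f₁ hf₁)
        (hfam f₂ hf₂) (hdec f₁ hf₁) (hdec f₂ hf₂) hw₁ hw₂ (x := X.toReal + η / (2 * e + 1))
        (by
          conv_lhs => rw [← hX, ← ENNReal.ofReal_toReal hXt]
          exact ENNReal.ofReal_le_ofReal (le_add_of_nonneg_right (by positivity)))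
        (by positivity) j
      rw [← hB, ← hC₁, ← hx, he] at h1
      refine h1.trans ?_
      have h2 : 2 * e * (η / (2 * e + 1)) ≤ η := by
        rw [mul_div_assoc', div_le_iff₀ (by positivity), mul_add, mul_one, mul_comm η]
        exact le_add_of_nonneg_right hη.le
      rw [mul_add]
      linarith
    refine hmain.trans (mul_le_mul_of_nonneg_right ?_ hXr)
    have := mul_nonneg hC₂0 hx0.le
    rw [mul_assoc _ ε, ← hx, add_mul, one_mul, mul_assoc, ← hedef]
    linarith
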